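/- **Setting.** A *body* is a bounded connected set $B\subset\mathbb R^2$, not contained in a line, whose boundary is piecewise smooth (a finite union of simple regular $C^\infty$ arcs that meet at most at their end points). For a bounded set $B$ whose convex hull $\operatorname{conv}B$ has nonempty interior, consider the billiard outside $B$. A particle enters $\operatorname{conv}B$ at a point $\xi\in\partial(\operatorname{conv}B)$ with unit velocity $v$, where $-v$ makes the angle $\varphi\in(-\pi/2,\pi/2)$ (counted clockwise) with the outward unit normal $n_\xi$; it makes finitely many (at least one) elastic reflections at regular points of $\partial B$, and then leaves $\operatorname{conv}B$ for ever at a point $\xi^+$ with velocity $v^+$, which makes the angle $\varphi^+$ with $n_{\xi^+}$. With the partial map $T_B:(\varphi,\xi)\mapsto(\varphi^+,\xi^+)$ so defined, the *mean resistance* of $B$, moving with velocity $(0,1)$ and slowly and uniformly rotating, is $$\mathcal R(B)=-\frac38\int_{\partial(\operatorname{conv}B)}\int_{-\pi/2}^{\pi/2}\bigl(\sin(\varphi^+-\varphi),\,1+\cos(\varphi^+-\varphi)\bigr)\cos\varphi\,d\varphi\,d\xi ,$$ where $d\xi$ is arc length and the integral is over the domain of $T_B$. Write $|\partial C|$ for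 the length of the boundary of $C$. For $\varepsilon>0$ the *mushroom* $\Omega_\varepsilon$ is the union of the stem $[0,1]\times[0,\varepsilon]$ and the cap, which is the upper half $\{x_2\ge\varepsilon\}$ of the (filled) ellipse with foci $(0,\varepsilon),(1,\varepsilon)$ and major semi-axis $1/\varepsilon$; its *base* is $[0,1]\times\{0\}$. Let $K\subset\mathbb R^2$ be a bounded convex set with nonempty interior. A set $B_\varepsilon$ is *obtained from $K$ by planting mushrooms* if the following holds. There is a convex polygon $K_\varepsilon\subset K$ with $|\partial K|-|\partial K_\varepsilon|<\varepsilon$. On each side $a$ of $K_\varepsilon$ stands a rectangle $R_a\subset K_\varepsilon$ with one side $a'\subset a$; the rectangles are mutually disjoint, and $|\partial K_\varepsilon|-\sum_a|a'|<\varepsilon$. In each $R_a$ there are finitely many successive orders of mushrooms, each order consisting of finitely many (at least one) mushrooms of equal size, smaller than those of the preceding order. All of them are similar to $\Omega_\varepsilon$, have their bases on $a'$, lie in $R_a$ and are pairwise disjoint, and the part of $a'$ not covered by their bases has length less than $\varepsilon|a'|$. Finally, $B_\varepsilon$ is $K_\varepsilon$ with all these mushrooms removed. **Theorem.** Let $K\subset\mathbb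 R^2$ be a bounded convex set with nonempty interior. 1. $|\mathcal R(K)|=|\partial K|$. 2. $\displaystyle\sup\{|\mathcal R(B)|:\ B\subset K \text{ a body}\}=\tfrac32\,|\mathcal R(K)|$. 3. For every $\varepsilon\in(0,1)$ there is a set $B_\varepsilon$ obtained from $K$ by planting mushrooms similar to $\Omega_\varepsilon$ that is a body contained in $K$. 4. If for all sufficiently small $\varepsilon>0$ the set $B_\varepsilon$ is obtained from $K$ by planting mushrooms similar to $\Omega_\varepsilon$, then $\displaystyle\lim_{\varepsilon\to0^+}|\mathcal R(B_\varepsilon)|=\tfrac32\,|\mathcal R(K)|$. -/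

import Mathlib

open MeasureTheory Set Filter Topology Asymptotics
open scoped ContDiff

noncomputable section

/-- The Euclidean plane. -/
abbrev Plane : Type := EuclideanSpace ℝ (Fin 2)

/-- The vector `x` turned clockwise through the angle `θ`. -/
def rotCW (θ : ℝ) (x : Plane) : Plane :=
  !₂[Real.cos θ * x 0 + Real.sin θ * x 1, -Real.sin θ * x 0 + Real.cos θ * x 1]

/-- The vector `x` turned counterclockwise through a right angle. -/
def leftTurn (x : Plane) : Plane := !₂[-x 1, x 0]

/-- The oriented area spanned by two vectors. -/
def cross (x y : Plane) : ℝ := x 0 * y 1 - x 1 * y 0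

/-- The length of the boundary of a plane set (one-dimensional Hausdorff measure, normalized so that
a segment has its usual length). -/
def perimeter (C : Set Plane) : ℝ := (μH[1] (frontier C)).toReal

/-- `n` is the outward unit normal to the boundary of the convex set `C` at `p`: it is the only unit
vector whose supporting half-plane at `p` contains `C`. -/
def IsOutwardNormal (C : Set Plane) (p n : Plane) : Prop :=
  {m : Plane | ‖m‖ = 1 ∧ ∀ q ∈ C, inner ℝ m (q - p) ≤ 0} = {n}

/-- `p` is a regular point of the boundary of `B`, with unit normal `n` (determined up to sign):
the boundary is tangent at `p` to the line through `p` orthogonal to `n`, and approaches `p` along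
this line from both sides (so corners, cusps and end points are not regular). -/
def HasBoundaryNormal (B : Set Plane) (p n : Plane) : Prop :=
  p ∈ frontier B ∧ ‖n‖ = 1 ∧
  (fun q : Plane => inner ℝ n (q - p)) =o[𝓝[frontier B] p] (fun q : Plane => q - p) ∧
  (∃ᶠ q in 𝓝[frontier B] p, 0 < inner ℝ (leftTurn n) (q - p)) ∧
  (∃ᶠ q in 𝓝[frontier B] p, inner ℝ (leftTurn n) (q - p) < 0)

/-- The boundary of `B` consists of finitely many simple regular `C^∞` arcs which can meet only at
their end points. -/
def HasPiecewiseSmoothBoundary (B : Set Plane) : Prop :=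
  ∃ (N : ℕ) (γ : Fin N → ℝ → Plane),
    (∀ i, ContDiff ℝ ∞ (γ i) ∧ InjOn (γ i) (Icc 0 1) ∧ ∀ t ∈ Icc (0 : ℝ) 1, deriv (γ i) t ≠ 0) ∧
    (∀ i j, i ≠ j → Disjoint (γ i '' Ioo 0 1) (γ j '' Icc 0 1)) ∧
    frontier B = ⋃ i, γ i '' Icc 0 1

/-- A body: a bounded connected plane set with piecewise smooth boundary, not contained in a line. -/
structure IsBody (B : Set Plane) : Prop where
  bounded : Bornology.IsBounded B
  connected : IsConnected B
  nondegenerate : (interior (convexHull ℝ B)).Nonempty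
  boundary : HasPiecewiseSmoothBoundary B

/-- One step of the billiard outside `B`. A state is a pair (position, velocity). The particle moves
freely from its present position until it first meets the boundary of `B`; this happens
at a regular point, not tangentially, and there the velocity is reflected elastically. -/
def Bounce (B : Set Plane) (a b : Plane × Plane) : Prop :=
  (∃ t : ℝ, 0 < t ∧ b.1 = a.1 + t • a.2 ∧ ∀ s ∈ Ioo 0 t, a.1 + s • a.2 ∉ frontier B) ∧
  ∃ n : Plane, HasBoundaryNormal B b.1 n ∧ inner ℝ n a.2 ≠ 0 ∧
    b.2 = a.2 - (2 * inner ℝ n a.2) • n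

/-- The graph of the scattering map `T_B : (φ, ξ) ↦ (φ⁺, ξ⁺)`. A particle enters `conv B` at the
point `ξ` of its boundary with velocity `v`, where `-v` makes the (clockwise) angle `φ` with the outward
normal at `ξ`. Coming freely from outside (say, from the point `ξ - v`), it makes finitely many, and
at least one, reflections from the boundary of `B`, after which it moves freely for ever.
It leaves `conv B` at the point `ξ⁺` with velocity `v⁺`, which makes the angle `φ⁺` with the outward
normal at `ξ⁺`. -/
def Scatters (B : Set Plane) (z z' : ℝ × Plane) : Prop :=
  z.1 ∈ Ioo (-(Real.pi / 2)) (Real.pi / 2) ∧ z'.1 ∈ Ioo (-(Real.pi / 2)) (Real.pi / 2) ∧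
  z.2 ∈ frontier (convexHull ℝ B) ∧ z'.2 ∈ frontier (convexHull ℝ B) ∧
  ∃ n n' v y w : Plane,
    IsOutwardNormal (convexHull ℝ B) z.2 n ∧ IsOutwardNormal (convexHull ℝ B) z'.2 n' ∧
    -v = rotCW z.1 n ∧ w = rotCW z'.1 n' ∧
    Relation.TransGen (Bounce B) (z.2 - v, v) (y, w) ∧
    (∀ s : ℝ, 0 < s → y + s • w ∉ frontier B) ∧
    ∃ s : ℝ, 0 ≤ s ∧ z'.2 = y + s • w ∧ ∀ s' : ℝ, s < s' → y + s' • w ∉ closure (convexHull ℝ B)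

/-- The measure `dμ(φ, ξ) = cos φ dφ dξ` on `(-π/2, π/2) × ∂(conv B)`, where `dξ` is arc length. -/
def phaseMeasure (B : Set Plane) : Measure (ℝ × Plane) :=
  ((volume.restrict (Ioo (-(Real.pi / 2)) (Real.pi / 2))).withDensity
      (fun φ => ENNReal.ofReal (Real.cos φ))).prod
    ((μH[1] : Measure Plane).restrict (frontier (convexHull ℝ B)))

open Classical in
/-- The vector `(sin (φ⁺ - φ), 1 + cos (φ⁺ - φ))`, proportional to the momentum exchanged in the
collision; it is put to be `0` where the scattering map is not defined. -/
def impulse (B : Set Plane) (z : ℝ × Plane) : Plane :=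
  if h : ∃ z' : ℝ × Plane, Scatters B z z' then
    !₂[Real.sin (h.choose.1 - z.1), 1 + Real.cos (h.choose.1 - z.1)]
  else 0

/-- The mean resistance of the slowly and uniformly rotating set `B` moving with the velocity
`(0, 1)`, in the normalization `c = 3/8`. -/
def meanResistance (B : Set Plane) : Plane :=
  -(3 / 8 : ℝ) • ∫ z, impulse B z ∂(phaseMeasure B)

/-- The mushroom `Ω_ε`: the stem `[0,1] × [0,ε]` and the cap, which is the upper half of the ellipse
with foci `(0, ε)`, `(1, ε)` and major semi-axis `1/ε`. -/
def mushroom (ε : ℝ) : Set Plane :=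
  {x | 0 ≤ x 0 ∧ x 0 ≤ 1 ∧ 0 ≤ x 1 ∧ x 1 ≤ ε} ∪
  {x | ε ≤ x 1 ∧ dist x !₂[0, ε] + dist x !₂[1, ε] ≤ 2 * (1 / ε)}

/-- The rectangle `[0, l] × [0, d]`. -/
def rectangle (l d : ℝ) : Set Plane := {x | 0 ≤ x 0 ∧ x 0 ≤ l ∧ 0 ≤ x 1 ∧ x 1 ≤ d}

/-- The similarity with ratio `s` that sends the origin to `p` and the directions of the first and
second axis to those of `u` and of `leftTurn u` (for a unit vector `u`). -/
def place (p u : Plane) (s : ℝ) (x : Plane) : Plane :=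
  p + s • (x 0 • u + x 1 • leftTurn u)

/-- The points `V 0, V 1, …` are the vertices, in counterclockwise order, of a convex polygon with
`k + 3` sides `[V i, V (i + 1)]`. -/
def IsConvexPolygon {k : ℕ} (V : Fin (k + 3) → Plane) : Prop :=
  ∀ i j, j ≠ i → j ≠ i + 1 → 0 < cross (V (i + 1) - V i) (V j - V i)

/-- The unit vector along the side `[V i, V (i + 1)]`. -/
def sideDir {k : ℕ} (V : Fin (k + 3) → Plane) (i : Fin (k + 3)) : Plane :=
  (1 / ‖V (i + 1) - V i‖) • (V (i + 1) - V i)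

/-- The mushroom similar to `Ω_ε`, with ratio `s`, planted on the `i`-th side of the polygon, its base
beginning at the distance `t` from the vertex `V i`. -/
def plantedMushroom {k : ℕ} (V : Fin (k + 3) → Plane) (ε : ℝ) (i : Fin (k + 3)) (s t : ℝ) :
    Set Plane :=
  place (V i + t • sideDir V i) (sideDir V i) s '' mushroom ε

/-- The data for building a body `B_ε` in `K`: an inscribed convex polygon `K_ε`, a rectangle on each of
its sides, and, in each rectangle, several successive orders of mushrooms planted along the side. -/
structure Planting (K : Set Plane) (ε : ℝ) where
  /-- the number of sides, minus three -/
  k : ℕ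
  /-- the vertices of the polygon -/
  V : Fin (k + 3) → Plane
  polygon : IsConvexPolygon V
  subset : convexHull ℝ (range V) ⊆ K
  perimeter_lt : perimeter K - perimeter (convexHull ℝ (range V)) < ε
  /-- the distance from the vertex `V i` to the `i`-th rectangle -/
  start : Fin (k + 3) → ℝ
  /-- the length of the side of the `i`-th rectangle that lies on the `i`-th side of the polygon -/
  len : Fin (k + 3) → ℝ
  /-- the other dimension of the `i`-th rectangle -/
  depth : Fin (k + 3) → ℝ
  /-- the rectangles -/
  rect : Fin (k + 3) → Set Plane
  rect_eq : ∀ i, rect i =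
    place (V i + start i • sideDir V i) (sideDir V i) 1 '' rectangle (len i) (depth i)
  start_nonneg : ∀ i, 0 ≤ start i
  len_pos : ∀ i, 0 < len i
  depth_pos : ∀ i, 0 < depth i
  base_le : ∀ i, start i + len i ≤ ‖V (i + 1) - V i‖
  rect_subset : ∀ i, rect i ⊆ convexHull ℝ (range V)
  rect_disjoint : ∀ i j, i ≠ j → Disjoint (rect i) (rect j)
  /-- the part of the perimeter of the polygon that the rectangles leave free is short -/
  free_lt : perimeter (convexHull ℝ (range V)) - ∑ i, len i < ε
  /-- the number of orders of mushrooms in the `i`-th rectangle -/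
  orders : Fin (k + 3) → ℕ
  /-- the common size of the mushrooms of a given order in the `i`-th rectangle -/
  size : Fin (k + 3) → ℕ → ℝ
  /-- the places where the mushrooms of a given order stand on the `i`-th side -/
  pos : Fin (k + 3) → ℕ → Finset ℝ
  size_pos : ∀ i, ∀ j < orders i, 0 < size i j
  size_lt : ∀ i j, j + 1 < orders i → size i (j + 1) < size i j
  pos_nonempty : ∀ i, ∀ j < orders i, (pos i j).Nonempty
  planted_subset : ∀ i, ∀ j < orders i, ∀ t ∈ pos i j, plantedMushroom V ε i (size i j) t ⊆ rect i
  planted_disjoint : ∀ i, ∀ j < orders i, ∀ j' < orders i, ∀ t ∈ pos i j, ∀ t' ∈ pos i j',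
    (j, t) ≠ (j', t') →
      Disjoint (plantedMushroom V ε i (size i j) t) (plantedMushroom V ε i (size i j') t')
  /-- the length that the bases of the mushrooms leave uncovered on a side of a rectangle is short -/
  uncovered_lt : ∀ i,
    len i - ∑ j ∈ Finset.range (orders i), ((pos i j).card : ℝ) * size i j < ε * len i

/-- The set `B_ε`: the polygon without all the planted mushrooms. -/
def Planting.body {K : Set Plane} {ε : ℝ} (S : Planting K ε) : Set Plane :=
  convexHull ℝ (range S.V) \
    ⋃ (i) (j) (_ : j < S.orders i) (t) (_ : t ∈ S.pos i j),
      plantedMushroom S.V ε i (S.size i j) t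

end

/-! ### Coordinates in the plane -/

/-! Upper bound. The integrand `(sin x, 1 + cos x)` with `x = φ⁺ - φ` has squared norm `2 + 2 cos x
≤ 4`, and the phase space has total measure `2 |∂(conv B)|`. With the factor `3/8` this gives
`|R(B)| ≤ 3/2 |∂(conv B)|` (`norm_meanResistance_le`). For `B ⊆ K` the hull of `B` lies in `K`, and
boundary length is monotone for convex sets because the nearest-point projection does not increase
length (`perimeter_mono`). For `K` itself almost every particle is reflected once, at its entry
point, so `φ⁺ = -φ`, and the angular integral `8/3` cancels the factor `3/8`
(`meanResistance_convex`).

Sharpness. The bound `3/2` is approached if almost all particles leave with `φ⁺` close to `φ`, that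
is, if they are sent back where they came from. A mushroom does this. Its foci are the ends of the
segment through which the stem opens into the cap, so a particle that comes up the stem crosses the
focal segment, and by the focal property (`focal_reflection`) its reflection at the ellipse crosses
that segment again. The focal distance is 1 and the ellipse has size of order `1/ε`, so the two
directions are opposite up to `O(ε)` (`mushroom_trajectory`). Entries near the ends of the base or
at nearly tangential angles could hit the stem; nearly normal ones could reach the apex of the cap,
where the mushroom may touch the far side of its rectangle. These exceptional entries, governed by a
parameter `δ`, have small measure. Removing mushrooms leaves the vertices of the polygon in place,
so the convex hull and the phase space remain those of the polygon (`convexHull_body`). As the bases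
nearly exhaust the perimeter, the second component of the resistance has a lower bound that is
continuous in `δ` and `ε` and equals `3/2 |∂K|` at the origin (`meanResistance_ge`,
`tendsto_meanResistance_planting`).

Well-posedness. The lower bound needs an integrable integrand. The dynamics is deterministic, so the
scattering relation is a graph (`Scatters.right_unique`); the graph is Borel, and by the
Lusin–Souslin theorem injective projections of Borel sets are Borel. This yields
`measurable_impulse`.

Existence. A polygon inscribed in `K` with nearly the same perimeter comes from a strictly
subadditive perturbation of the gauge of `K` (`exists_inscribed_polygon`). Along each side, ever
finer grids of square cells, each holding one mushroom, are fitted into what the bases of the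
earlier mushrooms leave free; the uncovered length decays geometrically (`exists_packing`). Later
cells are so small that they fit beneath the caps of earlier mushrooms and beside their stems. Hence
each cell avoids all larger mushrooms: removing the mushrooms from the largest to the smallest never
disconnects the set (`isPreconnected_body`), and the boundary is a finite list of arcs
(`hasPiecewiseSmoothBoundary_body`). -/

theorem plane_ext {x y : Plane} (h0 : x 0 = y 0) (h1 : x 1 = y 1) : x = y := by
  ext i; fin_cases i
  exacts [h0, h1]

@[simp] theorem plane_mk_zero (a b : ℝ) : (!₂[a, b] : Plane) 0 = a := rfl

@[simp] theorem plane_mk_one (a b : ℝ) : (!₂[a, b] : Plane) 1 = b := rfl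

theorem plane_inner (x y : Plane) : inner ℝ x y = x 0 * y 0 + x 1 * y 1 := by
  simp [PiLp.inner_apply, Fin.sum_univ_two, mul_comm]

theorem plane_norm_sq (x : Plane) : ‖x‖ ^ 2 = x 0 ^ 2 + x 1 ^ 2 := by
  rw [← real_inner_self_eq_norm_sq, plane_inner]; ring

@[simp] theorem leftTurn_zero (x : Plane) : leftTurn x 0 = -x 1 := rfl

@[simp] theorem leftTurn_one (x : Plane) : leftTurn x 1 = x 0 := rfl

@[simp] theorem rotCW_zero (θ : ℝ) (x : Plane) :
    rotCW θ x 0 = Real.cos θ * x 0 + Real.sin θ * x 1 := rfl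

@[simp] theorem rotCW_one (θ : ℝ) (x : Plane) :
    rotCW θ x 1 = -Real.sin θ * x 0 + Real.cos θ * x 1 := rfl

theorem rotCW_eq (θ : ℝ) (x : Plane) :
    rotCW θ x = Real.cos θ • x - Real.sin θ • leftTurn x := by
  apply plane_ext <;> simp <;> ring

theorem inner_leftTurn_self (x : Plane) : inner ℝ (leftTurn x) x = (0 : ℝ) := by
  rw [plane_inner]; simp; ring

theorem inner_self_leftTurn (x : Plane) : inner ℝ x (leftTurn x) = (0 : ℝ) := by
  rw [plane_inner]; simp; ring

theorem norm_leftTurn (x : Plane) : ‖leftTurn x‖ = ‖x‖ := by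
  have h : ‖leftTurn x‖ ^ 2 = ‖x‖ ^ 2 := by rw [plane_norm_sq, plane_norm_sq]; simp; ring
  exact (sq_eq_sq₀ (norm_nonneg _) (norm_nonneg _)).1 h

theorem inner_rotCW_rotCW (θ η : ℝ) (x : Plane) :
    inner ℝ (rotCW θ x) (rotCW η x) = Real.cos (θ - η) * ‖x‖ ^ 2 := by
  rw [plane_inner, plane_norm_sq, Real.cos_sub]; simp; ring

theorem unit_sq {n : Plane} (hn : ‖n‖ = 1) : n 0 ^ 2 + n 1 ^ 2 = 1 := by
  rw [← plane_norm_sq, hn]; norm_num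

theorem unit_decomp {n : Plane} (hn : ‖n‖ = 1) (x : Plane) :
    x = (inner ℝ n x : ℝ) • n + (inner ℝ (leftTurn n) x : ℝ) • leftTurn n := by
  have h := unit_sq hn
  apply plane_ext
  · simp [plane_inner]; linear_combination (-x 0) * h
  · simp [plane_inner]; linear_combination (-x 1) * h

theorem cross_eq_inner (x y : Plane) : cross x y = inner ℝ (leftTurn x) y := by
  rw [plane_inner]; simp [cross]; ring

/-- A unit vector orthogonal to `leftTurn n` is `±n`. -/
theorem unit_eq_or_neg {n m : Plane} (hn : ‖n‖ = 1) (hm : ‖m‖ = 1)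
    (h : inner ℝ (leftTurn n) m = (0 : ℝ)) : m = n ∨ m = -n := by
  have hd := unit_decomp hn m
  rw [h, zero_smul, add_zero] at hd
  have h2 : |(inner ℝ n m : ℝ)| = 1 := by
    have := congrArg norm hd
    rw [norm_smul, hn, hm, mul_one, Real.norm_eq_abs] at this
    exact this.symm
  rcases (abs_eq zero_le_one).1 h2 with h3 | h3
  · left; rw [hd, h3, one_smul]
  · right; rw [hd, h3, neg_one_smul]

/-! ### The scattering map is single valued -/

/-- Two independent normals would make both coordinates of `q - p`, hence `q - p` itself, `o(q - p)`
along the boundary. Then `p` would be isolated in the frontier, against the requirement that the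
boundary approaches `p`. -/
theorem HasBoundaryNormal.eq_or_neg {B : Set Plane} {p n m : Plane} (hn : HasBoundaryNormal B p n)
    (hm : HasBoundaryNormal B p m) : m = n ∨ m = -n := by
  obtain ⟨-, hn1, hno, hfr, -⟩ := hn
  obtain ⟨-, hm1, hmo, -, -⟩ := hm
  refine unit_eq_or_neg hn1 hm1 ?_
  by_contra hc
  set c : ℝ := inner ℝ (leftTurn n) m with hcdef
  have hmd := unit_decomp hn1 m
  -- the tangential coordinate is a combination of the two normal coordinates
  have key : ∀ x : Plane, c * inner ℝ (leftTurn n) x = inner ℝ m x - inner ℝ n m * inner ℝ n x := by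
    intro x
    conv_rhs => rw [hmd]
    rw [inner_add_left, real_inner_smul_left, real_inner_smul_left]
    simp only [inner_add_right, real_inner_smul_right, inner_self_leftTurn,
      real_inner_self_eq_norm_sq, hn1]
    rw [hcdef]; ring
  have hτ : (fun q : Plane => (inner ℝ (leftTurn n) (q - p) : ℝ)) =o[𝓝[frontier B] p]
      (fun q : Plane => q - p) := by
    have h1 := (hmo.sub (hno.const_mul_left (inner ℝ n m))).const_mul_left c⁻¹
    refine h1.congr_left fun q => ?_
    rw [← key, inv_mul_cancel_left₀ hc]
  have hid : ∀ᶠ q in 𝓝[frontier B] p, q - p = 0 := by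
    have h1 : (fun q : Plane => q - p) =o[𝓝[frontier B] p] (fun q : Plane => q - p) := by
      refine IsBigO.trans_isLittleO (IsBigO.of_norm_le fun q => ?_) (hno.norm_left.add hτ.norm_left)
      conv_lhs => rw [unit_decomp hn1 (q - p)]
      refine (norm_add_le _ _).trans ?_
      rw [norm_smul, norm_smul, norm_leftTurn, hn1, mul_one, mul_one]
    filter_upwards [h1.def (half_pos one_pos)] with q hq
    rw [← norm_le_zero_iff]
    linarith [norm_nonneg (q - p)]
  obtain ⟨q, hq, hq0⟩ := (hfr.and_eventually hid).exists
  rw [hq0, inner_zero_right] at hq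
  exact lt_irrefl _ hq

/-- The point hit is in the frontier, so the first hitting time is determined; the normal is
determined up to sign, and the reflection is even in the normal. -/
theorem Bounce.right_unique {B : Set Plane} {a b c : Plane × Plane} (hb : Bounce B a b)
    (hc : Bounce B a c) : b = c := by
  obtain ⟨⟨t, ht, hbt, hbf⟩, n, hn, hn0, hbn⟩ := hb
  obtain ⟨⟨s, hs, hcs, hcf⟩, m, hm, hm0, hcm⟩ := hc
  have hts : t = s := by
    rcases lt_trichotomy t s with h | h | h
    · exact absurd (hbt ▸ hn.1) (hcf t ⟨ht, h⟩)
    · exact h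
    · exact absurd (hcs ▸ hm.1) (hbf s ⟨hs, h⟩)
  have h1 : b.1 = c.1 := by rw [hbt, hcs, hts]
  refine Prod.ext h1 ?_
  rw [hbn, hcm]
  rcases hn.eq_or_neg (h1 ▸ hm) with h | h
  · rw [h]
  · rw [h, inner_neg_left]; simp

theorem not_bounce_of_free {B : Set Plane} {y w : Plane} (h : ∀ s : ℝ, 0 < s → y + s • w ∉ frontier B)
    (b : Plane × Plane) : ¬ Bounce B (y, w) b := by
  rintro ⟨⟨t, ht, hbt, -⟩, n, hn, -⟩
  exact h t ht (hbt ▸ hn.1)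

/-- For a deterministic relation two orbits from one state are comparable, so two terminal states
must coincide. -/
theorem transGen_bounce_unique {B : Set Plane} {a b c : Plane × Plane}
    (hab : Relation.TransGen (Bounce B) a b) (hac : Relation.TransGen (Bounce B) a c)
    (hb : ∀ d, ¬ Bounce B b d) (hc : ∀ d, ¬ Bounce B c d) : b = c := by
  have key : ∀ {x y : Plane × Plane}, (∀ d, ¬ Bounce B x d) →
      Relation.ReflTransGen (Bounce B) x y → x = y := by
    intro x y hx hxy
    rcases Relation.ReflTransGen.cases_head hxy with h | ⟨d, hd, -⟩
    · exact h
    · exact absurd hd (hx d)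
  rcases Relation.ReflTransGen.total_of_right_unique
    (fun _ _ _ h h' => h.right_unique h') hab.to_reflTransGen hac.to_reflTransGen with h | h
  · exact key hb h
  · exact (key hc h).symm

theorem IsOutwardNormal.unique {C : Set Plane} {p n m : Plane} (hn : IsOutwardNormal C p n)
    (hm : IsOutwardNormal C p m) : n = m := by
  unfold IsOutwardNormal at hn hm
  exact singleton_injective (hn.symm.trans hm)

theorem IsOutwardNormal.norm_eq {C : Set Plane} {p n : Plane} (hn : IsOutwardNormal C p n) :
    ‖n‖ = 1 := by
  have : n ∈ ({n} : Set Plane) := rfl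
  rw [← hn] at this
  exact this.1

theorem IsOutwardNormal.inner_le {C : Set Plane} {p n : Plane} (hn : IsOutwardNormal C p n) :
    ∀ q ∈ C, inner ℝ n (q - p) ≤ (0 : ℝ) := by
  have : n ∈ ({n} : Set Plane) := rfl
  rw [← hn] at this
  exact this.2

theorem rotCW_injOn {n : Plane} (hn : ‖n‖ = 1) :
    InjOn (fun θ => rotCW θ n) (Ioo (-(Real.pi / 2)) (Real.pi / 2)) := by
  intro θ hθ η hη h
  have h' : rotCW θ n = rotCW η n := h
  have hs : ∀ α, inner ℝ (leftTurn n) (rotCW α n) = -Real.sin α := by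
    intro α
    rw [rotCW_eq, inner_sub_right, real_inner_smul_right, real_inner_smul_right,
      inner_leftTurn_self, real_inner_self_eq_norm_sq, norm_leftTurn, hn]; ring
  have h2 := hs θ
  rw [h', hs η] at h2
  exact Real.injOn_sin (Ioo_subset_Icc_self hθ) (Ioo_subset_Icc_self hη) (by linarith)

theorem last_time_unique {C : Set Plane} {y w p q : Plane} {s t : ℝ}
    (hp : p ∈ C) (hq : q ∈ C) (hs : p = y + s • w) (ht : q = y + t • w)
    (hs' : ∀ s', s < s' → y + s' • w ∉ C) (ht' : ∀ s', t < s' → y + s' • w ∉ C) : s = t := by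
  rcases lt_trichotomy s t with h | h | h
  · exact absurd (ht ▸ hq) (hs' t h)
  · exact h
  · exact absurd (hs ▸ hp) (ht' s h)

/-- The entry normal and the angle fix the initial velocity, determinism fixes the final free
flight, the last time in the closed hull fixes the exit point, and the exit normal then fixes the
angle. -/
theorem Scatters.right_unique {B : Set Plane} {z z₁ z₂ : ℝ × Plane} (h₁ : Scatters B z z₁)
    (h₂ : Scatters B z z₂) : z₁ = z₂ := by
  obtain ⟨-, ha, -, hf, n, m, v, y, w, hn, hm, hv, hw, ht, hfree, s, hs, hz, hlast⟩ := h₁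
  obtain ⟨-, ha', -, hf', n', m', v', y', w', hn', hm', hv', hw', ht', hfree', s', hs', hz', hlast'⟩ := h₂
  obtain rfl := hn.unique hn'
  obtain rfl : v = v' := neg_injective (hv.trans hv'.symm)
  have hyw := transGen_bounce_unique ht ht' (not_bounce_of_free hfree) (not_bounce_of_free hfree')
  obtain ⟨rfl, rfl⟩ := Prod.mk.inj hyw
  obtain rfl := last_time_unique (frontier_subset_closure hf) (frontier_subset_closure hf') hz hz'
    hlast hlast'
  have h2 : z₁.2 = z₂.2 := hz.trans hz'.symm
  rw [← h2] at hm'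
  obtain rfl := hm.unique hm'
  refine Prod.ext ?_ h2
  exact rotCW_injOn hm.norm_eq ha ha' (hw.symm.trans hw')

open Classical in
-- This makes the arbitrary choice in `impulse` harmless: there is only one value to choose.
theorem impulse_eq {B : Set Plane} {z z' : ℝ × Plane} (h : Scatters B z z') :
    impulse B z = !₂[Real.sin (z'.1 - z.1), 1 + Real.cos (z'.1 - z.1)] := by
  have hex : ∃ z' : ℝ × Plane, Scatters B z z' := ⟨z', h⟩
  have : hex.choose = z' := hex.choose_spec.right_unique h
  rw [impulse, dif_pos hex, this]

/-- The squared norm is `2 + 2 cos (φ⁺ - φ)`, maximal exactly when the angles coincide. This is the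
source of the constant `3/2`. -/
theorem norm_impulse_le (B : Set Plane) (z : ℝ × Plane) : ‖impulse B z‖ ≤ 2 := by
  unfold impulse
  split_ifs with h
  · refine abs_le_of_sq_le_sq' ?_ (by norm_num) |>.2
    rw [plane_norm_sq]
    generalize h.choose.1 - z.1 = x
    change Real.sin x ^ 2 + (1 + Real.cos x) ^ 2 ≤ 2 ^ 2
    nlinarith [Real.sin_sq_add_cos_sq x, Real.cos_le_one x]
  · simp

theorem impulse_one_nonneg (B : Set Plane) (z : ℝ × Plane) : 0 ≤ impulse B z 1 := by
  unfold impulse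
  split_ifs with h
  · change 0 ≤ 1 + Real.cos (h.choose.1 - z.1)
    linarith [Real.neg_one_le_cos (h.choose.1 - z.1)]
  · simp

/-! ### Measurability of the scattering map -/

theorem continuous_leftTurn : Continuous leftTurn := by
  refine (PiLp.continuous_toLp 2 _).comp (continuous_pi fun i => ?_)
  fin_cases i
  · exact (PiLp.continuous_apply 2 _ 1).neg
  · exact PiLp.continuous_apply 2 _ 0

@[fun_prop]
theorem Continuous.leftTurn' {X : Type*} [TopologicalSpace X] {f : X → Plane} (hf : Continuous f) :
    Continuous fun x => leftTurn (f x) := continuous_leftTurn.comp hf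

@[fun_prop]
theorem Continuous.rotCW' {X : Type*} [TopologicalSpace X] {f : X → Plane} {θ : X → ℝ}
    (hθ : Continuous θ) (hf : Continuous f) : Continuous fun x => rotCW (θ x) (f x) := by
  simp only [rotCW_eq]
  fun_prop

theorem MeasurableSet.setOf_and {X : Type*} [MeasurableSpace X] {P Q : X → Prop}
    (hP : MeasurableSet {x | P x}) (hQ : MeasurableSet {x | Q x}) :
    MeasurableSet {x | P x ∧ Q x} := hP.inter hQ

theorem measurableSet_forall_nat {X : Type*} [MeasurableSpace X] {P : ℕ → X → Prop}
    (h : ∀ k, MeasurableSet {x | P k x}) : MeasurableSet {x | ∀ k, P k x} := by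
  rw [ofPred_forall]
  exact .iInter h

theorem measurableSet_exists_nat {X : Type*} [MeasurableSpace X] {P : ℕ → X → Prop}
    (h : ∀ k, MeasurableSet {x | P k x}) : MeasurableSet {x | ∃ k, P k x} := by
  rw [ofPred_exists]
  exact .iUnion h

instance : StandardBorelSpace Plane := inferInstance

section Projections

variable {X Y : Type*} [MetricSpace X] [ProperSpace X] [MeasurableSpace X] [BorelSpace X]
  [MetricSpace Y] [ProperSpace Y]

/-- The projection of an `F_σ` set of a proper space is measurable. -/
theorem measurableSet_exists_closed_and_open {P Q : X → Y → Prop}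
    (hP : IsClosed {p : X × Y | P p.1 p.2}) (hQ : IsOpen {p : X × Y | Q p.1 p.2}) :
    MeasurableSet {x | ∃ y, P x y ∧ Q x y} := by
  obtain ⟨F, hF, -, hU, -⟩ := hQ.exists_iUnion_isClosed
  have : {x | ∃ y, P x y ∧ Q x y} = ⋃ n, Prod.fst '' ({p : X × Y | P p.1 p.2} ∩ F n) := by
    rw [← image_iUnion, ← inter_iUnion, hU]
    ext x
    simp
  rw [this]
  refine MeasurableSet.iUnion fun n => ?_
  -- Closed subsets of a proper space are σ-compact, and so are their continuous images.
  obtain ⟨K, hK, hKU⟩ := (isSigmaCompact_univ.of_isClosed_subset (hP.inter (hF n))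
    (subset_univ _)).image continuous_fst
  rw [← hKU]
  exact MeasurableSet.iUnion fun m => (hK m).isClosed.measurableSet

theorem measurableSet_forall_of_exists_not {P Q : X → Y → Prop}
    (hP : IsClosed {p : X × Y | P p.1 p.2}) (hQ : IsOpen {p : X × Y | Q p.1 p.2}) :
    MeasurableSet {x | ∀ y, P x y → ¬ Q x y} := by
  have := (measurableSet_exists_closed_and_open hP hQ).compl
  convert this using 1
  ext x
  simp

/-- The projection of a measurable graph is measurable (Lusin–Souslin). -/
theorem measurableSet_exists_of_unique {X Y : Type*} [MeasurableSpace X] [StandardBorelSpace X]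
    [MeasurableSpace Y] [StandardBorelSpace Y] {P : X → Y → Prop}
    (hP : MeasurableSet {p : X × Y | P p.1 p.2}) (hu : ∀ x y y', P x y → P x y' → y = y') :
    MeasurableSet {x | ∃ y, P x y} := by
  have : {x | ∃ y, P x y} = Prod.fst '' {p : X × Y | P p.1 p.2} := by
    ext x; simp
  rw [this]
  refine hP.image_of_measurable_injOn measurable_fst ?_
  rintro ⟨x, y⟩ h ⟨x', y'⟩ h' hx
  obtain rfl : x = x' := hx
  rw [hu x y y' h h']

end Projections

/-- Radii and error constants of the form `1 / (k + 1)` suffice, so the limit conditions become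
countable combinations of projections of closed-and-open conditions on `q`. -/
theorem measurableSet_hasBoundaryNormal (B : Set Plane) :
    MeasurableSet {x : Plane × Plane | HasBoundaryNormal B x.1 x.2} := by
  have hF : IsClosed (frontier B) := isClosed_frontier
  have hiff : ∀ x : Plane × Plane, HasBoundaryNormal B x.1 x.2 ↔ x.1 ∈ frontier B ∧ ‖x.2‖ = 1 ∧
      (∀ k : ℕ, ∃ m : ℕ, ∀ q, q ∈ frontier B → ¬ (dist q x.1 < 1 / (m + 1 : ℝ) ∧
        1 / (k + 1 : ℝ) * ‖q - x.1‖ < ‖(inner ℝ x.2 (q - x.1) : ℝ)‖)) ∧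
      (∀ m : ℕ, ∃ q, q ∈ frontier B ∧ (dist q x.1 < 1 / (m + 1 : ℝ) ∧
        0 < (inner ℝ (leftTurn x.2) (q - x.1) : ℝ))) ∧
      (∀ m : ℕ, ∃ q, q ∈ frontier B ∧ (dist q x.1 < 1 / (m + 1 : ℝ) ∧
        (inner ℝ (leftTurn x.2) (q - x.1) : ℝ) < 0)) := by
    rintro ⟨p, n⟩
    have hbas : (𝓝[frontier B] p).HasBasis (fun _ : ℕ => True)
        fun m => Metric.ball p (1 / (m + 1 : ℝ)) ∩ frontier B := by
      exact nhdsWithin_hasBasis Metric.nhds_basis_ball_inv_nat_succ _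
    unfold HasBoundaryNormal
    refine and_congr_right fun _ => and_congr_right fun _ => and_congr ?_ (and_congr ?_ ?_)
    · constructor
      · intro h k
        have := h.def (c := 1 / (k + 1 : ℝ)) (by positivity)
        obtain ⟨m, -, hm⟩ := hbas.eventually_iff.1 this
        exact ⟨m, fun q hq h' => absurd (hm ⟨h'.1, hq⟩) (not_le.2 h'.2)⟩
      · intro h
        refine IsLittleO.of_bound fun c hc => ?_
        obtain ⟨k, hk⟩ := exists_nat_one_div_lt hc
        obtain ⟨m, hm⟩ := h k
        refine hbas.eventually_iff.2 ⟨m, trivial, fun q hq => ?_⟩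
        have h1 := hm q hq.2
        rw [not_and, not_lt] at h1
        exact (h1 hq.1).trans (mul_le_mul_of_nonneg_right hk.le (norm_nonneg _))
    · rw [hbas.frequently_iff]
      simp only [forall_const]
      refine forall_congr' fun m => exists_congr fun q => ?_
      simp only [mem_inter_iff, Metric.mem_ball]
      tauto
    · rw [hbas.frequently_iff]
      simp only [forall_const]
      refine forall_congr' fun m => exists_congr fun q => ?_
      simp only [mem_inter_iff, Metric.mem_ball]
      tauto
  simp only [hiff]
  have hFq : IsClosed {p : (Plane × Plane) × Plane | p.2 ∈ frontier B} :=
    hF.preimage continuous_snd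
  refine .setOf_and (hF.preimage continuous_fst).measurableSet (.setOf_and ?_ (.setOf_and ?_ (.setOf_and ?_ ?_)))
  · exact (isClosed_eq (by fun_prop) (by fun_prop)).measurableSet
  · refine measurableSet_forall_nat fun k => measurableSet_exists_nat fun m => ?_
    exact measurableSet_forall_of_exists_not
      (P := fun (_ : Plane × Plane) (q : Plane) => q ∈ frontier B) hFq
      (Q := fun x q => dist q x.1 < 1 / (m + 1 : ℝ) ∧
        1 / (k + 1 : ℝ) * ‖q - x.1‖ < ‖(inner ℝ x.2 (q - x.1) : ℝ)‖)
      ((isOpen_lt (by fun_prop) (by fun_prop)).and (isOpen_lt (by fun_prop) (by fun_prop)))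
  · refine measurableSet_forall_nat fun m => measurableSet_exists_closed_and_open
      (P := fun (_ : Plane × Plane) (q : Plane) => q ∈ frontier B) hFq
      ((isOpen_lt (by fun_prop) (by fun_prop)).and (isOpen_lt (by fun_prop) (by fun_prop)))
  · refine measurableSet_forall_nat fun m => measurableSet_exists_closed_and_open
      (P := fun (_ : Plane × Plane) (q : Plane) => q ∈ frontier B) hFq
      ((isOpen_lt (by fun_prop) (by fun_prop)).and (isOpen_lt (by fun_prop) (by fun_prop)))

/-- Being a supporting normal is a closed condition; uniqueness forbids another `m` satisfying a
closed condition and the open condition `m ≠ n`, hence is the complement of such a projection. -/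
theorem measurableSet_isOutwardNormal (C : Set Plane) :
    MeasurableSet {x : Plane × Plane | IsOutwardNormal C x.1 x.2} := by
  have hiff : ∀ x : Plane × Plane, IsOutwardNormal C x.1 x.2 ↔
      (‖x.2‖ = 1 ∧ ∀ q ∈ C, inner ℝ x.2 (q - x.1) ≤ (0 : ℝ)) ∧
      ∀ m : Plane, (‖m‖ = 1 ∧ ∀ q ∈ C, inner ℝ m (q - x.1) ≤ (0 : ℝ)) → ¬ m ≠ x.2 := by
    intro x
    unfold IsOutwardNormal
    rw [eq_singleton_iff_unique_mem]
    simp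
  have hcl : ∀ {X : Type} [TopologicalSpace X] {f g : X → Plane}, Continuous f → Continuous g →
      IsClosed {x | ‖g x‖ = 1 ∧ ∀ q ∈ C, inner ℝ (g x) (q - f x) ≤ (0 : ℝ)} := by
    intro X _ f g hf hg
    refine IsClosed.inter (isClosed_eq (by fun_prop) (by fun_prop)) ?_
    have : {x | ∀ q ∈ C, inner ℝ (g x) (q - f x) ≤ (0 : ℝ)} =
        ⋂ q ∈ C, {x | inner ℝ (g x) (q - f x) ≤ (0 : ℝ)} := by ext x; simp
    change IsClosed {x | ∀ q ∈ C, inner ℝ (g x) (q - f x) ≤ (0 : ℝ)}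
    rw [this]
    exact isClosed_biInter fun q _ => isClosed_le (by fun_prop) (by fun_prop)
  simp only [hiff]
  refine .setOf_and (hcl continuous_fst continuous_snd).measurableSet ?_
  exact measurableSet_forall_of_exists_not
    (P := fun (x : Plane × Plane) (m : Plane) =>
      ‖m‖ = 1 ∧ ∀ q ∈ C, inner ℝ m (q - x.1) ≤ (0 : ℝ))
    (hcl (continuous_fst.comp continuous_fst) continuous_snd)
    (Q := fun x m => m ≠ x.2) (isOpen_ne_fun (by fun_prop) (by fun_prop))

/-- Choosing the sign of the normal against the incoming velocity makes the witness (time, normal)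
unique, which is what the projection theorem for graphs requires. -/
theorem bounce_iff {B : Set Plane} {a b : Plane × Plane} : Bounce B a b ↔
    ∃ y : ℝ × Plane, HasBoundaryNormal B b.1 y.2 ∧ inner ℝ y.2 a.2 < (0 : ℝ) ∧
      b.2 = a.2 - (2 * inner ℝ y.2 a.2 : ℝ) • y.2 ∧ 0 < y.1 ∧ b.1 = a.1 + y.1 • a.2 ∧
      ∀ s : ℝ, a.1 + s • a.2 ∈ frontier B → ¬ (0 < s ∧ s < y.1) := by
  constructor
  · rintro ⟨⟨t, ht, hbt, hfree⟩, n, hn, hn0, hb⟩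
    have hfree' : ∀ s : ℝ, a.1 + s • a.2 ∈ frontier B → ¬ (0 < s ∧ s < t) :=
      fun s h1 h2 => hfree s h2 h1
    rcases lt_or_gt_of_ne hn0 with h | h
    · exact ⟨(t, n), hn, h, hb, ht, hbt, hfree'⟩
    · refine ⟨(t, -n), ?_, by simpa using h, by rw [hb, inner_neg_left]; simp, ht, hbt, hfree'⟩
      obtain ⟨h1, h2, h3, h4, h5⟩ := hn
      have hneg : leftTurn (-n) = -leftTurn n := by apply plane_ext <;> simp
      refine ⟨h1, by rwa [norm_neg], ?_, ?_, ?_⟩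
      · simpa only [inner_neg_left] using h3.neg_left
      · simpa only [hneg, inner_neg_left, neg_pos] using h5
      · simpa only [hneg, inner_neg_left, neg_lt_zero] using h4
  · rintro ⟨⟨t, n⟩, hn, hn0, hb, ht, hbt, hfree⟩
    exact ⟨⟨t, ht, hbt, fun s hs h => hfree s h hs⟩, n, hn, hn0.ne, hb⟩

theorem measurableSet_bounce (B : Set Plane) :
    MeasurableSet {x : (Plane × Plane) × (Plane × Plane) | Bounce B x.1 x.2} := by
  have hF : IsClosed (frontier B) := isClosed_frontier
  simp only [bounce_iff]
  refine measurableSet_exists_of_unique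
    (P := fun (x : (Plane × Plane) × (Plane × Plane)) (y : ℝ × Plane) =>
      HasBoundaryNormal B x.2.1 y.2 ∧ inner ℝ y.2 x.1.2 < (0 : ℝ) ∧
      x.2.2 = x.1.2 - (2 * inner ℝ y.2 x.1.2 : ℝ) • y.2 ∧ 0 < y.1 ∧ x.2.1 = x.1.1 + y.1 • x.1.2 ∧
      ∀ s : ℝ, x.1.1 + s • x.1.2 ∈ frontier B → ¬ (0 < s ∧ s < y.1)) ?_ ?_
  · refine .setOf_and ?_ (.setOf_and ?_ (.setOf_and ?_ (.setOf_and ?_ (.setOf_and ?_ ?_))))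
    · exact (measurableSet_hasBoundaryNormal B).preimage
        (f := fun p : ((Plane × Plane) × (Plane × Plane)) × (ℝ × Plane) => (p.1.2.1, p.2.2))
        (by fun_prop)
    · exact (isOpen_lt (by fun_prop) (by fun_prop)).measurableSet
    · exact (isClosed_eq (by fun_prop) (by fun_prop)).measurableSet
    · exact (isOpen_lt (by fun_prop) (by fun_prop)).measurableSet
    · exact (isClosed_eq (by fun_prop) (by fun_prop)).measurableSet
    · exact measurableSet_forall_of_exists_not
        (P := fun (p : ((Plane × Plane) × (Plane × Plane)) × (ℝ × Plane)) (s : ℝ) =>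
          p.1.1.1 + s • p.1.1.2 ∈ frontier B) (hF.preimage (by fun_prop))
        (Q := fun p s => 0 < s ∧ s < p.2.1)
        ((isOpen_lt (by fun_prop) (by fun_prop)).and (isOpen_lt (by fun_prop) (by fun_prop)))
  · rintro ⟨a, b⟩ ⟨t, n⟩ ⟨t', n'⟩ ⟨h1, h2, -, -, h5, -⟩ ⟨k1, k2, -, -, k5, -⟩
    have hn : n' = n := by
      rcases h1.eq_or_neg k1 with h | h
      · exact h
      · exfalso
        dsimp only at h h2 k2
        rw [h, inner_neg_left] at k2
        linarith
    have h0 : a.2 ≠ 0 := by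
      rintro h; dsimp only at h2; rw [h, inner_zero_right] at h2; exact lt_irrefl _ h2
    have ht : t = t' := by
      have := add_left_cancel (h5.symm.trans k5)
      exact smul_left_injective ℝ h0 this
    rw [hn, ht]

/-- The states that can be reached in exactly `k + 1` reflections. -/
def BounceIter (B : Set Plane) : ℕ → Plane × Plane → Plane × Plane → Prop
  | 0 => Bounce B
  | k + 1 => fun a c => ∃ b, BounceIter B k a b ∧ Bounce B b c

theorem BounceIter.right_unique {B : Set Plane} {k : ℕ} {a b c : Plane × Plane}
    (hb : BounceIter B k a b) (hc : BounceIter B k a c) : b = c := by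
  induction k generalizing b c with
  | zero => exact Bounce.right_unique hb hc
  | succ k ih =>
    obtain ⟨d, hd, hb⟩ := hb
    obtain ⟨e, he, hc⟩ := hc
    obtain rfl := ih hd he
    exact hb.right_unique hc

theorem transGen_bounce_iff {B : Set Plane} {a c : Plane × Plane} :
    Relation.TransGen (Bounce B) a c ↔ ∃ k, BounceIter B k a c := by
  constructor
  · intro h
    induction h with
    | single h => exact ⟨0, h⟩
    | tail _ h ih =>
      obtain ⟨k, hk⟩ := ih
      exact ⟨k + 1, _, hk, h⟩
  · rintro ⟨k, hk⟩
    induction k generalizing c with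
    | zero => exact .single hk
    | succ k ih =>
      obtain ⟨b, hb, hc⟩ := hk
      exact (ih hb).tail hc

theorem measurableSet_bounceIter (B : Set Plane) (k : ℕ) :
    MeasurableSet {x : (Plane × Plane) × (Plane × Plane) | BounceIter B k x.1 x.2} := by
  induction k with
  | zero => exact measurableSet_bounce B
  | succ k ih =>
    refine measurableSet_exists_of_unique
      (P := fun (x : (Plane × Plane) × (Plane × Plane)) (b : Plane × Plane) =>
        BounceIter B k x.1 b ∧ Bounce B b x.2) (.setOf_and ?_ ?_) ?_
    · exact ih.preimage (f := fun p : ((Plane × Plane) × (Plane × Plane)) × (Plane × Plane) =>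
        (p.1.1, p.2)) (by fun_prop)
    · exact (measurableSet_bounce B).preimage
        (f := fun p : ((Plane × Plane) × (Plane × Plane)) × (Plane × Plane) =>
        (p.2, p.1.2)) (by fun_prop)
    · exact fun x y y' h h' => h.1.right_unique h'.1

theorem measurableSet_transGen_bounce (B : Set Plane) :
    MeasurableSet {x : (Plane × Plane) × (Plane × Plane) |
      Relation.TransGen (Bounce B) x.1 x.2} := by
  simp only [transGen_bounce_iff]
  exact measurableSet_exists_nat fun k => measurableSet_bounceIter B k

/-- The velocities are eliminated through the normals and angles. The remaining witnesses (two
normals, the last reflection point and the exit time) are unique, so their projection is injective.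
-/
theorem measurableSet_scatters (B : Set Plane) :
    MeasurableSet {x : (ℝ × Plane) × (ℝ × Plane) | Scatters B x.1 x.2} := by
  have hF : IsClosed (frontier B) := isClosed_frontier
  have hC : IsClosed (frontier (convexHull ℝ B)) := isClosed_frontier
  set C := convexHull ℝ B with hCdef
  have hiff : ∀ x : (ℝ × Plane) × (ℝ × Plane), Scatters B x.1 x.2 ↔
      ∃ u : (Plane × Plane) × (Plane × ℝ),
      (x.1.1 ∈ Ioo (-(Real.pi / 2)) (Real.pi / 2) ∧ x.2.1 ∈ Ioo (-(Real.pi / 2)) (Real.pi / 2) ∧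
      x.1.2 ∈ frontier C ∧ x.2.2 ∈ frontier C) ∧
      (IsOutwardNormal C x.1.2 u.1.1 ∧ IsOutwardNormal C x.2.2 u.1.2) ∧
      Relation.TransGen (Bounce B) (x.1.2 - (-rotCW x.1.1 u.1.1), -rotCW x.1.1 u.1.1)
        (u.2.1, rotCW x.2.1 u.1.2) ∧
      (∀ s : ℝ, u.2.1 + s • rotCW x.2.1 u.1.2 ∈ frontier B → ¬ 0 < s) ∧
      0 ≤ u.2.2 ∧ x.2.2 = u.2.1 + u.2.2 • rotCW x.2.1 u.1.2 ∧
      ∀ s : ℝ, u.2.1 + s • rotCW x.2.1 u.1.2 ∈ closure C → ¬ u.2.2 < s := by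
    rintro ⟨z, z'⟩
    constructor
    · rintro ⟨h1, h2, h3, h4, n, n', v, y, w, hn, hn', hv, rfl, ht, hfree, s, hs, hz, hl⟩
      obtain rfl : v = -rotCW z.1 n := by rw [← hv, neg_neg]
      exact ⟨((n, n'), (y, s)), ⟨h1, h2, h3, h4⟩, ⟨hn, hn'⟩, ht, fun t h h' => hfree t h' h, hs, hz,
        fun t h h' => hl t h' h⟩
    · rintro ⟨⟨⟨n, n'⟩, y, s⟩, ⟨h1, h2, h3, h4⟩, ⟨hn, hn'⟩, ht, hfree, hs, hz, hl⟩
      exact ⟨h1, h2, h3, h4, n, n', _, y, _, hn, hn', neg_neg _, rfl, ht,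
        fun t h h' => hfree t h' h, s, hs, hz, fun t h h' => hl t h' h⟩
  simp only [hiff]
  refine measurableSet_exists_of_unique
    (P := fun (x : (ℝ × Plane) × (ℝ × Plane)) (u : (Plane × Plane) × (Plane × ℝ)) =>
      (x.1.1 ∈ Ioo (-(Real.pi / 2)) (Real.pi / 2) ∧ x.2.1 ∈ Ioo (-(Real.pi / 2)) (Real.pi / 2) ∧
      x.1.2 ∈ frontier C ∧ x.2.2 ∈ frontier C) ∧
      (IsOutwardNormal C x.1.2 u.1.1 ∧ IsOutwardNormal C x.2.2 u.1.2) ∧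
      Relation.TransGen (Bounce B) (x.1.2 - (-rotCW x.1.1 u.1.1), -rotCW x.1.1 u.1.1)
        (u.2.1, rotCW x.2.1 u.1.2) ∧
      (∀ s : ℝ, u.2.1 + s • rotCW x.2.1 u.1.2 ∈ frontier B → ¬ 0 < s) ∧
      0 ≤ u.2.2 ∧ x.2.2 = u.2.1 + u.2.2 • rotCW x.2.1 u.1.2 ∧
      ∀ s : ℝ, u.2.1 + s • rotCW x.2.1 u.1.2 ∈ closure C → ¬ u.2.2 < s)
    (.setOf_and (.setOf_and ?_ (.setOf_and ?_ (.setOf_and ?_ ?_))) (.setOf_and (.setOf_and ?_ ?_)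
      (.setOf_and ?_ (.setOf_and ?_ (.setOf_and ?_ (.setOf_and ?_ ?_)))))) ?_
  · exact (isOpen_Ioo.preimage (by fun_prop)).measurableSet
  · exact (isOpen_Ioo.preimage (by fun_prop)).measurableSet
  · exact (hC.preimage (by fun_prop)).measurableSet
  · exact (hC.preimage (by fun_prop)).measurableSet
  · exact (measurableSet_isOutwardNormal C).preimage
      (f := fun p : ((ℝ × Plane) × (ℝ × Plane)) × ((Plane × Plane) × (Plane × ℝ)) =>
        (p.1.1.2, p.2.1.1)) (by fun_prop)
  · exact (measurableSet_isOutwardNormal C).preimage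
      (f := fun p : ((ℝ × Plane) × (ℝ × Plane)) × ((Plane × Plane) × (Plane × ℝ)) =>
        (p.1.2.2, p.2.1.2)) (by fun_prop)
  · refine (measurableSet_transGen_bounce B).preimage
      (f := fun p : ((ℝ × Plane) × (ℝ × Plane)) × ((Plane × Plane) × (Plane × ℝ)) =>
        ((p.1.1.2 - (-rotCW p.1.1.1 p.2.1.1), -rotCW p.1.1.1 p.2.1.1),
        (p.2.2.1, rotCW p.1.2.1 p.2.1.2))) (Continuous.measurable (by fun_prop))
  · exact measurableSet_forall_of_exists_not
      (P := fun (p : ((ℝ × Plane) × (ℝ × Plane)) × ((Plane × Plane) × (Plane × ℝ))) (s : ℝ) =>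
        p.2.2.1 + s • rotCW p.1.2.1 p.2.1.2 ∈ frontier B) (hF.preimage (by fun_prop))
      (Q := fun p s => 0 < s) (isOpen_lt (by fun_prop) (by fun_prop))
  · exact (isClosed_le (by fun_prop) (by fun_prop)).measurableSet
  · exact (isClosed_eq (by fun_prop) (by fun_prop)).measurableSet
  · exact measurableSet_forall_of_exists_not
      (P := fun (p : ((ℝ × Plane) × (ℝ × Plane)) × ((Plane × Plane) × (Plane × ℝ))) (s : ℝ) =>
        p.2.2.1 + s • rotCW p.1.2.1 p.2.1.2 ∈ closure C) (isClosed_closure.preimage (by fun_prop))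
      (Q := fun p s => p.2.2.2 < s) (isOpen_lt (by fun_prop) (by fun_prop))
  · rintro ⟨z, z'⟩ ⟨⟨n, n'⟩, y, s⟩ ⟨⟨m, m'⟩, y', s'⟩ ⟨⟨-, -, -, hf⟩, ⟨hn, hn'⟩, ht, hfree, -, hz, hl⟩
      ⟨-, ⟨hm, hm'⟩, ht', hfree', -, hz', hl'⟩
    obtain rfl := hn.unique hm
    obtain rfl := hn'.unique hm'
    dsimp only at ht ht' hz hz' hl hl' hfree hfree' hf
    have hyw := transGen_bounce_unique ht ht'
      (not_bounce_of_free fun s hs h => hfree s h hs) (not_bounce_of_free fun s hs h => hfree' s h hs)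
    obtain ⟨rfl, -⟩ := Prod.mk.inj hyw
    obtain rfl := last_time_unique (frontier_subset_closure hf) (frontier_subset_closure hf) hz hz'
      (fun t h h' => hl t h' h) (fun t h h' => hl' t h' h)
    rfl

/-- Without this the Bochner integral could be `0` by default and no lower bound would follow. A
preimage is the projection of a part of the graph, together with the complement of the domain when
the default value `0` is in the target set. -/
theorem measurable_impulse (B : Set Plane) : Measurable (impulse B) := by
  have hg : Measurable fun p : (ℝ × Plane) × (ℝ × Plane) =>
      (!₂[Real.sin (p.2.1 - p.1.1), 1 + Real.cos (p.2.1 - p.1.1)] : Plane) := by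
    refine Continuous.measurable ((PiLp.continuous_toLp 2 _).comp (continuous_pi fun i => ?_))
    fin_cases i
    · change Continuous fun p : (ℝ × Plane) × (ℝ × Plane) => Real.sin (p.2.1 - p.1.1)
      fun_prop
    · change Continuous fun p : (ℝ × Plane) × (ℝ × Plane) => 1 + Real.cos (p.2.1 - p.1.1)
      fun_prop
  intro A hA
  have h1 : MeasurableSet {z : ℝ × Plane | ∃ z' : ℝ × Plane, Scatters B z z' ∧
      (!₂[Real.sin (z'.1 - z.1), 1 + Real.cos (z'.1 - z.1)] : Plane) ∈ A} :=
    measurableSet_exists_of_unique (P := fun z z' : ℝ × Plane => Scatters B z z' ∧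
      (!₂[Real.sin (z'.1 - z.1), 1 + Real.cos (z'.1 - z.1)] : Plane) ∈ A)
      ((measurableSet_scatters B).inter (hg hA)) fun z z' z'' h h' => h.1.right_unique h'.1
  have h2 : MeasurableSet {z : ℝ × Plane | ∃ z' : ℝ × Plane, Scatters B z z'} :=
    measurableSet_exists_of_unique (P := fun z z' : ℝ × Plane => Scatters B z z')
      (measurableSet_scatters B) fun z z' z'' h h' => h.right_unique h'
  have h3 : impulse B ⁻¹' A = {z : ℝ × Plane | ∃ z' : ℝ × Plane, Scatters B z z' ∧
      (!₂[Real.sin (z'.1 - z.1), 1 + Real.cos (z'.1 - z.1)] : Plane) ∈ A} ∪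
      ({z : ℝ × Plane | ∃ z' : ℝ × Plane, Scatters B z z'}ᶜ ∩ {z | (0 : Plane) ∈ A}) := by
    ext z
    by_cases hz : ∃ z', Scatters B z z'
    · obtain ⟨z', hz'⟩ := hz
      simp only [mem_preimage, impulse_eq hz', mem_union, mem_inter_iff, mem_compl_iff, mem_ofPred_eq]
      constructor
      · exact fun h => Or.inl ⟨z', hz', h⟩
      · rintro (⟨z'', h, h'⟩ | ⟨h, -⟩)
        · rwa [hz'.right_unique h]
        · exact absurd ⟨z', hz'⟩ h
    · have h0 : impulse B z = 0 := by rw [impulse, dif_neg hz]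
      simp only [mem_preimage, h0, mem_union, mem_inter_iff, mem_compl_iff, mem_ofPred_eq]
      constructor
      · exact fun h => Or.inr ⟨hz, h⟩
      · rintro (⟨z'', h, h'⟩ | ⟨-, h⟩)
        · exact absurd ⟨z'', h⟩ hz
        · exact h
  rw [h3]
  exact h1.union (h2.compl.inter (.const _))

/-! ### Supporting lines and the length of the boundary of a convex set -/

theorem exists_support {C : Set Plane} (hC : Convex ℝ C) (hi : (interior C).Nonempty) {p : Plane}
    (hp : p ∉ interior C) : ∃ m : Plane, ‖m‖ = 1 ∧ ∀ q ∈ C, inner ℝ m (q - p) ≤ (0 : ℝ) := by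
  obtain ⟨f, hf0, hf⟩ := geometric_hahn_banach_of_nonempty_interior_point hC hp hi
  set m := (InnerProductSpace.toDual ℝ Plane).symm f with hm
  have hmf : ∀ y, inner ℝ m y = f y := fun y => InnerProductSpace.toDual_symm_apply
  have hm0 : m ≠ 0 := by
    intro h0
    refine hf0 (ContinuousLinearMap.ext fun y => ?_)
    rw [← hmf, h0, inner_zero_left, zero_apply]
  refine ⟨(‖m‖⁻¹ : ℝ) • m, ?_, fun q hq => ?_⟩
  · rw [norm_smul, norm_inv, norm_norm, inv_mul_cancel₀ (norm_ne_zero_iff.2 hm0)]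
  · rw [real_inner_smul_left, hmf, map_sub]
    exact mul_nonpos_of_nonneg_of_nonpos (by positivity) (by linarith [hf q hq])

theorem notMem_interior_of_support {C : Set Plane} {p m : Plane} (hm : ‖m‖ = 1)
    (h : ∀ q ∈ C, inner ℝ m (q - p) ≤ (0 : ℝ)) : p ∉ interior C := by
  intro hp
  have ht : Tendsto (fun t : ℝ => p + t • m) (𝓝 0) (𝓝 p) := by
    have : Continuous fun t : ℝ => p + t • m := by fun_prop
    simpa using this.tendsto 0
  have h1 : ∀ᶠ t : ℝ in 𝓝[>] 0, p + t • m ∈ C :=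
    nhdsWithin_le_nhds (ht.eventually (mem_interior_iff_mem_nhds.1 hp))
  obtain ⟨t, ht1, ht2⟩ := (h1.and self_mem_nhdsWithin).exists
  have := h _ ht1
  rw [add_sub_cancel_left, real_inner_smul_right, real_inner_self_eq_norm_sq, hm] at this
  have h3 : (0 : ℝ) < t := ht2
  linarith

theorem support_closure {C : Set Plane} {p m : Plane}
    (h : ∀ q ∈ C, inner ℝ m (q - p) ≤ (0 : ℝ)) : ∀ q ∈ closure C, inner ℝ m (q - p) ≤ (0 : ℝ) := by
  have hcl : IsClosed {q : Plane | inner ℝ m (q - p) ≤ (0 : ℝ)} :=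
    isClosed_le (by fun_prop) (by fun_prop)
  exact fun q hq => closure_minimal h hcl hq

theorem mem_frontier_of_support {C : Set Plane} {p m : Plane} (hp : p ∈ closure C) (hm : ‖m‖ = 1)
    (h : ∀ q ∈ C, inner ℝ m (q - p) ≤ (0 : ℝ)) : p ∈ frontier C :=
  ⟨hp, notMem_interior_of_support hm h⟩

/-- A segment from a point of a set to a point outside meets the frontier. -/
theorem exists_mem_segment_frontier {D : Set Plane} {x y : Plane} (hx : x ∈ D) (hy : y ∉ D) :
    ∃ z ∈ segment ℝ x y, z ∈ frontier D := by
  have hpre : IsPreconnected (segment ℝ x y) := (convex_segment x y).isPreconnected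
  by_contra! hcon
  have h1 : segment ℝ x y ⊆ interior D ∪ (closure D)ᶜ := by
    intro z hz
    by_cases hz' : z ∈ closure D
    · left
      by_contra h
      exact hcon z hz ⟨hz', h⟩
    · exact Or.inr hz'
  obtain ⟨z, -, hz1, hz2⟩ := hpre _ _ isOpen_interior isClosed_closure.isOpen_compl h1
    ⟨x, left_mem_segment ℝ x y, (h1 (left_mem_segment ℝ x y)).resolve_right
      fun h => h (subset_closure hx)⟩
    ⟨y, right_mem_segment ℝ x y, (h1 (right_mem_segment ℝ x y)).resolve_left
      fun h => hy (interior_subset h)⟩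
  exact hz2 (subset_closure (interior_subset hz1))

theorem exists_ray_frontier {D : Set Plane} (hb : Bornology.IsBounded D) {p m : Plane}
    (hp : p ∈ closure D) (hm : ‖m‖ = 1) : ∃ s : ℝ, 0 ≤ s ∧ p + s • m ∈ frontier D := by
  by_cases hpD : p ∈ D
  · obtain ⟨R, hR⟩ := hb.subset_closedBall p
    have hout : p + (|R| + 1) • m ∉ D := by
      intro h
      have := hR h
      rw [Metric.mem_closedBall, dist_eq_norm, add_sub_cancel_left, norm_smul, hm, mul_one,
        Real.norm_eq_abs, abs_of_nonneg (by positivity)] at this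
      linarith [le_abs_self R]
    obtain ⟨z, hz, hzf⟩ := exists_mem_segment_frontier hpD hout
    rw [segment_eq_image'] at hz
    obtain ⟨t, ht, rfl⟩ := hz
    refine ⟨t * (|R| + 1), mul_nonneg ht.1 (by positivity), ?_⟩
    simpa [smul_smul] using hzf
  -- A point of the closure that is outside `D` is itself a frontier point.
  · exact ⟨0, le_rfl, by simpa using ⟨hp, fun h => hpD (interior_subset h)⟩⟩

/-- The nearest-point projection onto `closure C` is 1-Lipschitz and maps a part of `frontier D`
onto `frontier C`: a boundary point `p` of `C` is the projection of every point of a normal ray at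
`p`, and this ray meets the frontier of the bounded set `D`. -/
theorem frontier_measure_mono {C D : Set Plane} (hC : Convex ℝ C) (hi : (interior C).Nonempty)
    (hCD : C ⊆ D) (hb : Bornology.IsBounded D) : μH[1] (frontier C) ≤ μH[1] (frontier D) := by
  have hcc : Convex ℝ (closure C) := hC.closure
  have hne : (closure C).Nonempty := hi.mono (interior_subset.trans subset_closure)
  have hex : ∀ x : Plane, ∃ v ∈ closure C, ∀ q ∈ closure C, inner ℝ (x - v) (q - v) ≤ (0 : ℝ) := by
    intro x
    obtain ⟨v, hv, h⟩ := exists_norm_eq_iInf_of_complete_convex hne isClosed_closure.isComplete hcc x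
    exact ⟨v, hv, (norm_eq_iInf_iff_real_inner_le_zero hcc hv).1 h⟩
  choose π hπ hπi using hex
  -- Adding the two variational inequalities gives `‖a - b‖² ≤ ⟨x - y, a - b⟩`, the firm
  -- nonexpansiveness of the projection.
  have hcontr : ∀ x y a b : Plane, inner ℝ (x - a) (b - a) ≤ (0 : ℝ) →
      inner ℝ (y - b) (a - b) ≤ (0 : ℝ) → ‖a - b‖ ≤ ‖x - y‖ := by
    intro x y a b h1 h2
    have h3 : ‖a - b‖ ^ 2 ≤ inner ℝ (x - y) (a - b) := by
      rw [← real_inner_self_eq_norm_sq]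
      have e1 : inner ℝ (x - a) (b - a) = -(inner ℝ (x - a) (a - b) : ℝ) := by
        rw [← inner_neg_right, neg_sub]
      have e2 : inner ℝ (x - y) (a - b) = inner ℝ (x - a) (a - b) + inner ℝ (a - b) (a - b)
          - (inner ℝ (y - b) (a - b) : ℝ) := by
        rw [← inner_add_left, ← inner_sub_left]; congr 1; abel
      linarith
    have h4 := h3.trans (real_inner_le_norm _ _)
    by_contra! hlt
    have : 0 ≤ ‖x - y‖ := norm_nonneg _
    nlinarith
  have hlip : LipschitzWith 1 π := LipschitzWith.of_dist_le_mul fun x y => by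
    rw [NNReal.coe_one, one_mul, dist_eq_norm, dist_eq_norm]
    exact hcontr x y _ _ (hπi x _ (hπ y)) (hπi y _ (hπ x))
  have hsub : frontier C ⊆ π '' frontier D := by
    intro p hp
    obtain ⟨m, hm, hms⟩ := exists_support hC hi hp.2
    obtain ⟨s, hs, hsf⟩ := exists_ray_frontier hb (closure_mono hCD hp.1) hm
    refine ⟨_, hsf, ?_⟩
    have h1 := hcontr (p + s • m) (p + s • m) (π (p + s • m)) p (hπi _ _ hp.1) (by
      rw [add_sub_cancel_left, real_inner_smul_left]
      exact mul_nonpos_of_nonneg_of_nonpos hs (support_closure hms _ (hπ _)))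
    rw [sub_self, norm_zero] at h1
    exact sub_eq_zero.1 (norm_le_zero_iff.1 h1)
  calc μH[1] (frontier C) ≤ μH[1] (π '' frontier D) := measure_mono hsub
    _ ≤ (1 : NNReal) ^ (1 : ℝ) * μH[1] (frontier D) := by
        simpa using hlip.hausdorffMeasure_image_le zero_le_one (frontier D)
    _ = μH[1] (frontier D) := by simp

/-- Comparison with a large square, whose frontier is covered by four segments. -/
theorem frontier_measure_lt_top {C : Set Plane} (hC : Convex ℝ C) (hi : (interior C).Nonempty)
    (hb : Bornology.IsBounded C) : μH[1] (frontier C) < ⊤ := by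
  obtain ⟨R, hR⟩ := hb.subset_closedBall 0
  set Q : Set Plane := {x | |x 0| ≤ |R| ∧ |x 1| ≤ |R|} with hQ
  have hcoord : ∀ (x : Plane) (i : Fin 2), |x i| ≤ ‖x‖ := fun x i => by
    simpa using PiLp.norm_apply_le x i
  have hCQ : C ⊆ Q := by
    intro x hx
    have h1 : ‖x‖ ≤ |R| := (by simpa using hR hx : ‖x‖ ≤ R).trans (le_abs_self R)
    exact ⟨(hcoord x 0).trans h1, (hcoord x 1).trans h1⟩
  have hQb : Bornology.IsBounded Q := by
    refine (Metric.isBounded_closedBall (x := (0 : Plane)) (r := 2 * |R|)).subset fun x hx => ?_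
    rw [mem_closedBall_zero_iff]
    refine abs_le_of_sq_le_sq' ?_ (by positivity) |>.2
    rw [plane_norm_sq, ← sq_abs (x 0), ← sq_abs (x 1)]
    nlinarith [hx.1, hx.2, abs_nonneg (x 0), abs_nonneg (x 1), abs_nonneg R]
  have hQc : IsClosed Q :=
    (isClosed_le (by fun_prop) (by fun_prop)).and (isClosed_le (by fun_prop) (by fun_prop))
  have hQo : IsOpen {x : Plane | |x 0| < |R| ∧ |x 1| < |R|} :=
    (isOpen_lt (by fun_prop) (by fun_prop)).and (isOpen_lt (by fun_prop) (by fun_prop))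
  have hseg : ∀ a b c d x : Plane, (x ∈ segment ℝ a b ∨ x ∈ segment ℝ b c ∨ x ∈ segment ℝ c d ∨
      x ∈ segment ℝ d a) → x ∈ segment ℝ a b ∪ segment ℝ b c ∪ segment ℝ c d ∪ segment ℝ d a := by
    intro a b c d x; simp only [mem_union]; tauto
  have hv : ∀ r : ℝ, ∀ x : Plane, x 0 = r → |x 1| ≤ |R| →
      x ∈ segment ℝ (!₂[r, -|R|] : Plane) !₂[r, |R|] := by
    intro r x hx h
    obtain ⟨h1, h2⟩ := abs_le.1 h
    obtain ⟨a, b, ha, hb, hab, he⟩ : x 1 ∈ segment ℝ (-|R|) |R| := by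
      rw [segment_eq_Icc (h1.trans h2)]; exact ⟨h1, h2⟩
    refine ⟨a, b, ha, hb, hab, plane_ext ?_ ?_⟩
    · simp [hx, ← add_mul, hab]
    · simpa using he
  have hh : ∀ r : ℝ, ∀ x : Plane, x 1 = r → |x 0| ≤ |R| →
      x ∈ segment ℝ (!₂[-|R|, r] : Plane) !₂[|R|, r] := by
    intro r x hx h
    obtain ⟨h1, h2⟩ := abs_le.1 h
    obtain ⟨a, b, ha, hb, hab, he⟩ : x 0 ∈ segment ℝ (-|R|) |R| := by
      rw [segment_eq_Icc (h1.trans h2)]; exact ⟨h1, h2⟩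
    refine ⟨a, b, ha, hb, hab, plane_ext ?_ ?_⟩
    · simpa using he
    · simp [hx, ← add_mul, hab]
  have hfr : frontier Q ⊆ (segment ℝ (!₂[|R|, -|R|] : Plane) !₂[|R|, |R|] ∪
      segment ℝ (!₂[-|R|, -|R|] : Plane) !₂[-|R|, |R|]) ∪
      (segment ℝ (!₂[-|R|, |R|] : Plane) !₂[|R|, |R|] ∪
      segment ℝ (!₂[-|R|, -|R|] : Plane) !₂[|R|, -|R|]) := by
    intro x hx
    have hxQ : x ∈ Q := hQc.frontier_subset hx
    by_cases h0 : |x 0| < |R|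
    · by_cases h1 : |x 1| < |R|
      · exact absurd (interior_maximal (fun y hy => ⟨hy.1.le, hy.2.le⟩ : _ ⊆ Q) hQo ⟨h0, h1⟩) hx.2
      · right
        have h2 : |x 1| = |R| := le_antisymm hxQ.2 (not_lt.1 h1)
        rcases abs_choice (x 1) with h | h
        · exact Or.inl (hh _ x (by rw [← h2, h]) h0.le)
        · exact Or.inr (hh _ x (by rw [← h2, h, neg_neg]) h0.le)
    · left
      have h2 : |x 0| = |R| := le_antisymm hxQ.1 (not_lt.1 h0)
      rcases abs_choice (x 0) with h | h
      · exact Or.inl (hv _ x (by rw [← h2, h]) hxQ.2)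
      · exact Or.inr (hv _ x (by rw [← h2, h, neg_neg]) hxQ.2)
  have hs : ∀ a b : Plane, μH[1] (segment ℝ a b) < ⊤ := fun a b => by
    rw [hausdorffMeasure_segment]; exact edist_lt_top a b
  refine (frontier_measure_mono hC hi hCQ hQb).trans_lt ((measure_mono hfr).trans_lt ?_)
  exact measure_union_lt_top (measure_union_lt_top (hs _ _) (hs _ _))
    (measure_union_lt_top (hs _ _) (hs _ _))

theorem perimeter_mono {C D : Set Plane} (hC : Convex ℝ C) (hi : (interior C).Nonempty)
    (hCD : C ⊆ D) (hD : Convex ℝ D) (hb : Bornology.IsBounded D) : perimeter C ≤ perimeter D :=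
  ENNReal.toReal_mono (frontier_measure_lt_top hD (hi.mono (interior_mono hCD)) hb).ne
    (frontier_measure_mono hC hi hCD hb)

/-! ### The total phase volume and the upper bound for the resistance -/

theorem integral_cos_half_pi :
    ∫ φ in Ioo (-(Real.pi / 2)) (Real.pi / 2), Real.cos φ = 2 := by
  rw [← integral_Ioc_eq_integral_Ioo, ← intervalIntegral.integral_of_le (by linarith [Real.pi_pos]),
    integral_cos]
  norm_num

/-- The angular factor of the phase measure. -/
noncomputable def angleMeasure : Measure ℝ :=
  (volume.restrict (Ioo (-(Real.pi / 2)) (Real.pi / 2))).withDensity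
      (fun φ => ENNReal.ofReal (Real.cos φ))

theorem phaseMeasure_eq (B : Set Plane) : phaseMeasure B =
    angleMeasure.prod ((μH[1] : Measure Plane).restrict (frontier (convexHull ℝ B))) := rfl

theorem angleMeasure_apply {s : Set ℝ} (hs : MeasurableSet s)
    (hsub : s ⊆ Ioo (-(Real.pi / 2)) (Real.pi / 2)) :
    angleMeasure s = ENNReal.ofReal (∫ φ in s, Real.cos φ) := by
  have hint : Integrable Real.cos (volume.restrict s) :=
    (Real.continuous_cos.integrableOn_Icc (a := -(Real.pi / 2)) (b := Real.pi / 2)).mono_set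
      (hsub.trans Ioo_subset_Icc_self)
  rw [angleMeasure, withDensity_apply _ hs, Measure.restrict_restrict hs,
    inter_eq_left.2 hsub, ofReal_integral_eq_lintegral_ofReal hint]
  filter_upwards [ae_restrict_mem hs] with φ hφ
  exact Real.cos_nonneg_of_mem_Icc (Ioo_subset_Icc_self (hsub hφ))

theorem angleMeasure_univ : angleMeasure univ = 2 := by
  have h : angleMeasure univ = angleMeasure (Ioo (-(Real.pi / 2)) (Real.pi / 2)) := by
    rw [angleMeasure, withDensity_apply _ .univ, withDensity_apply _ measurableSet_Ioo,
      Measure.restrict_univ, Measure.restrict_restrict measurableSet_Ioo, inter_self]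
  rw [h, angleMeasure_apply measurableSet_Ioo subset_rfl, integral_cos_half_pi]
  norm_num

instance : IsFiniteMeasure angleMeasure := ⟨by rw [angleMeasure_univ]; norm_num⟩

/-- The constant is `3/8 · 2 · 2`: normalization, maximal impulse, total mass of the angular
measure. No measurability is used. -/
theorem norm_meanResistance_le {B : Set Plane} (hi : (interior (convexHull ℝ B)).Nonempty)
    (hb : Bornology.IsBounded B) : ‖meanResistance B‖ ≤ 3 / 2 * perimeter (convexHull ℝ B) := by
  have hfin := frontier_measure_lt_top (convex_convexHull ℝ B) hi (isBounded_convexHull.2 hb)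
  have : IsFiniteMeasure ((μH[1] : Measure Plane).restrict (frontier (convexHull ℝ B))) :=
    ⟨by rwa [Measure.restrict_apply_univ]⟩
  have h1 : ‖∫ z, impulse B z ∂(phaseMeasure B)‖ ≤ 2 * (phaseMeasure B).real univ := by
    rw [phaseMeasure_eq]
    exact norm_integral_le_of_norm_le_const (.of_forall fun z => norm_impulse_le B z)
  have h2 : (phaseMeasure B).real univ = 2 * perimeter (convexHull ℝ B) := by
    rw [phaseMeasure_eq, measureReal_def, ← univ_prod_univ, Measure.prod_prod, angleMeasure_univ,
      Measure.restrict_apply_univ, ENNReal.toReal_mul]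
    rfl
  rw [meanResistance, norm_smul]
  have h3 : ‖(-(3 / 8) : ℝ)‖ = 3 / 8 := by norm_num
  rw [h3]
  rw [h2] at h1
  linarith

/-! ### Regular boundary points of convex sets, and the resistance of a convex set -/

@[fun_prop]
theorem Continuous.cross' {X : Type*} [TopologicalSpace X] {f g : X → Plane} (hf : Continuous f)
    (hg : Continuous g) : Continuous fun x => cross (f x) (g x) := by
  unfold cross
  fun_prop

/-- The normal cone of a set at a point. -/
def normalCone (C : Set Plane) (p : Plane) : Set Plane := {m | ∀ q ∈ C, inner ℝ m (q - p) ≤ (0 : ℝ)}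

theorem normalCone_combo {C : Set Plane} {p m m' : Plane} (hm : m ∈ normalCone C p)
    (hm' : m' ∈ normalCone C p) {a b : ℝ} (ha : 0 ≤ a) (hb : 0 ≤ b) :
    a • m + b • m' ∈ normalCone C p := by
  intro q hq
  rw [inner_add_left, real_inner_smul_left, real_inner_smul_left]
  have := mul_nonpos_of_nonneg_of_nonpos ha (hm q hq)
  have := mul_nonpos_of_nonneg_of_nonpos hb (hm' q hq)
  linarith

/-- The positive combinations of two independent vectors form an open cone; by Cramer's rule
membership is the positivity of two quotients of cross products. -/
theorem normalCone_interior_nonempty {C : Set Plane} {p m m' : Plane} (hm : m ∈ normalCone C p)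
    (hm' : m' ∈ normalCone C p) (h : cross m m' ≠ 0) : (interior (normalCone C p)).Nonempty := by
  set U : Set Plane := {x | 0 < cross x m' / cross m m' ∧ 0 < cross m x / cross m m'} with hU
  have hUo : IsOpen U := by
    exact (isOpen_lt (by fun_prop) (by fun_prop)).and (isOpen_lt (by fun_prop) (by fun_prop))
  refine ⟨m + m', interior_maximal (fun x hx => ?_) hUo ?_⟩
  · have : x = (cross x m' / cross m m') • m + (cross m x / cross m m') • m' := by
      apply plane_ext
      · simp only [PiLp.add_apply, PiLp.smul_apply, smul_eq_mul]
        field_simp; unfold cross; ring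
      · simp only [PiLp.add_apply, PiLp.smul_apply, smul_eq_mul]
        field_simp; unfold cross; ring
    rw [this]
    exact normalCone_combo hm hm' hx.1.le hx.2.le
  · have h1 : cross (m + m') m' = cross m m' := by
      unfold cross; simp only [PiLp.add_apply]; ring
    have h2 : cross m (m + m') = cross m m' := by
      unfold cross; simp only [PiLp.add_apply]; ring
    constructor
    · rw [h1, div_self h]; exact one_pos
    · rw [h2, div_self h]; exact one_pos

/-- A common normal `m` is maximal over the closure at both points, so `⟨m, q - p⟩ = 0`; tilting `m`
towards `q - p` would stay in the cone at `p` while preferring `q` to `p`. -/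
theorem normalCone_interior_disjoint {C : Set Plane} {p q : Plane} (hp : p ∈ closure C)
    (hq : q ∈ closure C) (hpq : p ≠ q) :
    Disjoint (interior (normalCone C p)) (interior (normalCone C q)) := by
  rw [Set.disjoint_left]
  intro m hm hm'
  have ht : Tendsto (fun t : ℝ => m + t • (q - p)) (𝓝 0) (𝓝 m) := by
    have : Continuous fun t : ℝ => m + t • (q - p) := by fun_prop
    simpa using this.tendsto 0
  have h1 : ∀ᶠ t : ℝ in 𝓝[>] 0, m + t • (q - p) ∈ normalCone C p :=
    nhdsWithin_le_nhds (ht.eventually (mem_interior_iff_mem_nhds.1 hm))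
  obtain ⟨t, ht1, ht2⟩ := (h1.and self_mem_nhdsWithin).exists
  have h3 := support_closure ht1 q hq
  have h4 := support_closure (interior_subset hm') p hp
  have h5 : inner ℝ m (p - q) = -(inner ℝ m (q - p) : ℝ) := by rw [← inner_neg_right, neg_sub]
  rw [inner_add_left, real_inner_smul_left, real_inner_self_eq_norm_sq] at h3
  have h6 : 0 < ‖q - p‖ := norm_pos_iff.2 (sub_ne_zero.2 hpq.symm)
  have h7 : 0 < t * ‖q - p‖ ^ 2 := mul_pos ht2 (by positivity)
  linarith

/-- A convex set with interior points has a unique outward normal at all but countably many points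
of its boundary. -/
theorem countable_corners {C : Set Plane} (hC : Convex ℝ C) (hi : (interior C).Nonempty) :
    {p ∈ frontier C | ¬ ∃ n, IsOutwardNormal C p n}.Countable := by
  refine PairwiseDisjoint.countable_of_isOpen (s := fun p => interior (normalCone C p)) ?_
    (fun _ _ => isOpen_interior) ?_
  · intro p hp q hq hpq
    exact normalCone_interior_disjoint hp.1.1 hq.1.1 hpq
  · rintro p ⟨hp, hno⟩
    obtain ⟨m, hm, hmC⟩ := exists_support hC hi hp.2
    obtain ⟨m', ⟨hm', hmC'⟩, hne⟩ : ∃ m', (‖m'‖ = 1 ∧ ∀ q ∈ C, inner ℝ m' (q - p) ≤ (0 : ℝ)) ∧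
        m' ≠ m := by
      by_contra! hcon
      exact hno ⟨m, eq_singleton_iff_unique_mem.2 ⟨⟨hm, hmC⟩, hcon⟩⟩
    refine normalCone_interior_nonempty (m := m) (m' := m') hmC hmC' fun h0 => ?_
    rw [cross_eq_inner] at h0
    rcases unit_eq_or_neg hm hm' h0 with h | h
    · exact hne h
    -- If both `m` and `-m` were normals, `C` would lie on a line: `m` would support `C` even at an
    -- interior point.
    · obtain ⟨x, hx⟩ := hi
      refine notMem_interior_of_support (p := x) hm (fun q hq => ?_) hx
      have h1 := hmC q hq
      have h2 := hmC' x (interior_subset hx)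
      rw [h, inner_neg_left] at h2
      have h3 : q - x = (q - p) - (x - p) := by abel
      rw [h3, inner_sub_right]
      linarith

/-- Unit normals depend upper semicontinuously on the base point: by compactness, the points of a
closed ball that carry a unit normal at distance at least `c` from `n` form a closed set, which does
not contain `p`. -/
theorem exists_unit_close_normal {C : Set Plane} {p n : Plane} (hn : IsOutwardNormal C p n) {c : ℝ}
    (hc : 0 < c) : ∀ᶠ q in 𝓝 p, ∀ m : Plane, ‖m‖ = 1 → m ∈ normalCone C q → ‖m - n‖ < c := by
  by_contra hcon
  rw [not_eventually] at hcon
  set S : Set (Plane × Plane) := {x | ‖x.2‖ = 1 ∧ (∀ y ∈ C, inner ℝ x.2 (y - x.1) ≤ (0 : ℝ)) ∧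
    c ≤ ‖x.2 - n‖} ∩ (Metric.closedBall p 1 ×ˢ Metric.closedBall 0 1) with hS
  have hScl : IsCompact S := by
    refine ((isCompact_closedBall _ _).prod (isCompact_closedBall _ _)).inter_left ?_
    have h0 : IsClosed {x : Plane × Plane | ∀ y ∈ C, inner ℝ x.2 (y - x.1) ≤ (0 : ℝ)} := by
      have : {x : Plane × Plane | ∀ y ∈ C, inner ℝ x.2 (y - x.1) ≤ (0 : ℝ)} =
        ⋂ y ∈ C, {x | inner ℝ x.2 (y - x.1) ≤ (0 : ℝ)} := by ext x; simp
      rw [this]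
      exact isClosed_biInter fun q _ => isClosed_le (by fun_prop) (by fun_prop)
    exact (isClosed_eq (by fun_prop) (by fun_prop)).and
      (h0.and (isClosed_le (by fun_prop) (by fun_prop)))
  have hT : IsClosed (Prod.fst '' S) := (hScl.image continuous_fst).isClosed
  have hpT : p ∈ Prod.fst '' S := by
    rw [← hT.closure_eq, mem_closure_iff_frequently]
    refine (hcon.and_eventually (Metric.closedBall_mem_nhds p one_pos)).mono ?_
    rintro q ⟨hq, hqb⟩
    push Not at hq
    obtain ⟨m, hm1, hm2, hm3⟩ := hq
    exact ⟨(q, m), ⟨⟨hm1, hm2, hm3⟩, hqb, by simp [hm1]⟩, rfl⟩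
  obtain ⟨⟨q, m⟩, ⟨⟨h1, h2, h3⟩, -⟩, hq⟩ := hpT
  obtain rfl : q = p := hq
  have : m ∈ ({n} : Set Plane) := by rw [← hn]; exact ⟨h1, h2⟩
  rw [mem_singleton_iff.1 this, sub_self, norm_zero] at h3
  linarith

/-- As `n` is the only unit normal, `τ` is not one, so `C` has interior points on its positive side.
Starting close to `p` on the segment to such a point and climbing along `n`, one leaves `C` through
a frontier point still on the positive side. -/
theorem IsOutwardNormal.frequently_pos {C : Set Plane} (hC : Convex ℝ C) {p n τ : Plane} (hp : p ∈ frontier C)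
    (hi : (interior C).Nonempty)
    (hn : IsOutwardNormal C p n) (hτ : ‖τ‖ = 1) (hτn : inner ℝ τ n = (0 : ℝ)) :
    ∃ᶠ q in 𝓝[frontier C] p, 0 < (inner ℝ τ (q - p) : ℝ) := by
  have hn1 := hn.norm_eq
  -- a point of `C` on the positive side
  obtain ⟨q₀, hq₀, hpos₀⟩ : ∃ q ∈ C, 0 < (inner ℝ τ (q - p) : ℝ) := by
    by_contra! hcon
    have : τ ∈ ({n} : Set Plane) := by rw [← hn]; exact ⟨hτ, hcon⟩
    rw [mem_singleton_iff.1 this, real_inner_self_eq_norm_sq, hn1] at hτn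
    norm_num at hτn
  obtain ⟨q, hq, hpos⟩ : ∃ q ∈ interior C, 0 < (inner ℝ τ (q - p) : ℝ) := by
    have h1 : q₀ ∈ closure (interior C) := by
      rw [hC.closure_interior_eq_closure_of_nonempty_interior hi]; exact subset_closure hq₀
    have hop : IsOpen {q : Plane | 0 < (inner ℝ τ (q - p) : ℝ)} :=
      isOpen_lt (by fun_prop) (by fun_prop)
    obtain ⟨q, h2, h3⟩ := mem_closure_iff.1 h1 _ hop hpos₀
    exact ⟨q, h3, h2⟩
  set d := ‖q - p‖ with hd
  have hnq : |(inner ℝ n (q - p) : ℝ)| ≤ d := by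
    simpa [hn1] using abs_real_inner_le_norm n (q - p)
  -- above each point of the segment from `p` to `q` there is a point of the boundary
  have key : ∀ t : ℝ, 0 < t → t ≤ 1 → ∃ x ∈ frontier C, 0 < (inner ℝ τ (x - p) : ℝ) ∧
      dist x p ≤ t * (2 * d + 1) := by
    intro t ht ht1
    have hx : p + t • (q - p) ∈ C := by
      refine interior_subset ?_
      have := hC.combo_interior_closure_mem_interior hq hp.1 ht (by linarith : 0 ≤ 1 - t) (by ring)
      convert this using 1
      module
    -- The point of the segment is at most `t * d` below the supporting line, so a climb of `t * (d
    -- + 1)` leaves `C`.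
    have hy : p + t • (q - p) + (t * (d + 1)) • n ∉ C := by
      intro h
      have h1 := hn.inner_le _ h
      rw [add_sub_right_comm, add_sub_cancel_left, inner_add_right, real_inner_smul_right,
        real_inner_smul_right, real_inner_self_eq_norm_sq, hn1] at h1
      have h2 := (abs_le.1 hnq).1
      nlinarith
    obtain ⟨z, hz, hzf⟩ := exists_mem_segment_frontier hx hy
    rw [segment_eq_image'] at hz
    obtain ⟨s, hs, rfl⟩ := hz
    refine ⟨_, hzf, ?_, ?_⟩
    · rw [add_sub_cancel_left, add_sub_right_comm, add_sub_cancel_left, inner_add_right,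
        real_inner_smul_right, real_inner_smul_right, real_inner_smul_right, hτn]
      nlinarith [mul_pos ht hpos]
    · rw [add_sub_cancel_left, dist_eq_norm, add_sub_right_comm, add_sub_cancel_left]
      refine (norm_add_le _ _).trans ?_
      rw [norm_smul, norm_smul, norm_smul, hn1, Real.norm_eq_abs, Real.norm_eq_abs,
        Real.norm_eq_abs, abs_of_pos ht, abs_of_nonneg hs.1, abs_of_nonneg
        (mul_nonneg ht.le (by positivity))]
      have : s * (t * (d + 1) * 1) ≤ t * (d + 1) := by
        rw [mul_one]; exact mul_le_of_le_one_left (mul_nonneg ht.le (by positivity)) hs.2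
      linarith
  rw [frequently_nhdsWithin_iff, Metric.nhds_basis_ball.frequently_iff]
  intro r hr
  have hd0 : 0 < 2 * d + 1 := by positivity
  obtain ⟨x, hx, hx1, hx2⟩ := key (min 1 (r / (2 * (2 * d + 1)))) (by positivity) (min_le_left _ _)
  refine ⟨x, ?_, hx1, hx⟩
  rw [Metric.mem_ball]
  refine hx2.trans_lt ?_
  calc min 1 (r / (2 * (2 * d + 1))) * (2 * d + 1) ≤ r / (2 * (2 * d + 1)) * (2 * d + 1) :=
        mul_le_mul_of_nonneg_right (min_le_right _ _) hd0.le
    _ = r / 2 := by field_simp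
    _ < r := by linarith

/-- At a nearby frontier point `q` some unit normal `m` is close to `n`. Since `m` supports at `q`
and `n` at `p`, the normal coordinate of `q - p` is at most `‖m - n‖ ‖q - p‖` in absolute value. -/
theorem IsOutwardNormal.hasBoundaryNormal {C : Set Plane} (hC : Convex ℝ C)
    (hi : (interior C).Nonempty) {p n : Plane} (hp : p ∈ frontier C) (hn : IsOutwardNormal C p n) :
    HasBoundaryNormal C p n := by
  have hn1 := hn.norm_eq
  refine ⟨hp, hn1, ?_, ?_, ?_⟩
  · refine IsLittleO.of_bound fun c hc => ?_
    filter_upwards [nhdsWithin_le_nhds (exists_unit_close_normal hn hc), self_mem_nhdsWithin]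
      with q hq hqf
    obtain ⟨m, hm1, hm⟩ := exists_support hC hi hqf.2
    have h1 := hq m hm1 hm
    have h2 := support_closure hm p hp.1
    have h3 := support_closure hn.inner_le q hqf.1
    have h4 : (inner ℝ (m - n) (q - p) : ℝ) ≤ ‖m - n‖ * ‖q - p‖ := real_inner_le_norm _ _
    have h5 : inner ℝ m (p - q) = -(inner ℝ m (q - p) : ℝ) := by rw [← inner_neg_right, neg_sub]
    rw [inner_sub_left] at h4
    rw [Real.norm_eq_abs, abs_of_nonpos h3]
    have h6 := mul_le_mul_of_nonneg_right h1.le (norm_nonneg (q - p))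
    linarith
  · exact hn.frequently_pos hC hp hi (by rw [norm_leftTurn, hn1]) (inner_leftTurn_self n)
  · have := hn.frequently_pos hC (τ := -leftTurn n) hp hi (by rw [norm_neg, norm_leftTurn, hn1])
      (by rw [inner_neg_left, inner_leftTurn_self, neg_zero])
    simpa only [inner_neg_left, neg_pos] using this

/-- There is a single reflection, at the entry point itself, and both flights stay strictly beyond
the supporting line at that point. The angle of reflection is counted on the other side of the
normal. -/
theorem scatters_convex {K : Set Plane} (hK : Convex ℝ K) (hi : (interior K).Nonempty) {ξ n : Plane}
    (hξ : ξ ∈ frontier K) (hn : IsOutwardNormal K ξ n) {φ : ℝ}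
    (hφ : φ ∈ Ioo (-(Real.pi / 2)) (Real.pi / 2)) : Scatters K (φ, ξ) (-φ, ξ) := by
  have hn1 := hn.norm_eq
  have hcos := Real.cos_pos_of_mem_Ioo hφ
  have hin : ∀ θ, inner ℝ n (rotCW θ n) = Real.cos θ := fun θ => by
    rw [rotCW_eq, inner_sub_right, real_inner_smul_right, real_inner_smul_right,
      inner_self_leftTurn, real_inner_self_eq_norm_sq, hn1]; ring
  have hout : ∀ x, 0 < (inner ℝ n (x - ξ) : ℝ) → x ∉ closure K := fun x hx hxK =>
    (support_closure hn.inner_le x hxK).not_gt hx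
  have hfree : ∀ s : ℝ, 0 < s → ξ + s • rotCW (-φ) n ∉ closure K := by
    intro s hs
    refine hout _ ?_
    rw [add_sub_cancel_left, real_inner_smul_right, hin, Real.cos_neg]
    exact mul_pos hs hcos
  have hconv : convexHull ℝ K = K := hK.convexHull_eq
  refine ⟨hφ, ⟨by simpa using neg_lt_neg hφ.2, by simpa using neg_lt_neg hφ.1⟩, by rwa [hconv],
    by rwa [hconv], n, n, -rotCW φ n, ξ, rotCW (-φ) n, by rwa [hconv], by rwa [hconv], neg_neg _, rfl,
    .single ⟨⟨1, one_pos, by simp, fun s hs h => ?_⟩, n, hn.hasBoundaryNormal hK hi hξ, ?_, ?_⟩,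
    fun s hs h => hfree s hs (frontier_subset_closure h), 0, le_rfl, by simp, fun s hs => ?_⟩
  · refine hout _ ?_ (frontier_subset_closure h)
    have : ξ - -rotCW φ n + s • -rotCW φ n - ξ = (1 - s) • rotCW φ n := by module
    dsimp only
    rw [this, real_inner_smul_right, hin]
    exact mul_pos (by linarith [hs.2]) hcos
  · dsimp only
    rw [inner_neg_right, hin]
    exact (neg_lt_zero.2 hcos).ne
  · dsimp only
    rw [inner_neg_right, hin, rotCW_eq, rotCW_eq, Real.cos_neg, Real.sin_neg]
    module
  · rw [hconv]; exact hfree s hs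

/-! ### Angular integrals and the resistance of a convex set -/

theorem integral_plane_apply {X : Type*} [MeasurableSpace X] {μ : Measure X} {f : X → Plane}
    (hf : Integrable f μ) (i : Fin 2) : (∫ x, f x ∂μ) i = ∫ x, f x i ∂μ :=
  ((EuclideanSpace.proj i : Plane →L[ℝ] ℝ).integral_comp_comm hf).symm

theorem integral_angleMeasure (f : ℝ → ℝ) : ∫ φ, f φ ∂angleMeasure =
    ∫ φ in (-(Real.pi / 2))..(Real.pi / 2), Real.cos φ * f φ := by
  rw [angleMeasure, integral_withDensity_eq_integral_toReal_smul (by fun_prop) (by simp),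
    intervalIntegral.integral_of_le (by linarith [Real.pi_pos]), integral_Ioc_eq_integral_Ioo]
  refine setIntegral_congr_fun measurableSet_Ioo fun φ hφ => ?_
  rw [smul_eq_mul, ENNReal.toReal_ofReal (Real.cos_nonneg_of_mem_Icc (Ioo_subset_Icc_self hφ))]

/-- The second component is `∫ 2 cos³ φ = 8/3`, the reciprocal of the normalization `3/8`. -/
theorem integral_impulse_self : ∫ φ, (!₂[Real.sin (-φ - φ), 1 + Real.cos (-φ - φ)] : Plane)
    ∂angleMeasure = !₂[0, 8 / 3] := by
  have hc : Continuous fun φ : ℝ => (!₂[Real.sin (-φ - φ), 1 + Real.cos (-φ - φ)] : Plane) := by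
    refine (PiLp.continuous_toLp 2 _).comp (continuous_pi fun i => ?_)
    fin_cases i
    · change Continuous fun φ : ℝ => Real.sin (-φ - φ)
      fun_prop
    · change Continuous fun φ : ℝ => 1 + Real.cos (-φ - φ)
      fun_prop
  have hint : Integrable (fun φ : ℝ => (!₂[Real.sin (-φ - φ), 1 + Real.cos (-φ - φ)] : Plane))
      angleMeasure := by
    refine Integrable.of_bound hc.aestronglyMeasurable 2 (.of_forall fun φ => ?_)
    refine abs_le_of_sq_le_sq' ?_ (by norm_num) |>.2
    rw [plane_norm_sq]
    generalize -φ - φ = x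
    change Real.sin x ^ 2 + (1 + Real.cos x) ^ 2 ≤ 2 ^ 2
    nlinarith [Real.sin_sq_add_cos_sq x, Real.cos_le_one x]
  apply plane_ext
  · rw [integral_plane_apply hint]
    change ∫ φ, Real.sin (-φ - φ) ∂angleMeasure = 0
    have h1 : ∀ φ : ℝ, Real.cos φ * Real.sin (-φ - φ) = -2 * (Real.sin φ * Real.cos φ ^ 2) := by
      intro φ
      rw [show -φ - φ = -(2 * φ) by ring, Real.sin_neg, Real.sin_two_mul]; ring
    rw [integral_angleMeasure]
    simp only [h1]
    rw [intervalIntegral.integral_const_mul, integral_sin_mul_cos_sq]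
    simp
  · rw [integral_plane_apply hint]
    change ∫ φ, (1 + Real.cos (-φ - φ)) ∂angleMeasure = 8 / 3
    have h1 : ∀ φ : ℝ, Real.cos φ * (1 + Real.cos (-φ - φ)) = 2 * Real.cos φ ^ 3 := by
      intro φ
      rw [show -φ - φ = -(2 * φ) by ring, Real.cos_neg, Real.cos_two_mul]; ring
    rw [integral_angleMeasure]
    simp only [h1]
    rw [intervalIntegral.integral_const_mul, integral_cos_pow_three]
    simp
    norm_num

/-- Corners are countable, hence null for the length measure, so specular reflection at the entry
point describes almost every particle. -/
theorem meanResistance_convex {K : Set Plane} (hK : Convex ℝ K) (hb : Bornology.IsBounded K)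
    (hi : (interior K).Nonempty) : ‖meanResistance K‖ = perimeter K := by
  have hconv : convexHull ℝ K = K := hK.convexHull_eq
  have hfin := frontier_measure_lt_top hK hi hb
  have : IsFiniteMeasure ((μH[1] : Measure Plane).restrict (frontier K)) :=
    ⟨by rwa [Measure.restrict_apply_univ]⟩
  have : NullSingletonClass (μH[1] : Measure Plane) := Measure.nullSingletonClass_hausdorff _ one_pos
  have h2 : ∀ᵐ ξ ∂((μH[1] : Measure Plane).restrict (frontier K)), ξ ∈ frontier K ∧
      ∃ n, IsOutwardNormal K ξ n := by
    have h3 : ∀ᵐ ξ ∂((μH[1] : Measure Plane).restrict (frontier K)),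
        ξ ∉ {p ∈ frontier K | ¬ ∃ n, IsOutwardNormal K p n} :=
      ae_restrict_of_ae ((countable_corners hK hi).ae_notMem _)
    filter_upwards [h3, ae_restrict_mem isClosed_frontier.measurableSet] with ξ h4 h5
    exact ⟨h5, by_contra fun h => h4 ⟨h5, h⟩⟩
  have h1 : ∀ᵐ φ ∂angleMeasure, φ ∈ Ioo (-(Real.pi / 2)) (Real.pi / 2) :=
    (withDensity_absolutelyContinuous _ _).ae_le (ae_restrict_mem measurableSet_Ioo)
  have hae : impulse K =ᵐ[phaseMeasure K]
      fun z => (!₂[Real.sin (-z.1 - z.1), 1 + Real.cos (-z.1 - z.1)] : Plane) := by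
    rw [phaseMeasure_eq, hconv]
    filter_upwards [Measure.quasiMeasurePreserving_fst.ae h1, Measure.quasiMeasurePreserving_snd.ae h2]
      with z hz1 hz2
    obtain ⟨φ, ξ⟩ := z
    obtain ⟨hf, n, hn⟩ := hz2
    have h3 := scatters_convex hK hi hf hn hz1
    rw [impulse_eq h3]
  have h6 : ∫ z, impulse K z ∂(phaseMeasure K) =
      ((μH[1] : Measure Plane).restrict (frontier K)).real univ • (!₂[0, 8 / 3] : Plane) := by
    rw [integral_congr_ae hae, phaseMeasure_eq, hconv, ← integral_impulse_self]
    exact integral_fun_fst (fun φ => (!₂[Real.sin (-φ - φ), 1 + Real.cos (-φ - φ)] : Plane))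
  rw [meanResistance, h6, norm_smul, norm_smul]
  have h5 : ‖(!₂[0, 8 / 3] : Plane)‖ = 8 / 3 := by
    refine (sq_eq_sq₀ (norm_nonneg _) (by norm_num)).1 ?_
    rw [plane_norm_sq, plane_mk_zero, plane_mk_one]; norm_num
  rw [h5, measureReal_def, Measure.restrict_apply_univ, Real.norm_eq_abs, Real.norm_eq_abs,
    abs_of_nonneg ENNReal.toReal_nonneg]
  unfold perimeter
  norm_num
  ring

/-! ### Orthonormal frames and similarities of the plane -/

/-- The linear map sending the standard basis to `u`, `leftTurn u`. -/
noncomputable def frame (u : Plane) : Plane →ₗ[ℝ] Plane where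
  toFun x := x 0 • u + x 1 • leftTurn u
  map_add' x y := by simp only [PiLp.add_apply]; module
  map_smul' c x := by simp only [PiLp.smul_apply, smul_eq_mul, RingHom.id_apply]; module

theorem frame_apply (u x : Plane) : frame u x = x 0 • u + x 1 • leftTurn u := rfl

theorem place_eq (p u : Plane) (s : ℝ) (x : Plane) : place p u s x = p + s • frame u x := rfl

theorem inner_frame {u : Plane} (hu : ‖u‖ = 1) (x y : Plane) :
    inner ℝ (frame u x) (frame u y) = (inner ℝ x y : ℝ) := by
  have h1 : inner ℝ u u = (1 : ℝ) := by rw [real_inner_self_eq_norm_sq, hu]; norm_num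
  have h2 : inner ℝ (leftTurn u) (leftTurn u) = (1 : ℝ) := by
    rw [real_inner_self_eq_norm_sq, norm_leftTurn, hu]; norm_num
  rw [frame_apply, frame_apply, plane_inner x y]
  simp only [inner_add_left, inner_add_right, real_inner_smul_left, real_inner_smul_right, h1, h2,
    inner_leftTurn_self, inner_self_leftTurn]
  ring

theorem norm_frame {u : Plane} (hu : ‖u‖ = 1) (x : Plane) : ‖frame u x‖ = ‖x‖ := by
  rw [norm_eq_sqrt_real_inner, inner_frame hu, ← norm_eq_sqrt_real_inner]

theorem continuous_frame (u : Plane) : Continuous (frame u) := by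
  simp only [funext (frame_apply u)]
  fun_prop

/-- The coordinates of a point in the frame with origin `p`, first axis `u` and unit length `s`. -/
noncomputable def coords (p u : Plane) (s : ℝ) (X : Plane) : Plane :=
  !₂[inner ℝ u (X - p) / s, inner ℝ (leftTurn u) (X - p) / s]

@[simp] theorem coords_zero (p u : Plane) (s : ℝ) (X : Plane) :
    coords p u s X 0 = inner ℝ u (X - p) / s := rfl

@[simp] theorem coords_one (p u : Plane) (s : ℝ) (X : Plane) :
    coords p u s X 1 = inner ℝ (leftTurn u) (X - p) / s := rfl

/-- The similarity `place p u s` as a homeomorphism. -/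
noncomputable def placeHomeo (p u : Plane) (s : ℝ) (hu : ‖u‖ = 1) (hs : 0 < s) : Plane ≃ₜ Plane where
  toFun := place p u s
  invFun := coords p u s
  left_inv x := by
    have h1 : inner ℝ u u = (1 : ℝ) := by rw [real_inner_self_eq_norm_sq, hu]; norm_num
    have h2 : inner ℝ (leftTurn u) (leftTurn u) = (1 : ℝ) := by
      rw [real_inner_self_eq_norm_sq, norm_leftTurn, hu]; norm_num
    have e : place p u s x - p = s • (x 0 • u + x 1 • leftTurn u) := by
      rw [place_eq, add_sub_cancel_left, frame_apply]
    apply plane_ext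
    · rw [coords_zero, e]
      simp only [inner_add_right, real_inner_smul_right, h1, inner_self_leftTurn]
      field_simp; ring
    · rw [coords_one, e]
      simp only [inner_add_right, real_inner_smul_right, h2, inner_leftTurn_self]
      field_simp; ring
  right_inv X := by
    rw [place_eq, frame_apply, coords_zero, coords_one]
    have := unit_decomp hu (X - p)
    calc p + s • ((inner ℝ u (X - p) / s) • u + (inner ℝ (leftTurn u) (X - p) / s) • leftTurn u)
        = p + ((s * (inner ℝ u (X - p) / s)) • u
          + (s * (inner ℝ (leftTurn u) (X - p) / s)) • leftTurn u) := by module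
      _ = p + (X - p) := by rw [mul_div_cancel₀ _ hs.ne', mul_div_cancel₀ _ hs.ne', ← this]
      _ = X := by abel
  continuous_toFun := by
    simp only [funext (place_eq p u s)]
    have := continuous_frame u
    fun_prop
  continuous_invFun := by
    refine (PiLp.continuous_toLp 2 _).comp (continuous_pi fun i => ?_)
    fin_cases i
    · change Continuous fun X : Plane => (inner ℝ u (X - p) : ℝ) / s
      fun_prop
    · change Continuous fun X : Plane => (inner ℝ (leftTurn u) (X - p) : ℝ) / s
      fun_prop

section

variable {p u : Plane} {s : ℝ}

theorem coords_place (hu : ‖u‖ = 1) (hs : 0 < s) (x : Plane) : coords p u s (place p u s x) = x :=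
  (placeHomeo p u s hu hs).left_inv x

theorem place_coords (hu : ‖u‖ = 1) (hs : 0 < s) (X : Plane) : place p u s (coords p u s X) = X :=
  (placeHomeo p u s hu hs).right_inv X

theorem mem_place_image (hu : ‖u‖ = 1) (hs : 0 < s) {A : Set Plane} {X : Plane} :
    X ∈ place p u s '' A ↔ coords p u s X ∈ A := by
  constructor
  · rintro ⟨x, hx, rfl⟩
    rwa [coords_place hu hs]
  · exact fun h => ⟨_, h, place_coords hu hs X⟩

theorem dist_place (hu : ‖u‖ = 1) (hs : 0 < s) (x y : Plane) :
    dist (place p u s x) (place p u s y) = s * dist x y := by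
  rw [dist_eq_norm, place_eq, place_eq, add_sub_add_left_eq_sub, ← smul_sub, ← map_sub, norm_smul,
    norm_frame hu, Real.norm_eq_abs, abs_of_pos hs, dist_eq_norm]

theorem place_add (x y : Plane) : place p u s (x + y) = place p u s x + s • frame u y := by
  rw [place_eq, place_eq, map_add]; module

/-- Converts flight times: time `t` in the plane corresponds to time `t / s` in the model mushroom.
-/
theorem place_add_smul (hs : 0 < s) (x d : Plane) (t : ℝ) :
    place p u s x + t • frame u d = place p u s (x + (t / s) • d) := by
  rw [place_add, map_smul, smul_smul, mul_div_cancel₀ _ hs.ne']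

theorem inner_leftTurn_place_sub (hu : ‖u‖ = 1) (x y : Plane) :
    inner ℝ (leftTurn u) (place p u s x - place p u s y) = s * (x 1 - y 1) := by
  have h2 : inner ℝ (leftTurn u) (leftTurn u) = (1 : ℝ) := by
    rw [real_inner_self_eq_norm_sq, norm_leftTurn, hu]; norm_num
  rw [place_eq, place_eq, add_sub_add_left_eq_sub, ← smul_sub, ← map_sub, frame_apply]
  simp only [inner_add_right, real_inner_smul_right, h2, inner_leftTurn_self, PiLp.sub_apply]
  ring

end

/-! ### Normals of level sets -/

theorem tendsto_line (q d : Plane) : Tendsto (fun η : ℝ => q + η • d) (𝓝 0) (𝓝 q) := by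
  have : Continuous fun η : ℝ => q + η • d := by fun_prop
  simpa using this.tendsto 0

theorem eventually_lt_along {f : Plane → ℝ} {q g d : Plane}
    (hf : HasFDerivAt f (innerSL ℝ g) q) (hd : inner ℝ g d < (0 : ℝ)) :
    ∀ᶠ η : ℝ in 𝓝[>] 0, f (q + η • d) < f q := by
  have hline : HasDerivAt (fun η : ℝ => f (q + η • d)) (inner ℝ g d) 0 := by
    have h1 : HasDerivAt (fun η : ℝ => q + η • d) d 0 := by
      simpa using ((hasDerivAt_id (0 : ℝ)).smul_const d).const_add q
    have h2 : HasFDerivAt f (innerSL ℝ g) (q + (0 : ℝ) • d) := by simpa using hf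
    exact h2.comp_hasDerivAt (0 : ℝ) h1
  have h3 := hline.tendsto_slope_zero_right.eventually_lt_const hd
  filter_upwards [h3, self_mem_nhdsWithin] with η h4 h5
  have h5' : (0 : ℝ) < η := h5
  simp only [zero_add, zero_smul, add_zero, smul_eq_mul] at h4
  have h6 := mul_neg_of_pos_of_neg h5' h4
  rw [mul_inv_cancel_left₀ h5'.ne'] at h6
  linarith

/-- Along the directions `τ - g` and `τ + g` the function is respectively below and above its value
at `q`; the intermediate value theorem finds a level point between them, and its tangential
coordinate is positive. -/
theorem frequently_level_pos {f : Plane → ℝ} {q g τ : Plane} (hc : Continuous f)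
    (hf : HasFDerivAt f (innerSL ℝ g) q) (hg : g ≠ 0) (hτ : ‖τ‖ = 1) (hτg : inner ℝ τ g = (0 : ℝ)) :
    ∃ᶠ X in 𝓝[{X | f X = f q}] q, 0 < (inner ℝ τ (X - q) : ℝ) := by
  have hgg : 0 < (inner ℝ g g : ℝ) := real_inner_self_pos.2 hg
  have hgτ : inner ℝ g τ = (0 : ℝ) := by rw [real_inner_comm, hτg]
  have h1 : ∀ᶠ η : ℝ in 𝓝[>] 0, f (q + η • (τ - g)) < f q := eventually_lt_along hf (by
    rw [inner_sub_right, hgτ]; linarith)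
  have h2 : ∀ᶠ η : ℝ in 𝓝[>] 0, f q < f (q + η • (τ + g)) := by
    have : HasFDerivAt (-f) (innerSL ℝ (-g)) q := by rw [map_neg]; exact hf.neg
    have h3 := eventually_lt_along (d := τ + g) this (by
      rw [inner_neg_left, inner_add_right, hgτ]; linarith)
    filter_upwards [h3] with η h4
    simpa using h4
  rw [frequently_nhdsWithin_iff, Metric.nhds_basis_ball.frequently_iff]
  intro r hr
  have h5 : ∀ᶠ η : ℝ in 𝓝[>] 0, η < r / (2 * (1 + ‖g‖)) :=
    nhdsWithin_le_nhds (eventually_lt_nhds (by positivity))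
  obtain ⟨η, h1, h2, h5, h6⟩ := (h1.and (h2.and (h5.and self_mem_nhdsWithin))).exists
  have h6' : (0 : ℝ) < η := h6
  have hcont : ContinuousOn (fun σ : ℝ => f (q + η • (τ + σ • g))) (Icc (-1) 1) := by fun_prop
  obtain ⟨σ, hσ, hσf⟩ := intermediate_value_Icc (by norm_num : (-1 : ℝ) ≤ 1) hcont
    (show f q ∈ Icc _ _ from ⟨by simpa [sub_eq_add_neg] using h1.le, by simpa using h2.le⟩)
  refine ⟨q + η • (τ + σ • g), ?_, ?_, hσf⟩
  · rw [Metric.mem_ball, dist_eq_norm, add_sub_cancel_left, norm_smul, Real.norm_eq_abs,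
      abs_of_pos h6']
    have h7 : ‖τ + σ • g‖ ≤ 1 + ‖g‖ := by
      refine (norm_add_le _ _).trans ?_
      rw [hτ, norm_smul, Real.norm_eq_abs]
      have := mul_le_mul_of_nonneg_right (abs_le.2 hσ) (norm_nonneg g)
      linarith
    calc η * ‖τ + σ • g‖ ≤ r / (2 * (1 + ‖g‖)) * (1 + ‖g‖) :=
          mul_le_mul h5.le h7 (norm_nonneg _) (h6'.le.trans h5.le)
      _ = r / 2 := by have : (1 + ‖g‖) ≠ 0 := by positivity
                      field_simp
      _ < r := by linarith
  · rw [add_sub_cancel_left, real_inner_smul_right, inner_add_right, real_inner_smul_right, hτg,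
      real_inner_self_eq_norm_sq, hτ]
    simpa using h6'

/-- Since `f` is constant on the frontier near `q`, its differentiability says exactly that the
gradient coordinate of `X - q` is `o(X - q)`. -/
theorem hasBoundaryNormal_of_level {B : Set Plane} {f : Plane → ℝ} {q g : Plane}
    (hc : Continuous f) (hf : HasFDerivAt f (innerSL ℝ g) q) (hg : ‖g‖ = 1) (hq : f q = 0)
    (hB : ∀ᶠ X in 𝓝 q, X ∈ frontier B ↔ f X = 0) :
    HasBoundaryNormal B q g := by
  have hnhds : 𝓝[frontier B] q = 𝓝[{X | f X = f q}] q :=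
    nhdsWithin_eq_iff_eventuallyEq.2 (by
      filter_upwards [hB] with X hX
      rw [hq]
      exact propext hX)
  have hg0 : g ≠ 0 := by rintro rfl; simp at hg
  refine ⟨hB.self_of_nhds.2 hq, hg, ?_, ?_, ?_⟩
  · rw [hnhds]
    have h1 := (hf.isLittleO).mono (nhdsWithin_le_nhds (s := {X | f X = f q}))
    refine h1.neg_left.congr' ?_ .rfl
    filter_upwards [self_mem_nhdsWithin] with X hX
    have hX' : f X = f q := hX
    simp [hX', inner_sub_right]
  · rw [hnhds]
    exact frequently_level_pos hc hf hg0 (by rw [norm_leftTurn, hg]) (inner_leftTurn_self g)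
  · rw [hnhds]
    have := frequently_level_pos (τ := -leftTurn g) hc hf hg0 (by rw [norm_neg, norm_leftTurn, hg])
      (by rw [inner_neg_left, inner_leftTurn_self, neg_zero])
    simpa only [inner_neg_left, neg_pos] using this

/-! ### Ellipses -/

/-- The sum of the distances to two foci. -/
noncomputable def focalSum (A C X : Plane) : ℝ := dist X A + dist X C

theorem continuous_focalSum (A C : Plane) : Continuous (focalSum A C) := by
  unfold focalSum; fun_prop

theorem focalSum_combo (A C X Y : Plane) {a b : ℝ} (ha : 0 ≤ a) (hb : 0 ≤ b) (hab : a + b = 1) :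
    focalSum A C (a • X + b • Y) ≤ a * focalSum A C X + b * focalSum A C Y := by
  have key : ∀ D : Plane, dist (a • X + b • Y) D ≤ a * dist X D + b * dist Y D := by
    intro D
    have e : a • X + b • Y - D = a • (X - D) + b • (Y - D) := by
      have : D = (a + b) • D := by rw [hab, one_smul]
      conv_lhs => rw [this]
      module
    rw [dist_eq_norm, e, dist_eq_norm, dist_eq_norm]
    refine (norm_add_le _ _).trans ?_
    rw [norm_smul, norm_smul, Real.norm_eq_abs, Real.norm_eq_abs, abs_of_nonneg ha, abs_of_nonneg hb]
  unfold focalSum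
  linarith [key A, key C]

theorem hasFDerivAt_dist {q A : Plane} (h : q ≠ A) :
    HasFDerivAt (fun X => dist X A) (innerSL ℝ ((1 / dist q A) • (q - A))) q := by
  have h0 : ‖q - A‖ ≠ 0 := norm_ne_zero_iff.2 (sub_ne_zero.2 h)
  have h1 : HasFDerivAt (fun X : Plane => ‖X - A‖ ^ 2) _ q :=
    ((hasFDerivAt_id q).sub_const A).norm_sq
  have h2 := h1.sqrt (by simpa using h0)
  have h3 : (fun X => dist X A) = fun X : Plane => Real.sqrt (‖X - A‖ ^ 2) := by
    funext X; rw [Real.sqrt_sq (norm_nonneg _), dist_eq_norm]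
  rw [h3]
  refine h2.congr_fderiv ?_
  ext x
  simp [dist_eq_norm, Real.sqrt_sq (norm_nonneg _)]
  field_simp

theorem exists_focal_gradient {A C q : Plane} (hq : dist A C < focalSum A C q) :
    q ≠ A ∧ q ≠ C ∧ (1 / dist q A) • (q - A) + (1 / dist q C) • (q - C) ≠ 0 ∧
    HasFDerivAt (focalSum A C) (innerSL ℝ ((1 / dist q A) • (q - A) + (1 / dist q C) • (q - C))) q := by
  have hA : q ≠ A := by
    rintro rfl; simp [focalSum] at hq
  have hC : q ≠ C := by
    rintro rfl; simp [focalSum, dist_comm] at hq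
  refine ⟨hA, hC, fun h0 => ?_, ?_⟩
  · -- otherwise `q` would lie between the foci
    have hA' : 0 < dist q A := dist_pos.2 hA
    have hC' : 0 < dist q C := dist_pos.2 hC
    have e : A - C = (1 + dist q A / dist q C) • (q - C) := by
      have h1 : q - A = -(dist q A / dist q C) • (q - C) := by
        have h2 := congrArg (fun v => dist q A • v) h0
        simp only [smul_add, smul_smul, smul_zero] at h2
        rw [mul_one_div_cancel hA'.ne', one_smul, mul_one_div] at h2
        rw [neg_smul]
        exact eq_neg_of_add_eq_zero_left h2
      have : A - C = (q - C) - (q - A) := by abel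
      rw [this, h1]; module
    have h2 : dist A C = dist q A + dist q C := by
      rw [dist_eq_norm A C, e, norm_smul, Real.norm_eq_abs, abs_of_pos (by positivity),
        ← dist_eq_norm]
      field_simp; ring
    exact hq.ne h2
  · rw [map_add]
    exact (hasFDerivAt_dist hA).add (hasFDerivAt_dist hC)

/-- If near a point of an ellipse the set `B` is the outside of the ellipse, then the normal of `B`
there is the bisector of the focal radii. -/
theorem hasBoundaryNormal_ellipse {B : Set Plane} {A C q : Plane} {c : ℝ} (hc : dist A C < c)
    (hq : focalSum A C q = c) (hB : ∀ᶠ X in 𝓝 q, X ∈ B ↔ c < focalSum A C X) {m : Plane}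
    (hm : m = (1 / dist q A) • (A - q) + (1 / dist q C) • (C - q)) :
    m ≠ 0 ∧ HasBoundaryNormal B q ((1 / ‖m‖) • m) := by
  obtain ⟨hA, hC, hg, hd⟩ := exists_focal_gradient (hq.symm ▸ hc)
  set g := (1 / dist q A) • (q - A) + (1 / dist q C) • (q - C) with hgdef
  have hmg : m = -g := by rw [hm, hgdef]; module
  have hm0 : m ≠ 0 := by rw [hmg]; exact neg_ne_zero.2 hg
  refine ⟨hm0, ?_⟩
  have hm1 : ‖m‖ ≠ 0 := norm_ne_zero_iff.2 hm0
  refine hasBoundaryNormal_of_level (f := fun X => (1 / ‖m‖) * (c - focalSum A C X))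
    (by have := continuous_focalSum A C; fun_prop) ?_ ?_ (by simp [hq]) ?_
  · have := (hd.const_sub c).const_mul (1 / ‖m‖)
    refine this.congr_fderiv ?_
    rw [hmg, smul_neg, smul_neg, map_neg, map_smul]
  · rw [norm_smul, norm_div, norm_one, norm_norm, one_div_mul_cancel hm1]
  · filter_upwards [eventually_eventually_nhds.2 hB] with X hX
    have h1 : X ∈ frontier B ↔ X ∈ frontier {Y | c < focalSum A C Y} := by
      have h2 : B =ᶠ[𝓝 X] {Y | c < focalSum A C Y} := by
        filter_upwards [hX] with Y hY using propext hY
      rw [frontier_eq_closure_inter_closure, frontier_eq_closure_inter_closure]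
      rw [mem_inter_iff, mem_inter_iff, mem_closure_iff_frequently, mem_closure_iff_frequently,
        mem_closure_iff_frequently, mem_closure_iff_frequently]
      refine and_congr (frequently_congr hX) (frequently_congr ?_)
      filter_upwards [hX] with Y hY using not_congr hY
    rw [h1]
    have h3 : (1 / ‖m‖) * (c - focalSum A C X) = 0 ↔ focalSum A C X = c := by
      rw [mul_eq_zero, or_iff_right (one_div_ne_zero hm1), sub_eq_zero, eq_comm]
    rw [h3]
    constructor
    · intro h
      exact ((frontier_lt_subset_eq continuous_const (continuous_focalSum A C)) h).symm
    · intro h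
      refine ⟨?_, fun hi => ?_⟩
      swap
      · have h2 : X ∈ {Y | c < focalSum A C Y} := interior_subset hi
        exact (show c < focalSum A C X from h2).ne' h
      rw [mem_closure_iff_frequently]
      -- Moving away from the focus `A` leaves the ellipse: `X` lies between `A`, where the focal
      -- sum is less than `c`, and the moved point, so by convexity the sum exceeds `c` there.
      have h4 : Tendsto (fun η : ℝ => X + η • (X - A)) (𝓝[>] 0) (𝓝 X) :=
        (tendsto_line X (X - A)).mono_left nhdsWithin_le_nhds
      refine h4.frequently (Eventually.frequently ?_)
      filter_upwards [self_mem_nhdsWithin] with η hη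
      have hη' : (0 : ℝ) < η := hη
      have h5 := focalSum_combo A C (X + η • (X - A)) A (a := 1 / (1 + η)) (b := η / (1 + η))
        (by positivity) (by positivity) (by field_simp)
      have h6 : (1 / (1 + η)) • (X + η • (X - A)) + (η / (1 + η)) • A = X := by
        have : (1 / (1 + η)) * (1 + η) = 1 := by field_simp
        calc _ = ((1 / (1 + η)) * (1 + η)) • X - ((1 / (1 + η)) * η - η / (1 + η)) • A := by module
          _ = X := by rw [this, one_div_mul_eq_div, sub_self, zero_smul, one_smul, sub_zero]
      have h7 : focalSum A C A = dist A C := by simp [focalSum]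
      rw [h6, h, h7] at h5
      have h8 : c * (1 + η) ≤ focalSum A C (X + η • (X - A)) + η * dist A C := by
        have := mul_le_mul_of_nonneg_right h5 (by positivity : 0 ≤ 1 + η)
        refine this.trans_eq ?_
        field_simp
      change c < focalSum A C (X + η • (X - A))
      nlinarith

/-- The focal property of the ellipse: a ray which crosses the segment between the foci is reflected
to a ray which crosses this segment. -/
theorem focal_reflection {A C q d n m : Plane} {x τ : ℝ} (hx : x ∈ Ioo (0 : ℝ) 1)
    (hA : q ≠ A) (hC : q ≠ C) (hτ : 0 < τ) (hq : q = (1 - x) • A + x • C + τ • d)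
    (hm : m = (1 / dist q A) • (A - q) + (1 / dist q C) • (C - q)) (hm0 : m ≠ 0)
    (hn : n = (1 / ‖m‖) • m) :
    ∃ ρ : ℝ, 0 < ρ ∧ ∃ x' : ℝ, x' * (x * dist q C ^ 2 + (1 - x) * dist q A ^ 2)
      = (1 - x) * dist q A ^ 2 ∧
      q + ρ • (d - (2 * inner ℝ n d : ℝ) • n) = (1 - x') • A + x' • C := by
  have h1 : 0 < dist q A := dist_pos.2 hA
  have h2 : 0 < dist q C := dist_pos.2 hC
  set r₁ := dist q A with hr₁
  set r₂ := dist q C with hr₂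
  have hmn : ‖m‖ ≠ 0 := norm_ne_zero_iff.2 hm0
  -- the reflection in terms of `m`
  have hrefl : (2 * inner ℝ n d : ℝ) • n = (2 * inner ℝ m d / ‖m‖ ^ 2 : ℝ) • m := by
    rw [hn, real_inner_smul_left, smul_smul]; congr 1; field_simp
  set e₁ := (1 / r₁) • (A - q) with he₁
  set e₂ := (1 / r₂) • (C - q) with he₂
  have hAq : A - q = r₁ • e₁ := by rw [he₁, smul_smul, mul_one_div_cancel h1.ne', one_smul]
  have hCq : C - q = r₂ • e₂ := by rw [he₂, smul_smul, mul_one_div_cancel h2.ne', one_smul]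
  have hn1 : inner ℝ e₁ e₁ = (1 : ℝ) := by
    rw [real_inner_self_eq_norm_sq, he₁, norm_smul, ← dist_eq_norm, dist_comm A q, Real.norm_eq_abs,
      abs_of_pos (by positivity), one_div_mul_cancel h1.ne']; norm_num
  have hn2 : inner ℝ e₂ e₂ = (1 : ℝ) := by
    rw [real_inner_self_eq_norm_sq, he₂, norm_smul, ← dist_eq_norm, dist_comm C q, Real.norm_eq_abs,
      abs_of_pos (by positivity), one_div_mul_cancel h2.ne']; norm_num
  have hms : ‖m‖ ^ 2 = 2 + 2 * inner ℝ e₁ e₂ := by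
    rw [← real_inner_self_eq_norm_sq, hm]
    simp only [inner_add_left, inner_add_right, hn1, hn2, real_inner_comm e₁ e₂]; ring
  have hms0 : 2 + 2 * inner ℝ e₁ e₂ ≠ (0 : ℝ) := by rw [← hms]; positivity
  have hd : d = (-(1 - x) * r₁ / τ) • e₁ + (-x * r₂ / τ) • e₂ := by
    have h3 : τ • d = -((1 - x) • (A - q) + x • (C - q)) := by
      have : (1 - x) • (A - q) + x • (C - q) = (1 - x) • A + x • C - q := by module
      rw [this]
      have h5 : τ • d = q - ((1 - x) • A + x • C) := by rw [eq_sub_iff_add_eq, add_comm, ← hq]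
      rw [h5, neg_sub]
    have h4 : d = (1 / τ) • (τ • d) := by rw [smul_smul, one_div_mul_cancel hτ.ne', one_smul]
    rw [h4, h3, hAq, hCq]
    module
  have hmd : 2 * inner ℝ m d / ‖m‖ ^ 2 = (-(1 - x) * r₁ / τ) + (-x * r₂ / τ) := by
    rw [hms, hd, hm]
    simp only [inner_add_left, inner_add_right, real_inner_smul_right, hn1, hn2,
      real_inner_comm e₁ e₂]
    rw [div_eq_iff hms0]
    ring
  -- Reflection in the line orthogonal to the bisector `e₁ + e₂` sends `e₁` to `-e₂` and `e₂` to
  -- `-e₁`, so the coefficients of `d` are exchanged and change sign.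
  have hw : d - (2 * inner ℝ n d : ℝ) • n = (x * r₂ / τ) • e₁ + ((1 - x) * r₁ / τ) • e₂ := by
    rw [hrefl, hmd, hm]
    nth_rw 1 [hd]
    module
  have hx0 := hx.1
  have hx1 : 0 < 1 - x := by linarith [hx.2]
  have hD : 0 < x * r₂ ^ 2 + (1 - x) * r₁ ^ 2 := by positivity
  -- The flight time `ρ` is chosen to make the coefficients of `A - q` and `C - q` in `ρ w` add up
  -- to 1, which places the end point on the line of the foci.
  refine ⟨τ * (r₁ * r₂) / (x * r₂ ^ 2 + (1 - x) * r₁ ^ 2), by positivity,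
    (1 - x) * r₁ ^ 2 / (x * r₂ ^ 2 + (1 - x) * r₁ ^ 2), by field_simp, ?_⟩
  rw [hw, he₁, he₂]
  set D := x * r₂ ^ 2 + (1 - x) * r₁ ^ 2 with hDdef
  have c1 : τ * (r₁ * r₂) / D * (x * r₂ / τ * (1 / r₁)) = 1 - (1 - x) * r₁ ^ 2 / D := by
    field_simp; rw [hDdef]; ring
  have c2 : τ * (r₁ * r₂) / D * ((1 - x) * r₁ / τ * (1 / r₂)) = (1 - x) * r₁ ^ 2 / D := by
    field_simp
  calc _ = q + ((τ * (r₁ * r₂) / D * (x * r₂ / τ * (1 / r₁))) • (A - q)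
        + (τ * (r₁ * r₂) / D * ((1 - x) * r₁ / τ * (1 / r₂))) • (C - q)) := by module
    _ = _ := by rw [c1, c2]; module

/-! ### Trajectories inside a mushroom -/

/-- The open region in which a particle that visits a mushroom moves freely: the hollow of the
mushroom and the half-plane outside its base. -/
def freeRegion (ε : ℝ) : Set Plane :=
  {x | x 1 < 0 ∨ (0 < x 0 ∧ x 0 < 1 ∧ focalSum !₂[0, ε] !₂[1, ε] x < 2 * (1 / ε)) ∨
    (ε < x 1 ∧ focalSum !₂[0, ε] !₂[1, ε] x < 2 * (1 / ε))}

theorem isOpen_freeRegion (ε : ℝ) : IsOpen (freeRegion ε) := by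
  have h := continuous_focalSum !₂[0, ε] !₂[1, ε]
  refine IsOpen.union (s₁ := {x : Plane | x 1 < 0}) (isOpen_lt (by fun_prop) (by fun_prop))
    (IsOpen.union ?_ ?_)
  · exact (isOpen_lt (by fun_prop) (by fun_prop)).and
      ((isOpen_lt (by fun_prop) (by fun_prop)).and (isOpen_lt (by fun_prop) (by fun_prop)))
  · exact (isOpen_lt (by fun_prop) (by fun_prop)).and (isOpen_lt (by fun_prop) (by fun_prop))

theorem norm_le_abs_add_abs (x : Plane) : ‖x‖ ≤ |x 0| + |x 1| := by
  refine abs_le_of_sq_le_sq' ?_ (by positivity) |>.2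
  rw [plane_norm_sq, ← sq_abs (x 0), ← sq_abs (x 1)]
  nlinarith [abs_nonneg (x 0), abs_nonneg (x 1)]

theorem abs_coord_le_norm (x : Plane) (i : Fin 2) : |x i| ≤ ‖x‖ := by
  simpa using PiLp.norm_apply_le x i

theorem focalSum_stem_le {ε : ℝ} {x : Plane} (h0 : 0 ≤ x 0) (h1 : x 0 ≤ 1) (h2 : 0 ≤ x 1)
    (h3 : x 1 ≤ ε) : focalSum !₂[0, ε] !₂[1, ε] x ≤ 2 + 2 * ε := by
  have k1 : dist x !₂[0, ε] ≤ 1 + ε := by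
    rw [dist_eq_norm]
    refine (norm_le_abs_add_abs _).trans (add_le_add ?_ ?_)
    · change |x 0 - 0| ≤ 1
      rw [sub_zero, abs_of_nonneg h0]; exact h1
    · change |x 1 - ε| ≤ ε
      rw [abs_le]; constructor <;> linarith
  have k2 : dist x !₂[1, ε] ≤ 1 + ε := by
    rw [dist_eq_norm]
    refine (norm_le_abs_add_abs _).trans (add_le_add ?_ ?_)
    · change |x 0 - 1| ≤ 1
      rw [abs_le]; constructor <;> linarith
    · change |x 1 - ε| ≤ ε
      rw [abs_le]; constructor <;> linarith
  unfold focalSum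
  linarith

theorem dist_foci (ε : ℝ) : dist (!₂[0, ε] : Plane) !₂[1, ε] = 1 := by
  rw [dist_eq_norm]
  refine (sq_eq_sq₀ (norm_nonneg _) (by norm_num)).1 ?_
  rw [plane_norm_sq]
  change (0 - 1 : ℝ) ^ 2 + (ε - ε) ^ 2 = 1 ^ 2
  ring

theorem focalSum_le_add (A C X Y : Plane) : focalSum A C X ≤ focalSum A C Y + 2 * dist X Y := by
  unfold focalSum
  linarith [dist_triangle X Y A, dist_triangle X Y C]

/-- The focal distances `r₁`, `r₂` are at least 1 and differ by at most 1, hence are comparable up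
to a factor 2. So the point of return on the focal segment stays away from its ends. -/
theorem abscissa_bounds {δ a' r₁ r₂ x' : ℝ} (hδ : 0 < δ) (ha0 : δ / 2 ≤ a') (ha1 : a' ≤ 1 - δ / 2)
    (hr1 : 1 ≤ r₁) (hr2 : 1 ≤ r₂) (hr12 : r₁ ≤ r₂ + 1) (hr21 : r₂ ≤ r₁ + 1)
    (hx' : x' * (a' * r₂ ^ 2 + (1 - a') * r₁ ^ 2) = (1 - a') * r₁ ^ 2) :
    δ / 8 ≤ x' ∧ x' ≤ 1 - δ / 8 := by
  set D := a' * r₂ ^ 2 + (1 - a') * r₁ ^ 2 with hD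
  have hD0 : 0 < D := by
    have : 0 < a' := by linarith
    have : 0 < 1 - a' := by linarith
    positivity
  have hD1 : D ≤ 4 * r₁ ^ 2 := by
    have h1 : r₂ ^ 2 ≤ 4 * r₁ ^ 2 := by nlinarith
    have h2 := mul_le_mul_of_nonneg_left h1 (by linarith : 0 ≤ a')
    have h3 : r₁ ^ 2 * (1 - a') ≤ 4 * r₁ ^ 2 * (1 - a') :=
      mul_le_mul_of_nonneg_right (by nlinarith) (by linarith)
    linarith
  have hD2 : D ≤ 4 * r₂ ^ 2 := by
    have h1 : r₁ ^ 2 ≤ 4 * r₂ ^ 2 := by nlinarith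
    have h2 := mul_le_mul_of_nonneg_left h1 (by linarith : 0 ≤ 1 - a')
    have h3 : r₂ ^ 2 * a' ≤ 4 * r₂ ^ 2 * a' :=
      mul_le_mul_of_nonneg_right (by nlinarith) (by linarith)
    linarith
  have hx0 : δ / 8 ≤ x' := by
    have h1 : δ / 8 * D ≤ x' * D := by
      rw [hx']
      have h2 := mul_le_mul_of_nonneg_left hD1 (by positivity : 0 ≤ δ / 8)
      have h3 := mul_le_mul_of_nonneg_right (by linarith : δ / 2 ≤ 1 - a') (sq_nonneg r₁)
      linarith
    exact le_of_mul_le_mul_right h1 hD0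
  have hx1 : x' ≤ 1 - δ / 8 := by
    have h1 : δ / 8 * D ≤ (1 - x') * D := by
      have h4 : (1 - x') * D = a' * r₂ ^ 2 := by rw [sub_mul, hx', hD]; ring
      rw [h4]
      have h2 := mul_le_mul_of_nonneg_left hD2 (by positivity : 0 ≤ δ / 8)
      have h3 := mul_le_mul_of_nonneg_right ha0 (sq_nonneg r₂)
      linarith
    linarith [le_of_mul_le_mul_right h1 hD0]
  exact ⟨hx0, hx1⟩

-- Since `cos φ ≥ sin δ`, the sideways drift in a stem of height `ε` is at most `δ / 100`, so the
-- particle passes it freely. The focal property brings it back to the focal segment, and the bound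
-- on the abscissa of return lets it pass the stem again. The flight to the ellipse lasts at least
-- `1 / (2ε)` while the two crossings of the focal segment are at most 1 apart, which makes the
-- final direction opposite to `d` up to `4ε`.
set_option maxHeartbeats 1000000 in
theorem mushroom_trajectory {ε δ a φ : ℝ} (hδ : 0 < δ) (hδ1 : δ ≤ 1 / 4) (hε : 0 < ε)
    (hεδ : ε ≤ Real.sin δ * δ / 100) (ha : a ∈ Icc δ (1 - δ)) (hφ : δ ≤ |φ|)
    (hφ' : |φ| ≤ Real.pi / 2 - δ) :
    ∃ (q m n w : Plane) (T₁ T₂ b : ℝ),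
      m = (1 / dist q !₂[0, ε]) • (!₂[0, ε] - q) + (1 / dist q !₂[1, ε]) • (!₂[1, ε] - q) ∧
      n = (1 / ‖m‖) • m ∧ w = !₂[Real.sin φ, Real.cos φ]
        - (2 * inner ℝ n !₂[Real.sin φ, Real.cos φ] : ℝ) • n ∧
      inner ℝ n !₂[Real.sin φ, Real.cos φ] ≠ (0 : ℝ) ∧
      0 < T₁ ∧ q = !₂[a, 0] + T₁ • !₂[Real.sin φ, Real.cos φ] ∧ ε < q 1 ∧ q 0 ≠ 1 / 2 ∧
      focalSum !₂[0, ε] !₂[1, ε] q = 2 * (1 / ε) ∧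
      (∀ σ < T₁, !₂[a, 0] + σ • !₂[Real.sin φ, Real.cos φ] ∈ freeRegion ε) ∧
      ‖w‖ = 1 ∧ w 1 < 0 ∧ 1 - δ ≤ -inner ℝ w !₂[Real.sin φ, Real.cos φ] ∧
      0 < T₂ ∧ q + T₂ • w = !₂[b, 0] ∧ b ∈ Ioo (0 : ℝ) 1 ∧
      ∀ σ : ℝ, 0 < σ → q + σ • w ∈ freeRegion ε := by
  set A : Plane := !₂[0, ε] with hA
  set C : Plane := !₂[1, ε] with hC
  set d : Plane := !₂[Real.sin φ, Real.cos φ] with hd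
  set κ := Real.sin δ with hκ
  have hpi := Real.pi_gt_three
  have hκ0 : 0 < κ := Real.sin_pos_of_pos_of_lt_pi hδ (by linarith)
  have hκ1 : κ ≤ 1 := Real.sin_le_one δ
  have hsin : κ ≤ |Real.sin φ| := by
    rw [Real.abs_sin_eq_sin_abs_of_abs_le_pi (by linarith)]
    exact Real.sin_le_sin_of_le_of_le_pi_div_two (by linarith) (by linarith) hφ
  have hcos : κ ≤ Real.cos φ := by
    rw [← Real.cos_abs φ, hκ, ← Real.cos_pi_div_two_sub]
    exact Real.cos_le_cos_of_nonneg_of_le_pi (abs_nonneg _) (by linarith) hφ'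
  have hd1 : ‖d‖ = 1 := by
    refine (sq_eq_sq₀ (norm_nonneg _) (by norm_num)).1 ?_
    rw [plane_norm_sq, hd, plane_mk_zero, plane_mk_one, Real.sin_sq_add_cos_sq]; norm_num
  set s₀ := Real.sin φ with hs₀
  set c₀ := Real.cos φ with hc₀
  have hc0 : 0 < c₀ := hκ0.trans_le hcos
  have hs1 : |s₀| ≤ 1 := Real.abs_sin_le_one φ
  have hεκ : ε / κ ≤ δ / 100 := by rw [div_le_iff₀ hκ0]; linarith
  have hεc : ε / c₀ ≤ δ / 100 := (div_le_div_of_nonneg_left hε.le hκ0 hcos).trans hεκ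
  have hεδ' : ε ≤ δ / 100 := by
    refine hεδ.trans ?_
    have := mul_le_mul_of_nonneg_right hκ1 hδ.le
    linarith
  have hε1 : ε ≤ 1 / 400 := by linarith
  have hεκ4 : 400 * ε ≤ κ := by
    have h1 := mul_le_mul_of_nonneg_left hδ1 hκ0.le
    linarith
  have hc400 : 400 ≤ 1 / ε := by rw [le_div_iff₀ hε]; linarith
  set c := 2 * (1 / ε) with hcdef
  have hstem : ∀ x : Plane, 0 ≤ x 0 → x 0 ≤ 1 → 0 ≤ x 1 → x 1 ≤ ε → focalSum A C x < c := by
    intro x h0 h1 h2 h3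
    have := focalSum_stem_le h0 h1 h2 h3
    linarith
  -- the point where the particle enters the cap
  set a' := a + ε / c₀ * s₀ with ha'
  have hshift : |ε / c₀ * s₀| ≤ δ / 100 := by
    rw [abs_mul, abs_of_nonneg (by positivity)]
    calc ε / c₀ * |s₀| ≤ ε / c₀ * 1 := mul_le_mul_of_nonneg_left hs1 (by positivity)
      _ ≤ δ / 100 := by linarith
  obtain ⟨hsh1, hsh2⟩ := abs_le.1 hshift
  have ha0 : δ / 2 ≤ a' := by linarith [ha.1]
  have ha1 : a' ≤ 1 - δ / 2 := by linarith [ha.2]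
  set p : Plane := !₂[a', ε] with hp
  have hp0 : p 0 = a' := rfl
  have hp1 : p 1 = ε := rfl
  have hpAC : p = (1 - a') • A + a' • C := by
    apply plane_ext
    · change a' = (1 - a') * 0 + a' * 1; ring
    · change ε = (1 - a') * ε + a' * ε; ring
  have hpξ : ∀ τ : ℝ, p + τ • d = !₂[a, 0] + (ε / c₀ + τ) • d := by
    intro τ
    apply plane_ext
    · change a' + τ * s₀ = a + (ε / c₀ + τ) * s₀; rw [ha']; ring
    · change ε + τ * c₀ = 0 + (ε / c₀ + τ) * c₀; field_simp; ring
  have hfp : focalSum A C p ≤ 2 + 2 * ε :=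
    focalSum_stem_le (by rw [hp0]; linarith) (by rw [hp0]; linarith) (by rw [hp1]; linarith)
      (by rw [hp1])
  have hfpc : focalSum A C p < c := by linarith
  have hdist : ∀ (x : Plane) (τ : ℝ), dist (x + τ • d) x = |τ| := by
    intro x τ
    rw [dist_eq_norm, add_sub_cancel_left, norm_smul, hd1, mul_one, Real.norm_eq_abs]
  -- the point where it hits the arc
  obtain ⟨τ, hτ, hτf⟩ : ∃ τ ∈ Icc 0 c, focalSum A C (p + τ • d) = c := by
    have hcont : ContinuousOn (fun τ : ℝ => focalSum A C (p + τ • d)) (Icc 0 c) := by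
      have := continuous_focalSum A C
      fun_prop
    have hc0' : 0 ≤ c := by positivity
    refine intermediate_value_Icc hc0' hcont ⟨by simpa using hfpc.le, ?_⟩
    have h3 := hdist p c
    rw [abs_of_nonneg hc0', dist_comm] at h3
    have h4 : dist p (p + c • d) ≤ dist p A + dist (p + c • d) A := dist_triangle_right _ _ _
    have h5 : dist p (p + c • d) ≤ dist p C + dist (p + c • d) C := dist_triangle_right _ _ _
    rw [h3] at h4 h5
    unfold focalSum at hfpc ⊢
    linarith
  set q := p + τ • d with hq
  -- The focal sum grows at rate at most 2 along the ray, from at most `2 + 2ε` to `2 / ε`.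
  have hτε : 1 / (2 * ε) ≤ τ := by
    have h1 := focalSum_le_add A C q p
    rw [hτf, hdist, abs_of_nonneg hτ.1] at h1
    have h2 : 1 / (2 * ε) = 1 / ε / 2 := by field_simp
    rw [h2]
    linarith
  have hτ0 : 0 < τ := lt_of_lt_of_le (by positivity) hτε
  have hq0 : q 0 = a' + τ * s₀ := rfl
  have hq1 : q 1 = ε + τ * c₀ := rfl
  have hq1ε : ε < q 1 := by rw [hq1]; linarith [mul_pos hτ0 hc0]
  -- Because `|φ| ≥ δ`, the horizontal displacement on the way to the ellipse exceeds 1, so the apex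
  -- is missed.
  have hqne : q 0 ≠ 1 / 2 := by
    rw [hq0]
    have h1 : 1 / (2 * ε) * κ ≤ |τ * s₀| := by
      rw [abs_mul, abs_of_pos hτ0]
      exact mul_le_mul hτε hsin hκ0.le hτ0.le
    have h2 : 1 < 1 / (2 * ε) * κ := by
      rw [one_div_mul_eq_div, lt_div_iff₀ (by positivity)]; linarith
    intro h
    have h3 : τ * s₀ = 1 / 2 - a' := by linarith
    rw [h3] at h1
    have h4 : |1 / 2 - a'| ≤ 1 := by rw [abs_le]; constructor <;> linarith
    linarith
  have hsegq : ∀ (Y : Plane), focalSum A C Y < c → ∀ θ : ℝ, 0 ≤ θ → θ < 1 →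
      focalSum A C ((1 - θ) • Y + θ • q) < c := by
    intro Y hY θ h0 h1
    have h2 := focalSum_combo A C Y q (by linarith : 0 ≤ 1 - θ) h0 (by ring)
    rw [hτf] at h2
    have h3 := mul_lt_mul_of_pos_left hY (by linarith : 0 < 1 - θ)
    linarith
  -- the reflection
  have hACq : dist A C < focalSum A C q := by rw [hτf, dist_foci]; linarith
  obtain ⟨hqA, hqC, hg, -⟩ := exists_focal_gradient hACq
  set m : Plane := (1 / dist q A) • (A - q) + (1 / dist q C) • (C - q) with hm
  have hm0 : m ≠ 0 := by
    have : m = -((1 / dist q A) • (q - A) + (1 / dist q C) • (q - C)) := by rw [hm]; module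
    rw [this]; exact neg_ne_zero.2 hg
  set n : Plane := (1 / ‖m‖) • m with hn
  have hn1 : ‖n‖ = 1 := by
    rw [hn, norm_smul, norm_div, norm_one, norm_norm, one_div_mul_cancel (norm_ne_zero_iff.2 hm0)]
  obtain ⟨ρ, hρ, x', hx', hqρ⟩ := focal_reflection (d := d) (n := n) (x := a') (τ := τ)
    ⟨by linarith, by linarith⟩ hqA hqC hτ0 (by rw [← hpAC]) hm hm0 hn
  set w : Plane := d - (2 * inner ℝ n d : ℝ) • n with hw
  have hw1 : ‖w‖ = 1 := by
    have h1 : ‖w‖ ^ 2 = 1 ^ 2 := by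
      rw [hw, norm_sub_sq_real, norm_smul, hn1, hd1, real_inner_smul_right, real_inner_comm n d,
        mul_one, Real.norm_eq_abs, sq_abs]; ring
    exact (sq_eq_sq₀ (norm_nonneg _) (by norm_num)).1 h1
  set r₁ := dist q A with hr₁
  set r₂ := dist q C with hr₂
  have hr : r₁ + r₂ = c := hτf
  have hr12 : r₁ ≤ r₂ + 1 := by
    have := dist_triangle q C A
    rw [dist_comm C A, dist_foci] at this; exact this
  have hr21 : r₂ ≤ r₁ + 1 := by
    have := dist_triangle q A C
    rw [dist_foci] at this; exact this
  obtain ⟨hx0, hx1⟩ := abscissa_bounds hδ ha0 ha1 (by linarith) (by linarith) hr12 hr21 hx'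
  set p' : Plane := !₂[x', ε] with hp'
  have hp'0 : p' 0 = x' := rfl
  have hp'1 : p' 1 = ε := rfl
  have hqp' : q + ρ • w = p' := by
    rw [hqρ]
    apply plane_ext
    · change (1 - x') * 0 + x' * 1 = x'; ring
    · change (1 - x') * ε + x' * ε = ε; ring
  -- the final velocity is almost opposite to the initial one
  have hpp : ‖p' - p‖ ≤ 1 := by
    refine (norm_le_abs_add_abs _).trans ?_
    change |x' - a'| + |ε - ε| ≤ 1
    rw [sub_self, abs_zero, add_zero, abs_le]
    constructor <;> linarith
  -- On the path `p → q → p'` the two long flights almost cancel: their sum has norm at most 1.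
  have hsum : ρ • w + τ • d = p' - p := by rw [← hqp', hq]; module
  have hρτ : |τ - ρ| ≤ 1 := by
    have h1 := abs_norm_sub_norm_le (τ • d) (-(ρ • w))
    rw [norm_neg, norm_smul, norm_smul, hd1, hw1, mul_one, mul_one, Real.norm_eq_abs,
      Real.norm_eq_abs, abs_of_pos hτ0, abs_of_pos hρ, sub_neg_eq_add, add_comm (τ • d), hsum] at h1
    exact h1.trans hpp
  have hwd : ‖w + d‖ ≤ 4 * ε := by
    have h1 : τ • (w + d) = (p' - p) + (τ - ρ) • w := by rw [← hsum]; module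
    have h2 : τ * ‖w + d‖ ≤ 2 := by
      calc τ * ‖w + d‖ = ‖τ • (w + d)‖ := by rw [norm_smul, Real.norm_eq_abs, abs_of_pos hτ0]
        _ ≤ ‖p' - p‖ + ‖(τ - ρ) • w‖ := by rw [h1]; exact norm_add_le _ _
        _ ≤ 1 + 1 := by
          rw [norm_smul, hw1, mul_one, Real.norm_eq_abs]; exact add_le_add hpp hρτ
        _ = 2 := by norm_num
    have h3 : 1 / (2 * ε) * ‖w + d‖ ≤ 2 :=
      (mul_le_mul_of_nonneg_right hτε (norm_nonneg _)).trans h2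
    rw [one_div_mul_eq_div, div_le_iff₀ (by positivity)] at h3
    linarith
  have hw1neg : w 1 ≤ -(κ / 2) := by
    have h1 := (abs_coord_le_norm (w + d) 1).trans hwd
    have h2 : (w + d) 1 = w 1 + c₀ := rfl
    rw [h2] at h1
    linarith [(abs_le.1 h1).2]
  have hw1n : w 1 < 0 := by linarith
  have hangle : 1 - δ ≤ -inner ℝ w d := by
    have h1 : ‖w + d‖ ^ 2 = 2 + 2 * inner ℝ w d := by
      rw [norm_add_sq_real, hw1, hd1]; ring
    have h2 : ‖w + d‖ ^ 2 ≤ (4 * ε) ^ 2 := pow_le_pow_left₀ (norm_nonneg _) hwd 2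
    nlinarith
  -- A tangential hit would leave the velocity unchanged, whereas it has been found to be nearly
  -- reversed.
  have hnd : (inner ℝ n d : ℝ) ≠ 0 := by
    intro h0
    rw [hw, h0, mul_zero, zero_smul, sub_zero, real_inner_self_eq_norm_sq, hd1] at hangle
    linarith
  -- the way back through the stem
  set η := ε / (-w 1) with hη
  have hη0 : 0 < η := div_pos hε (by linarith)
  have hη1 : η ≤ δ / 50 := by
    have h1 : η ≤ ε / (κ / 2) := div_le_div_of_nonneg_left hε.le (by positivity) (by linarith)
    have h2 : ε / (κ / 2) = 2 * (ε / κ) := by field_simp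
    linarith
  have hw0 : |w 0| ≤ 1 := hw1 ▸ abs_coord_le_norm w 0
  have hηw : η * w 1 = -ε := by
    rw [hη]
    have : w 1 ≠ 0 := hw1n.ne
    field_simp
  have hx0' : ∀ σ : ℝ, 0 ≤ σ → σ ≤ η → 0 < x' + σ * w 0 ∧ x' + σ * w 0 < 1 := by
    intro σ h0 h1
    have h2 : |σ * w 0| ≤ δ / 50 := by
      rw [abs_mul, abs_of_nonneg h0]
      calc σ * |w 0| ≤ σ * 1 := mul_le_mul_of_nonneg_left hw0 h0
        _ ≤ δ / 50 := by linarith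
    obtain ⟨h3, h4⟩ := abs_le.1 h2
    constructor <;> linarith
  have hqσ : ∀ σ : ℝ, q + σ • w = p' + (σ - ρ) • w := by
    intro σ; rw [← hqp']; module
  refine ⟨q, m, n, w, ε / c₀ + τ, ρ + η, x' + η * w 0, hm, hn, hw, hnd, by positivity, hpξ τ, hq1ε,
    hqne, hτf, ?_, hw1, hw1n, hangle, by positivity, ?_, hx0' η hη0.le le_rfl, ?_⟩
  · intro σ hσ
    by_cases h0 : σ < 0
    · left
      change 0 + σ * c₀ < 0
      linarith [mul_neg_of_neg_of_pos h0 hc0]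
    · push Not at h0
      by_cases h1 : σ ≤ ε / c₀
      · have h2 : |σ * s₀| ≤ δ / 100 := by
          rw [abs_mul, abs_of_nonneg h0]
          calc σ * |s₀| ≤ σ * 1 := mul_le_mul_of_nonneg_left hs1 h0
            _ ≤ δ / 100 := by linarith
        obtain ⟨h3, h4⟩ := abs_le.1 h2
        have h5 : 0 < a + σ * s₀ := by linarith [ha.1]
        have h6 : a + σ * s₀ < 1 := by linarith [ha.2]
        have h7 : σ * c₀ ≤ ε := by rwa [le_div_iff₀ hc0] at h1
        refine Or.inr (Or.inl ⟨h5, h6, hstem _ h5.le h6.le ?_ ?_⟩)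
        · change 0 ≤ 0 + σ * c₀
          rw [zero_add]; exact mul_nonneg h0 hc0.le
        · change 0 + σ * c₀ ≤ ε
          rwa [zero_add]
      · push Not at h1
        refine Or.inr (Or.inr ⟨?_, ?_⟩)
        · change ε < 0 + σ * c₀
          rw [zero_add]; rwa [div_lt_iff₀ hc0] at h1
        · have h2 := hsegq p hfpc ((σ - ε / c₀) / τ) (div_nonneg (by linarith) hτ0.le)
            (by rw [div_lt_one hτ0]; linarith)
          convert h2 using 1
          have h3 := hpξ (σ - ε / c₀)
          rw [add_sub_cancel] at h3
          rw [← h3, hq]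
          congr 1
          have h4 : (σ - ε / c₀) = (σ - ε / c₀) / τ * τ := by field_simp
          nth_rw 1 [h4]
          module
  · rw [hqσ, add_sub_cancel_left]
    apply plane_ext
    · rfl
    · change ε + η * w 1 = 0
      rw [hηw]; ring
  · intro σ hσ
    by_cases h1 : σ < ρ
    · refine Or.inr (Or.inr ⟨?_, ?_⟩)
      · have h2 : q 1 + ρ * w 1 = ε := congrArg (fun x : Plane => x 1) hqp'
        change ε < q 1 + σ * w 1
        have := mul_lt_mul_of_neg_right h1 hw1n
        linarith
      · have h3 : q + σ • w = (1 - (1 - σ / ρ)) • p' + (1 - σ / ρ) • q := by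
          have h4 : σ = σ / ρ * ρ := by field_simp
          rw [← hqp']
          nth_rw 1 [h4]
          module
        rw [h3]
        refine hsegq p' (hstem _ ?_ ?_ ?_ ?_) _ ?_ ?_
        · rw [hp'0]; linarith
        · rw [hp'0]; linarith
        · rw [hp'1]; exact hε.le
        · rw [hp'1]
        · rw [sub_nonneg, div_le_one hρ]; exact h1.le
        · linarith [div_pos hσ hρ]
    · push Not at h1
      rw [hqσ]
      by_cases h2 : σ - ρ ≤ η
      · obtain ⟨h3, h4⟩ := hx0' (σ - ρ) (by linarith) h2
        have h5 := mul_le_mul_of_nonpos_right h2 hw1n.le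
        have h6 := mul_nonpos_of_nonneg_of_nonpos (by linarith : 0 ≤ σ - ρ) hw1n.le
        refine Or.inr (Or.inl ⟨h3, h4, hstem _ h3.le h4.le ?_ ?_⟩)
        · change 0 ≤ ε + (σ - ρ) * w 1
          linarith
        · change ε + (σ - ρ) * w 1 ≤ ε
          linarith
      · push Not at h2
        left
        change ε + (σ - ρ) * w 1 < 0
        have := mul_lt_mul_of_neg_right h2 hw1n
        linarith

/-- A particle that enters a mushroom of small parameter through the middle part of its base, neither
almost orthogonally nor almost tangentially, is sent back almost in the direction it came from. -/
theorem scatters_mushroom {B : Set Plane} {p u : Plane} {s ε δ a φ : ℝ} (hu : ‖u‖ = 1) (hs : 0 < s)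
    (hδ : 0 < δ) (hδ1 : δ ≤ 1 / 4) (hε : 0 < ε) (hεδ : ε ≤ Real.sin δ * δ / 100)
    (hfree : ∀ x ∈ freeRegion ε, place p u s x ∉ B)
    (harc : ∀ x : Plane, ε < x 1 → focalSum !₂[0, ε] !₂[1, ε] x = 2 * (1 / ε) → x 0 ≠ 1 / 2 →
      ∀ᶠ X in 𝓝 (place p u s x), (X ∈ B ↔
        s * (2 * (1 / ε)) < focalSum (place p u s !₂[0, ε]) (place p u s !₂[1, ε]) X))
    (hbase : ∀ x ∈ Ioo (0 : ℝ) 1, place p u s !₂[x, 0] ∈ frontier (convexHull ℝ B) ∧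
      IsOutwardNormal (convexHull ℝ B) (place p u s !₂[x, 0]) (-leftTurn u))
    (ha : a ∈ Icc δ (1 - δ)) (hφ : δ ≤ |φ|) (hφ' : |φ| ≤ Real.pi / 2 - δ) :
    ∃ z', Scatters B (φ, place p u s !₂[a, 0]) z' ∧ 1 - δ ≤ Real.cos (z'.1 - φ) := by
  obtain ⟨q, m, n, w, T₁, T₂, b, hm, hn, hw, hnd, hT₁, hq, hq1, hq0, hqf, hin, hw1, hwneg, hang, hT₂,
    hqb, hb, hout⟩ := mushroom_trajectory hδ hδ1 hε hεδ ha hφ hφ'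
  set d : Plane := !₂[Real.sin φ, Real.cos φ] with hd
  have hpi := Real.pi_pos
  have hfr : ∀ x ∈ freeRegion ε, place p u s x ∉ frontier B := by
    intro x hx hxf
    have hop : IsOpen (place p u s '' freeRegion ε) :=
      (placeHomeo p u s hu hs).isOpenMap _ (isOpen_freeRegion ε)
    obtain ⟨y, ⟨z, hz, rfl⟩, hyB⟩ := mem_closure_iff.1 hxf.1 _ hop ⟨x, hx, rfl⟩
    exact hfree z hz hyB
  have haI : a ∈ Ioo (0 : ℝ) 1 := ⟨by linarith [ha.1], by linarith [ha.2]⟩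
  obtain ⟨ha1, ha2⟩ := hbase a haI
  obtain ⟨hb1, hb2⟩ := hbase b hb
  -- the final angle
  have hww : w 0 ^ 2 + w 1 ^ 2 = 1 := unit_sq hw1
  have hw0 : |w 0| < 1 := by
    rw [← sq_lt_one_iff_abs_lt_one]; nlinarith
  obtain ⟨hw0l, hw0r⟩ := abs_lt.1 hw0
  -- The outward normal is `-leftTurn u`, so a velocity making the angle `ψ` with it has frame
  -- coordinates `(-sin ψ, -cos ψ)`.
  set ψ := Real.arcsin (-w 0) with hψ
  have hsψ : Real.sin ψ = -w 0 := Real.sin_arcsin (by linarith) (by linarith)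
  have hcψ : Real.cos ψ = -w 1 := by
    rw [hψ, Real.cos_arcsin, neg_sq]
    have : 1 - w 0 ^ 2 = (-w 1) ^ 2 := by linarith
    rw [this, Real.sqrt_sq (by linarith)]
  have hψI : ψ ∈ Ioo (-(Real.pi / 2)) (Real.pi / 2) := by
    refine ⟨?_, ?_⟩
    · exact Real.neg_pi_div_two_lt_arcsin.2 (by linarith)
    · exact Real.arcsin_lt_pi_div_two.2 (by linarith)
  have hll : leftTurn (leftTurn u) = -u := by apply plane_ext <;> simp
  have hneg : leftTurn (-leftTurn u) = u := by apply plane_ext <;> simp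
  have hrot : ∀ θ, rotCW θ (-leftTurn u) = -frame u !₂[Real.sin θ, Real.cos θ] := by
    intro θ
    rw [rotCW_eq, hneg, frame_apply, plane_mk_zero, plane_mk_one]; module
  have hvw : frame u w = rotCW ψ (-leftTurn u) := by
    rw [hrot, hsψ, hcψ, frame_apply, frame_apply, plane_mk_zero, plane_mk_one]; module
  have hφI : φ ∈ Ioo (-(Real.pi / 2)) (Real.pi / 2) := by
    have := abs_le.1 hφ'
    constructor <;> linarith
  -- the normal at the point of reflection
  have hr0 : (0 : ℝ) < s * (2 * (1 / ε)) := by positivity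
  have hsin1 : Real.sin δ * δ ≤ 1 := by
    have := mul_le_mul (Real.sin_le_one δ) (by linarith : δ ≤ 1) hδ.le zero_le_one
    linarith
  have hnorm : HasBoundaryNormal B (place p u s q) (frame u n) := by
    have hε1 : 1 < 2 * (1 / ε) := by
      rw [mul_one_div, lt_div_iff₀ hε]; linarith
    have hdA := dist_place (p := p) hu hs q !₂[0, ε]
    have hdC := dist_place (p := p) hu hs q !₂[1, ε]
    have hdAC := dist_place (p := p) hu hs !₂[0, ε] !₂[1, ε]
    rw [dist_foci] at hdAC
    obtain ⟨h1, h2⟩ := hasBoundaryNormal_ellipse (B := B) (A := place p u s !₂[0, ε])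
      (C := place p u s !₂[1, ε]) (q := place p u s q) (c := s * (2 * (1 / ε))) (m := frame u m)
      (by rw [hdAC]; exact mul_lt_mul_of_pos_left hε1 hs)
      (by rw [focalSum, hdA, hdC, ← mul_add, ← hqf, focalSum])
      (harc q hq1 hqf hq0) (by
        rw [hdA, hdC, hm, map_add, map_smul, map_smul, map_sub, map_sub]
        simp only [place_eq]
        rw [add_sub_add_left_eq_sub, add_sub_add_left_eq_sub, ← smul_sub, ← smul_sub, smul_smul,
          smul_smul]
        have key : ∀ r : ℝ, 1 / r = 1 / (s * r) * s := fun r => by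
          rw [one_div, one_div, mul_inv, mul_comm s⁻¹, mul_assoc, inv_mul_cancel₀ hs.ne', mul_one]
        rw [← key, ← key])
    rw [norm_frame hu, ← map_smul, ← hn] at h2
    exact h2
  -- The billiard is started at `ξ - v`, one unit of time before the entry; hence the `1` in the
  -- hitting time `1 + s * T₁`.
  have hstart : place p u s !₂[a, 0] - frame u d = place p u s (!₂[a, 0] + (-(1 / s)) • d) := by
    rw [sub_eq_add_neg, ← neg_one_smul ℝ (frame u d), place_add_smul hs]
    congr 3; ring
  -- After time `T₂` the particle is strictly beyond the base line, which supports the hull.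
  have houtside : ∀ t : ℝ, T₂ < t → place p u s (q + t • w) ∉ closure (convexHull ℝ B) := by
    intro t ht hcl
    have h1 := support_closure hb2.inner_le _ hcl
    rw [inner_neg_left, inner_leftTurn_place_sub hu] at h1
    have h2 : (q + t • w) 1 = (t - T₂) * w 1 := by
      have h3 : q 1 + T₂ * w 1 = 0 := congrArg (fun x : Plane => x 1) hqb
      change q 1 + t * w 1 = (t - T₂) * w 1
      linarith
    have h4 : (!₂[b, 0] : Plane) 1 = 0 := rfl
    rw [h2, h4, sub_zero] at h1
    have := mul_neg_of_pos_of_neg (sub_pos.2 ht) hwneg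
    have := mul_neg_of_pos_of_neg hs this
    linarith
  refine ⟨(ψ, place p u s !₂[b, 0]), ⟨hφI, hψI, ha1, hb1, -leftTurn u, -leftTurn u, frame u d,
    place p u s q, frame u w, ha2, hb2, (hrot φ).symm, hvw, .single ⟨⟨1 + s * T₁, by positivity, ?_, ?_⟩,
    frame u n, hnorm, ?_, ?_⟩, ?_, s * T₂, by positivity, ?_, ?_⟩, ?_⟩
  · dsimp only
    rw [hstart, place_add_smul hs, hq]
    congr 1
    have : (1 + s * T₁) / s = 1 / s + T₁ := by field_simp
    rw [this]; module
  · intro t ht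
    dsimp only
    rw [hstart, place_add_smul hs]
    have : !₂[a, 0] + -(1 / s) • d + (t / s) • d = !₂[a, 0] + (t / s - 1 / s) • d := by module
    rw [this]
    refine hfr _ (hin _ ?_)
    rw [← sub_div, div_lt_iff₀ hs]
    linarith [ht.2]
  · dsimp only
    rwa [inner_frame hu]
  · dsimp only
    rw [inner_frame hu, hw, map_sub, map_smul]
  · intro t ht
    rw [place_add_smul hs]
    exact hfr _ (hout _ (div_pos ht hs))
  · rw [place_add_smul hs, mul_div_cancel_left₀ _ hs.ne', hqb]
  · intro t ht
    rw [place_add_smul hs]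
    exact houtside _ (by rw [lt_div_iff₀ hs]; linarith)
  · have h1 := inner_rotCW_rotCW ψ φ (-leftTurn u)
    rw [norm_neg, norm_leftTurn, hu, ← hvw, hrot φ, inner_neg_right, inner_frame hu] at h1
    dsimp only
    linarith

/-! ### Convex polygons -/

section Polygon

variable {k : ℕ} {V : Fin (k + 3) → Plane}

theorem fin_add_one_ne (i : Fin (k + 3)) : i + 1 ≠ i := by
  intro h
  exact one_ne_zero (add_eq_left.1 h)

theorem fin_add_two_ne (i : Fin (k + 3)) : i + 1 + 1 ≠ i := by
  intro h
  rw [add_assoc] at h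
  have h2 := congrArg Fin.val (add_eq_left.1 h)
  rw [Fin.val_add] at h2
  have h1 : ((1 : Fin (k + 3)) : ℕ) = 1 := rfl
  rw [h1] at h2
  have h3 : (1 + 1) % (k + 3) = 2 := Nat.mod_eq_of_lt (by omega)
  rw [h3] at h2
  exact absurd h2 (by simp)

/-- The affine function that is positive on the inner side of the `i`-th side of a polygon. -/
def sideFun (V : Fin (k + 3) → Plane) (i : Fin (k + 3)) (x : Plane) : ℝ :=
  cross (V (i + 1) - V i) (x - V i)

theorem continuous_sideFun (V : Fin (k + 3) → Plane) (i : Fin (k + 3)) : Continuous (sideFun V i) := by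
  unfold sideFun; fun_prop

theorem sideFun_combo (V : Fin (k + 3) → Plane) (i : Fin (k + 3)) (x y : Plane) {a b : ℝ}
    (hab : a + b = 1) : sideFun V i (a • x + b • y) = a * sideFun V i x + b * sideFun V i y := by
  obtain rfl : b = 1 - a := by linarith
  unfold sideFun cross
  simp only [PiLp.sub_apply, PiLp.add_apply, PiLp.smul_apply, smul_eq_mul]
  ring

@[simp] theorem sideFun_left (V : Fin (k + 3) → Plane) (i : Fin (k + 3)) : sideFun V i (V i) = 0 := by
  simp [sideFun, cross]

@[simp] theorem sideFun_right (V : Fin (k + 3) → Plane) (i : Fin (k + 3)) :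
    sideFun V i (V (i + 1)) = 0 := by
  simp only [sideFun, cross]; ring

theorem IsConvexPolygon.sideFun_pos (hV : IsConvexPolygon V) {i j : Fin (k + 3)} (h : j ≠ i)
    (h' : j ≠ i + 1) : 0 < sideFun V i (V j) := hV i j h h'

theorem IsConvexPolygon.sideFun_nonneg (hV : IsConvexPolygon V) (i j : Fin (k + 3)) :
    0 ≤ sideFun V i (V j) := by
  by_cases h : j = i
  · rw [h, sideFun_left]
  · by_cases h' : j = i + 1
    · rw [h', sideFun_right]
    · exact (hV.sideFun_pos h h').le

theorem convex_sideFun_nonneg (V : Fin (k + 3) → Plane) (i : Fin (k + 3)) :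
    Convex ℝ {x | 0 ≤ sideFun V i x} := by
  intro x hx y hy a b ha hb hab
  change 0 ≤ sideFun V i (a • x + b • y)
  rw [sideFun_combo V i x y hab]
  exact add_nonneg (mul_nonneg ha hx) (mul_nonneg hb hy)

theorem IsConvexPolygon.sideFun_nonneg_of_mem (hV : IsConvexPolygon V) (i : Fin (k + 3)) {x : Plane}
    (hx : x ∈ convexHull ℝ (range V)) : 0 ≤ sideFun V i x := by
  refine convexHull_min ?_ (convex_sideFun_nonneg V i) hx
  rintro _ ⟨j, rfl⟩
  exact hV.sideFun_nonneg i j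

theorem isCompact_polygon (V : Fin (k + 3) → Plane) : IsCompact (convexHull ℝ (range V)) :=
  (finite_range V).isCompact_convexHull ℝ

/-- A convex polygon is the intersection of its half-planes. -/
theorem IsConvexPolygon.mem_iff (hV : IsConvexPolygon V) {x : Plane} :
    x ∈ convexHull ℝ (range V) ↔ ∀ i, 0 ≤ sideFun V i x := by
  refine ⟨fun hx i => hV.sideFun_nonneg_of_mem i hx, fun hx => ?_⟩
  by_contra hn
  -- A functional `f` separating `x` from the polygon is maximal at some vertex. The half-planes of
  -- the two sides at this vertex put `x` in the cone spanned by them, on which `f` does not exceed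
  -- its value at the vertex.
  obtain ⟨f, t, hf, hft⟩ := geometric_hahn_banach_closed_point (convex_convexHull ℝ (range V))
    (isCompact_polygon V).isClosed hn
  obtain ⟨i₀, -, hi₀⟩ := Finset.exists_max_image Finset.univ (fun i => f (V i)) Finset.univ_nonempty
  -- `i₀ = i + 1` for the side `i` before the maximal vertex
  obtain ⟨i, rfl⟩ : ∃ i, i₀ = i + 1 := ⟨i₀ - 1, by abel⟩
  set P := V (i + 1) with hP
  set a := V (i + 1 + 1) - P with ha
  set b := V i - P with hb
  have hab : 0 < cross a b := by
    have := hV.sideFun_pos (i := i + 1) (j := i) (fun h => fin_add_one_ne i h.symm)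
      (fun h => fin_add_two_ne i h.symm)
    exact this
  have h1 : 0 ≤ cross a (x - P) := hx (i + 1)
  have h2 : 0 ≤ cross (x - P) b := by
    have := hx i
    unfold sideFun at this
    rw [hb]
    unfold cross at this ⊢
    simp only [PiLp.sub_apply] at this ⊢
    linarith
  have e : x - P = (cross (x - P) b / cross a b) • a + (cross a (x - P) / cross a b) • b := by
    apply plane_ext
    · simp only [PiLp.add_apply, PiLp.smul_apply, smul_eq_mul]
      field_simp
      unfold cross; ring
    · simp only [PiLp.add_apply, PiLp.smul_apply, smul_eq_mul]
      field_simp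
      unfold cross; ring
  have h3 : f x - f P ≤ 0 := by
    rw [← map_sub, e, map_add, map_smul, map_smul, smul_eq_mul, smul_eq_mul, ha, hb, map_sub, map_sub]
    have h4 := hi₀ (i + 1 + 1) (Finset.mem_univ _)
    have h5 := hi₀ i (Finset.mem_univ _)
    have h6 := mul_nonpos_of_nonneg_of_nonpos (div_nonneg h2 hab.le) (sub_nonpos.2 h4)
    have h7 := mul_nonpos_of_nonneg_of_nonpos (div_nonneg h1 hab.le) (sub_nonpos.2 h5)
    linarith
  have h8 := hf P (subset_convexHull ℝ _ (mem_range_self _))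
  linarith

theorem IsConvexPolygon.ne (hV : IsConvexPolygon V) (i : Fin (k + 3)) : V (i + 1) ≠ V i := by
  intro h
  have := hV.sideFun_pos (i := i) (j := i + 1 + 1) (fin_add_two_ne i)
    (fun h' => fin_add_one_ne (i + 1) h')
  rw [sideFun, h, sub_self] at this
  simp [cross] at this

theorem IsConvexPolygon.norm_pos (hV : IsConvexPolygon V) (i : Fin (k + 3)) :
    0 < ‖V (i + 1) - V i‖ := norm_pos_iff.2 (sub_ne_zero.2 (hV.ne i))

theorem IsConvexPolygon.norm_sideDir (hV : IsConvexPolygon V) (i : Fin (k + 3)) :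
    ‖sideDir V i‖ = 1 := by
  rw [sideDir, norm_smul, norm_div, norm_one, norm_norm, one_div_mul_cancel (hV.norm_pos i).ne']

theorem IsConvexPolygon.vertex_succ (hV : IsConvexPolygon V) (i : Fin (k + 3)) :
    V (i + 1) = V i + ‖V (i + 1) - V i‖ • sideDir V i := by
  rw [sideDir, smul_smul, mul_one_div_cancel (hV.norm_pos i).ne', one_smul]; abel

theorem IsConvexPolygon.sideFun_eq (hV : IsConvexPolygon V) (i : Fin (k + 3)) (x : Plane) :
    sideFun V i x = ‖V (i + 1) - V i‖ * inner ℝ (leftTurn (sideDir V i)) (x - V i) := by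
  have h : V (i + 1) - V i = ‖V (i + 1) - V i‖ • sideDir V i := by
    rw [sideDir, smul_smul, mul_one_div_cancel (hV.norm_pos i).ne', one_smul]
  unfold sideFun
  nth_rw 1 [h]
  rw [cross_eq_inner, ← real_inner_smul_left]
  congr 1
  apply plane_ext <;> simp

theorem IsConvexPolygon.interior_of_pos (V : Fin (k + 3) → Plane) (hV : IsConvexPolygon V) {x : Plane}
    (hx : ∀ i, 0 < sideFun V i x) : x ∈ interior (convexHull ℝ (range V)) := by
  have ho : IsOpen {x | ∀ i, 0 < sideFun V i x} := by
    have : {x | ∀ i, 0 < sideFun V i x} = ⋂ i, {x | 0 < sideFun V i x} := by ext; simp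
    rw [this]
    exact isOpen_iInter_of_finite fun i => isOpen_lt continuous_const (continuous_sideFun V i)
  exact interior_maximal (fun y hy => hV.mem_iff.2 fun i => (hy i).le) ho hx

/-- At the barycentre of the vertices each side function is an average of nonnegative numbers, one
of them positive since there is a third vertex. -/
theorem IsConvexPolygon.interior_nonempty (hV : IsConvexPolygon V) :
    (interior (convexHull ℝ (range V))).Nonempty := by
  set N : ℝ := ((k + 3 : ℕ) : ℝ) with hN
  have hN0 : 0 < N := by positivity
  have h1 : ∀ i, sideFun V i (∑ j, (1 / N) • V j) = (1 / N) * ∑ j, sideFun V i (V j) := by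
    intro i
    have h2 : ∑ j : Fin (k + 3), (1 / N) • V j - V i = (1 / N) • ∑ j, (V j - V i) := by
      rw [← Finset.smul_sum, Finset.sum_sub_distrib, Finset.sum_const, Finset.card_univ,
        Fintype.card_fin, smul_sub, ← Nat.cast_smul_eq_nsmul ℝ, smul_smul,
        one_div_mul_cancel hN0.ne', one_smul]
    unfold sideFun
    rw [h2, cross_eq_inner, real_inner_smul_right, inner_sum]
    simp only [cross_eq_inner]
  refine ⟨∑ j, (1 / N) • V j, hV.interior_of_pos V fun i => ?_⟩
  rw [h1]
  refine mul_pos (by positivity) (Finset.sum_pos' (fun j _ => hV.sideFun_nonneg i j)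
    ⟨i + 1 + 1, Finset.mem_univ _, ?_⟩)
  exact hV.sideFun_pos (fin_add_two_ne i) (fun h' => fin_add_one_ne (i + 1) h')

/-- On the line of a side, the inequality of the preceding side cuts off one half-line and that of
the following side the other. -/
theorem IsConvexPolygon.mem_segment_of_sideFun_eq_zero (hV : IsConvexPolygon V) {i : Fin (k + 3)}
    {x : Plane} (hx : x ∈ convexHull ℝ (range V)) (h0 : sideFun V i x = 0) :
    ∃ t ∈ Icc 0 ‖V (i + 1) - V i‖, x = V i + t • sideDir V i := by
  set u := sideDir V i with hu
  have hu1 : ‖u‖ = 1 := hV.norm_sideDir i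
  set L := ‖V (i + 1) - V i‖ with hL
  have hL0 : 0 < L := hV.norm_pos i
  rw [hV.sideFun_eq, mul_eq_zero, or_iff_right hL0.ne'] at h0
  set t : ℝ := inner ℝ u (x - V i) with ht
  have hxt : x = V i + t • u := by
    have := unit_decomp hu1 (x - V i)
    rw [h0, zero_smul, add_zero, ← ht] at this
    rw [← this]; abel
  have hcomb : x = (1 - t / L) • V i + (t / L) • V (i + 1) := by
    rw [hV.vertex_succ i, ← hL, hxt]
    have : t / L * L = t := by field_simp
    nth_rw 1 [← this]
    module
  refine ⟨t, ⟨?_, ?_⟩, hxt⟩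
  · -- use the previous side
    obtain ⟨j, hj⟩ : ∃ j, i = j + 1 := ⟨i - 1, by abel⟩
    have h1 := hV.sideFun_nonneg_of_mem j hx
    rw [hcomb, sideFun_combo _ _ _ _ (by ring)] at h1
    have h2 : sideFun V j (V i) = 0 := by rw [hj, sideFun_right]
    have h3 : 0 < sideFun V j (V (i + 1)) := by
      rw [hj]
      exact hV.sideFun_pos (fin_add_two_ne j) (fin_add_one_ne (j + 1))
    rw [h2, mul_zero, zero_add] at h1
    have := nonneg_of_mul_nonneg_left h1 h3
    rwa [le_div_iff₀ hL0, zero_mul] at this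
  · have h1 := hV.sideFun_nonneg_of_mem (i + 1) hx
    rw [hcomb, sideFun_combo _ _ _ _ (by ring), sideFun_left, mul_zero, add_zero] at h1
    have h3 : 0 < sideFun V (i + 1) (V i) :=
      hV.sideFun_pos (fun h => fin_add_one_ne i h.symm) (fun h => fin_add_two_ne i h.symm)
    have := nonneg_of_mul_nonneg_left h1 h3
    rw [sub_nonneg, div_le_one hL0] at this
    exact this

theorem IsConvexPolygon.exists_sideFun_eq_zero (hV : IsConvexPolygon V) {x : Plane}
    (hx : x ∈ frontier (convexHull ℝ (range V))) : ∃ i, sideFun V i x = 0 := by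
  by_contra! h
  have hxP := (isCompact_polygon V).isClosed.frontier_subset hx
  exact hx.2 (hV.interior_of_pos V fun i =>
    lt_of_le_of_ne (hV.sideFun_nonneg_of_mem i hxP) (h i).symm)

theorem IsConvexPolygon.side_mem (hV : IsConvexPolygon V) (i : Fin (k + 3)) {t : ℝ}
    (ht : t ∈ Icc 0 ‖V (i + 1) - V i‖) : V i + t • sideDir V i ∈ convexHull ℝ (range V) := by
  have hL0 := hV.norm_pos i
  have e : V i + t • sideDir V i = (1 - t / ‖V (i + 1) - V i‖) • V i +
      (t / ‖V (i + 1) - V i‖) • V (i + 1) := by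
    rw [sideDir]; module
  rw [e]
  exact convex_convexHull ℝ _ (subset_convexHull ℝ _ (mem_range_self _))
    (subset_convexHull ℝ _ (mem_range_self _)) (sub_nonneg.2 ((div_le_one hL0).2 ht.2))
    (div_nonneg ht.1 hL0.le) (by ring)

/-- At most one end of the side lies on the line of another side, so the affine function is positive
in between. -/
theorem IsConvexPolygon.sideFun_side_pos (hV : IsConvexPolygon V) {i j : Fin (k + 3)} (hij : j ≠ i)
    {t : ℝ} (ht : t ∈ Ioo 0 ‖V (i + 1) - V i‖) : 0 < sideFun V j (V i + t • sideDir V i) := by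
  have hL0 := hV.norm_pos i
  have e : V i + t • sideDir V i = (1 - t / ‖V (i + 1) - V i‖) • V i +
      (t / ‖V (i + 1) - V i‖) • V (i + 1) := by
    rw [sideDir]; module
  have h1 : 0 < 1 - t / ‖V (i + 1) - V i‖ := sub_pos.2 ((div_lt_one hL0).2 ht.2)
  have h2 : 0 < t / ‖V (i + 1) - V i‖ := div_pos ht.1 hL0
  rw [e, sideFun_combo _ _ _ _ (by ring)]
  by_cases h3 : i = j + 1
  · have : 0 < sideFun V j (V (i + 1)) := by
      rw [h3]; exact hV.sideFun_pos (fin_add_two_ne j) (fin_add_one_ne (j + 1))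
    exact add_pos_of_nonneg_of_pos (mul_nonneg h1.le (hV.sideFun_nonneg j i)) (mul_pos h2 this)
  · exact add_pos_of_pos_of_nonneg (mul_pos h1 (hV.sideFun_pos hij.symm h3))
      (mul_nonneg h2.le (hV.sideFun_nonneg j _))

theorem IsConvexPolygon.inner_nonneg_of_mem (hV : IsConvexPolygon V) (i : Fin (k + 3)) {x : Plane}
    (hx : x ∈ convexHull ℝ (range V)) : 0 ≤ (inner ℝ (leftTurn (sideDir V i)) (x - V i) : ℝ) := by
  have := hV.sideFun_nonneg_of_mem i hx
  rw [hV.sideFun_eq] at this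
  exact nonneg_of_mul_nonneg_right this (hV.norm_pos i)

theorem IsConvexPolygon.side_mem_frontier (hV : IsConvexPolygon V) (i : Fin (k + 3)) {t : ℝ}
    (ht : t ∈ Icc 0 ‖V (i + 1) - V i‖) :
    V i + t • sideDir V i ∈ frontier (convexHull ℝ (range V)) := by
  refine mem_frontier_of_support (m := -leftTurn (sideDir V i)) (subset_closure (hV.side_mem i ht))
    (by rw [norm_neg, norm_leftTurn, hV.norm_sideDir]) fun q hq => ?_
  have h1 := hV.inner_nonneg_of_mem i hq
  have h2 : q - (V i + t • sideDir V i) = (q - V i) - t • sideDir V i := by abel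
  rw [h2, inner_neg_left, inner_sub_right, real_inner_smul_right, inner_leftTurn_self]
  linarith

/-- Inside a side, the two end points force a normal to be orthogonal to the side, and a third
vertex decides its sign. -/
theorem IsConvexPolygon.isOutwardNormal_side (hV : IsConvexPolygon V) (i : Fin (k + 3)) {t : ℝ}
    (ht : t ∈ Ioo 0 ‖V (i + 1) - V i‖) : IsOutwardNormal (convexHull ℝ (range V))
      (V i + t • sideDir V i) (-leftTurn (sideDir V i)) := by
  set u := sideDir V i with hu
  have hu1 : ‖u‖ = 1 := hV.norm_sideDir i
  have hll : ‖leftTurn u‖ = 1 := by rw [norm_leftTurn, hu1]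
  have hsup : ∀ q ∈ convexHull ℝ (range V), inner ℝ (-leftTurn u) (q - (V i + t • u)) ≤ (0 : ℝ) := by
    intro q hq
    have h1 := hV.inner_nonneg_of_mem i hq
    have h2 : q - (V i + t • u) = (q - V i) - t • u := by abel
    rw [h2, inner_neg_left, inner_sub_right, real_inner_smul_right, inner_leftTurn_self]
    linarith
  refine eq_singleton_iff_unique_mem.2 ⟨⟨by rw [norm_neg, hll], hsup⟩, ?_⟩
  rintro m ⟨hm1, hm⟩
  have hv : ∀ j, V j ∈ convexHull ℝ (range V) := fun j => subset_convexHull ℝ _ (mem_range_self j)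
  have h1 := hm _ (hv i)
  have h2 := hm _ (hv (i + 1))
  rw [hV.vertex_succ i, ← hu, add_sub_add_left_eq_sub, ← sub_smul, real_inner_smul_right] at h2
  have h3 : V i - (V i + t • u) = (-t) • u := by module
  rw [h3, real_inner_smul_right] at h1
  have h4 : (inner ℝ m u : ℝ) = 0 := by
    have := ht.1
    have := ht.2
    nlinarith
  have h5 : inner ℝ (leftTurn (leftTurn u)) m = (0 : ℝ) := by
    have : leftTurn (leftTurn u) = -u := by apply plane_ext <;> simp
    rw [this, inner_neg_left, real_inner_comm, h4, neg_zero]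
  rcases unit_eq_or_neg hll hm1 h5 with h6 | h6
  · exfalso
    have h7 := hV.sideFun_pos (i := i) (j := i + 1 + 1) (fin_add_two_ne i) (fin_add_one_ne (i + 1))
    have h8 := hm _ (hv (i + 1 + 1))
    have h9 := hsup _ (hv (i + 1 + 1))
    rw [h6] at h8
    rw [inner_neg_left] at h9
    have h10 : V (i + 1 + 1) - (V i + t • u) = (V (i + 1 + 1) - V i) - t • u := by abel
    rw [hV.sideFun_eq] at h7
    have h11 := pos_of_mul_pos_right h7 (norm_nonneg _)
    rw [h10, inner_sub_right, real_inner_smul_right, inner_leftTurn_self] at h8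
    linarith
  · exact h6

end Polygon

/-! ### The shape of a mushroom -/

theorem mem_mushroom {ε : ℝ} {x : Plane} : x ∈ mushroom ε ↔
    (0 ≤ x 0 ∧ x 0 ≤ 1 ∧ 0 ≤ x 1 ∧ x 1 ≤ ε) ∨
      (ε ≤ x 1 ∧ focalSum !₂[0, ε] !₂[1, ε] x ≤ 2 * (1 / ε)) := Iff.rfl

theorem isClosed_mushroom (ε : ℝ) : IsClosed (mushroom ε) := by
  have h := continuous_focalSum !₂[0, ε] !₂[1, ε]
  refine IsClosed.union (s₁ := {x : Plane | 0 ≤ x 0 ∧ x 0 ≤ 1 ∧ 0 ≤ x 1 ∧ x 1 ≤ ε}) ?_ ?_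
  · exact (isClosed_le (by fun_prop) (by fun_prop)).and ((isClosed_le (by fun_prop) (by fun_prop)).and
      ((isClosed_le (by fun_prop) (by fun_prop)).and (isClosed_le (by fun_prop) (by fun_prop))))
  · exact (isClosed_le (by fun_prop) (by fun_prop)).and (isClosed_le (by fun_prop) (by fun_prop))

theorem focalSum_axis (ε r : ℝ) : focalSum !₂[0, ε] !₂[1, ε] !₂[r, ε] = |r| + |r - 1| := by
  have key : ∀ y : ℝ, dist (!₂[r, ε] : Plane) !₂[y, ε] = |r - y| := by
    intro y
    refine (sq_eq_sq₀ dist_nonneg (abs_nonneg _)).1 ?_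
    rw [dist_eq_norm, plane_norm_sq, sq_abs]
    change (r - y) ^ 2 + (ε - ε) ^ 2 = (r - y) ^ 2
    ring
  rw [focalSum, key, key, sub_zero]

theorem focalSum_ge_axis (ε : ℝ) (x : Plane) : |x 0| + |x 0 - 1| ≤ focalSum !₂[0, ε] !₂[1, ε] x := by
  refine add_le_add ?_ ?_
  · have := abs_coord_le_norm (x - !₂[0, ε]) 0
    rw [dist_eq_norm]
    change |x 0 - 0| ≤ _ at this
    rwa [sub_zero] at this
  · have := abs_coord_le_norm (x - !₂[1, ε]) 0
    rw [dist_eq_norm]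
    exact this

theorem focalSum_gt_axis {ε : ℝ} {x : Plane} (hx : x 1 ≠ ε) :
    |x 0| + |x 0 - 1| < focalSum !₂[0, ε] !₂[1, ε] x := by
  refine add_lt_add ?_ ?_
  · refine abs_lt_of_sq_lt_sq ?_ dist_nonneg
    rw [dist_eq_norm, plane_norm_sq]
    change x 0 ^ 2 < (x 0 - 0) ^ 2 + (x 1 - ε) ^ 2
    have : 0 < (x 1 - ε) ^ 2 := by have := sub_ne_zero.2 hx; positivity
    rw [sub_zero]; linarith
  · refine abs_lt_of_sq_lt_sq ?_ dist_nonneg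
    rw [dist_eq_norm, plane_norm_sq]
    change (x 0 - 1) ^ 2 < (x 0 - 1) ^ 2 + (x 1 - ε) ^ 2
    have : 0 < (x 1 - ε) ^ 2 := by have := sub_ne_zero.2 hx; positivity
    linarith

theorem mushroom_left_mem {ε : ℝ} (h0 : 0 < ε) (h : ε < 1) : !₂[1 / 2 - 1 / ε, ε] ∈ mushroom ε := by
  have h1 : 1 < 1 / ε := by rw [lt_div_iff₀ h0]; linarith
  refine mem_mushroom.2 (Or.inr ⟨le_rfl, ?_⟩)
  rw [focalSum_axis, abs_of_neg (by linarith), abs_of_neg (by linarith)]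
  linarith

theorem mushroom_right_mem {ε : ℝ} (h0 : 0 < ε) (h : ε < 1) : !₂[1 / 2 + 1 / ε, ε] ∈ mushroom ε := by
  have h1 : 1 < 1 / ε := by rw [lt_div_iff₀ h0]; linarith
  refine mem_mushroom.2 (Or.inr ⟨le_rfl, ?_⟩)
  rw [focalSum_axis, abs_of_pos (by linarith), abs_of_pos (by linarith)]
  linarith

/-- Horizontal extent of the mushroom: its extreme points are the ends of the major axis. -/
theorem eq_of_extreme_abscissa {ε : ℝ} (h0 : 0 < ε) (h : ε < 1) {x : Plane} (hx : x ∈ mushroom ε)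
    (hx0 : x 0 ≤ 1 / 2 - 1 / ε ∨ 1 / 2 + 1 / ε ≤ x 0) : x 1 = ε := by
  have h1 : 1 < 1 / ε := by rw [lt_div_iff₀ h0]; linarith
  rcases mem_mushroom.1 hx with ⟨h2, h3, -, -⟩ | ⟨h2, h3⟩
  · rcases hx0 with h4 | h4 <;> linarith
  · by_contra hne
    have h4 := focalSum_gt_axis hne
    rcases hx0 with h5 | h5
    · rw [abs_of_neg (by linarith), abs_of_neg (by linarith)] at h4
      linarith
    · rw [abs_of_pos (by linarith), abs_of_pos (by linarith)] at h4
      linarith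

/-- A point of the arc above the major axis and off the minor axis is not extreme in any of the
coordinate directions. -/
theorem exists_beyond_arc {ε : ℝ} {q : Plane} (hq1 : ε < q 1)
    (hqf : focalSum !₂[0, ε] !₂[1, ε] q = 2 * (1 / ε)) (hq0 : q 0 ≠ 1 / 2) :
    (∃ x ∈ mushroom ε, x 0 < q 0) ∧ (∃ x ∈ mushroom ε, q 0 < x 0) ∧ ∃ x ∈ mushroom ε, q 1 < x 1 := by
  have h1 := focalSum_gt_axis hq1.ne'
  rw [hqf, ← focalSum_axis ε] at h1
  set f := focalSum !₂[0, ε] !₂[1, ε] with hf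
  set y : Plane := !₂[q 0, ε] with hy
  have hmove : ∀ (z : Plane), f z < 2 * (1 / ε) → ∀ d : Plane, ‖d‖ = 1 →
      f (z + ((2 * (1 / ε) - f z) / 2) • d) ≤ 2 * (1 / ε) := by
    intro z hz d hd
    have := focalSum_le_add !₂[0, ε] !₂[1, ε] (z + ((2 * (1 / ε) - f z) / 2) • d) z
    rw [dist_eq_norm, add_sub_cancel_left, norm_smul, hd, mul_one, Real.norm_eq_abs,
      abs_of_pos (by linarith)] at this
    have h2 : f z + 2 * ((2 * (1 / ε) - f z) / 2) = 2 * (1 / ε) := by ring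
    exact this.trans h2.le
  have he0 : ‖(!₂[1, 0] : Plane)‖ = 1 := by
    refine (sq_eq_sq₀ (norm_nonneg _) (by norm_num)).1 ?_
    rw [plane_norm_sq, plane_mk_zero, plane_mk_one]; norm_num
  have he1 : ‖(!₂[0, 1] : Plane)‖ = 1 := by
    refine (sq_eq_sq₀ (norm_nonneg _) (by norm_num)).1 ?_
    rw [plane_norm_sq, plane_mk_zero, plane_mk_one]; norm_num
  set r := (2 * (1 / ε) - f y) / 2 with hr
  have hr0 : 0 < r := by rw [hr]; linarith
  refine ⟨⟨y + r • -!₂[1, 0], Or.inr ⟨?_, hmove y h1 _ (by rw [norm_neg, he0])⟩, ?_⟩,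
    ⟨y + r • !₂[1, 0], Or.inr ⟨?_, hmove y h1 _ he0⟩, ?_⟩, ?_⟩
  · change ε ≤ ε + r * -0
    linarith
  · change q 0 + r * -1 < q 0
    linarith
  · change ε ≤ ε + r * 0
    linarith
  · change q 0 < q 0 + r * 1
    linarith
  · -- the point of the minor axis at the height of `q` is inside the ellipse
    set z : Plane := !₂[1 / 2, q 1] with hz
    have hfz : f z < 2 * (1 / ε) := by
      rw [← hqf]
      have hA : ∀ (w : Plane) (y : ℝ), dist w !₂[y, ε] ^ 2 = (w 0 - y) ^ 2 + (w 1 - ε) ^ 2 := by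
        intro w y
        rw [dist_eq_norm, plane_norm_sq]; rfl
      have a1 := hA q 0
      have a2 := hA q 1
      have b1 := hA z 0
      have b2 := hA z 1
      have hz0 : z 0 = 1 / 2 := rfl
      have hz1 : z 1 = q 1 := rfl
      rw [hz0, hz1] at b1 b2
      have n1 : 0 ≤ dist q !₂[0, ε] := dist_nonneg
      have n2 : 0 ≤ dist q !₂[1, ε] := dist_nonneg
      have m1 : 0 ≤ dist z !₂[0, ε] := dist_nonneg
      have m2 : 0 ≤ dist z !₂[1, ε] := dist_nonneg
      change dist z !₂[0, ε] + dist z !₂[1, ε] < dist q !₂[0, ε] + dist q !₂[1, ε]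
      set α := dist q !₂[0, ε]
      set β := dist q !₂[1, ε]
      set γ := dist z !₂[0, ε]
      set γ' := dist z !₂[1, ε]
      have e : γ' = γ := (sq_eq_sq₀ m2 m1).1 (by rw [b1, b2]; norm_num)
      rw [e]
      set h := q 1 - ε
      have hh : 0 < h := sub_pos.2 hq1
      have hne : 0 < (1 - 2 * q 0) ^ 2 := by
        have : 1 - 2 * q 0 ≠ 0 := by intro h'; exact hq0 (by linarith)
        positivity
      -- The squares differ by `h² (1 - 2 q₀)² > 0`. Adding the squared distances turns this into
      -- `(α + β)² > 1 + 4h² = (2γ)²`: at a given height the focal sum is least on the minor axis.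
      have hprod : q 0 * (1 - q 0) + h ^ 2 < α * β := by
        refine lt_of_pow_lt_pow_left₀ 2 (by positivity) ?_
        rw [mul_pow, a1, a2]
        nlinarith [mul_pos (mul_pos hh hh) hne]
      refine lt_of_pow_lt_pow_left₀ 2 (by positivity) ?_
      nlinarith
    refine ⟨z + ((2 * (1 / ε) - f z) / 2) • !₂[0, 1], Or.inr ⟨?_, hmove z hfz _ he1⟩, ?_⟩
    · change ε ≤ q 1 + ((2 * (1 / ε) - f z) / 2) * 1
      linarith
    · change q 1 < q 1 + ((2 * (1 / ε) - f z) / 2) * 1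
      linarith

theorem inner_side_place {u : Plane} (hu : ‖u‖ = 1) (A : Plane) (t s : ℝ) (x : Plane) :
    inner ℝ u (place (A + t • u) u s x - A) = t + s * x 0 ∧
      inner ℝ (leftTurn u) (place (A + t • u) u s x - A) = s * x 1 := by
  have h1 : inner ℝ u u = (1 : ℝ) := by rw [real_inner_self_eq_norm_sq, hu]; norm_num
  have h2 : inner ℝ (leftTurn u) (leftTurn u) = (1 : ℝ) := by
    rw [real_inner_self_eq_norm_sq, norm_leftTurn, hu]; norm_num
  have e : place (A + t • u) u s x - A = t • u + s • (x 0 • u + x 1 • leftTurn u) := by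
    rw [place_eq, frame_apply]; abel
  rw [e]
  simp only [inner_add_right, real_inner_smul_right, h1, h2, inner_leftTurn_self, inner_self_leftTurn]
  constructor <;> ring

/-! ### Plantings -/

namespace Planting

variable {K : Set Plane} {ε : ℝ} (S : Planting K ε)

/-- The set of all planted mushrooms: side of the polygon, order, place. -/
def index : Finset (Σ _ : Fin (S.k + 3), Σ _ : ℕ, ℝ) :=
  Finset.univ.sigma fun i => (Finset.range (S.orders i)).sigma fun j => S.pos i j

/-- The planted mushroom with a given index. -/
def mush (m : Σ _ : Fin (S.k + 3), Σ _ : ℕ, ℝ) : Set Plane :=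
  plantedMushroom S.V ε m.1 (S.size m.1 m.2.1) m.2.2

variable {S}

theorem mem_index {m : Σ _ : Fin (S.k + 3), Σ _ : ℕ, ℝ} :
    m ∈ S.index ↔ m.2.1 < S.orders m.1 ∧ m.2.2 ∈ S.pos m.1 m.2.1 := by
  simp [index]

variable (S)

theorem body_eq : S.body = convexHull ℝ (range S.V) \ ⋃ m ∈ S.index, S.mush m := by
  unfold body
  congr 1
  ext x
  simp only [mem_iUnion, mem_index]
  constructor
  · rintro ⟨i, j, hj, t, ht, hx⟩
    exact ⟨⟨i, j, t⟩, ⟨hj, ht⟩, hx⟩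
  · rintro ⟨⟨i, j, t⟩, ⟨hj, ht⟩, hx⟩
    exact ⟨i, j, hj, t, ht, hx⟩

theorem norm_sideDir (i : Fin (S.k + 3)) : ‖sideDir S.V i‖ = 1 := S.polygon.norm_sideDir i

variable {S}

theorem size_pos_of_mem {m : Σ _ : Fin (S.k + 3), Σ _ : ℕ, ℝ} (hm : m ∈ S.index) :
    0 < S.size m.1 m.2.1 := S.size_pos _ _ (mem_index.1 hm).1

theorem mush_subset_rect {m : Σ _ : Fin (S.k + 3), Σ _ : ℕ, ℝ} (hm : m ∈ S.index) :
    S.mush m ⊆ S.rect m.1 := S.planted_subset _ _ (mem_index.1 hm).1 _ (mem_index.1 hm).2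

theorem mush_disjoint {m m' : Σ _ : Fin (S.k + 3), Σ _ : ℕ, ℝ} (hm : m ∈ S.index)
    (hm' : m' ∈ S.index) (h : m ≠ m') : Disjoint (S.mush m) (S.mush m') := by
  obtain ⟨i, j, t⟩ := m
  obtain ⟨i', j', t'⟩ := m'
  by_cases hi : i = i'
  · subst hi
    refine S.planted_disjoint i j (mem_index.1 hm).1 j' (mem_index.1 hm').1 t (mem_index.1 hm).2 t'
      (mem_index.1 hm').2 fun h' => h ?_
    obtain ⟨rfl, rfl⟩ := Prod.mk.inj h'
    rfl
  · exact (S.rect_disjoint i i' hi).mono (mush_subset_rect hm) (mush_subset_rect hm')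

theorem isClosed_mush {m : Σ _ : Fin (S.k + 3), Σ _ : ℕ, ℝ} (hm : m ∈ S.index) :
    IsClosed (S.mush m) :=
  (placeHomeo _ _ _ (S.norm_sideDir m.1) (size_pos_of_mem hm)).isClosedMap _ (isClosed_mushroom ε)

theorem mem_rect_iff {i : Fin (S.k + 3)} {X : Plane} : X ∈ S.rect i ↔
    (S.start i ≤ inner ℝ (sideDir S.V i) (X - S.V i) ∧
      inner ℝ (sideDir S.V i) (X - S.V i) ≤ S.start i + S.len i) ∧
    0 ≤ (inner ℝ (leftTurn (sideDir S.V i)) (X - S.V i) : ℝ) ∧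
      inner ℝ (leftTurn (sideDir S.V i)) (X - S.V i) ≤ S.depth i := by
  have hu := S.norm_sideDir i
  rw [S.rect_eq, mem_place_image hu one_pos]
  have e : X - (S.V i + S.start i • sideDir S.V i) = (X - S.V i) + -(S.start i • sideDir S.V i) := by
    abel
  change (0 ≤ inner ℝ (sideDir S.V i) (X - (S.V i + S.start i • sideDir S.V i)) / 1 ∧
    inner ℝ (sideDir S.V i) (X - (S.V i + S.start i • sideDir S.V i)) / 1 ≤ S.len i ∧
    0 ≤ (inner ℝ (leftTurn (sideDir S.V i)) (X - (S.V i + S.start i • sideDir S.V i)) : ℝ) / 1 ∧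
    inner ℝ (leftTurn (sideDir S.V i)) (X - (S.V i + S.start i • sideDir S.V i)) / 1 ≤ S.depth i) ↔ _
  rw [e, inner_add_right, inner_add_right, inner_neg_right, inner_neg_right, real_inner_smul_right,
    real_inner_smul_right, inner_leftTurn_self, real_inner_self_eq_norm_sq, hu, div_one, div_one]
  constructor
  · rintro ⟨h1, h2, h3, h4⟩
    exact ⟨⟨by linarith, by linarith⟩, by linarith, by linarith⟩
  · rintro ⟨⟨h1, h2⟩, h3, h4⟩
    exact ⟨by linarith, by linarith, by linarith, by linarith⟩

theorem interior_rect {i : Fin (S.k + 3)} {X : Plane}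
    (h1 : S.start i < inner ℝ (sideDir S.V i) (X - S.V i))
    (h2 : inner ℝ (sideDir S.V i) (X - S.V i) < S.start i + S.len i)
    (h3 : 0 < (inner ℝ (leftTurn (sideDir S.V i)) (X - S.V i) : ℝ))
    (h4 : inner ℝ (leftTurn (sideDir S.V i)) (X - S.V i) < S.depth i) : X ∈ interior (S.rect i) := by
  have ho : IsOpen {X : Plane | S.start i < inner ℝ (sideDir S.V i) (X - S.V i) ∧
      inner ℝ (sideDir S.V i) (X - S.V i) < S.start i + S.len i ∧
      0 < (inner ℝ (leftTurn (sideDir S.V i)) (X - S.V i) : ℝ) ∧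
      inner ℝ (leftTurn (sideDir S.V i)) (X - S.V i) < S.depth i} :=
    (isOpen_lt (by fun_prop) (by fun_prop)).and ((isOpen_lt (by fun_prop) (by fun_prop)).and
      ((isOpen_lt (by fun_prop) (by fun_prop)).and (isOpen_lt (by fun_prop) (by fun_prop))))
  exact interior_maximal (fun Y hY => mem_rect_iff.2 ⟨⟨hY.1.le, hY.2.1.le⟩, hY.2.2.1.le, hY.2.2.2.le⟩)
    ho ⟨h1, h2, h3, h4⟩

theorem inner_sideDir_place {m : Σ _ : Fin (S.k + 3), Σ _ : ℕ, ℝ} (x : Plane) :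
    inner ℝ (sideDir S.V m.1) (place (S.V m.1 + m.2.2 • sideDir S.V m.1) (sideDir S.V m.1)
      (S.size m.1 m.2.1) x - S.V m.1) = m.2.2 + S.size m.1 m.2.1 * x 0 ∧
    inner ℝ (leftTurn (sideDir S.V m.1)) (place (S.V m.1 + m.2.2 • sideDir S.V m.1) (sideDir S.V m.1)
      (S.size m.1 m.2.1) x - S.V m.1) = S.size m.1 m.2.1 * x 1 :=
  inner_side_place (S.norm_sideDir m.1) _ _ _ x

theorem mushroom_bounds {m : Σ _ : Fin (S.k + 3), Σ _ : ℕ, ℝ} (hm : m ∈ S.index) {x : Plane}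
    (hx : x ∈ mushroom ε) :
    S.start m.1 ≤ m.2.2 + S.size m.1 m.2.1 * x 0 ∧
    m.2.2 + S.size m.1 m.2.1 * x 0 ≤ S.start m.1 + S.len m.1 ∧
    0 ≤ S.size m.1 m.2.1 * x 1 ∧ S.size m.1 m.2.1 * x 1 ≤ S.depth m.1 := by
  have h1 := mem_rect_iff.1 (mush_subset_rect hm ⟨x, hx, rfl⟩)
  obtain ⟨e1, e2⟩ := inner_sideDir_place (S := S) (m := m) x
  rw [e1, e2] at h1
  exact ⟨h1.1.1, h1.1.2, h1.2.1, h1.2.2⟩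

/-- The cap overhangs the stem on both sides and still lies in the rectangle, so the base keeps away
from the vertices of the polygon. -/
theorem base_bounds (h0 : 0 < ε) (h1 : ε < 1) {m : Σ _ : Fin (S.k + 3), Σ _ : ℕ, ℝ}
    (hm : m ∈ S.index) : 0 < m.2.2 ∧
    m.2.2 + S.size m.1 m.2.1 < ‖S.V (m.1 + 1) - S.V m.1‖ := by
  have h2 := (mushroom_bounds hm (mushroom_left_mem h0 h1)).1
  have h3 := (mushroom_bounds hm (mushroom_right_mem h0 h1)).2.1
  rw [plane_mk_zero] at h2 h3
  have hs := size_pos_of_mem hm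
  have h4 : 1 < 1 / ε := by rw [lt_div_iff₀ h0]; linarith
  have h5 := S.start_nonneg m.1
  have h6 := S.base_le m.1
  constructor
  · have := mul_neg_of_pos_of_neg hs (by linarith : 1 / 2 - 1 / ε < 0)
    linarith
  · have := mul_lt_mul_of_pos_left (by linarith : 1 < 1 / 2 + 1 / ε) hs
    linarith

/-- A vertex of the polygon is not the middle of a segment in the polygon. -/
theorem vertex_extreme {k : ℕ} {V : Fin (k + 3) → Plane} (hV : IsConvexPolygon V) (j : Fin (k + 3))
    {d : Plane} (h1 : V j + d ∈ convexHull ℝ (range V)) (h2 : V j - d ∈ convexHull ℝ (range V)) :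
    d = 0 := by
  obtain ⟨i, rfl⟩ : ∃ i, j = i + 1 := ⟨j - 1, by abel⟩
  have a1 := hV.sideFun_nonneg_of_mem i h1
  have a2 := hV.sideFun_nonneg_of_mem i h2
  have b1 := hV.sideFun_nonneg_of_mem (i + 1) h1
  have b2 := hV.sideFun_nonneg_of_mem (i + 1) h2
  have c := hV.sideFun_pos (i := i) (j := i + 1 + 1) (fin_add_two_ne i) (fin_add_one_ne (i + 1))
  unfold sideFun cross at a1 a2 b1 b2 c
  simp only [PiLp.sub_apply, PiLp.add_apply] at a1 a2 b1 b2 c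
  have e1 : (V (i + 1) 0 - V i 0) * d 1 - (V (i + 1) 1 - V i 1) * d 0 = 0 := by linarith
  have e2 : (V (i + 1 + 1) 0 - V (i + 1) 0) * d 1 - (V (i + 1 + 1) 1 - V (i + 1) 1) * d 0 = 0 := by
    linarith
  have c' : (V (i + 1) 0 - V i 0) * (V (i + 1 + 1) 1 - V i 1) -
      (V (i + 1) 1 - V i 1) * (V (i + 1 + 1) 0 - V i 0) ≠ 0 := c.ne'
  apply plane_ext
  · refine mul_left_cancel₀ c' ?_
    change _ = _ * (0 : ℝ)
    linear_combination (V (i + 1 + 1) 0 - V (i + 1) 0) * e1 - (V (i + 1) 0 - V i 0) * e2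
  · refine mul_left_cancel₀ c' ?_
    change _ = _ * (0 : ℝ)
    linear_combination (V (i + 1 + 1) 1 - V (i + 1) 1) * e1 - (V (i + 1) 1 - V i 1) * e2

/-- Every point of a planted mushroom is the midpoint of a nontrivial segment in its rectangle,
which an extreme point of the polygon cannot be: horizontally in general, vertically at the ends of
the major axis. -/
theorem vertex_mem_body (h0 : 0 < ε) (h1 : ε < 1) (j : Fin (S.k + 3)) : S.V j ∈ S.body := by
  rw [body_eq]
  refine ⟨subset_convexHull ℝ _ (mem_range_self j), ?_⟩
  simp only [mem_iUnion, not_exists]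
  rintro m hm ⟨x, hx, hxV⟩
  set u := sideDir S.V m.1 with hu
  have hu1 : ‖u‖ = 1 := S.norm_sideDir m.1
  have huu : inner ℝ u u = (1 : ℝ) := by rw [real_inner_self_eq_norm_sq, hu1]; norm_num
  have hll : inner ℝ (leftTurn u) (leftTurn u) = (1 : ℝ) := by
    rw [real_inner_self_eq_norm_sq, norm_leftTurn, hu1]; norm_num
  have hs := size_pos_of_mem hm
  obtain ⟨e1, e2⟩ := inner_sideDir_place (S := S) (m := m) x
  rw [hxV] at e1 e2
  have hb := mushroom_bounds hm hx
  have hε : 1 < 1 / ε := by rw [lt_div_iff₀ h0]; linarith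
  -- a vertex cannot lie strictly between two points of the rectangle
  have key : ∀ d : Plane, d ≠ 0 → ¬ (S.V j + d ∈ S.rect m.1 ∧ S.V j - d ∈ S.rect m.1) :=
    fun d hd h => hd (vertex_extreme S.polygon j (S.rect_subset _ h.1) (S.rect_subset _ h.2))
  have hu0 : u ≠ 0 := by rintro h; rw [h] at hu1; simp at hu1
  have hl0 : leftTurn u ≠ 0 := by rintro h; rw [h] at hll; simp at hll
  have hplus : ∀ d : Plane, S.V j + d - S.V m.1 = (S.V j - S.V m.1) + d := fun d => by abel
  have hminus : ∀ d : Plane, S.V j - d - S.V m.1 = (S.V j - S.V m.1) + -d := fun d => by abel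
  by_cases hx0 : x 0 ≤ 1 / 2 - 1 / ε ∨ 1 / 2 + 1 / ε ≤ x 0
  · have hx1 := eq_of_extreme_abscissa h0 h1 hx hx0
    -- Any point of the cap higher than its bottom would do; it shows that the rectangle extends
    -- above the ends of the major axis.
    have hε2 : !₂[1 / 2, ε + (1 / ε - 1 / 2)] ∈ mushroom ε := by
      refine Or.inr ⟨?_, ?_⟩
      · change ε ≤ ε + (1 / ε - 1 / 2); linarith
      · have h3 := focalSum_le_add !₂[0, ε] !₂[1, ε] !₂[1 / 2, ε + (1 / ε - 1 / 2)] !₂[1 / 2, ε]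
        have h4 : dist (!₂[1 / 2, ε + (1 / ε - 1 / 2)] : Plane) !₂[1 / 2, ε] ≤ 1 / ε - 1 / 2 := by
          rw [dist_eq_norm]
          refine (norm_le_abs_add_abs _).trans ?_
          change |(1 / 2 : ℝ) - 1 / 2| + |ε + (1 / ε - 1 / 2) - ε| ≤ _
          rw [sub_self, abs_zero, zero_add, add_sub_cancel_left, abs_of_pos (by linarith)]
        rw [focalSum_axis] at h3
        have h5 : |(1 / 2 : ℝ)| + |1 / 2 - 1| = 1 := by norm_num [abs_of_pos, abs_of_neg]
        rw [h5] at h3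
        change focalSum _ _ _ ≤ _
        linarith
    have hb2 := (mushroom_bounds hm hε2).2.2.2
    rw [plane_mk_one] at hb2
    have hgap : S.size m.1 m.2.1 * x 1 < S.depth m.1 := by
      refine lt_of_lt_of_le (mul_lt_mul_of_pos_left ?_ hs) hb2
      rw [hx1]; linarith
    have hpos : 0 < S.size m.1 m.2.1 * x 1 := by rw [hx1]; positivity
    set r := min (S.size m.1 m.2.1 * x 1) (S.depth m.1 - S.size m.1 m.2.1 * x 1) with hr
    have hr0 : 0 < r := lt_min hpos (sub_pos.2 hgap)
    have hr1 : r ≤ S.size m.1 m.2.1 * x 1 := min_le_left _ _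
    have hr2 : r ≤ S.depth m.1 - S.size m.1 m.2.1 * x 1 := min_le_right _ _
    refine key (r • leftTurn u) (smul_ne_zero hr0.ne' hl0) ⟨mem_rect_iff.2 ?_, mem_rect_iff.2 ?_⟩
    · rw [hplus, inner_add_right, inner_add_right, real_inner_smul_right, real_inner_smul_right,
        ← hu, inner_self_leftTurn, hll, e1, e2]
      exact ⟨⟨by linarith [hb.1], by linarith [hb.2.1]⟩, by linarith, by linarith⟩
    · rw [hminus, inner_add_right, inner_add_right, inner_neg_right, inner_neg_right,
        real_inner_smul_right, real_inner_smul_right,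
        ← hu, inner_self_leftTurn, hll, e1, e2]
      exact ⟨⟨by linarith [hb.1], by linarith [hb.2.1]⟩, by linarith, by linarith⟩
  · push Not at hx0
    have h2 := (mushroom_bounds hm (mushroom_left_mem h0 h1)).1
    have h3 := (mushroom_bounds hm (mushroom_right_mem h0 h1)).2.1
    rw [plane_mk_zero] at h2 h3
    have h4 := mul_lt_mul_of_pos_left hx0.1 hs
    have h5 := mul_lt_mul_of_pos_left hx0.2 hs
    set r := min (m.2.2 + S.size m.1 m.2.1 * x 0 - S.start m.1)
      (S.start m.1 + S.len m.1 - (m.2.2 + S.size m.1 m.2.1 * x 0)) with hr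
    have hr0 : 0 < r := lt_min (by linarith) (by linarith)
    have hr1 : r ≤ m.2.2 + S.size m.1 m.2.1 * x 0 - S.start m.1 := min_le_left _ _
    have hr2 : r ≤ S.start m.1 + S.len m.1 - (m.2.2 + S.size m.1 m.2.1 * x 0) := min_le_right _ _
    refine key (r • u) (smul_ne_zero hr0.ne' hu0) ⟨mem_rect_iff.2 ?_, mem_rect_iff.2 ?_⟩
    · rw [hplus, inner_add_right, inner_add_right, real_inner_smul_right, real_inner_smul_right,
        ← hu, inner_leftTurn_self, huu, e1, e2]
      exact ⟨⟨by linarith, by linarith⟩, by linarith [hb.2.2.1], by linarith [hb.2.2.2]⟩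
    · rw [hminus, inner_add_right, inner_add_right, inner_neg_right, inner_neg_right,
        real_inner_smul_right, real_inner_smul_right,
        ← hu, inner_leftTurn_self, huu, e1, e2]
      exact ⟨⟨by linarith, by linarith⟩, by linarith [hb.2.2.1], by linarith [hb.2.2.2]⟩

theorem convexHull_body (h0 : 0 < ε) (h1 : ε < 1) :
    convexHull ℝ S.body = convexHull ℝ (range S.V) := by
  refine Subset.antisymm (convexHull_min sdiff_subset (convex_convexHull ℝ _)) (convexHull_mono ?_)
  rintro _ ⟨j, rfl⟩
  exact vertex_mem_body h0 h1 j

end Planting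

/-! ### The resistance of a polygon with planted mushrooms -/

/-- The admissible angles exhaust the total mass 2 of the angular measure as `δ` tends to 0. -/
theorem angleMeasure_steep {δ : ℝ} (hδ : 0 < δ) (hδ1 : δ ≤ 1 / 4) :
    angleMeasure.real (Icc (-(Real.pi / 2 - δ)) (-δ) ∪ Icc δ (Real.pi / 2 - δ)) =
      2 * (Real.cos δ - Real.sin δ) := by
  have hpi := Real.pi_gt_three
  have hsub : Icc (-(Real.pi / 2 - δ)) (-δ) ∪ Icc δ (Real.pi / 2 - δ) ⊆
      Ioo (-(Real.pi / 2)) (Real.pi / 2) := by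
    rintro φ (⟨h1, h2⟩ | ⟨h1, h2⟩) <;> constructor <;> linarith
  have hm : MeasurableSet (Icc (-(Real.pi / 2 - δ)) (-δ) ∪ Icc δ (Real.pi / 2 - δ)) :=
    measurableSet_Icc.union measurableSet_Icc
  have hnn : 0 ≤ ∫ φ in Icc (-(Real.pi / 2 - δ)) (-δ) ∪ Icc δ (Real.pi / 2 - δ), Real.cos φ :=
    setIntegral_nonneg hm fun φ hφ => Real.cos_nonneg_of_mem_Icc (Ioo_subset_Icc_self (hsub hφ))
  have hc : ∀ a b : ℝ, IntegrableOn Real.cos (Icc a b) := fun a b =>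
    Real.continuous_cos.integrableOn_Icc
  have hval : ∀ a b : ℝ, a ≤ b → ∫ φ in Icc a b, Real.cos φ = Real.sin b - Real.sin a := by
    intro a b hab
    rw [integral_Icc_eq_integral_Ioc, ← intervalIntegral.integral_of_le hab, integral_cos]
  rw [measureReal_def, angleMeasure_apply hm hsub, ENNReal.toReal_ofReal hnn,
    setIntegral_union ?_ measurableSet_Icc (hc _ _) (hc _ _), hval _ _ (by linarith),
    hval _ _ (by linarith), Real.sin_neg, Real.sin_neg, Real.sin_pi_div_two_sub]
  · ring
  · refine Set.disjoint_left.2 fun φ h1 h2 => ?_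
    linarith [h1.2, h2.1]

namespace Planting

variable {K : Set Plane} {ε : ℝ} {S : Planting K ε}

/-- The similarity that carries the model mushroom to the planted one. -/
noncomputable def pl (S : Planting K ε) (m : Σ _ : Fin (S.k + 3), Σ _ : ℕ, ℝ) : Plane → Plane :=
  place (S.V m.1 + m.2.2 • sideDir S.V m.1) (sideDir S.V m.1) (S.size m.1 m.2.1)

theorem pl_base (m : Σ _ : Fin (S.k + 3), Σ _ : ℕ, ℝ) (x : ℝ) :
    S.pl m !₂[x, 0] = S.V m.1 + (m.2.2 + S.size m.1 m.2.1 * x) • sideDir S.V m.1 := by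
  rw [pl, place_eq, frame_apply, plane_mk_zero, plane_mk_one]
  module

theorem base_mem_mushroom (h0 : 0 < ε) {x : ℝ} (hx : x ∈ Icc (0 : ℝ) 1) : !₂[x, 0] ∈ mushroom ε :=
  Or.inl ⟨hx.1, hx.2, le_rfl, h0.le⟩

theorem base_bounds' (h0 : 0 < ε) (h1 : ε < 1) {m : Σ _ : Fin (S.k + 3), Σ _ : ℕ, ℝ}
    (hm : m ∈ S.index) {x : ℝ} (hx : x ∈ Icc (0 : ℝ) 1) :
    m.2.2 + S.size m.1 m.2.1 * x ∈ Ioo 0 ‖S.V (m.1 + 1) - S.V m.1‖ := by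
  obtain ⟨h2, h3⟩ := base_bounds h0 h1 hm
  have hs := size_pos_of_mem hm
  constructor
  · have := mul_nonneg hs.le hx.1; linarith
  · have := mul_le_mul_of_nonneg_left hx.2 hs.le; linarith

/-- Near a point of the arc other than the apex and the ends, the body is the outside of a single
ellipse: the point is interior to the rectangle, hence to the polygon, and the other mushrooms are
closed and disjoint from this one. -/
theorem exists_scatters {δ a φ : ℝ} (hδ : 0 < δ) (hδ1 : δ ≤ 1 / 4) (h0 : 0 < ε) (h1 : ε < 1)
    (hεδ : ε ≤ Real.sin δ * δ / 100) {m : Σ _ : Fin (S.k + 3), Σ _ : ℕ, ℝ} (hm : m ∈ S.index)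
    (ha : a ∈ Icc δ (1 - δ)) (hφ : δ ≤ |φ|) (hφ' : |φ| ≤ Real.pi / 2 - δ) :
    ∃ z', Scatters S.body (φ, S.pl m !₂[a, 0]) z' ∧ 1 - δ ≤ Real.cos (z'.1 - φ) := by
  have hs := size_pos_of_mem hm
  have hu := S.norm_sideDir m.1
  have hcd : ∀ X, S.pl m (coords (S.V m.1 + m.2.2 • sideDir S.V m.1) (sideDir S.V m.1)
      (S.size m.1 m.2.1) X) = X := fun X => place_coords hu hs X
  refine scatters_mushroom hu hs hδ hδ1 h0 hεδ ?_ ?_ ?_ ha hφ hφ'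
  · intro x hx hB
    rw [body_eq] at hB
    -- The body lies above the base line, so the half-plane part of the free region cannot meet it.
    have h2 := S.polygon.inner_nonneg_of_mem m.1 hB.1
    rw [(inner_sideDir_place x).2] at h2
    have h3 : 0 ≤ x 1 := nonneg_of_mul_nonneg_right h2 hs
    refine hB.2 (mem_iUnion₂.2 ⟨m, hm, x, ?_, rfl⟩)
    rcases hx with h | ⟨h4, h5, h6⟩ | ⟨h4, h5⟩
    · exact absurd h (not_lt.2 h3)
    · rcases le_total (x 1) ε with h | h
      · exact Or.inl ⟨h4.le, h5.le, h3, h⟩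
      · exact Or.inr ⟨h, h6.le⟩
    · exact Or.inr ⟨h4.le, h5.le⟩
  · intro x hx1 hxf hx0
    change ∀ᶠ X in 𝓝 (S.pl m x), _
    have hxm : x ∈ mushroom ε := Or.inr ⟨hx1.le, hxf.le⟩
    have hxM : S.pl m x ∈ S.mush m := ⟨x, hxm, rfl⟩
    -- The mushroom, and with it the rectangle, extends strictly beyond the point to the left, to
    -- the right and upwards.
    have hint : S.pl m x ∈ interior (S.rect m.1) := by
      obtain ⟨⟨y, hy, hyx⟩, ⟨z, hz, hzx⟩, ⟨w, hw, hwx⟩⟩ := exists_beyond_arc hx1 hxf hx0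
      obtain ⟨e1, e2⟩ := inner_sideDir_place (S := S) (m := m) x
      have i1 := (mushroom_bounds hm hy).1
      have i2 := (mushroom_bounds hm hz).2.1
      have i3 := (mushroom_bounds hm hw).2.2.2
      have j1 := mul_lt_mul_of_pos_left hyx hs
      have j2 := mul_lt_mul_of_pos_left hzx hs
      have j3 := mul_lt_mul_of_pos_left hwx hs
      have j4 : 0 < S.size m.1 m.2.1 * x 1 := mul_pos hs (h0.trans hx1)
      refine interior_rect ?_ ?_ ?_ ?_
      · rw [pl, e1]; linarith
      · rw [pl, e1]; linarith
      · rw [pl, e2]; exact j4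
      · rw [pl, e2]; linarith
    have ev1 : ∀ᶠ X in 𝓝 (S.pl m x), X ∈ convexHull ℝ (range S.V) :=
      mem_of_superset (isOpen_interior.mem_nhds hint) (interior_subset.trans (S.rect_subset _))
    have ev2 : ∀ᶠ X in 𝓝 (S.pl m x), X ∉ ⋃ m' ∈ S.index.erase m, S.mush m' := by
      have hcl : IsClosed (⋃ m' ∈ S.index.erase m, S.mush m') :=
        isClosed_biUnion_finset fun m' hm' => isClosed_mush (Finset.mem_of_mem_erase hm')
      refine hcl.isOpen_compl.mem_nhds ?_
      · simp only [mem_compl_iff, mem_iUnion, not_exists]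
        intro m' hm' hX
        obtain ⟨h2, h3⟩ := Finset.mem_erase.1 hm'
        exact Set.disjoint_left.1 (mush_disjoint hm h3 h2.symm) hxM hX
    have ev3 : ∀ᶠ X in 𝓝 (S.pl m x), ε < coords (S.V m.1 + m.2.2 • sideDir S.V m.1) (sideDir S.V m.1)
      (S.size m.1 m.2.1) X 1 := by
      refine ((placeHomeo _ _ _ hu hs).symm.continuous.tendsto (S.pl m x)).eventually
        (p := fun y => ε < y 1) ?_
      have e : (placeHomeo _ _ _ hu hs).symm (S.pl m x) = x := coords_place hu hs x
      rw [e]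
      exact (isOpen_lt continuous_const (by fun_prop) : IsOpen {y : Plane | ε < y 1}).mem_nhds hx1
    filter_upwards [ev1, ev2, ev3] with X h1 h2 h3
    set y := coords (S.V m.1 + m.2.2 • sideDir S.V m.1) (sideDir S.V m.1) (S.size m.1 m.2.1) X with hy
    have hXy : X = S.pl m y := (hcd X).symm
    have hf : focalSum (place (S.V m.1 + m.2.2 • sideDir S.V m.1) (sideDir S.V m.1) (S.size m.1 m.2.1)
        !₂[0, ε]) (place (S.V m.1 + m.2.2 • sideDir S.V m.1) (sideDir S.V m.1) (S.size m.1 m.2.1)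
        !₂[1, ε]) X = S.size m.1 m.2.1 * focalSum !₂[0, ε] !₂[1, ε] y := by
      rw [hXy, pl, focalSum, dist_place hu hs, dist_place hu hs, focalSum]; ring
    have hM : X ∈ S.mush m ↔ focalSum !₂[0, ε] !₂[1, ε] y ≤ 2 * (1 / ε) := by
      rw [mush, plantedMushroom, mem_place_image hu hs, ← hy, mem_mushroom]
      constructor
      · rintro (h | h)
        · exact absurd h.2.2.2 (not_le.2 h3)
        · exact h.2
      · exact fun h => Or.inr ⟨h3.le, h⟩
    rw [hf, mul_lt_mul_iff_right₀ hs, ← not_le, ← hM, body_eq]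
    constructor
    · exact fun h h4 => h.2 (mem_iUnion₂.2 ⟨m, hm, h4⟩)
    · refine fun h => ⟨h1, fun h4 => ?_⟩
      obtain ⟨m', hm', h5⟩ := mem_iUnion₂.1 h4
      by_cases h6 : m' = m
      · exact h (h6 ▸ h5)
      · exact h2 (mem_iUnion₂.2 ⟨m', Finset.mem_erase.2 ⟨h6, hm'⟩, h5⟩)
  · intro x hx
    rw [convexHull_body h0 h1]
    have := base_bounds' h0 h1 hm (Ioo_subset_Icc_self hx)
    change S.pl m !₂[x, 0] ∈ _ ∧ IsOutwardNormal _ (S.pl m !₂[x, 0]) _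
    rw [pl_base]
    exact ⟨S.polygon.side_mem_frontier m.1 (Ioo_subset_Icc_self this),
      S.polygon.isOutwardNormal_side m.1 this⟩

/-- The middle part of the base of a planted mushroom. -/
noncomputable def middle (S : Planting K ε) (δ : ℝ) (m : Σ _ : Fin (S.k + 3), Σ _ : ℕ, ℝ) : Set Plane :=
  segment ℝ (S.pl m !₂[δ, 0]) (S.pl m !₂[1 - δ, 0])

theorem exists_of_mem_middle {δ : ℝ} (hδ1 : δ ≤ 1 / 4) {m : Σ _ : Fin (S.k + 3), Σ _ : ℕ, ℝ}
    {X : Plane} (hX : X ∈ S.middle δ m) : ∃ a ∈ Icc δ (1 - δ), X = S.pl m !₂[a, 0] := by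
  obtain ⟨b, c, hb, hc, hbc, rfl⟩ := hX
  refine ⟨b * δ + c * (1 - δ), ?_, ?_⟩
  · have := convex_Icc δ (1 - δ) ⟨le_rfl, by linarith⟩ ⟨by linarith, le_rfl⟩ hb hc hbc
    simpa using this
  · simp only [pl_base]
    have : S.V m.1 = b • S.V m.1 + c • S.V m.1 := by rw [← add_smul, hbc, one_smul]
    nth_rw 3 [this]
    have e : m.2.2 = b * m.2.2 + c * m.2.2 := by rw [← add_mul, hbc, one_mul]
    nth_rw 3 [e]
    module

theorem measure_middle {δ : ℝ} (hδ1 : δ ≤ 1 / 4) {m : Σ _ : Fin (S.k + 3), Σ _ : ℕ, ℝ}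
    (hm : m ∈ S.index) : (μH[1] : Measure Plane).real (S.middle δ m) =
      S.size m.1 m.2.1 * (1 - 2 * δ) := by
  have hs := size_pos_of_mem hm
  rw [middle, measureReal_def, hausdorffMeasure_segment, edist_dist, ENNReal.toReal_ofReal dist_nonneg,
    dist_eq_norm, pl_base, pl_base, add_sub_add_left_eq_sub, ← sub_smul, norm_smul, S.norm_sideDir,
    mul_one, add_sub_add_left_eq_sub, ← mul_sub, Real.norm_eq_abs, abs_mul, abs_of_pos hs,
    abs_of_nonpos (by linarith)]
  ring

theorem sum_size_ge : (1 - ε) * ∑ i, S.len i ≤ ∑ m ∈ S.index, S.size m.1 m.2.1 := by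
  rw [index, Finset.sum_sigma, Finset.mul_sum]
  refine Finset.sum_le_sum fun i _ => ?_
  have := S.uncovered_lt i
  rw [Finset.sum_sigma]
  simp only [Finset.sum_const, nsmul_eq_mul]
  linarith

/-- Only the second component is used. It is nonnegative everywhere and at least `2 - δ` for
admissible angles and entries in the middle parts of the bases; the other factors are the angular
mass, the middle fraction `1 - 2δ`, the covered fraction `1 - ε` and the total length of the
rectangles. -/
theorem meanResistance_ge {δ : ℝ} (hδ : 0 < δ) (hδ1 : δ ≤ 1 / 4) (h0 : 0 < ε) (h1 : ε < 1)
    (hεδ : ε ≤ Real.sin δ * δ / 100) (hb : Bornology.IsBounded K) :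
    3 / 8 * ((2 - δ) * (2 * (Real.cos δ - Real.sin δ) * ((1 - 2 * δ) *
      ((1 - ε) * (perimeter K - 2 * ε))))) ≤ ‖meanResistance S.body‖ := by
  have hcv := convexHull_body (S := S) h0 h1
  set P := convexHull ℝ (range S.V) with hP
  have hbP : Bornology.IsBounded P := hb.subset S.subset
  have hfin := frontier_measure_lt_top (convex_convexHull ℝ (range S.V)) S.polygon.interior_nonempty hbP
  set ν : Measure Plane := (μH[1] : Measure Plane).restrict (frontier P) with hν
  have hνf : IsFiniteMeasure ν := ⟨by rwa [hν, Measure.restrict_apply_univ]⟩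
  have hph : phaseMeasure S.body = angleMeasure.prod ν := by rw [phaseMeasure_eq, hcv]
  set A : Set ℝ := Icc (-(Real.pi / 2 - δ)) (-δ) ∪ Icc δ (Real.pi / 2 - δ) with hA
  have hAm : MeasurableSet A := measurableSet_Icc.union measurableSet_Icc
  set G : Set Plane := ⋃ m ∈ S.index, S.middle δ m with hG
  have hmm : ∀ m, MeasurableSet (S.middle δ m) := fun m => by
    rw [middle, ← convexHull_pair]
    exact (((finite_singleton _).insert _).isCompact_convexHull ℝ).measurableSet
  have hGm : MeasurableSet G := Finset.measurableSet_biUnion _ fun m _ => hmm m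
  have hmid : ∀ m ∈ S.index, S.middle δ m ⊆ frontier P ∩ S.mush m := by
    intro m hm X hX
    obtain ⟨a, ha, rfl⟩ := exists_of_mem_middle hδ1 hX
    have haI : a ∈ Icc (0 : ℝ) 1 := ⟨by linarith [ha.1], by linarith [ha.2]⟩
    refine ⟨?_, !₂[a, 0], base_mem_mushroom h0 haI, rfl⟩
    rw [pl_base]
    exact S.polygon.side_mem_frontier m.1 (Ioo_subset_Icc_self (base_bounds' h0 h1 hm haI))
  have hGν : ν.real G = (1 - 2 * δ) * ∑ m ∈ S.index, S.size m.1 m.2.1 := by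
    rw [hG, measureReal_biUnion_finset ?_ fun m _ => hmm m, Finset.mul_sum]
    · refine Finset.sum_congr rfl fun m hm => ?_
      rw [hν, measureReal_restrict_apply (hmm m), inter_eq_left.2 fun X hX => (hmid m hm hX).1,
        measure_middle hδ1 hm]
      ring
    · intro m hm m' hm' hne
      exact (mush_disjoint hm hm' hne).mono (fun X hX => (hmid m hm hX).2)
        fun X hX => (hmid m' hm' hX).2
  -- In `perimeter K - 2 * ε`, one `ε` is lost in passing to the polygon and the other in passing to
  -- the rectangles.
  have hGge : (1 - 2 * δ) * ((1 - ε) * (perimeter K - 2 * ε)) ≤ ν.real G := by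
    rw [hGν]
    refine mul_le_mul_of_nonneg_left (le_trans ?_ sum_size_ge) (by linarith)
    refine mul_le_mul_of_nonneg_left ?_ (by linarith)
    have := S.perimeter_lt
    have := S.free_lt
    linarith
  have hint : Integrable (impulse S.body) (angleMeasure.prod ν) :=
    Integrable.of_bound (measurable_impulse _).aestronglyMeasurable 2
      (.of_forall fun z => norm_impulse_le _ z)
  have hint1 : Integrable (fun z => impulse S.body z 1) (angleMeasure.prod ν) :=
    Integrable.of_bound ((by fun_prop : Continuous fun x : Plane => x 1).measurable.comp
      (measurable_impulse _)).aestronglyMeasurable 2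
      (.of_forall fun z => (PiLp.norm_apply_le _ _).trans (norm_impulse_le _ z))
  have hlow : (2 - δ) * (angleMeasure.prod ν).real (A ×ˢ G) ≤
      ∫ z, impulse S.body z 1 ∂(angleMeasure.prod ν) := by
    refine le_trans ?_ (setIntegral_le_integral (s := A ×ˢ G) hint1
      (.of_forall fun z => impulse_one_nonneg _ z))
    have : (2 - δ) * (angleMeasure.prod ν).real (A ×ˢ G) =
        ∫ _ in A ×ˢ G, (2 - δ) ∂(angleMeasure.prod ν) := by
      rw [setIntegral_const, smul_eq_mul, mul_comm]
    rw [this]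
    refine setIntegral_mono_on (integrable_const _).integrableOn hint1.integrableOn (hAm.prod hGm) ?_
    rintro ⟨φ, X⟩ ⟨hφ, hX⟩
    obtain ⟨m, hm, hXm⟩ := mem_iUnion₂.1 hX
    obtain ⟨a, ha, rfl⟩ := exists_of_mem_middle hδ1 hXm
    have hφ1 : δ ≤ |φ| ∧ |φ| ≤ Real.pi / 2 - δ := by
      rcases hφ with ⟨h2, h3⟩ | ⟨h2, h3⟩
      · rw [abs_of_nonpos (by linarith)]; constructor <;> linarith
      · rw [abs_of_nonneg (by linarith)]; exact ⟨h2, h3⟩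
    obtain ⟨z', hz', hcos⟩ := exists_scatters hδ hδ1 h0 h1 hεδ hm ha hφ1.1 hφ1.2
    rw [impulse_eq hz', plane_mk_one]
    dsimp only
    linarith
  rw [measureReal_prod_prod, angleMeasure_steep hδ hδ1] at hlow
  have hnorm : 3 / 8 * ∫ z, impulse S.body z 1 ∂(angleMeasure.prod ν) ≤ ‖meanResistance S.body‖ := by
    refine le_trans ?_ (PiLp.norm_apply_le _ (1 : Fin 2))
    have h2 : meanResistance S.body 1 = -(3 / 8) * ∫ z, impulse S.body z 1 ∂(angleMeasure.prod ν) := by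
      rw [meanResistance, hph, ← integral_plane_apply hint]
      rfl
    rw [h2, Real.norm_eq_abs]
    refine le_trans (le_of_eq ?_) (neg_le_abs _)
    ring
  refine le_trans (mul_le_mul_of_nonneg_left (le_trans ?_ hlow) (by norm_num)) hnorm
  refine mul_le_mul_of_nonneg_left ?_ (by linarith)
  refine mul_le_mul_of_nonneg_left hGge ?_
  rw [← angleMeasure_steep hδ hδ1]
  have := measureReal_nonneg (μ := angleMeasure)
    (s := Icc (-(Real.pi / 2 - δ)) (-δ) ∪ Icc δ (Real.pi / 2 - δ))
  exact this

theorem meanResistance_le (h0 : 0 < ε) (h1 : ε < 1) (hK : Convex ℝ K) (hb : Bornology.IsBounded K) :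
    ‖meanResistance S.body‖ ≤ 3 / 2 * perimeter K := by
  have hcv := convexHull_body (S := S) h0 h1
  have hi := S.polygon.interior_nonempty
  have hbb : Bornology.IsBounded S.body := hb.subset (sdiff_subset.trans S.subset)
  refine (norm_meanResistance_le (by rwa [hcv]) hbb).trans ?_
  rw [hcv]
  exact mul_le_mul_of_nonneg_left (perimeter_mono (convex_convexHull ℝ _) hi S.subset hK hb)
    (by norm_num)

end Planting

/-- The parameter `δ` is fixed first and `ε` is then taken small compared with it; continuity of the
lower bound at the origin suffices, so no rate is needed. -/
theorem tendsto_meanResistance_planting {K : Set Plane} (hK : Convex ℝ K)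
    (hb : Bornology.IsBounded K) (B : ℝ → Set Plane)
    (hB : ∀ᶠ ε in 𝓝[>] (0 : ℝ), ∃ S : Planting K ε, B ε = S.body) :
    Tendsto (fun ε => ‖meanResistance (B ε)‖) (𝓝[>] (0 : ℝ)) (𝓝 (3 / 2 * perimeter K)) := by
  have hpos : ∀ᶠ ε in 𝓝[>] (0 : ℝ), 0 < ε := self_mem_nhdsWithin
  have hlt : ∀ r : ℝ, 0 < r → ∀ᶠ ε in 𝓝[>] (0 : ℝ), ε < r := fun r hr =>
    mem_nhdsWithin_of_mem_nhds (Iio_mem_nhds hr)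
  refine tendsto_order.2 ⟨fun r hr => ?_, fun r hr => ?_⟩
  · -- the lower bound is a continuous function of `δ` and `ε`
    set F : ℝ × ℝ → ℝ := fun p => 3 / 8 * ((2 - p.1) * (2 * (Real.cos p.1 - Real.sin p.1) *
      ((1 - 2 * p.1) * ((1 - p.2) * (perimeter K - 2 * p.2))))) with hF
    have hFc : Continuous F := by rw [hF]; fun_prop
    have hF0 : F (0, 0) = 3 / 2 * perimeter K := by
      simp only [hF, Real.cos_zero, Real.sin_zero]; ring
    have hev : ∀ᶠ p in 𝓝 ((0 : ℝ), (0 : ℝ)), r < F p := by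
      have := hFc.tendsto (0, 0)
      rw [hF0] at this
      exact this.eventually (lt_mem_nhds hr)
    rw [nhds_prod_eq] at hev
    obtain ⟨p1, hp1, p2, hp2, hp⟩ := eventually_prod_iff.1 hev
    have hδe : ∀ᶠ δ in 𝓝[>] (0 : ℝ), 0 < δ ∧ δ < 1 / 4 ∧ p1 δ :=
      hpos.and ((hlt _ (by norm_num)).and (mem_nhdsWithin_of_mem_nhds hp1))
    obtain ⟨δ, hδ, hδ1, hδp⟩ := hδe.exists
    have hsin : 0 < Real.sin δ := Real.sin_pos_of_pos_of_lt_pi hδ (by linarith [Real.pi_gt_three])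
    filter_upwards [hB, hpos, hlt 1 one_pos, hlt (Real.sin δ * δ / 100) (by positivity),
      mem_nhdsWithin_of_mem_nhds hp2] with ε ⟨S, hS⟩ h0 h1 h2 h3
    rw [hS]
    exact (hp hδp h3).trans_le (S.meanResistance_ge hδ hδ1.le h0 h1 h2.le hb)
  · filter_upwards [hB, hpos, hlt 1 one_pos] with ε ⟨S, hS⟩ h0 h1
    rw [hS]
    exact (S.meanResistance_le h0 h1 hK hb).trans_lt hr

/-! ### Polygons inscribed in a convex set -/

/-- Lagrange's identity `⟨x, y⟩² + cross x y ^ 2 = ‖x‖² ‖y‖²` makes the Cauchy–Schwarz inequality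
strict. -/
theorem norm_add_lt_of_cross_ne {x y : Plane} (h : cross x y ≠ 0) : ‖x + y‖ < ‖x‖ + ‖y‖ := by
  refine lt_of_pow_lt_pow_left₀ 2 (by positivity) ?_
  have h1 : (inner ℝ x y : ℝ) < ‖x‖ * ‖y‖ := by
    refine lt_of_pow_lt_pow_left₀ 2 (by positivity) ?_
    rw [mul_pow, plane_norm_sq, plane_norm_sq, plane_inner]
    have : 0 < cross x y ^ 2 := by positivity
    unfold cross at this
    nlinarith
  rw [norm_add_sq_real]
  nlinarith

/-- A nonnegative sublinear function, strictly subadditive on linearly independent vectors. -/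
structure IsStrictGauge (g : Plane → ℝ) : Prop where
  nonneg : ∀ x, 0 ≤ g x
  smul : ∀ c : ℝ, 0 ≤ c → ∀ x, g (c • x) = c * g x
  add_lt : ∀ x y, cross x y ≠ 0 → g (x + y) < g x + g y

theorem plane_eq_combo {P Q : Plane} (hc : cross P Q ≠ 0) (x : Plane) :
    x = (cross x Q / cross P Q) • P + (cross P x / cross P Q) • Q := by
  apply plane_ext
  · simp only [PiLp.add_apply, PiLp.smul_apply, smul_eq_mul]
    field_simp
    unfold cross; ring
  · simp only [PiLp.add_apply, PiLp.smul_apply, smul_eq_mul]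
    field_simp
    unfold cross; ring

theorem cross_sub_sub {P Q x : Plane} (hc : cross P Q ≠ 0) :
    cross (Q - P) (x - P) = cross P Q * (1 - (cross x Q / cross P Q + cross P x / cross P Q)) := by
  field_simp
  simp only [cross, PiLp.sub_apply]; ring

namespace IsStrictGauge

variable {g : Plane → ℝ}

/-- When `b > 0`, strict subadditivity applied to `b Q = x + (-a) P` gives `b < g x - a`; otherwise
the left side is negative. -/
theorem coeff_lt (hg : IsStrictGauge g) {P Q x : Plane} {a b : ℝ} (hP : g P = 1) (hc : cross P Q ≠ 0)
    (ha : a < 0) (hx : x = a • P + b • Q) (hQ : g Q = 1) : a + b < g x := by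
  rcases le_or_gt b 0 with hb | hb
  · linarith [hg.nonneg x]
  · have e : b • Q = x + (-a) • P := by rw [hx]; module
    have h1 := hg.add_lt x ((-a) • P) ?_
    · rw [← e, hg.smul _ hb.le, hg.smul _ (by linarith), hP, hQ] at h1
      linarith
    · have : cross x ((-a) • P) = a * b * cross P Q := by
        rw [hx]; simp only [cross, PiLp.add_apply, PiLp.smul_apply, smul_eq_mul]; ring
      rw [this]
      exact mul_ne_zero (mul_ne_zero ha.ne hb.ne') hc

/-- A vector outside the angle spanned by `P` and `Q` lies on the inner side of the line `PQ` if it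
does not exceed these two vectors. -/
theorem cross_pos (hg : IsStrictGauge g) {P Q x : Plane} (hP : g P = 1) (hQ : g Q = 1)
    (hc : 0 < cross P Q) (h : cross x Q < 0 ∨ cross P x < 0) (hx : g x ≤ 1) :
    0 < cross (Q - P) (x - P) := by
  rw [cross_sub_sub hc.ne']
  have hxe := plane_eq_combo hc.ne' x
  refine mul_pos hc (sub_pos.2 (lt_of_lt_of_le ?_ hx))
  rcases h with h | h
  · exact hg.coeff_lt hP hc.ne' (div_neg_of_neg_of_pos h hc) hxe hQ
  · have hc' : cross Q P ≠ 0 := by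
      have : cross Q P = -cross P Q := by unfold cross; ring
      rw [this]; exact neg_ne_zero.2 hc.ne'
    rw [add_comm]
    exact hg.coeff_lt hQ hc' (div_neg_of_neg_of_pos h hc) (hxe.trans (add_comm _ _)) hP

/-- A small enough vector lies on the inner side of the line through two near points of the
unit sphere. -/
theorem cross_nonneg (hg : IsStrictGauge g) {P Q x : Plane} {L : ℝ} (hP : g P = 1) (hQ : g Q = 1)
    (hL : 0 ≤ L) (hlip : ∀ x y, g x - g y ≤ L * ‖x - y‖) (hc : 0 < cross P Q)
    (hPQ : L * ‖Q - P‖ < 1) (hx : g x ≤ 1 - L * ‖Q - P‖) : 0 ≤ cross (Q - P) (x - P) := by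
  have hn : 0 ≤ L * ‖Q - P‖ := by positivity
  by_cases h : cross x Q < 0 ∨ cross P x < 0
  · exact (hg.cross_pos hP hQ hc h (by linarith)).le
  push Not at h
  rw [cross_sub_sub hc.ne']
  have hxe := plane_eq_combo hc.ne' x
  set a := cross x Q / cross P Q with ha
  set b := cross P x / cross P Q with hb
  have ha0 : 0 ≤ a := div_nonneg h.1 hc.le
  have hb0 : 0 ≤ b := div_nonneg h.2 hc.le
  refine mul_nonneg hc.le (sub_nonneg.2 ?_)
  -- Replacing `Q` by `P` costs at most `L b ‖Q - P‖`, whence `(a + b)(1 - L ‖Q - P‖) ≤ g x`.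
  have h1 := hlip ((a + b) • P) x
  rw [hg.smul _ (by positivity), hP, mul_one] at h1
  have e : (a + b) • P - x = b • (P - Q) := by nth_rw 1 [hxe]; module
  rw [e, norm_smul, Real.norm_eq_abs, abs_of_nonneg hb0, norm_sub_rev] at h1
  have h2 : b * (L * ‖Q - P‖) ≤ (a + b) * (L * ‖Q - P‖) :=
    mul_le_mul_of_nonneg_right (by linarith) hn
  by_contra h3
  push Not at h3
  nlinarith

end IsStrictGauge

/-! ### Polygons with vertices at equally spaced polar angles -/

theorem fin_val_add_one {k : ℕ} (i : Fin (k + 3)) : ((i + 1 : Fin (k + 3)) : ℕ) = (i + 1) % (k + 3) := by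
  rw [Fin.val_add]; rfl

/-- Says that the vertex `d` steps ahead lies outside the angle between the current vertex and the
next one; these signs feed `IsStrictGauge.cross_pos`. -/
theorem sin_neg_or {N d : ℕ} (hd : 2 ≤ d) (hdN : d < N) :
    Real.sin (2 * Real.pi / N - d * (2 * Real.pi / N)) < 0 ∨ Real.sin (d * (2 * Real.pi / N)) < 0 := by
  have hpi := Real.pi_pos
  have hN : (0 : ℝ) < N := by exact_mod_cast (by omega : 0 < N)
  set h := 2 * Real.pi / N with hh
  have hh0 : 0 < h := by positivity
  have hd' : (2 : ℝ) ≤ d := by exact_mod_cast hd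
  have hdN' : (d : ℝ) * h < 2 * Real.pi := by
    have : (d : ℝ) < N := by exact_mod_cast hdN
    calc (d : ℝ) * h < N * h := mul_lt_mul_of_pos_right this hh0
      _ = 2 * Real.pi := by rw [hh]; field_simp
  by_cases hlt : ((d : ℝ) - 1) * h < Real.pi
  · left
    have : h - d * h = -((d - 1) * h) := by ring
    rw [this, Real.sin_neg]
    exact neg_neg_of_pos (Real.sin_pos_of_pos_of_lt_pi (mul_pos (by linarith) hh0) hlt)
  · right
    have : Real.sin (d * h) = -Real.sin (2 * Real.pi - d * h) := by
      rw [Real.sin_two_pi_sub, neg_neg]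
    rw [this]
    refine neg_neg_of_pos (Real.sin_pos_of_pos_of_lt_pi (by linarith) ?_)
    push Not at hlt
    nlinarith

/-- The unit vector with a given polar angle. -/
noncomputable def polar (θ : ℝ) : Plane := !₂[Real.cos θ, Real.sin θ]

theorem cross_polar (s t : ℝ) : cross (polar s) (polar t) = Real.sin (t - s) := by
  rw [Real.sin_sub]; simp only [cross, polar, plane_mk_zero, plane_mk_one]; ring

theorem norm_polar (θ : ℝ) : ‖polar θ‖ = 1 := by
  refine (sq_eq_sq₀ (norm_nonneg _) zero_le_one).1 ?_
  rw [plane_norm_sq, polar, plane_mk_zero, plane_mk_one, one_pow, Real.cos_sq_add_sin_sq]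

theorem continuous_polar : Continuous polar := by
  refine (PiLp.continuous_toLp 2 _).comp (continuous_pi fun i => ?_)
  fin_cases i
  · exact Real.continuous_cos
  · exact Real.continuous_sin

/-- The point of the unit sphere of a gauge with a given polar angle. -/
noncomputable def gaugePolar (g : Plane → ℝ) (θ : ℝ) : Plane := (1 / g (polar θ)) • polar θ

/-- The vertices are points of the unit sphere of `g` with equally spaced polar angles. Strict
subadditivity makes the polygon strictly convex, and uniform continuity makes neighbouring vertices
so close that the sides stay outside the level `1 - η`. -/
theorem IsStrictGauge.exists_polygon {g : Plane → ℝ} (hg : IsStrictGauge g) (hpos : ∀ x, x ≠ 0 → 0 < g x)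
    {L : ℝ} (hL : 0 ≤ L) (hlip : ∀ x y, g x - g y ≤ L * ‖x - y‖) (hcont : Continuous g) (p : Plane)
    {η : ℝ} (hη : 0 < η) (hη1 : η < 1) : ∃ (k : ℕ) (V : Fin (k + 3) → Plane), IsConvexPolygon V ∧
      (∀ i, g (V i - p) = 1) ∧ ∀ x, g (x - p) ≤ 1 - η → x ∈ convexHull ℝ (range V) := by
  have hpi := Real.pi_pos
  have hgp : ∀ θ, 0 < g (polar θ) := fun θ => hpos _ fun h => by
    have := norm_polar θ; rw [h] at this; simp at this
  set f := gaugePolar g with hf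
  have hfc : Continuous f := by
    rw [hf]; unfold gaugePolar
    exact (continuous_const.div (hcont.comp continuous_polar) fun θ => (hgp θ).ne').smul
      continuous_polar
  have hfp : ∀ θ, f (θ + 2 * Real.pi) = f θ := fun θ => by
    simp only [hf, gaugePolar, polar, Real.cos_add_two_pi, Real.sin_add_two_pi]
  have hf1 : ∀ θ, g (f θ) = 1 := fun θ => by
    rw [hf, gaugePolar, hg.smul _ (one_div_nonneg.2 (hgp θ).le), one_div_mul_cancel (hgp θ).ne']
  have hfx : ∀ s t, cross (f s) (f t) = 1 / g (polar s) * (1 / g (polar t)) * Real.sin (t - s) := by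
    intro s t
    rw [← cross_polar]
    simp only [hf, gaugePolar, cross, PiLp.smul_apply, smul_eq_mul]; ring
  have hfpos : ∀ s t, 0 < 1 / g (polar s) * (1 / g (polar t)) := fun s t =>
    mul_pos (one_div_pos.2 (hgp s)) (one_div_pos.2 (hgp t))
  obtain ⟨ρ, hρ, huc⟩ := Metric.uniformContinuousOn_iff.1
    ((isCompact_Icc (a := 0) (b := 2 * Real.pi)).uniformContinuousOn_of_continuous hfc.continuousOn)
    (η / (L + 1)) (by positivity)
  obtain ⟨k, hk⟩ := exists_nat_gt (2 * Real.pi / ρ)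
  set N : ℕ := k + 3 with hN
  have hN0 : (0 : ℝ) < N := by positivity
  have hN3 : (3 : ℝ) ≤ N := by rw [hN]; push_cast; linarith [(Nat.cast_nonneg k : (0 : ℝ) ≤ k)]
  set h := 2 * Real.pi / N with hh
  have hh0 : 0 < h := by positivity
  have hNh : N * h = 2 * Real.pi := by rw [hh]; field_simp
  have hhρ : h < ρ := by
    rw [div_lt_iff₀ hρ] at hk
    rw [hh, div_lt_iff₀ hN0]
    have : (k : ℝ) ≤ N := by rw [hN]; push_cast; linarith
    nlinarith
  have hhpi : h < Real.pi := by nlinarith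
  have hsucc : ∀ i : Fin N, f (((i + 1 : Fin N) : ℕ) * h) = f ((i : ℕ) * h + h) := by
    intro i
    have e : ((i + 1 : Fin N) : ℕ) = (i + 1) % N := fin_val_add_one i
    rcases lt_or_ge ((i : ℕ) + 1) N with h1 | h1
    · rw [e, Nat.mod_eq_of_lt h1]; congr 1; push_cast; ring
    · have h2 : (i : ℕ) + 1 = N := by omega
      rw [e, h2, Nat.mod_self]
      have h3 : ((i : ℕ) : ℝ) * h + h = 0 + 2 * Real.pi := by
        have h4 : ((i : ℕ) : ℝ) + 1 = N := by exact_mod_cast h2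
        linear_combination hNh + h * h4
      rw [h3, hfp]; simp
  have hcpos : ∀ s, 0 < cross (f s) (f (s + h)) := fun s => by
    rw [hfx, add_sub_cancel_left]
    exact mul_pos (hfpos _ _) (Real.sin_pos_of_pos_of_lt_pi hh0 hhpi)
  have hpoly : IsConvexPolygon (fun i : Fin N => p + f ((i : ℕ) * h)) := by
    intro i j hji hji1
    simp only [add_sub_add_left_eq_sub]
    rw [hsucc]
    -- the position of the `j`-th vertex counted from the `i`-th one
    obtain ⟨d, hd2, hdN, hdj⟩ : ∃ d : ℕ, 2 ≤ d ∧ d < N ∧ f ((j : ℕ) * h) = f ((i : ℕ) * h + d * h) := by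
      have e : ((i + 1 : Fin N) : ℕ) = (i + 1) % N := fin_val_add_one i
      have hne : (j : ℕ) ≠ i := fun h' => hji (Fin.ext h')
      have hne1 : (j : ℕ) ≠ ((i + 1 : Fin N) : ℕ) := fun h' => hji1 (Fin.ext h')
      rw [e] at hne1
      have hi := i.2
      have hj := j.2
      rcases lt_or_ge (i : ℕ) j with h1 | h1
      · have h2 : ((i : ℕ) + 1) % N = i + 1 := Nat.mod_eq_of_lt (by omega)
        refine ⟨j - i, by omega, by omega, ?_⟩
        rw [Nat.cast_sub h1.le]; congr 1; ring
      · have h2 : (j : ℕ) < i := by omega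
        refine ⟨j + N - i, ?_, by omega, ?_⟩
        -- If `i` is the last index, its successor is 0, and the exclusion of `j = 0` rules out `d =
        -- 1`.
        · by_cases h3 : (i : ℕ) + 1 = N
          · rw [h3, Nat.mod_self] at hne1; omega
          · omega
        · rw [Nat.cast_sub (by omega), Nat.cast_add, ← hfp]
          congr 1
          rw [← hNh]; ring
    rw [hdj]
    refine hg.cross_pos (hf1 _) (hf1 _) (hcpos _) ?_ (hf1 _).le
    rw [hfx, hfx, ← smul_eq_mul, ← smul_eq_mul (_ * _) (Real.sin _), smul_neg_iff_of_pos_left (hfpos _ _),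
      smul_neg_iff_of_pos_left (hfpos _ _)]
    have := sin_neg_or hd2 hdN
    rw [← hh] at this
    have e1 : (i : ℕ) * h + h - ((i : ℕ) * h + d * h) = h - d * h := by ring
    rwa [e1, add_sub_cancel_left]
  refine ⟨k, fun i => p + f ((i : ℕ) * h), hpoly, fun i => ?_, fun x hx => ?_⟩
  · rw [add_sub_cancel_left, hf1]
  · rw [hpoly.mem_iff]
    intro i
    unfold sideFun
    rw [add_sub_add_left_eq_sub, ← sub_sub, hsucc]
    have hnear : ‖f ((i : ℕ) * h + h) - f ((i : ℕ) * h)‖ < η / (L + 1) := by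
      rw [← dist_eq_norm]
      have h1 : ((i : ℕ) : ℝ) + 1 ≤ N := by exact_mod_cast i.2
      have h2 : ((i : ℕ) : ℝ) * h + h ≤ 2 * Real.pi := by rw [← hNh]; nlinarith
      have h3 : 0 ≤ ((i : ℕ) : ℝ) * h := by positivity
      refine huc _ ⟨by linarith, h2⟩ _ ⟨h3, by linarith⟩ ?_
      rw [Real.dist_eq, add_sub_cancel_left, abs_of_pos hh0]
      exact hhρ
    have hLη : L * ‖f ((i : ℕ) * h + h) - f ((i : ℕ) * h)‖ ≤ η := by
      refine (mul_le_mul_of_nonneg_left hnear.le hL).trans ?_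
      rw [mul_div_assoc', div_le_iff₀ (by linarith)]
      nlinarith
    exact hg.cross_nonneg (hf1 _) (hf1 _) hL hlip (hcpos _) (by linarith) (by linarith)

theorem perimeter_homothety (p : Plane) {c : ℝ} (hc : 0 < c) (K : Set Plane) :
    perimeter (AffineMap.homothety p c '' K) = c * perimeter K := by
  have hh : IsHomeomorph (AffineMap.homothety p c : Plane → Plane) := by
    refine isHomeomorph_iff_exists_inverse.2 ⟨AffineMap.homothety_continuous p c,
      AffineMap.homothety p c⁻¹, fun x => ?_, fun x => ?_, AffineMap.homothety_continuous p _⟩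
    · simp [AffineMap.homothety_apply, smul_smul, inv_mul_cancel₀ hc.ne']
    · simp [AffineMap.homothety_apply, smul_smul, mul_inv_cancel₀ hc.ne']
  rw [perimeter, ← hh.image_frontier, hausdorffMeasure_homothety_image zero_le_one p hc.ne', perimeter,
    NNReal.rpow_one, ENNReal.toReal_smul, NNReal.smul_def, coe_nnnorm, Real.norm_eq_abs, abs_of_pos hc,
    smul_eq_mul]

/-- Adding a small multiple of the norm to the gauge of `K` about an interior point makes it
strictly subadditive. Its unit sphere stays inside `K`, and the polygon built on it contains a
homothetic copy `cK`, whose perimeter is `c * perimeter K`. -/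
theorem exists_inscribed_polygon {K : Set Plane} (hK : Convex ℝ K) (hb : Bornology.IsBounded K)
    (hi : (interior K).Nonempty) {ε : ℝ} (hε : 0 < ε) : ∃ (k : ℕ) (V : Fin (k + 3) → Plane),
      IsConvexPolygon V ∧ convexHull ℝ (range V) ⊆ K ∧
      perimeter K - perimeter (convexHull ℝ (range V)) < ε := by
  obtain ⟨p, hp⟩ := hi
  have hP0 : 0 ≤ perimeter K := ENNReal.toReal_nonneg
  set K' : Set Plane := (fun y => p + y) ⁻¹' K with hK'
  have hK'c : Convex ℝ K' := hK.translate_preimage_right p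
  have hK'0 : K' ∈ 𝓝 (0 : Plane) :=
    (by fun_prop : Continuous fun y : Plane => p + y).continuousAt.preimage_mem_nhds
      (by simpa using mem_interior_iff_mem_nhds.1 hp)
  have habs : Absorbent ℝ K' := absorbent_nhds_zero hK'0
  obtain ⟨r, hr, hrK⟩ := Metric.mem_nhds_iff.1 hK'0
  obtain ⟨R, hR0, hR⟩ : ∃ R : ℝ, 0 < R ∧ ∀ y ∈ K', ‖y‖ ≤ R := by
    obtain ⟨R, hR⟩ := hb.exists_norm_le
    refine ⟨R + ‖p‖ + 1, ?_, fun y hy => ?_⟩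
    · have := (norm_nonneg p).trans (hR p (interior_subset hp))
      positivity
    · have := norm_sub_le (p + y) p
      rw [add_sub_cancel_left] at this
      linarith [hR _ hy]
  -- the ratio of homothety
  set c : ℝ := 1 - ε / (2 * (perimeter K + ε)) with hc
  have hc1 : c < 1 := by
    have : 0 < ε / (2 * (perimeter K + ε)) := by positivity
    linarith
  have hc0 : 0 < c := by
    have : ε / (2 * (perimeter K + ε)) < 1 := by rw [div_lt_one (by positivity)]; linarith
    linarith
  have hcP : perimeter K - c * perimeter K < ε := by
    have : perimeter K - c * perimeter K = ε * (perimeter K / (2 * (perimeter K + ε))) := by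
      rw [hc]; ring
    rw [this]
    have : perimeter K / (2 * (perimeter K + ε)) < 1 := by rw [div_lt_one (by positivity)]; linarith
    nlinarith
  -- With `δ * R = (1 - c) / 2` the new gauge is at most `1 + (1 - c) / 2` on `K'`, and `c (1 + (1 -
  -- c) / 2) ≤ 1 - (1 - c) / 2`; this is why `η = (1 - c) / 2` below.
  set δ : ℝ := (1 - c) / (2 * R) with hδ
  have hδ0 : 0 < δ := by have : 0 < 1 - c := by linarith
                         positivity
  have hδR : δ * R = (1 - c) / 2 := by rw [hδ]; field_simp
  set g : Plane → ℝ := fun x => gauge K' x + δ * ‖x‖ with hg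
  have hsg : IsStrictGauge g := by
    refine ⟨fun x => add_nonneg (gauge_nonneg x) (by positivity), fun a ha x => ?_, fun x y hxy => ?_⟩
    · simp only [hg]
      rw [gauge_smul_of_nonneg ha, norm_smul, Real.norm_eq_abs, abs_of_nonneg ha, smul_eq_mul]
      ring
    · have h1 := gauge_add_le hK'c habs x y
      have h2 := mul_lt_mul_of_pos_left (norm_add_lt_of_cross_ne hxy) hδ0
      simp only [hg]
      linarith
  have hgp : ∀ x, x ≠ 0 → 0 < g x := fun x hx =>
    add_pos_of_nonneg_of_pos (gauge_nonneg x) (mul_pos hδ0 (norm_pos_iff.2 hx))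
  have hgc : Continuous g := (continuous_gauge hK'c hK'0).add (by fun_prop)
  have hlip : ∀ x y, g x - g y ≤ (1 / r + δ) * ‖x - y‖ := by
    intro x y
    have h1 := gauge_add_le hK'c habs (x - y) y
    rw [sub_add_cancel] at h1
    have h2 := mul_gauge_le_norm hrK (x := x - y)
    have h3 : gauge K' (x - y) ≤ 1 / r * ‖x - y‖ := by
      rw [one_div, inv_mul_eq_div, le_div_iff₀ hr]; linarith
    have h4 := mul_le_mul_of_nonneg_left (norm_sub_norm_le x y) hδ0.le
    simp only [hg]
    linarith
  obtain ⟨k, V, hV, hV1, hVK⟩ := hsg.exists_polygon hgp (by positivity) hlip hgc p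
    (η := (1 - c) / 2) (by linarith) (by linarith)
  have hsub : convexHull ℝ (range V) ⊆ K := by
    refine convexHull_min ?_ hK
    rintro _ ⟨i, rfl⟩
    have h1 := hV1 i
    have hne : V i - p ≠ 0 := by
      intro h0
      rw [h0] at h1
      simp [hg] at h1
    have h2 : gauge K' (V i - p) < 1 := by
      have : 0 < δ * ‖V i - p‖ := mul_pos hδ0 (norm_pos_iff.2 hne)
      simp only [hg] at h1
      linarith
    have h3 : V i - p ∈ K' := setOfPred_gauge_lt_one_subset_self hK'c (mem_of_mem_nhds hK'0) habs h2
    simpa [hK'] using h3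
  have hcK : AffineMap.homothety p c '' K ⊆ convexHull ℝ (range V) := by
    rintro _ ⟨x, hx, rfl⟩
    refine hVK _ ?_
    have hxK : x - p ∈ K' := by simpa [hK'] using hx
    have e : AffineMap.homothety p c x - p = c • (x - p) := by
      simp [AffineMap.homothety_apply]
    rw [e, hsg.smul _ hc0.le]
    have h1 := gauge_le_one_of_mem hxK
    have h2 := mul_le_mul_of_nonneg_left (hR _ hxK) hδ0.le
    have h3 : g (x - p) ≤ 1 + (1 - c) / 2 := by simp only [hg]; linarith
    nlinarith
  refine ⟨k, V, hV, hsub, lt_of_le_of_lt (sub_le_sub_left ?_ _) hcP⟩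
  rw [← perimeter_homothety p hc0]
  refine perimeter_mono (hK.affine_image _) ?_ hcK (convex_convexHull ℝ _) (hb.subset hsub)
  exact ⟨p, (AffineMap.homothety_isOpenMap p c hc0.ne').image_interior_subset K
    ⟨p, hp, AffineMap.homothety_apply_same p c⟩⟩

/-! ### Packing bases of mushrooms into an interval -/

/-- An open set of reals is half filled by the cells of any sufficiently fine grid that it contains. -/
theorem exists_grid_cells {U : Set ℝ} (hU : IsOpen U) {l m : ℝ} (hUl : U ⊆ Icc 0 l) (hm : 0 < m)
    (hUm : ENNReal.ofReal m ≤ volume U) {w₀ : ℝ} (hw₀ : 0 < w₀) : ∃ w, 0 < w ∧ w < w₀ ∧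
      ∃ c : Finset ℝ, (∀ a ∈ c, Icc a (a + w) ⊆ U) ∧ (∀ a ∈ c, ∀ a' ∈ c, a < a' → a + w ≤ a') ∧
        m / 2 ≤ c.card * w := by
  have h1 : ENNReal.ofReal (m / 2) < volume U :=
    lt_of_lt_of_le ((ENNReal.ofReal_lt_ofReal_iff hm).2 (by linarith)) hUm
  -- A compact part of measure more than `m / 2` has a uniform neighbourhood in `U`. Grid cells
  -- narrower than it that meet the compact set lie in `U`, and they cover the compact set.
  obtain ⟨F, hFU, hF, hFm⟩ := hU.exists_lt_isCompact h1
  obtain ⟨r, hr, hrU⟩ := hF.exists_thickening_subset_open hU hFU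
  set w := min r w₀ / 2 with hw
  have hmin : 0 < min r w₀ := lt_min hr hw₀
  have hw0 : 0 < w := by positivity
  have hwr : w < r := by have := min_le_left r w₀; linarith
  refine ⟨w, hw0, by have := min_le_right r w₀; linarith, ?_⟩
  classical
  set Z : Finset ℤ := (Finset.Icc 0 ⌊l / w⌋).filter fun z => ∃ x ∈ F, ⌊x / w⌋ = z with hZ
  have hfl : ∀ x : ℝ, ⌊x / w⌋ * w ≤ x ∧ x < ⌊x / w⌋ * w + w := by
    intro x
    have h2 := Int.floor_le (x / w)
    have h3 := Int.lt_floor_add_one (x / w)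
    rw [le_div_iff₀ hw0] at h2
    rw [div_lt_iff₀ hw0] at h3
    constructor <;> linarith
  have hinj : Function.Injective fun z : ℤ => (z : ℝ) * w := fun z z' h =>
    Int.cast_injective (mul_right_cancel₀ hw0.ne' h)
  refine ⟨Z.image fun z : ℤ => (z : ℝ) * w, ?_, ?_, ?_⟩
  · intro a ha y hy
    obtain ⟨z, hz, rfl⟩ := Finset.mem_image.1 ha
    obtain ⟨x, hx, rfl⟩ := (Finset.mem_filter.1 hz).2
    refine hrU (Metric.mem_thickening_iff.2 ⟨x, hx, lt_of_le_of_lt ?_ hwr⟩)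
    obtain ⟨h2, h3⟩ := hfl x
    rw [Real.dist_eq, abs_le]
    constructor <;> linarith [hy.1, hy.2]
  · intro a ha a' ha' hlt
    obtain ⟨z, -, rfl⟩ := Finset.mem_image.1 ha
    obtain ⟨z', -, rfl⟩ := Finset.mem_image.1 ha'
    have h2 : z < z' := by
      have := lt_of_mul_lt_mul_right hlt hw0.le
      exact_mod_cast this
    have h3 : (z : ℝ) + 1 ≤ z' := by exact_mod_cast Int.add_one_le_iff.2 h2
    nlinarith
  · rw [Finset.card_image_of_injective _ hinj]
    have hcov : F ⊆ ⋃ z ∈ Z, Ico ((z : ℝ) * w) (z * w + w) := by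
      intro x hx
      obtain ⟨h2, h3⟩ := hfl x
      refine mem_iUnion₂.2 ⟨⌊x / w⌋, Finset.mem_filter.2 ⟨Finset.mem_Icc.2 ⟨?_, ?_⟩, x, hx, rfl⟩, h2, h3⟩
      · exact Int.floor_nonneg.2 (div_nonneg (hUl (hFU hx)).1 hw0.le)
      · exact Int.floor_le_floor (div_le_div_of_nonneg_right (hUl (hFU hx)).2 hw0.le)
    have h2 : volume F ≤ ENNReal.ofReal (Z.card * w) := by
      refine (measure_mono hcov).trans ((measure_biUnion_finset_le _ _).trans ?_)
      simp only [Real.volume_Ico, add_sub_cancel_left, Finset.sum_const, nsmul_eq_mul]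
      rw [ENNReal.ofReal_mul (by positivity), ENNReal.ofReal_natCast]
    exact ((ENNReal.ofReal_lt_ofReal_iff_of_nonneg (by positivity)).1 (hFm.trans_le h2)).le

/-- A system of disjoint cells in the rectangle `[0, l] × [0, D]`, arranged in `n` orders: the cells of
order `j` are squares of side `w j` on the base of the rectangle with abscissas beginning at the points
of `c j`. In the middle of the base of each of them an interval of length `ε * w j / 3` is marked; the
cells of the next orders are small and miss the marked intervals. -/
structure IsPacking (ε l D : ℝ) (n : ℕ) (w : ℕ → ℝ) (c : ℕ → Finset ℝ) : Prop where
  pos : ∀ j < n, 0 < w j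
  le : ∀ j < n, w j ≤ D
  small : ∀ j j', j < j' → j' < n → w j' < ε * (ε * w j / 3)
  nonempty : ∀ j < n, (c j).Nonempty
  mem : ∀ j < n, ∀ a ∈ c j, 0 ≤ a ∧ a + w j ≤ l
  same : ∀ j < n, ∀ a ∈ c j, ∀ a' ∈ c j, a < a' → a + w j ≤ a'
  diff : ∀ j j', j < j' → j' < n → ∀ a ∈ c j, ∀ a' ∈ c j',
    a' + w j' < a + w j / 2 - ε * w j / 6 ∨ a + w j / 2 + ε * w j / 6 < a'

/-- The length that the marked intervals of a packing leave free. -/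
noncomputable def freeLength (ε l : ℝ) (n : ℕ) (w : ℕ → ℝ) (c : ℕ → Finset ℝ) : ℝ :=
  l - ∑ j ∈ Finset.range n, ((c j).card : ℝ) * (ε * w j / 3)

/-- The new cells fill at least half of what the marked intervals leave free, and each marks the
fraction `ε / 3` of itself, so the free length drops at least by the factor `1 - ε / 6`. -/
theorem IsPacking.extend {ε l D : ℝ} {n : ℕ} {w : ℕ → ℝ} {c : ℕ → Finset ℝ} (h0 : 0 < ε)
    (hD : 0 < D) (h : IsPacking ε l D n w c) (hf : 0 < freeLength ε l n w c) :
    ∃ w' c', IsPacking ε l D (n + 1) w' c' ∧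
      freeLength ε l (n + 1) w' c' ≤ (1 - ε / 6) * freeLength ε l n w c := by
  set M : Set ℝ := ⋃ j ∈ Finset.range n, ⋃ a ∈ c j,
    Icc (a + w j / 2 - ε * w j / 6) (a + w j / 2 + ε * w j / 6) with hM
  have hMc : IsClosed M := isClosed_biUnion_finset fun j _ => isClosed_biUnion_finset fun a _ =>
    isClosed_Icc
  have hMv : volume M ≤ ENNReal.ofReal (∑ j ∈ Finset.range n, ((c j).card : ℝ) * (ε * w j / 3)) := by
    have hnn : ∀ j ∈ Finset.range n, 0 ≤ ε * w j / 3 := fun j hj => by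
      have := h.pos j (Finset.mem_range.1 hj); positivity
    rw [ENNReal.ofReal_sum_of_nonneg fun j hj => mul_nonneg (Nat.cast_nonneg _) (hnn j hj)]
    refine (measure_biUnion_finset_le _ _).trans (Finset.sum_le_sum fun j hj => ?_)
    refine (measure_biUnion_finset_le _ _).trans (le_of_eq ?_)
    have e : ∀ a : ℝ, a + w j / 2 + ε * w j / 6 - (a + w j / 2 - ε * w j / 6) = ε * w j / 3 := fun a => by
      ring
    simp only [Real.volume_Icc, e, Finset.sum_const, nsmul_eq_mul]
    rw [ENNReal.ofReal_mul (by positivity), ENNReal.ofReal_natCast]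
  have hUv : ENNReal.ofReal (freeLength ε l n w c) ≤ volume (Ioo 0 l \ M) := by
    refine le_trans ?_ (le_measure_sdiff)
    rw [Real.volume_Ioo, sub_zero, freeLength, ENNReal.ofReal_sub _ (Finset.sum_nonneg fun j hj => ?_)]
    · exact tsub_le_tsub_left hMv _
    · have := h.pos j (Finset.mem_range.1 hj); positivity
  -- The bound `ε * (ε * w j / 3)` is the stem height of the older mushrooms, so new cells will fit
  -- under their caps.
  obtain ⟨w₀, hw₀, hw₀D, hw₀s⟩ : ∃ w₀, 0 < w₀ ∧ w₀ ≤ D ∧ ∀ j < n, w₀ ≤ ε * (ε * w j / 3) := by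
    have : ∀ᶠ x in 𝓝[>] (0 : ℝ), 0 < x ∧ x ≤ D ∧ ∀ j ∈ Finset.range n, x ≤ ε * (ε * w j / 3) := by
      have hev : ∀ r : ℝ, 0 < r → ∀ᶠ x in 𝓝[>] (0 : ℝ), x ≤ r := fun r hr =>
        mem_nhdsWithin_of_mem_nhds (Iic_mem_nhds hr)
      refine eventually_mem_nhdsWithin.and ((hev D hD).and ?_)
      rw [Filter.eventually_all_finset]
      intro j hj
      have := h.pos j (Finset.mem_range.1 hj)
      exact hev _ (by positivity)
    obtain ⟨x, h1, h2, h3⟩ := this.exists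
    exact ⟨x, h1, h2, fun j hj => h3 j (Finset.mem_range.2 hj)⟩
  obtain ⟨W, hW, hWw, C, hC, hCs, hCm⟩ := exists_grid_cells (isOpen_Ioo.sdiff hMc)
    (sdiff_subset.trans Ioo_subset_Icc_self) hf hUv hw₀
  have hw1 : ∀ j, j ≠ n → Function.update w n W j = w j := fun j hj => Function.update_of_ne hj _ _
  have hc1 : ∀ j, j ≠ n → Function.update c n C j = c j := fun j hj => Function.update_of_ne hj _ _
  have hsplit : ∀ j, j < n + 1 → j = n ∨ (j ≠ n ∧ j < n) := fun j hj => by omega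
  have hmarked : ∀ j < n, ∀ a ∈ c j, ∀ x ∈ Icc (a + w j / 2 - ε * w j / 6)
      (a + w j / 2 + ε * w j / 6), x ∈ M := fun j hj a ha x hx =>
    mem_iUnion₂.2 ⟨j, Finset.mem_range.2 hj, mem_iUnion₂.2 ⟨a, ha, hx⟩⟩
  refine ⟨Function.update w n W, Function.update c n C, ⟨?_, ?_, ?_, ?_, ?_, ?_, ?_⟩, ?_⟩
  · intro j hj
    rcases hsplit j hj with rfl | ⟨h1, h2⟩
    · rwa [Function.update_self]
    · rw [hw1 j h1]; exact h.pos j h2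
  · intro j hj
    rcases hsplit j hj with rfl | ⟨h1, h2⟩
    · rw [Function.update_self]; linarith
    · rw [hw1 j h1]; exact h.le j h2
  · intro j j' hjj hj'
    rw [hw1 j (by omega)]
    rcases hsplit j' hj' with rfl | ⟨h1, h2⟩
    · rw [Function.update_self]; exact hWw.trans_le (hw₀s j hjj)
    · rw [hw1 j' h1]; exact h.small j j' hjj h2
  · intro j hj
    rcases hsplit j hj with rfl | ⟨h1, h2⟩
    · rw [Function.update_self]
      rw [← Finset.card_pos, ← Nat.cast_pos (α := ℝ)]
      exact pos_of_mul_pos_left (lt_of_lt_of_le (by positivity) hCm) hW.le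
    · rw [hc1 j h1]; exact h.nonempty j h2
  · intro j hj a ha
    rcases hsplit j hj with rfl | ⟨h1, h2⟩
    · rw [Function.update_self] at ha ⊢
      have h3 := (hC a ha ⟨le_rfl, by linarith⟩).1
      have h4 := (hC a ha ⟨by linarith, le_rfl⟩).1
      exact ⟨h3.1.le, h4.2.le⟩
    · rw [hc1 j h1] at ha; rw [hw1 j h1]; exact h.mem j h2 a ha
  · intro j hj a ha a' ha'
    rcases hsplit j hj with rfl | ⟨h1, h2⟩
    · rw [Function.update_self] at ha ha' ⊢
      exact hCs a ha a' ha'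
    · rw [hc1 j h1] at ha ha'; rw [hw1 j h1]; exact h.same j h2 a ha a' ha'
  · intro j j' hjj hj' a ha a' ha'
    rw [hc1 j (by omega)] at ha
    rw [hw1 j (by omega)]
    rcases hsplit j' hj' with rfl | ⟨h1, h2⟩
    · rw [Function.update_self] at ha' ⊢
      by_contra hcon
      push Not at hcon
      have hwj := h.pos j hjj
      have hεw : 0 < ε * w j / 6 := by positivity
      -- A cell that touches a marked interval contains its left end, or else begins inside it;
      -- either way it contains a marked point.
      rcases le_total a' (a + w j / 2 - ε * w j / 6) with h3 | h3
      · exact (hC a' ha' ⟨h3, hcon.1⟩).2 (hmarked j hjj a ha _ ⟨le_rfl, by linarith⟩)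
      · exact (hC a' ha' ⟨le_rfl, by linarith⟩).2 (hmarked j hjj a ha _ ⟨h3, hcon.2⟩)
    · rw [hc1 j' h1] at ha'; rw [hw1 j' h1]; exact h.diff j j' hjj h2 a ha a' ha'
  · rw [freeLength, Finset.sum_range_succ, Function.update_self, Function.update_self]
    have : ∑ j ∈ Finset.range n, ((Function.update c n C j).card : ℝ) * (ε * Function.update w n W j / 3) =
        ∑ j ∈ Finset.range n, ((c j).card : ℝ) * (ε * w j / 3) :=
      Finset.sum_congr rfl fun j hj => by
        have hj' : j ≠ n := (Finset.mem_range.1 hj).ne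
        rw [hw1 j hj', hc1 j hj']
    rw [this]
    have h2 := mul_le_mul_of_nonneg_left hCm (by positivity : 0 ≤ ε / 3)
    rw [freeLength] at h2 ⊢
    nlinarith

/-- Repeated extension makes the free length decay geometrically. -/
theorem exists_packing {ε l D : ℝ} (h0 : 0 < ε) (h1 : ε < 1) (hl : 0 < l) (hD : 0 < D) :
    ∃ n w c, IsPacking ε l D n w c ∧ freeLength ε l n w c < ε * l := by
  -- The first alternative stops the process once the goal is reached, since `IsPacking.extend`
  -- needs a positive free length.
  have key : ∀ N : ℕ, ∃ n w c, IsPacking ε l D n w c ∧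
      (freeLength ε l n w c < ε * l ∨ freeLength ε l n w c ≤ (1 - ε / 6) ^ N * l) := by
    intro N
    induction N with
    | zero =>
      refine ⟨0, 0, fun _ => ∅, ⟨?_, ?_, ?_, ?_, ?_, ?_, ?_⟩, Or.inr (by simp [freeLength])⟩ <;>
        intros <;> omega
    | succ N ih =>
      obtain ⟨n, w, c, h, hf⟩ := ih
      by_cases hfl : freeLength ε l n w c < ε * l
      · exact ⟨n, w, c, h, Or.inl hfl⟩
      · have h2 := hf.resolve_left hfl
        have hpos : 0 < freeLength ε l n w c := lt_of_lt_of_le (by positivity) (not_lt.1 hfl)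
        obtain ⟨w', c', h', hf'⟩ := h.extend h0 hD hpos
        refine ⟨n + 1, w', c', h', Or.inr (hf'.trans ?_)⟩
        rw [pow_succ', mul_assoc]
        exact mul_le_mul_of_nonneg_left h2 (by linarith)
  obtain ⟨N, hN⟩ := exists_pow_lt_of_lt_one h0 (by linarith : 1 - ε / 6 < 1)
  obtain ⟨n, w, c, h, hf⟩ := key N
  refine ⟨n, w, c, h, hf.elim id fun h2 => h2.trans_lt (mul_lt_mul_of_pos_right hN hl)⟩

/-! ### Existence of plantings -/

section Polygon

variable {k : ℕ} {V : Fin (k + 3) → Plane}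

theorem IsConvexPolygon.sideFun_coords (hV : IsConvexPolygon V) (i : Fin (k + 3)) (t h : ℝ) :
    sideFun V i (V i + t • sideDir V i + h • leftTurn (sideDir V i)) = ‖V (i + 1) - V i‖ * h := by
  rw [hV.sideFun_eq, add_assoc, add_sub_cancel_left, inner_add_right, real_inner_smul_right,
    real_inner_smul_right, inner_leftTurn_self, real_inner_self_eq_norm_sq, norm_leftTurn,
    hV.norm_sideDir]
  ring

/-- A neighbourhood of the middle part of a side where this side is the nearest one, in the sense of the
functions `sideFun`. -/
theorem IsConvexPolygon.exists_depth (hV : IsConvexPolygon V) (i : Fin (k + 3)) {σ : ℝ} (hσ : 0 < σ) :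
    ∃ D : ℝ, 0 < D ∧ ∀ t ∈ Icc σ (‖V (i + 1) - V i‖ - σ), ∀ h ∈ Icc 0 D, ∀ j, j ≠ i →
      sideFun V i (V i + t • sideDir V i + h • leftTurn (sideDir V i)) <
        sideFun V j (V i + t • sideDir V i + h • leftTurn (sideDir V i)) := by
  set U : Set Plane := ⋂ j : {j // j ≠ i}, {X | sideFun V i X < sideFun V j X} with hU
  have hUo : IsOpen U := isOpen_iInter_of_finite fun j =>
    isOpen_lt (continuous_sideFun V i) (continuous_sideFun V j)
  set F : Set Plane := (fun t : ℝ => V i + t • sideDir V i) '' Icc σ (‖V (i + 1) - V i‖ - σ) with hF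
  have hFc : IsCompact F := isCompact_Icc.image (by fun_prop)
  have hFU : F ⊆ U := by
    rintro _ ⟨t, ht, rfl⟩
    refine mem_iInter.2 fun j => ?_
    have h1 := hV.sideFun_side_pos j.2 (t := t) ⟨by linarith [ht.1], by linarith [ht.2]⟩
    have h2 := hV.sideFun_coords i t 0
    rw [zero_smul, add_zero, mul_zero] at h2
    simpa [h2] using h1
  obtain ⟨r, hr, hrU⟩ := hFc.exists_thickening_subset_open hUo hFU
  refine ⟨r / 2, by positivity, fun t ht h hh j hj => ?_⟩
  have : V i + t • sideDir V i + h • leftTurn (sideDir V i) ∈ U := by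
    refine hrU (Metric.mem_thickening_iff.2 ⟨_, ⟨t, ht, rfl⟩, ?_⟩)
    rw [dist_eq_norm, add_sub_cancel_left, norm_smul, norm_leftTurn, hV.norm_sideDir, mul_one,
      Real.norm_eq_abs, abs_of_nonneg hh.1]
    linarith [hh.2]
  exact mem_iInter.1 this ⟨j, hj⟩

theorem IsConvexPolygon.perimeter_le (hV : IsConvexPolygon V) :
    perimeter (convexHull ℝ (range V)) ≤ ∑ i, ‖V (i + 1) - V i‖ := by
  have hcov : frontier (convexHull ℝ (range V)) ⊆
      ⋃ i ∈ (Finset.univ : Finset (Fin (k + 3))), segment ℝ (V i) (V (i + 1)) := by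
    intro x hx
    obtain ⟨i, h0⟩ := hV.exists_sideFun_eq_zero hx
    have hL := hV.norm_pos i
    obtain ⟨t, ht, rfl⟩ := hV.mem_segment_of_sideFun_eq_zero
      ((isCompact_polygon V).isClosed.frontier_subset hx) h0
    refine mem_iUnion₂.2 ⟨i, Finset.mem_univ _, 1 - t / ‖V (i + 1) - V i‖, t / ‖V (i + 1) - V i‖,
      sub_nonneg.2 ((div_le_one hL).2 ht.2), div_nonneg ht.1 hL.le, by ring, ?_⟩
    rw [sideDir]; module
  have h1 := (measure_mono hcov).trans (measure_biUnion_finset_le (μ := (μH[1] : Measure Plane)) _ _)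
  refine (ENNReal.toReal_mono ?_ h1).trans (le_of_eq ?_)
  · exact (ENNReal.sum_lt_top.2 fun i _ => by rw [hausdorffMeasure_segment]; exact edist_lt_top _ _).ne
  · rw [ENNReal.toReal_sum fun i _ => by rw [hausdorffMeasure_segment]; exact (edist_lt_top _ _).ne]
    refine Finset.sum_congr rfl fun i _ => ?_
    rw [hausdorffMeasure_segment, edist_dist, ENNReal.toReal_ofReal dist_nonneg, dist_comm, dist_eq_norm]

end Polygon

/-- A rectangular neighbourhood of the mushroom in the half-plane above its base. -/
def modelCell (ε : ℝ) : Set Plane := {x | |x 0 - 1 / 2| ≤ 3 / (2 * ε) ∧ 0 ≤ x 1 ∧ x 1 ≤ 3 / ε}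

theorem mushroom_extent {ε : ℝ} (h0 : 0 < ε) (h1 : ε < 1) {x : Plane} (hx : x ∈ mushroom ε) :
    |x 0 - 1 / 2| ≤ 1 / ε ∧ 0 ≤ x 1 ∧ x 1 < 3 / ε := by
  have hε : 1 < 1 / ε := by rw [lt_div_iff₀ h0]; linarith
  have h3 : 3 / ε = 3 * (1 / ε) := by ring
  rw [h3, abs_le]
  rcases mem_mushroom.1 hx with ⟨a, b, c, d⟩ | ⟨a, b⟩
  · exact ⟨⟨by linarith, by linarith⟩, c, by linarith⟩
  · have h2 := (focalSum_ge_axis ε x).trans b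
    have h4 : x 1 - ε ≤ focalSum !₂[0, ε] !₂[1, ε] x := by
      have := (le_abs_self _).trans (abs_coord_le_norm (x - !₂[0, ε]) 1)
      rw [← dist_eq_norm] at this
      exact this.trans (le_add_of_nonneg_right dist_nonneg)
    refine ⟨⟨?_, ?_⟩, by linarith, by linarith⟩
    · linarith [neg_le_abs (x 0), neg_le_abs (x 0 - 1)]
    · linarith [le_abs_self (x 0), le_abs_self (x 0 - 1)]

theorem mushroom_subset_modelCell {ε : ℝ} (h0 : 0 < ε) (h1 : ε < 1) : mushroom ε ⊆ modelCell ε := by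
  intro x hx
  obtain ⟨a, b, c⟩ := mushroom_extent h0 h1 hx
  refine ⟨a.trans ?_, b, c.le⟩
  rw [div_le_div_iff₀ h0 (by positivity)]
  linarith

/-- The beginning of the base of the mushroom in the cell of a packing. -/
noncomputable def cellPos (ε σ w a : ℝ) : ℝ := σ + a + w / 2 - ε * w / 6

/-- The ratio `ε * w / 3` turns the model cell, of width and height `3 / ε`, into a square of side
`w`. -/
theorem cell_bounds {ε σ w a : ℝ} (h0 : 0 < ε) (hw : 0 < w) {x : Plane} (hx : x ∈ modelCell ε) :
    σ + a ≤ cellPos ε σ w a + ε * w / 3 * x 0 ∧ cellPos ε σ w a + ε * w / 3 * x 0 ≤ σ + a + w ∧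
      0 ≤ ε * w / 3 * x 1 ∧ ε * w / 3 * x 1 ≤ w := by
  obtain ⟨h1, h2, h3⟩ := hx
  have hs : 0 < ε * w / 3 := by positivity
  obtain ⟨h4, h5⟩ := abs_le.1 h1
  have e : ε * w / 3 * (3 / (2 * ε)) = w / 2 := by field_simp
  have e' : ε * w / 3 * (3 / ε) = w := by field_simp
  have h6 := mul_le_mul_of_nonneg_left h4 hs.le
  have h7 := mul_le_mul_of_nonneg_left h5 hs.le
  have h8 := mul_le_mul_of_nonneg_left h3 hs.le
  have h9 := mul_nonneg hs.le h2
  rw [mul_neg, e] at h6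
  rw [e] at h7
  rw [e'] at h8
  unfold cellPos
  refine ⟨by linarith, by linarith, h9, h8⟩

theorem cell_bounds_mushroom {ε σ w a : ℝ} (h0 : 0 < ε) (h1 : ε < 1) (hw : 0 < w) {x : Plane}
    (hx : x ∈ mushroom ε) : σ + a < cellPos ε σ w a + ε * w / 3 * x 0 ∧
      cellPos ε σ w a + ε * w / 3 * x 0 < σ + a + w := by
  obtain ⟨h2, -, -⟩ := mushroom_extent h0 h1 hx
  have hs : 0 < ε * w / 3 := by positivity
  obtain ⟨h4, h5⟩ := abs_le.1 h2
  have e : ε * w / 3 * (1 / ε) = w / 3 := by field_simp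
  have h6 := mul_le_mul_of_nonneg_left h4 hs.le
  have h7 := mul_le_mul_of_nonneg_left h5 hs.le
  rw [mul_neg, e] at h6
  rw [e] at h7
  unfold cellPos
  constructor <;> linarith

/-- In one order the cells at most abut, and a mushroom lies laterally strictly inside its own cell.
A cell of a later order is lower than the stem height of an older mushroom, so it could only meet
the stem, which stands over a marked interval that the cell misses. -/
theorem IsPacking.cell_disjoint {ε l D : ℝ} {n : ℕ} {w : ℕ → ℝ} {c : ℕ → Finset ℝ} (h0 : 0 < ε)
    (h1 : ε < 1) (h : IsPacking ε l D n w c) {u : Plane} (hu : ‖u‖ = 1) (A : Plane) (σ : ℝ) {j j' : ℕ}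
    (hj : j' ≤ j) (hjn : j < n) {a a' : ℝ} (ha : a ∈ c j) (ha' : a' ∈ c j') (hne : (j, a) ≠ (j', a')) :
    Disjoint (place (A + cellPos ε σ (w j) a • u) u (ε * w j / 3) '' modelCell ε)
      (place (A + cellPos ε σ (w j') a' • u) u (ε * w j' / 3) '' mushroom ε) := by
  refine Set.disjoint_left.2 ?_
  rintro _ ⟨x, hx, rfl⟩ ⟨y, hy, hxy⟩
  obtain ⟨e1, e2⟩ := inner_side_place hu A (cellPos ε σ (w j) a) (ε * w j / 3) x
  obtain ⟨f1, f2⟩ := inner_side_place hu A (cellPos ε σ (w j') a') (ε * w j' / 3) y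
  rw [hxy, e1] at f1
  rw [hxy, e2] at f2
  have hw := h.pos j hjn
  have hw' := h.pos j' (hj.trans_lt hjn)
  obtain ⟨b1, b2, b3, b4⟩ := cell_bounds (σ := σ) (a := a) h0 hw hx
  rcases hj.eq_or_lt with rfl | hlt
  · obtain ⟨c1, c2⟩ := cell_bounds_mushroom (σ := σ) (a := a') h0 h1 hw' hy
    rcases lt_trichotomy a a' with h2 | h2 | h2
    · have := h.same j' hjn a ha a' ha' h2; linarith
    · exact hne (by rw [h2])
    · have := h.same j' hjn a' ha' a ha h2; linarith
  · have hs := h.small j' j hlt hjn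
    have hy1 : y 1 < ε := by
      have h2 : ε * w j' / 3 * y 1 < ε * w j' / 3 * ε := by rw [← f2]; linarith
      exact lt_of_mul_lt_mul_left h2 (by positivity)
    rcases mem_mushroom.1 hy with ⟨h2, h3, -, -⟩ | ⟨h2, -⟩
    · have h4 := mul_le_mul_of_nonneg_left h3 (by positivity : 0 ≤ ε * w j' / 3)
      have h5 := mul_nonneg (by positivity : 0 ≤ ε * w j' / 3) h2
      have h6 : cellPos ε σ (w j') a' = σ + a' + w j' / 2 - ε * w j' / 6 := rfl
      rcases h.diff j' j hlt hjn a' ha' a ha with h7 | h7 <;> linarith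
    · linarith

namespace Planting

/-- In a nested planting the rectangles touch the boundary of the polygon only along their bases, and
each mushroom has a cell that misses the other mushrooms of the same and of the preceding orders. -/
structure IsNested {K : Set Plane} {ε : ℝ} (S : Planting K ε) : Prop where
  mem_interior : ∀ i, ∀ X ∈ S.rect i, 0 < (inner ℝ (leftTurn (sideDir S.V i)) (X - S.V i) : ℝ) →
    X ∈ interior (convexHull ℝ (range S.V))
  cell_subset : ∀ m ∈ S.index, S.pl m '' modelCell ε ⊆ S.rect m.1
  cell_disjoint : ∀ m ∈ S.index, ∀ m' ∈ S.index, m ≠ m' → m'.2.1 ≤ m.2.1 →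
    Disjoint (S.pl m '' modelCell ε) (S.mush m')

end Planting

/-- Each side is shortened by `σ` at both ends, which costs less than `ε` in all. The rectangles are
so thin that on each of them its own side function is strictly the smallest. -/
theorem exists_nested_planting {K : Set Plane} (hK : Convex ℝ K) (hb : Bornology.IsBounded K)
    (hi : (interior K).Nonempty) {ε : ℝ} (h0 : 0 < ε) (h1 : ε < 1) :
    ∃ S : Planting K ε, S.IsNested := by
  obtain ⟨k, V, hV, hVK, hper⟩ := exists_inscribed_polygon hK hb hi h0
  obtain ⟨σ, hσ, hσL, hσε⟩ : ∃ σ > 0, (∀ i, 2 * σ < ‖V (i + 1) - V i‖) ∧ 2 * σ * (k + 3) < ε := by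
    have hev : ∀ r : ℝ, 0 < r → ∀ᶠ x in 𝓝[>] (0 : ℝ), x < r := fun r hr =>
      mem_nhdsWithin_of_mem_nhds (Iio_mem_nhds hr)
    have : ∀ᶠ σ in 𝓝[>] (0 : ℝ), 0 < σ ∧ (∀ i, σ < ‖V (i + 1) - V i‖ / 2) ∧ σ < ε / (2 * (k + 3)) := by
      refine eventually_mem_nhdsWithin.and (Filter.Eventually.and ?_ (hev _ (by positivity)))
      rw [Filter.eventually_all]
      exact fun i => hev _ (half_pos (hV.norm_pos i))
    obtain ⟨σ, h2, h3, h4⟩ := this.exists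
    refine ⟨σ, h2, fun i => by linarith [h3 i], ?_⟩
    rw [lt_div_iff₀ (by positivity)] at h4
    linarith
  choose D hD hDside using fun i => hV.exists_depth i hσ
  set l : Fin (k + 3) → ℝ := fun i => ‖V (i + 1) - V i‖ - 2 * σ with hl
  have hl0 : ∀ i, 0 < l i := fun i => sub_pos.2 (hσL i)
  choose n w c hP hfree using fun i => exists_packing h0 h1 (hl0 i) (hD i)
  have hu := hV.norm_sideDir
  -- points of the rectangles in coordinates
  have hplace : ∀ i t s x, place (V i + t • sideDir V i) (sideDir V i) s x =
      V i + (t + s * x 0) • sideDir V i + (s * x 1) • leftTurn (sideDir V i) := by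
    intro i t s x
    rw [place_eq, frame_apply]; module
  have hrect : ∀ i X, X ∈ place (V i + σ • sideDir V i) (sideDir V i) 1 '' rectangle (l i) (D i) →
      ∃ t ∈ Icc σ (‖V (i + 1) - V i‖ - σ), ∃ h ∈ Icc 0 (D i),
        X = V i + t • sideDir V i + h • leftTurn (sideDir V i) := by
    rintro i _ ⟨x, ⟨a1, a2, a3, a4⟩, rfl⟩
    refine ⟨σ + x 0, ⟨by linarith, ?_⟩, x 1, ⟨a3, a4⟩, ?_⟩
    · simp only [hl] at a2; linarith
    · rw [hplace, one_mul, one_mul]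
  -- This comparison gives at once the inclusion of the rectangles in the polygon, their
  -- disjointness, and the interiority of their points off the base.
  have hpos : ∀ i X, X ∈ place (V i + σ • sideDir V i) (sideDir V i) 1 '' rectangle (l i) (D i) →
      0 ≤ sideFun V i X ∧ ∀ j, j ≠ i → sideFun V i X < sideFun V j X := by
    intro i X hX
    obtain ⟨t, ht, h, hh, rfl⟩ := hrect i X hX
    refine ⟨?_, hDside i t ht h hh⟩
    rw [hV.sideFun_coords]
    exact mul_nonneg (norm_nonneg _) hh.1
  have hcell : ∀ i, ∀ j < n i, ∀ a ∈ c i j,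
      place (V i + cellPos ε σ (w i j) a • sideDir V i) (sideDir V i) (ε * w i j / 3) '' modelCell ε ⊆
        place (V i + σ • sideDir V i) (sideDir V i) 1 '' rectangle (l i) (D i) := by
    rintro i j hj a ha _ ⟨x, hx, rfl⟩
    have hw := (hP i).pos j hj
    obtain ⟨b1, b2, b3, b4⟩ := cell_bounds (σ := σ) (a := a) h0 hw hx
    obtain ⟨m1, m2⟩ := (hP i).mem j hj a ha
    refine ⟨!₂[cellPos ε σ (w i j) a + ε * w i j / 3 * x 0 - σ, ε * w i j / 3 * x 1], ⟨?_, ?_, b3, ?_⟩, ?_⟩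
    · change 0 ≤ cellPos ε σ (w i j) a + ε * w i j / 3 * x 0 - σ; linarith
    · change cellPos ε σ (w i j) a + ε * w i j / 3 * x 0 - σ ≤ l i; linarith
    · exact b4.trans ((hP i).le j hj)
    · rw [hplace, hplace, plane_mk_zero, plane_mk_one, one_mul, one_mul, add_sub_cancel]
  have hinj : ∀ i j, Function.Injective (cellPos ε σ (w i j)) := fun i j a a' h => by
    unfold cellPos at h; linarith
  have hmc := mushroom_subset_modelCell h0 h1
  classical
  let S : Planting K ε :=
    { k := k
      V := V
      polygon := hV
      subset := hVK
      perimeter_lt := hper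
      start := fun _ => σ
      len := l
      depth := D
      rect := fun i => place (V i + σ • sideDir V i) (sideDir V i) 1 '' rectangle (l i) (D i)
      rect_eq := fun i => rfl
      start_nonneg := fun _ => hσ.le
      len_pos := hl0
      depth_pos := hD
      base_le := fun i => by simp only [hl]; linarith
      rect_subset := fun i X hX => by
        rw [hV.mem_iff]
        obtain ⟨h2, h3⟩ := hpos i X hX
        intro j
        by_cases hj : j = i
        · rwa [hj]
        · exact h2.trans (h3 j hj).le
      rect_disjoint := fun i j hij => Set.disjoint_left.2 fun X h2 h3 =>
        lt_asymm ((hpos i X h2).2 j hij.symm) ((hpos j X h3).2 i hij)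
      free_lt := by
        have h2 := hV.perimeter_le
        have h3 : ∑ i, l i = ∑ i, ‖V (i + 1) - V i‖ - 2 * σ * (k + 3) := by
          simp only [hl, Finset.sum_sub_distrib, Finset.sum_const, Finset.card_univ, Fintype.card_fin,
            nsmul_eq_mul]
          push_cast; ring
        rw [h3]; linarith
      orders := n
      size := fun i j => ε * w i j / 3
      pos := fun i j => (c i j).image (cellPos ε σ (w i j))
      size_pos := fun i j hj => by have := (hP i).pos j hj; positivity
      size_lt := fun i j hj => by
        have h2 := (hP i).small j (j + 1) (Nat.lt_succ_self j) hj
        have h3 := (hP i).pos j (by omega)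
        have h4 : 0 < ε * w i j / 3 := by positivity
        have h5 := (hP i).pos (j + 1) hj
        nlinarith
      pos_nonempty := fun i j hj => ((hP i).nonempty j hj).image _
      planted_subset := fun i j hj t ht => by
        obtain ⟨a, ha, rfl⟩ := Finset.mem_image.1 ht
        exact (image_mono hmc).trans (hcell i j hj a ha)
      planted_disjoint := fun i j hj j' hj' t ht t' ht' hne => by
        obtain ⟨a, ha, rfl⟩ := Finset.mem_image.1 ht
        obtain ⟨a', ha', rfl⟩ := Finset.mem_image.1 ht'
        have hne' : (j, a) ≠ (j', a') := by
          rintro h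
          obtain ⟨rfl, rfl⟩ := Prod.mk.inj h
          exact hne rfl
        rcases le_total j' j with h2 | h2
        · exact ((hP i).cell_disjoint h0 h1 (hu i) (V i) σ h2 hj ha ha' hne').mono_left (image_mono hmc)
        · exact (((hP i).cell_disjoint h0 h1 (hu i) (V i) σ h2 hj' ha' ha hne'.symm).mono_left
            (image_mono hmc)).symm
      uncovered_lt := fun i => by
        have h2 := hfree i
        unfold freeLength at h2
        simp only [Finset.card_image_of_injective _ (hinj i _)]
        exact h2 }
  have hidx : ∀ (i : Fin (k + 3)) (j : ℕ) (t : ℝ), (⟨i, j, t⟩ : Σ _ : Fin (k + 3), Σ _ : ℕ, ℝ) ∈ S.index →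
      j < n i ∧ ∃ a ∈ c i j, cellPos ε σ (w i j) a = t := fun i j t hm =>
    ⟨(Planting.mem_index.1 hm).1, Finset.mem_image.1 (Planting.mem_index.1 hm).2⟩
  have hsub : ∀ m ∈ S.index, S.pl m '' modelCell ε ⊆ S.rect m.1 := by
    rintro ⟨i, j, t⟩ hm
    obtain ⟨hj, a, ha, rfl⟩ := hidx i j t hm
    exact hcell i j hj a ha
  refine ⟨S, ⟨fun i X hX hX0 => ?_, hsub, fun m hm m' hm' hne hle => ?_⟩⟩
  · obtain ⟨h2, h3⟩ := hpos i X hX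
    have h4 : 0 < sideFun V i X := by
      rw [hV.sideFun_eq]; exact mul_pos (hV.norm_pos i) hX0
    refine hV.interior_of_pos V fun j => ?_
    by_cases hj : j = i
    · rwa [hj]
    · exact h4.trans (h3 j hj)
  · by_cases hi : m.1 = m'.1
    · obtain ⟨i, j, t⟩ := m
      obtain ⟨i', j', t'⟩ := m'
      obtain rfl : i = i' := hi
      obtain ⟨hj, a, ha, rfl⟩ := hidx i j t hm
      obtain ⟨hj', a', ha', rfl⟩ := hidx i j' t' hm'
      refine (hP i).cell_disjoint h0 h1 (hu i) (V i) σ hle hj ha ha' ?_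
      rintro h
      obtain ⟨rfl, rfl⟩ := Prod.mk.inj h
      exact hne rfl
    · exact (S.rect_disjoint _ _ hi).mono (hsub m hm) (Planting.mush_subset_rect hm')

/-! ### Connectedness of nested plantings -/

/-- Removing a closed piece `M` from a connected set `X` leaves it connected, if a neighbourhood `C` of
`M` in `X` remains connected. -/
theorem IsPreconnected.sdiff_of_nhdsWithin {α : Type*} [TopologicalSpace α] {X M C : Set α}
    (hX : IsPreconnected X) (hM : IsClosed M) (hCX : C ⊆ X) (hC : ∀ x ∈ M, C ∈ 𝓝[X] x)
    (hCM : IsPreconnected (C \ M)) : IsPreconnected (X \ M) := by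
  have key : ∀ u v : Set α, IsOpen u → IsOpen v → X \ M ⊆ u ∪ v → (X \ M ∩ v).Nonempty →
      C \ M ⊆ u → (X \ M ∩ u).Nonempty → (X \ M ∩ (u ∩ v)).Nonempty := by
    intro u v hu hv huv hnv hCu hnu
    choose! O hO using fun x hx => mem_nhdsWithin.1 (hC x hx)
    have hoO : IsOpen (⋃ x ∈ M, O x) := isOpen_biUnion fun x hx => (hO x hx).1
    -- A separation of `X \ M` with `C \ M` on the side of `u` would extend to one of `X`: the
    -- neighbourhoods of points of `M` go to the side of `u`.
    have hcov : X ⊆ (u ∪ ⋃ x ∈ M, O x) ∪ (v \ M) := by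
      intro x hx
      by_cases hxM : x ∈ M
      · exact Or.inl (Or.inr (mem_iUnion₂.2 ⟨x, hxM, (hO x hxM).2.1⟩))
      · rcases huv ⟨hx, hxM⟩ with h | h
        · exact Or.inl (Or.inl h)
        · exact Or.inr ⟨h, hxM⟩
    obtain ⟨x₁, hx₁, hxu⟩ := hnu
    obtain ⟨x₂, hx₂, hxv⟩ := hnv
    obtain ⟨y, hyX, hyu, hyv⟩ := hX (u ∪ ⋃ x ∈ M, O x) (v \ M) (hu.union hoO) (hv.sdiff hM) hcov
      ⟨x₁, hx₁.1, Or.inl hxu⟩ ⟨x₂, hx₂.1, hxv, hx₂.2⟩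
    refine ⟨y, ⟨hyX, hyv.2⟩, ?_, hyv.1⟩
    rcases hyu with h | h
    · exact h
    · obtain ⟨x, hx, hyO⟩ := mem_iUnion₂.1 h
      exact hCu ⟨(hO x hx).2.2 ⟨hyO, hyX⟩, hyv.2⟩
  intro u v hu hv huv hnu hnv
  by_contra hne
  have hempty : C \ M ∩ (u ∩ v) = ∅ := by
    rw [← not_nonempty_iff_eq_empty]
    exact fun h => hne (h.mono (inter_subset_inter_left _ (sdiff_subset_sdiff_left hCX)))
  rcases isPreconnected_iff_subset_of_disjoint.1 hCM u v hu hv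
    ((sdiff_subset_sdiff_left hCX).trans huv) hempty with h | h
  · exact hne (key u v hu hv huv hnv h hnu)
  · rw [inter_comm u v] at hne
    rw [union_comm] at huv
    exact hne (key v u hv hu huv hnu h hnv)

/-! ### A cell stays connected without its mushroom -/

theorem focalSum_mono_height {ε : ℝ} {x y : Plane} (hx : ε ≤ x 1) (h0 : y 0 = x 0) (h1 : x 1 ≤ y 1) :
    focalSum !₂[0, ε] !₂[1, ε] x ≤ focalSum !₂[0, ε] !₂[1, ε] y := by
  have key : ∀ a : ℝ, dist x !₂[a, ε] ≤ dist y !₂[a, ε] := by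
    intro a
    refine le_of_sq_le_sq ?_ dist_nonneg
    rw [dist_eq_norm, dist_eq_norm, plane_norm_sq, plane_norm_sq]
    change (x 0 - a) ^ 2 + (x 1 - ε) ^ 2 ≤ (y 0 - a) ^ 2 + (y 1 - ε) ^ 2
    rw [h0]
    nlinarith
  exact add_le_add (key 0) (key 1)

theorem convex_modelCell (ε : ℝ) : Convex ℝ (modelCell ε) := by
  intro x hx y hy a b ha hb hab
  obtain ⟨h1, h2, h3⟩ := hx
  obtain ⟨k1, k2, k3⟩ := hy
  obtain rfl : b = 1 - a := by linarith
  rw [abs_le] at h1 k1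
  refine ⟨?_, ?_, ?_⟩
  · rw [abs_le]
    simp only [PiLp.add_apply, PiLp.smul_apply, smul_eq_mul]
    constructor <;> nlinarith
  · simp only [PiLp.add_apply, PiLp.smul_apply, smul_eq_mul]
    positivity
  · simp only [PiLp.add_apply, PiLp.smul_apply, smul_eq_mul]
    nlinarith

/-- The top and the two lateral sides of the cell form a connected frame that misses the mushroom. A
point at height at least `ε` is joined to it vertically upwards, a lower one by a convex strip on
its side of the stem. -/
theorem isPreconnected_modelCell_sdiff {ε : ℝ} (h0 : 0 < ε) (h1 : ε < 1) :
    IsPreconnected (modelCell ε \ mushroom ε) := by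
  have hε : 1 < 1 / ε := by rw [lt_div_iff₀ h0]; linarith
  have e1 : 3 / (2 * ε) = 3 / 2 * (1 / ε) := by ring
  have e2 : 3 / ε = 3 * (1 / ε) := by ring
  have hlin : ∀ r i, Convex ℝ {x : Plane | x i = r} := fun r i => by
    intro x hx y hy a b ha hb hab
    change a * x i + b * y i = r
    rw [mem_ofPred_eq] at hx hy
    rw [hx, hy, ← add_mul, hab, one_mul]
  have hlt : ∀ r i, Convex ℝ {x : Plane | x i < r} := fun r i => by
    have : {x : Plane | x i < r} = (EuclideanSpace.proj i : Plane →L[ℝ] ℝ) ⁻¹' Iio r := rfl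
    rw [this]
    exact (convex_Iio r).linear_preimage (EuclideanSpace.proj i : Plane →L[ℝ] ℝ).toLinearMap
  have hgt : ∀ r i, Convex ℝ {x : Plane | r < x i} := fun r i => by
    have : {x : Plane | r < x i} = (EuclideanSpace.proj i : Plane →L[ℝ] ℝ) ⁻¹' Ioi r := rfl
    rw [this]
    exact (convex_Ioi r).linear_preimage (EuclideanSpace.proj i : Plane →L[ℝ] ℝ).toLinearMap
  have hge : ∀ r i, Convex ℝ {x : Plane | r ≤ x i} := fun r i => by
    have : {x : Plane | r ≤ x i} = (EuclideanSpace.proj i : Plane →L[ℝ] ℝ) ⁻¹' Ici r := rfl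
    rw [this]
    exact (convex_Ici r).linear_preimage (EuclideanSpace.proj i : Plane →L[ℝ] ℝ).toLinearMap
  have hC := convex_modelCell ε
  -- the frame
  set T : Set Plane := modelCell ε ∩ {x | x 1 = 3 / ε} with hT
  set W : ℝ → Set Plane := fun r => modelCell ε ∩ {x | x 0 = r} with hW
  set r₁ := 1 / 2 - 3 / (2 * ε) with hr₁
  set r₂ := 1 / 2 + 3 / (2 * ε) with hr₂
  have hcell : ∀ r h, |r - 1 / 2| ≤ 3 / (2 * ε) → 0 ≤ h → h ≤ 3 / ε → !₂[r, h] ∈ modelCell ε :=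
    fun r h a b c => ⟨a, b, c⟩
  have ha1 : |r₁ - 1 / 2| ≤ 3 / (2 * ε) := by
    rw [hr₁, sub_sub_cancel_left, abs_neg, abs_of_pos (by positivity)]
  have ha2 : |r₂ - 1 / 2| ≤ 3 / (2 * ε) := by
    rw [hr₂, add_sub_cancel_left, abs_of_pos (by positivity)]
  have htop : 0 ≤ 3 / ε := by positivity
  have hTM : T ⊆ modelCell ε \ mushroom ε := fun x hx =>
    ⟨hx.1, fun h => (mushroom_extent h0 h1 h).2.2.ne hx.2⟩
  have hWM : ∀ r, 1 / ε < |r - 1 / 2| → W r ⊆ modelCell ε \ mushroom ε := by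
    intro r hr x hx
    refine ⟨hx.1, fun h => ?_⟩
    have := (mushroom_extent h0 h1 h).1
    rw [(hx.2 : x 0 = r)] at this
    linarith
  have hW1 : W r₁ ⊆ modelCell ε \ mushroom ε := hWM _ (by
    rw [hr₁, sub_sub_cancel_left, abs_neg, abs_of_pos (by positivity)]; linarith)
  have hW2 : W r₂ ⊆ modelCell ε \ mushroom ε := hWM _ (by
    rw [hr₂, add_sub_cancel_left, abs_of_pos (by positivity)]; linarith)
  have hF : IsPreconnected ((T ∪ W r₁) ∪ W r₂) := by
    refine IsPreconnected.union !₂[r₂, 3 / ε] (Or.inl ⟨hcell _ _ ha2 htop le_rfl, rfl⟩)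
      ⟨hcell _ _ ha2 htop le_rfl, rfl⟩ ?_ (hC.inter (hlin _ _)).isPreconnected
    exact IsPreconnected.union !₂[r₁, 3 / ε] ⟨hcell _ _ ha1 htop le_rfl, rfl⟩
      ⟨hcell _ _ ha1 htop le_rfl, rfl⟩ (hC.inter (hlin _ _)).isPreconnected
      (hC.inter (hlin _ _)).isPreconnected
  have hFM : (T ∪ W r₁) ∪ W r₂ ⊆ modelCell ε \ mushroom ε := union_subset (union_subset hTM hW1) hW2
  have hO : !₂[r₁, 3 / ε] ∈ (T ∪ W r₁) ∪ W r₂ := Or.inl (Or.inl ⟨hcell _ _ ha1 htop le_rfl, rfl⟩)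
  refine isPreconnected_of_forall !₂[r₁, 3 / ε] fun x hx => ?_
  obtain ⟨hxC, hxM⟩ := hx
  have hxC' := hxC
  obtain ⟨c1, c2, c3⟩ := hxC'
  rw [mem_mushroom, not_or] at hxM
  rcases le_or_gt ε (x 1) with hx1 | hx1
  · have hf : 2 * (1 / ε) < focalSum !₂[0, ε] !₂[1, ε] x := by
      by_contra h; exact hxM.2 ⟨hx1, not_lt.1 h⟩
    have hzC : !₂[x 0, 3 / ε] ∈ modelCell ε := hcell _ _ c1 htop le_rfl
    refine ⟨((T ∪ W r₁) ∪ W r₂) ∪ (modelCell ε ∩ ({y | y 0 = x 0} ∩ {y | x 1 ≤ y 1})),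
      union_subset hFM ?_, Or.inl hO, Or.inr ⟨hxC, rfl, le_refl (x 1)⟩, ?_⟩
    · rintro y ⟨hyC, hy0, hy1⟩
      refine ⟨hyC, fun hyM => ?_⟩
      have h2 := focalSum_mono_height hx1 hy0 hy1
      rw [mem_ofPred_eq] at hy0 hy1
      rcases mem_mushroom.1 hyM with ⟨a, b, c, d⟩ | ⟨a, b⟩
      · rw [hy0] at a b
        exact hxM.1 ⟨a, b, c2, hy1.trans d⟩
      · linarith
    · exact IsPreconnected.union !₂[x 0, 3 / ε] (Or.inl (Or.inl ⟨hzC, rfl⟩)) ⟨hzC, rfl, c3⟩ hF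
        (hC.inter ((hlin _ _).inter (hge _ _))).isPreconnected
  · have hx0 : x 0 < 0 ∨ 1 < x 0 := by
      by_contra h
      push Not at h
      exact hxM.1 ⟨h.1, h.2, c2, hx1.le⟩
    have hout : ∀ y ∈ mushroom ε, y 1 < ε → 0 ≤ y 0 ∧ y 0 ≤ 1 := fun y hy hy1 => by
      rcases mem_mushroom.1 hy with ⟨a, b, -, -⟩ | ⟨a, -⟩
      · exact ⟨a, b⟩
      · linarith
    rcases hx0 with hx0 | hx0
    · have hzC : !₂[r₁, x 1] ∈ modelCell ε := hcell _ _ ha1 c2 c3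
      refine ⟨((T ∪ W r₁) ∪ W r₂) ∪ (modelCell ε ∩ ({y | y 1 < ε} ∩ {y | y 0 < 0})),
        union_subset hFM ?_, Or.inl hO, Or.inr ⟨hxC, hx1, hx0⟩, ?_⟩
      · rintro y ⟨hyC, hy1, hy0⟩
        exact ⟨hyC, fun hyM => absurd (hout y hyM hy1).1 (not_le.2 hy0)⟩
      · refine IsPreconnected.union !₂[r₁, x 1] (Or.inl (Or.inr ⟨hzC, rfl⟩)) ⟨hzC, hx1, ?_⟩ hF
          (hC.inter ((hlt _ _).inter (hlt _ _))).isPreconnected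
        change r₁ < 0
        rw [hr₁, e1]; linarith
    · have hzC : !₂[r₂, x 1] ∈ modelCell ε := hcell _ _ ha2 c2 c3
      refine ⟨((T ∪ W r₁) ∪ W r₂) ∪ (modelCell ε ∩ ({y | y 1 < ε} ∩ {y | 1 < y 0})),
        union_subset hFM ?_, Or.inl hO, Or.inr ⟨hxC, hx1, hx0⟩, ?_⟩
      · rintro y ⟨hyC, hy1, hy0⟩
        exact ⟨hyC, fun hyM => absurd (hout y hyM hy1).2 (not_le.2 hy0)⟩
      · refine IsPreconnected.union !₂[r₂, x 1] (Or.inr ⟨hzC, rfl⟩) ⟨hzC, hx1, ?_⟩ hF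
          (hC.inter ((hlt _ _).inter (hgt _ _))).isPreconnected
        change 1 < r₂
        rw [hr₂, e1]; linarith

namespace Planting

variable {K : Set Plane} {ε : ℝ} {S : Planting K ε}

/-- The similarity of a planted mushroom as a homeomorphism. -/
noncomputable def plHomeo {m : Σ _ : Fin (S.k + 3), Σ _ : ℕ, ℝ} (hm : m ∈ S.index) : Plane ≃ₜ Plane :=
  placeHomeo (S.V m.1 + m.2.2 • sideDir S.V m.1) (sideDir S.V m.1) (S.size m.1 m.2.1)
    (S.norm_sideDir m.1) (size_pos_of_mem hm)

theorem plHomeo_apply {m : Σ _ : Fin (S.k + 3), Σ _ : ℕ, ℝ} (hm : m ∈ S.index) (x : Plane) :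
    plHomeo hm x = S.pl m x := rfl

theorem height_nonneg {m : Σ _ : Fin (S.k + 3), Σ _ : ℕ, ℝ} (hm : m ∈ S.index) {x : Plane}
    (hx : S.pl m x ∈ convexHull ℝ (range S.V)) : 0 ≤ x 1 := by
  have h := S.polygon.inner_nonneg_of_mem m.1 hx
  rw [pl, (inner_sideDir_place x).2] at h
  exact nonneg_of_mul_nonneg_right h (size_pos_of_mem hm)

/-- Near a mushroom, the polygon coincides with the cell of the mushroom. -/
theorem eventually_mem_cell (h0 : 0 < ε) (h1 : ε < 1) {m : Σ _ : Fin (S.k + 3), Σ _ : ℕ, ℝ}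
    (hm : m ∈ S.index) {x : Plane} (hx : x ∈ mushroom ε) : ∀ᶠ y in 𝓝 x,
      S.pl m y ∈ convexHull ℝ (range S.V) → y ∈ modelCell ε := by
  obtain ⟨a, b, c⟩ := mushroom_extent h0 h1 hx
  have hlt : |x 0 - 1 / 2| < 3 / (2 * ε) := by
    refine a.trans_lt ?_
    rw [div_lt_div_iff₀ h0 (by positivity)]
    linarith
  have e1 : ∀ᶠ y : Plane in 𝓝 x, |y 0 - 1 / 2| < 3 / (2 * ε) :=
    (isOpen_lt (by fun_prop) (by fun_prop) : IsOpen {y : Plane | |y 0 - 1 / 2| < 3 / (2 * ε)}).mem_nhds hlt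
  have e2 : ∀ᶠ y : Plane in 𝓝 x, y 1 < 3 / ε :=
    (isOpen_lt (by fun_prop) (by fun_prop) : IsOpen {y : Plane | y 1 < 3 / ε}).mem_nhds c
  filter_upwards [e1, e2] with y h2 h3 hy
  exact ⟨h2.le, height_nonneg hm hy, h3.le⟩

/-- The mushrooms are removed in increasing order, that is, larger ones first on each side. The cell
of the mushroom being removed avoids all those already removed, so only the connectedness of a
single cell without its mushroom matters. -/
theorem isPreconnected_body (hS : S.IsNested) (h0 : 0 < ε) (h1 : ε < 1) : IsPreconnected S.body := by
  have key : ∀ T : Finset (Σ _ : Fin (S.k + 3), Σ _ : ℕ, ℝ), T ⊆ S.index →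
      IsPreconnected (convexHull ℝ (range S.V) \ ⋃ m ∈ T, S.mush m) := by
    intro T
    classical
    induction T using Finset.induction_on_max_value
      (f := fun m : Σ _ : Fin (S.k + 3), Σ _ : ℕ, ℝ => m.2.1) with
    | empty =>
      intro _
      simpa using (convex_convexHull ℝ (range S.V)).isPreconnected
    | insert a s ha hmax ih =>
      intro hT
      have haI : a ∈ S.index := hT (Finset.mem_insert_self a s)
      have hsI : s ⊆ S.index := (Finset.subset_insert a s).trans hT
      have e : convexHull ℝ (range S.V) \ ⋃ m ∈ insert a s, S.mush m =
          (convexHull ℝ (range S.V) \ ⋃ m ∈ s, S.mush m) \ S.mush a := by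
        rw [Finset.set_biUnion_insert, union_comm, sdiff_sdiff]
      have hsub : S.pl a '' modelCell ε ⊆ convexHull ℝ (range S.V) \ ⋃ m ∈ s, S.mush m := by
        intro X hX
        refine ⟨S.rect_subset _ (hS.cell_subset a haI hX), fun hXm => ?_⟩
        obtain ⟨m, hm, hXm⟩ := mem_iUnion₂.1 hXm
        have hne : a ≠ m := by rintro rfl; exact ha hm
        exact Set.disjoint_left.1 (hS.cell_disjoint a haI m (hsI hm) hne (hmax m hm)) hX hXm
      rw [e]
      refine (ih hsI).sdiff_of_nhdsWithin (isClosed_mush haI) hsub ?_ ?_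
      · rintro _ ⟨x, hx, rfl⟩
        refine nhdsWithin_mono _ sdiff_subset ?_
        change S.pl a '' modelCell ε ∈ 𝓝[convexHull ℝ (range S.V)] (S.pl a x)
        rw [mem_nhdsWithin_iff_eventually]
        have h2 := (plHomeo haI).symm.continuous.tendsto (S.pl a x)
        rw [← plHomeo_apply haI, Homeomorph.symm_apply_apply] at h2
        filter_upwards [h2.eventually (eventually_mem_cell h0 h1 haI hx)] with X hX hXP
        have e2 : S.pl a ((plHomeo haI).symm X) = X := (plHomeo haI).apply_symm_apply X
        rw [e2] at hX
        exact ⟨_, hX hXP, e2⟩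
      · have e3 : S.pl a '' modelCell ε \ S.mush a = plHomeo haI '' (modelCell ε \ mushroom ε) :=
          (image_sdiff (plHomeo haI).injective _ _).symm
        rw [e3]
        exact (isPreconnected_modelCell_sdiff h0 h1).image _ (plHomeo haI).continuous.continuousOn
  rw [body_eq]
  exact key _ subset_rfl

end Planting

/-! ### Regular arcs -/

/-- A simple regular smooth arc, parametrized by the unit interval. -/
def IsArc (γ : ℝ → Plane) : Prop :=
  ContDiff ℝ ∞ γ ∧ InjOn γ (Icc 0 1) ∧ ∀ t ∈ Icc (0 : ℝ) 1, deriv γ t ≠ 0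

theorem isArc_segment (A : Plane) {d : Plane} (hd : d ≠ 0) : IsArc fun t => A + t • d := by
  refine ⟨by fun_prop, fun s _ t _ h => ?_, fun t _ => ?_⟩
  · exact smul_left_injective ℝ hd (add_left_cancel h)
  · have h : HasDerivAt (fun t : ℝ => A + t • d) ((1 : ℝ) • d) t :=
      ((hasDerivAt_id t).smul_const d).const_add A
    rw [h.deriv, one_smul]
    exact hd

theorem IsArc.place {γ : ℝ → Plane} (h : IsArc γ) (p : Plane) {u : Plane} {s : ℝ} (hu : ‖u‖ = 1)
    (hs : 0 < s) : IsArc fun t => place p u s (γ t) := by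
  set F : Plane →L[ℝ] Plane := LinearMap.toContinuousLinearMap (frame u) with hF
  have e : (fun t => _root_.place p u s (γ t)) = fun t => p + s • F (γ t) := rfl
  rw [e]
  refine ⟨?_, fun a ha b hb hab => h.2.1 ha hb ?_, fun t ht => ?_⟩
  · have h1 : ContDiff ℝ ∞ fun t => F (γ t) := F.contDiff.comp h.1
    exact contDiff_const.add (h1.const_smul s)
  · exact (placeHomeo p u s hu hs).injective hab
  · have h1 : HasDerivAt γ (deriv γ t) t :=
      ((h.1.differentiable (by norm_num)) t).hasDerivAt
    have h2 : HasDerivAt (fun t => p + s • F (γ t)) (s • F (deriv γ t)) t :=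
      ((F.hasFDerivAt.comp_hasDerivAt t h1).const_smul s).const_add p
    rw [h2.deriv]
    refine smul_ne_zero hs.ne' fun h3 => h.2.2 t ht ?_
    have h4 : ‖frame u (deriv γ t)‖ = 0 := by
      change ‖F (deriv γ t)‖ = 0
      rw [h3, norm_zero]
    rw [norm_frame hu] at h4
    exact norm_eq_zero.1 h4

theorem hasPiecewiseSmoothBoundary_of_arcs {B : Set Plane} {ι : Type*} [Finite ι] (γ : ι → ℝ → Plane)
    (h1 : ∀ i, IsArc (γ i)) (h2 : ∀ i j, i ≠ j → Disjoint (γ i '' Ioo 0 1) (γ j '' Icc 0 1))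
    (h3 : frontier B = ⋃ i, γ i '' Icc 0 1) : HasPiecewiseSmoothBoundary B := by
  obtain ⟨n, ⟨e⟩⟩ := Finite.exists_equiv_fin ι
  refine ⟨n, fun i => γ (e.symm i), fun i => h1 _, fun i j hij => h2 _ _ fun h =>
    hij (e.symm.injective h), ?_⟩
  rw [h3]
  exact (e.symm.surjective.iUnion_comp fun i => γ i '' Icc 0 1).symm

/-! ### The outline of a mushroom -/

/-- The outline of the mushroom: its boundary without the base. -/
def outline (ε : ℝ) : Set Plane :=
  {x | (x 0 = 0 ∨ x 0 = 1) ∧ 0 ≤ x 1 ∧ x 1 ≤ ε} ∪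
  ({x | x 1 = ε ∧ (x 0 ≤ 0 ∨ 1 ≤ x 0) ∧ |x 0 - 1 / 2| ≤ 1 / ε} ∪
  {x | ε ≤ x 1 ∧ focalSum !₂[0, ε] !₂[1, ε] x = 2 * (1 / ε)})

theorem focalSum_of_height {ε : ℝ} {x : Plane} (hx : x 1 = ε) :
    focalSum !₂[0, ε] !₂[1, ε] x = |x 0| + |x 0 - 1| := by
  rw [← focalSum_axis ε]
  congr 1
  exact plane_ext (by simp) (by simp [hx])

theorem abs_add_abs_sub_one_le {r a : ℝ} (ha : 1 / 2 ≤ a) (h : |r - 1 / 2| ≤ a) :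
    |r| + |r - 1| ≤ 2 * a := by
  obtain ⟨h1, h2⟩ := abs_le.1 h
  rcases abs_cases r with ⟨h3, -⟩ | ⟨h3, -⟩ <;> rcases abs_cases (r - 1) with ⟨h4, -⟩ | ⟨h4, -⟩ <;>
    rw [h3, h4] <;> linarith

theorem outline_subset_mushroom {ε : ℝ} (h0 : 0 < ε) (h1 : ε < 1) : outline ε ⊆ mushroom ε := by
  have hε : 1 < 1 / ε := by rw [lt_div_iff₀ h0]; linarith
  rintro x (⟨h2, h3, h4⟩ | ⟨h2, -, h3⟩ | ⟨h2, h3⟩)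
  · refine Or.inl ⟨?_, ?_, h3, h4⟩ <;> rcases h2 with h | h <;> rw [h] <;> norm_num
  · refine Or.inr ⟨h2.ge, ?_⟩
    change focalSum _ _ _ ≤ _
    rw [focalSum_of_height h2]
    exact abs_add_abs_sub_one_le (by linarith) h3
  · exact Or.inr ⟨h2, h3.le⟩

/-- The outline can be left within the upper half-plane: from the walls of the stem and the bottom
of the cap by moving sideways while lowering the height by the factor `1 - η`, and from the arc by
moving straight up. -/
theorem outline_subset_closure {ε : ℝ} (h0 : 0 < ε) (h1 : ε < 1) :
    outline ε ⊆ closure (modelCell ε \ mushroom ε) := by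
  intro x hx
  obtain ⟨e1, e2, e3⟩ := mushroom_extent h0 h1 (outline_subset_mushroom h0 h1 hx)
  have hlt : |x 0 - 1 / 2| < 3 / (2 * ε) := by
    refine e1.trans_lt ?_
    rw [div_lt_div_iff₀ h0 (by positivity)]
    linarith
  -- it suffices to leave the mushroom along a curve
  have key : ∀ γ : ℝ → Plane, Continuous γ → γ 0 = x →
      (∀ᶠ η in 𝓝[>] (0 : ℝ), 0 ≤ γ η 1 ∧ γ η ∉ mushroom ε) → x ∈ closure (modelCell ε \ mushroom ε) := by
    intro γ hγ hγ0 hev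
    have ht : Tendsto γ (𝓝[>] 0) (𝓝 x) := by
      have := hγ.tendsto 0
      rw [hγ0] at this
      exact this.mono_left nhdsWithin_le_nhds
    refine mem_closure_of_tendsto ht ?_
    have f1 : ∀ᶠ y : Plane in 𝓝 x, |y 0 - 1 / 2| < 3 / (2 * ε) :=
      (isOpen_lt (by fun_prop) (by fun_prop) :
        IsOpen {y : Plane | |y 0 - 1 / 2| < 3 / (2 * ε)}).mem_nhds hlt
    have f2 : ∀ᶠ y : Plane in 𝓝 x, y 1 < 3 / ε :=
      (isOpen_lt (by fun_prop) (by fun_prop) : IsOpen {y : Plane | y 1 < 3 / ε}).mem_nhds e3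
    filter_upwards [hev, ht.eventually f1, ht.eventually f2] with η g1 g2 g3
    exact ⟨⟨g2.le, g1.1, g3.le⟩, g1.2⟩
  have hsmall : ∀ᶠ η in 𝓝[>] (0 : ℝ), η < 1 := mem_nhdsWithin_of_mem_nhds (Iio_mem_nhds one_pos)
  have hposη : ∀ᶠ η in 𝓝[>] (0 : ℝ), 0 < η := eventually_mem_nhdsWithin
  have hleft : x 0 ≤ 0 → x 1 ≤ ε → x ∈ closure (modelCell ε \ mushroom ε) := by
    intro g1 g2
    refine key (fun η => x + η • !₂[-1, -x 1]) (by fun_prop) (by simp) ?_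
    filter_upwards [hsmall, hposη] with η k1 k2
    have c0 : (x + η • !₂[-1, -x 1] : Plane) 0 = x 0 - η := by simp; ring
    have c1 : (x + η • !₂[-1, -x 1] : Plane) 1 = (1 - η) * x 1 := by simp; ring
    rw [mem_mushroom, c0, c1]
    refine ⟨mul_nonneg (by linarith) e2, ?_⟩
    rintro (⟨l1, -⟩ | ⟨l1, -⟩)
    · linarith
    · nlinarith
  have hright : 1 ≤ x 0 → x 1 ≤ ε → x ∈ closure (modelCell ε \ mushroom ε) := by
    intro g1 g2
    refine key (fun η => x + η • !₂[1, -x 1]) (by fun_prop) (by simp) ?_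
    filter_upwards [hsmall, hposη] with η k1 k2
    have c0 : (x + η • !₂[1, -x 1] : Plane) 0 = x 0 + η := by simp
    have c1 : (x + η • !₂[1, -x 1] : Plane) 1 = (1 - η) * x 1 := by simp; ring
    rw [mem_mushroom, c0, c1]
    refine ⟨mul_nonneg (by linarith) e2, ?_⟩
    rintro (⟨-, l1, -⟩ | ⟨l1, -⟩)
    · linarith
    · nlinarith
  rcases hx with ⟨h2, h3, h4⟩ | ⟨h2, h3, -⟩ | ⟨h2, h3⟩
  · rcases h2 with h | h
    · exact hleft h.le h4
    · exact hright h.ge h4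
  · rcases h3 with h | h
    · exact hleft h h2.le
    · exact hright h h2.le
  · refine key (fun η => x + η • !₂[0, 1]) (by fun_prop) (by simp) ?_
    filter_upwards [hposη] with η k2
    have c0 : (x + η • !₂[0, 1] : Plane) 0 = x 0 := by simp
    have c1 : (x + η • !₂[0, 1] : Plane) 1 = x 1 + η := by simp
    refine ⟨by rw [c1]; linarith, ?_⟩
    have hd : ∀ a : ℝ, dist x !₂[a, ε] < dist (x + η • !₂[0, 1]) !₂[a, ε] := by
      intro a
      refine lt_of_pow_lt_pow_left₀ 2 dist_nonneg ?_
      rw [dist_eq_norm, dist_eq_norm, plane_norm_sq, plane_norm_sq]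
      simp only [PiLp.sub_apply, c0, c1]
      change (x 0 - a) ^ 2 + (x 1 - ε) ^ 2 < (x 0 - a) ^ 2 + (x 1 + η - ε) ^ 2
      nlinarith
    have hf : focalSum !₂[0, ε] !₂[1, ε] x < focalSum !₂[0, ε] !₂[1, ε] (x + η • !₂[0, 1]) :=
      add_lt_add (hd 0) (hd 1)
    rw [mem_mushroom, c0, c1]
    rintro (⟨-, -, -, l1⟩ | ⟨-, l1⟩)
    · linarith
    · linarith

/-- Near a point of the mushroom outside the outline, the mushroom fills the half-plane above its base. -/
theorem eventually_mem_mushroom {ε : ℝ} (h0 : 0 < ε) (h1 : ε < 1) {x : Plane} (hx : x ∈ mushroom ε)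
    (hxo : x ∉ outline ε) : ∀ᶠ y : Plane in 𝓝 x, 0 ≤ y 1 → y ∈ mushroom ε := by
  have hε : 1 < 1 / ε := by rw [lt_div_iff₀ h0]; linarith
  have hc := continuous_focalSum !₂[0, ε] !₂[1, ε]
  have o1 : IsOpen {y : Plane | 0 < y 0} := isOpen_lt (by fun_prop) (by fun_prop)
  have o2 : IsOpen {y : Plane | y 0 < 1} := isOpen_lt (by fun_prop) (by fun_prop)
  have o3 : IsOpen {y : Plane | y 1 < ε} := isOpen_lt (by fun_prop) (by fun_prop)
  have o4 : IsOpen {y : Plane | ε < y 1} := isOpen_lt (by fun_prop) (by fun_prop)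
  have o5 : IsOpen {y : Plane | focalSum !₂[0, ε] !₂[1, ε] y < 2 * (1 / ε)} :=
    isOpen_lt (by fun_prop) (by fun_prop)
  simp only [outline, mem_union, mem_ofPred_eq, not_or] at hxo
  obtain ⟨n1, n2, n3⟩ := hxo
  have hnear : 0 < x 0 → x 0 < 1 → x 1 ≤ ε → ∀ᶠ y : Plane in 𝓝 x, 0 ≤ y 1 → y ∈ mushroom ε := by
    intro g1 g2 g3
    rcases g3.lt_or_eq with g3 | g3
    · filter_upwards [o1.mem_nhds g1, o2.mem_nhds g2, o3.mem_nhds g3] with y k1 k2 k3 k4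
      exact Or.inl ⟨le_of_lt k1, le_of_lt k2, k4, le_of_lt k3⟩
    · have g4 : focalSum !₂[0, ε] !₂[1, ε] x < 2 * (1 / ε) := by
        rw [focalSum_of_height g3, abs_of_pos g1, abs_of_neg (by linarith)]; linarith
      filter_upwards [o1.mem_nhds g1, o2.mem_nhds g2, o5.mem_nhds g4] with y k1 k2 k3 k4
      rcases le_total (y 1) ε with k5 | k5
      · exact Or.inl ⟨le_of_lt k1, le_of_lt k2, k4, k5⟩
      · exact Or.inr ⟨k5, le_of_lt k3⟩
  rcases mem_mushroom.1 hx with ⟨g1, g2, g3, g4⟩ | ⟨g1, g2⟩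
  · refine hnear (g1.lt_of_ne' fun h => n1 ⟨Or.inl h, g3, g4⟩)
      (g2.lt_of_ne fun h => n1 ⟨Or.inr h, g3, g4⟩) g4
  · have g3 := g2.lt_of_ne fun h => n3 ⟨g1, h⟩
    rcases g1.lt_or_eq with g4 | g4
    · filter_upwards [o4.mem_nhds g4, o5.mem_nhds g3] with y k1 k2 _
      exact Or.inr ⟨le_of_lt k1, le_of_lt k2⟩
    · have hext := (mushroom_extent h0 h1 hx).1
      have g5 : ¬ (x 0 ≤ 0 ∨ 1 ≤ x 0) := fun h => n2 ⟨g4.symm, h, hext⟩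
      push Not at g5
      exact hnear g5.1 g5.2 g4.ge

/-- The five smooth arcs of the outline: the sides of the stem, the two parts of the bottom of the cap,
and the half ellipse. -/
noncomputable def outlineArc (ε : ℝ) : Fin 5 → ℝ → Plane
  | 0 => fun t => !₂[0, 0] + t • !₂[0, ε]
  | 1 => fun t => !₂[1, 0] + t • !₂[0, ε]
  | 2 => fun t => !₂[0, ε] + t • !₂[-(1 / ε - 1 / 2), 0]
  | 3 => fun t => !₂[1, ε] + t • !₂[1 / ε - 1 / 2, 0]
  | 4 => fun t => !₂[1 / 2, ε] + (Real.cos (Real.pi * t) • !₂[1 / ε, 0] +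
      Real.sin (Real.pi * t) • !₂[0, Real.sqrt ((1 / ε) ^ 2 - 1 / 4)])

section OutlineArc

variable {ε : ℝ}

theorem outlineArc_zero (t : ℝ) : outlineArc ε 0 t 0 = 0 ∧ outlineArc ε 0 t 1 = ε * t := by
  exact ⟨show (0 : ℝ) + t * 0 = 0 by ring, show 0 + t * ε = ε * t by ring⟩

theorem outlineArc_one (t : ℝ) : outlineArc ε 1 t 0 = 1 ∧ outlineArc ε 1 t 1 = ε * t := by
  exact ⟨show (1 : ℝ) + t * 0 = 1 by ring, show 0 + t * ε = ε * t by ring⟩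

theorem outlineArc_two (t : ℝ) :
    outlineArc ε 2 t 0 = -((1 / ε - 1 / 2) * t) ∧ outlineArc ε 2 t 1 = ε := by
  exact ⟨show 0 + t * -(1 / ε - 1 / 2) = -((1 / ε - 1 / 2) * t) by ring, show ε + t * 0 = ε by ring⟩

theorem outlineArc_three (t : ℝ) :
    outlineArc ε 3 t 0 = 1 + (1 / ε - 1 / 2) * t ∧ outlineArc ε 3 t 1 = ε := by
  exact ⟨show 1 + t * (1 / ε - 1 / 2) = 1 + (1 / ε - 1 / 2) * t by ring, show ε + t * 0 = ε by ring⟩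

theorem outlineArc_four (t : ℝ) :
    outlineArc ε 4 t 0 = 1 / 2 + 1 / ε * Real.cos (Real.pi * t) ∧
      outlineArc ε 4 t 1 = ε + Real.sqrt ((1 / ε) ^ 2 - 1 / 4) * Real.sin (Real.pi * t) := by
  exact ⟨show 1 / 2 + (Real.cos (Real.pi * t) * (1 / ε) + Real.sin (Real.pi * t) * 0) = _ by ring,
    show ε + (Real.cos (Real.pi * t) * 0 + Real.sin (Real.pi * t) * Real.sqrt ((1 / ε) ^ 2 - 1 / 4)) = _ by
      ring⟩

theorem isArc_outlineArc (h0 : 0 < ε) (h1 : ε < 1) (i : Fin 5) : IsArc (outlineArc ε i) := by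
  have hε : 1 < 1 / ε := by rw [lt_div_iff₀ h0]; linarith
  have hne0 : ∀ r : ℝ, r ≠ 0 → (!₂[r, 0] : Plane) ≠ 0 := fun r hr h => hr (by
    have := congrArg (fun x : Plane => x 0) h
    simpa using this)
  have hne1 : ∀ r : ℝ, r ≠ 0 → (!₂[0, r] : Plane) ≠ 0 := fun r hr h => hr (by
    have := congrArg (fun x : Plane => x 1) h
    simpa using this)
  have hpi := Real.pi_pos
  match i with
  | 0 => exact isArc_segment _ (hne1 _ h0.ne')
  | 1 => exact isArc_segment _ (hne1 _ h0.ne')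
  | 2 => exact isArc_segment _ (hne0 _ (by linarith))
  | 3 => exact isArc_segment _ (hne0 _ (by linarith))
  | 4 =>
    have hb : 0 < Real.sqrt ((1 / ε) ^ 2 - 1 / 4) := Real.sqrt_pos.2 (by nlinarith)
    refine ⟨?_, fun s hs t ht hst => ?_, fun t _ => ?_⟩
    · have h2 : ContDiff ℝ ∞ fun t : ℝ => Real.cos (Real.pi * t) :=
        Real.contDiff_cos.comp (contDiff_const.mul contDiff_id)
      have h3 : ContDiff ℝ ∞ fun t : ℝ => Real.sin (Real.pi * t) :=
        Real.contDiff_sin.comp (contDiff_const.mul contDiff_id)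
      exact contDiff_const.add ((h2.smul contDiff_const).add (h3.smul contDiff_const))
    · have h2 := congrArg (fun x : Plane => x 0) hst
      dsimp only at h2
      rw [(outlineArc_four s).1, (outlineArc_four t).1] at h2
      have h3 : Real.cos (Real.pi * s) = Real.cos (Real.pi * t) :=
        mul_left_cancel₀ (by positivity) (add_left_cancel h2)
      have h4 := Real.injOn_cos ⟨mul_nonneg hpi.le hs.1, mul_le_of_le_one_right hpi.le hs.2⟩
        ⟨mul_nonneg hpi.le ht.1, mul_le_of_le_one_right hpi.le ht.2⟩ h3
      exact mul_left_cancel₀ hpi.ne' h4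
    · have h2 : HasDerivAt (fun t : ℝ => Real.pi * t) Real.pi t := by
        simpa using (hasDerivAt_id t).const_mul Real.pi
      have h3 : HasDerivAt (outlineArc ε 4) ((-Real.sin (Real.pi * t) * Real.pi) • !₂[1 / ε, 0] +
          (Real.cos (Real.pi * t) * Real.pi) • !₂[0, Real.sqrt ((1 / ε) ^ 2 - 1 / 4)]) t :=
        ((h2.cos.smul_const _).add (h2.sin.smul_const _)).const_add _
      rw [h3.deriv]
      intro h
      have h4 := congrArg (fun x : Plane => x 0) h
      have h5 := congrArg (fun x : Plane => x 1) h
      change -Real.sin (Real.pi * t) * Real.pi * (1 / ε) + Real.cos (Real.pi * t) * Real.pi * 0 = 0 at h4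
      change -Real.sin (Real.pi * t) * Real.pi * 0 + Real.cos (Real.pi * t) * Real.pi *
        Real.sqrt ((1 / ε) ^ 2 - 1 / 4) = 0 at h5
      simp only [mul_zero, add_zero, zero_add, mul_eq_zero, neg_eq_zero, hpi.ne', or_false, hb.ne',
        (one_pos.trans hε).ne'] at h4 h5
      have := Real.sin_sq_add_cos_sq (Real.pi * t)
      rw [h4, h5] at this
      norm_num at this

/-- The equation of the half ellipse in terms of its parametrization. -/
theorem focalSum_eq_iff (h0 : 0 < ε) (h1 : ε < 1) {x : Plane} :
    (ε ≤ x 1 ∧ focalSum !₂[0, ε] !₂[1, ε] x = 2 * (1 / ε)) ↔ x ∈ outlineArc ε 4 '' Icc 0 1 := by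
  have hε : 1 < 1 / ε := by rw [lt_div_iff₀ h0]; linarith
  have hpi := Real.pi_pos
  set a := 1 / ε with ha
  have hb2 : Real.sqrt (a ^ 2 - 1 / 4) ^ 2 = a ^ 2 - 1 / 4 := Real.sq_sqrt (by nlinarith)
  have hb : 0 ≤ Real.sqrt (a ^ 2 - 1 / 4) := Real.sqrt_nonneg _
  set b := Real.sqrt (a ^ 2 - 1 / 4) with hbd
  have hd : ∀ (y : ℝ), dist x !₂[y, ε] ^ 2 = (x 0 - y) ^ 2 + (x 1 - ε) ^ 2 := by
    intro y
    rw [dist_eq_norm, plane_norm_sq]; rfl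
  constructor
  · rintro ⟨h2, h3⟩
    have hext := (mushroom_extent h0 h1 (Or.inr ⟨h2, h3.le⟩)).1
    rw [← ha] at hext
    obtain ⟨k1, k2⟩ := abs_le.1 hext
    set r := (x 0 - 1 / 2) / a with hr
    have hra : a * r = x 0 - 1 / 2 := by rw [hr]; field_simp
    have hr1 : -1 ≤ r := by rw [hr, le_div_iff₀ (by linarith)]; linarith
    have hr2 : r ≤ 1 := by rw [hr, div_le_one (by linarith)]; linarith
    have hθ : Real.pi * (Real.arccos r / Real.pi) = Real.arccos r := by field_simp
    refine ⟨Real.arccos r / Real.pi, ⟨div_nonneg (Real.arccos_nonneg r) hpi.le,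
      (div_le_one hpi).2 (Real.arccos_le_pi r)⟩, ?_⟩
    obtain ⟨e1, e2⟩ := outlineArc_four (ε := ε) (Real.arccos r / Real.pi)
    rw [hθ, ← ha] at e1 e2
    rw [Real.cos_arccos hr1 hr2] at e1
    apply plane_ext
    · rw [e1]; linarith
    · rw [e2, ← hbd]
      have hs0 : 0 ≤ Real.sin (Real.arccos r) := by rw [Real.sin_arccos]; exact Real.sqrt_nonneg _
      have hs2 : Real.sin (Real.arccos r) ^ 2 = 1 - r ^ 2 := by
        rw [Real.sin_sq, Real.cos_arccos hr1 hr2]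
      have : b * Real.sin (Real.arccos r) = x 1 - ε := by
        refine (sq_eq_sq₀ (mul_nonneg hb hs0) (by linarith)).1 ?_
        rw [mul_pow, hb2, hs2]
        have d1 := hd 0
        have d2 := hd 1
        change dist x !₂[0, ε] + dist x !₂[1, ε] = 2 * a at h3
        set α := dist x !₂[0, ε]
        set β := dist x !₂[1, ε]
        -- The difference of the squared focal distances, divided by their sum `2a`, gives `α - β =
        -- r`, hence `α = a + r / 2`.
        have hαβ : (α - β) * (2 * a) = 2 * x 0 - 1 := by rw [← h3]; linear_combination d1 - d2
        have hαβ' : α - β = r := by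
          have : 2 * a ≠ 0 := by linarith
          refine mul_right_cancel₀ this ?_
          rw [hαβ]; linear_combination -2 * hra
        have hα : α = a + r / 2 := by linarith
        rw [hα] at d1
        have hx0 : x 0 = 1 / 2 + a * r := by linarith
        rw [hx0] at d1
        linear_combination d1
      linarith
  · rintro ⟨t, ht, rfl⟩
    obtain ⟨e1, e2⟩ := outlineArc_four (ε := ε) t
    rw [← ha] at e1 e2
    rw [← hbd] at e2
    set x := outlineArc ε 4 t
    have hs : 0 ≤ Real.sin (Real.pi * t) := Real.sin_nonneg_of_nonneg_of_le_pi
      (mul_nonneg hpi.le ht.1) (mul_le_of_le_one_right hpi.le ht.2)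
    have hsc := Real.sin_sq_add_cos_sq (Real.pi * t)
    set co := Real.cos (Real.pi * t) with hco
    set si := Real.sin (Real.pi * t) with hsi
    have hc1 : -1 ≤ co := Real.neg_one_le_cos _
    have hc2 : co ≤ 1 := Real.cos_le_one _
    refine ⟨by rw [e2]; linarith [mul_nonneg hb hs], ?_⟩
    have d1 : dist x !₂[0, ε] = a + co / 2 := by
      refine (sq_eq_sq₀ dist_nonneg (by linarith)).1 ?_
      rw [hd, e1, e2]
      linear_combination (a ^ 2 - 1 / 4) * hsc + si ^ 2 * hb2
    have d2 : dist x !₂[1, ε] = a - co / 2 := by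
      refine (sq_eq_sq₀ dist_nonneg (by linarith)).1 ?_
      rw [hd, e1, e2]
      linear_combination (a ^ 2 - 1 / 4) * hsc + si ^ 2 * hb2
    rw [focalSum, d1, d2]; ring

theorem outline_eq (h0 : 0 < ε) (h1 : ε < 1) : outline ε = ⋃ i, outlineArc ε i '' Icc 0 1 := by
  have hε : 1 < 1 / ε := by rw [lt_div_iff₀ h0]; linarith
  have hA : 0 < 1 / ε - 1 / 2 := by linarith
  apply Subset.antisymm
  · rintro x (⟨h2, h3, h4⟩ | ⟨h2, h3, h4⟩ | h2)
    · have ht : x 1 / ε ∈ Icc (0 : ℝ) 1 := ⟨div_nonneg h3 h0.le, (div_le_one h0).2 h4⟩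
      have e : ε * (x 1 / ε) = x 1 := by field_simp
      rcases h2 with h2 | h2
      · refine mem_iUnion.2 ⟨0, x 1 / ε, ht, plane_ext ?_ ?_⟩
        · rw [(outlineArc_zero _).1, h2]
        · rw [(outlineArc_zero _).2, e]
      · refine mem_iUnion.2 ⟨1, x 1 / ε, ht, plane_ext ?_ ?_⟩
        · rw [(outlineArc_one _).1, h2]
        · rw [(outlineArc_one _).2, e]
    · obtain ⟨k1, k2⟩ := abs_le.1 h4
      rcases h3 with h3 | h3
      · refine mem_iUnion.2 ⟨2, -x 0 / (1 / ε - 1 / 2), ⟨div_nonneg (by linarith) hA.le,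
          (div_le_one hA).2 (by linarith)⟩, plane_ext ?_ ?_⟩
        · rw [(outlineArc_two _).1, mul_div_cancel₀ _ hA.ne', neg_neg]
        · rw [(outlineArc_two _).2, h2]
      · refine mem_iUnion.2 ⟨3, (x 0 - 1) / (1 / ε - 1 / 2), ⟨div_nonneg (by linarith) hA.le,
          (div_le_one hA).2 (by linarith)⟩, plane_ext ?_ ?_⟩
        · rw [(outlineArc_three _).1, mul_div_cancel₀ _ hA.ne', add_sub_cancel]
        · rw [(outlineArc_three _).2, h2]
    · exact mem_iUnion.2 ⟨4, (focalSum_eq_iff h0 h1).1 h2⟩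
  · refine iUnion_subset fun i => ?_
    match i with
    | 0 =>
      rintro _ ⟨t, ht, rfl⟩
      obtain ⟨e1, e2⟩ := outlineArc_zero (ε := ε) t
      refine Or.inl ⟨Or.inl e1, ?_, ?_⟩ <;> rw [e2]
      · exact mul_nonneg h0.le ht.1
      · exact mul_le_of_le_one_right h0.le ht.2
    | 1 =>
      rintro _ ⟨t, ht, rfl⟩
      obtain ⟨e1, e2⟩ := outlineArc_one (ε := ε) t
      refine Or.inl ⟨Or.inr e1, ?_, ?_⟩ <;> rw [e2]
      · exact mul_nonneg h0.le ht.1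
      · exact mul_le_of_le_one_right h0.le ht.2
    | 2 =>
      rintro _ ⟨t, ht, rfl⟩
      obtain ⟨e1, e2⟩ := outlineArc_two (ε := ε) t
      have k1 := mul_nonneg hA.le ht.1
      have k2 := mul_le_of_le_one_right hA.le ht.2
      refine Or.inr (Or.inl ⟨e2, Or.inl ?_, ?_⟩) <;> rw [e1]
      · linarith
      · rw [abs_le]; constructor <;> linarith
    | 3 =>
      rintro _ ⟨t, ht, rfl⟩
      obtain ⟨e1, e2⟩ := outlineArc_three (ε := ε) t
      have k1 := mul_nonneg hA.le ht.1
      have k2 := mul_le_of_le_one_right hA.le ht.2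
      refine Or.inr (Or.inl ⟨e2, Or.inr ?_, ?_⟩) <;> rw [e1]
      · linarith
      · rw [abs_le]; constructor <;> linarith
    | 4 => exact fun x hx => Or.inr (Or.inr ((focalSum_eq_iff h0 h1).2 hx))

theorem outlineArc_height_pos (h0 : 0 < ε) {i : Fin 5} {t : ℝ} (ht : t ∈ Ioo (0 : ℝ) 1) :
    0 < outlineArc ε i t 1 := by
  have hpi := Real.pi_pos
  match i with
  | 0 => rw [(outlineArc_zero t).2]; exact mul_pos h0 ht.1
  | 1 => rw [(outlineArc_one t).2]; exact mul_pos h0 ht.1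
  | 2 => rw [(outlineArc_two t).2]; exact h0
  | 3 => rw [(outlineArc_three t).2]; exact h0
  | 4 =>
    rw [(outlineArc_four t).2]
    have := mul_nonneg (Real.sqrt_nonneg ((1 / ε) ^ 2 - 1 / 4)) (Real.sin_nonneg_of_nonneg_of_le_pi
      (mul_nonneg hpi.le ht.1.le) (mul_le_of_le_one_right hpi.le ht.2.le))
    linarith

theorem outlineArc_ne (h0 : 0 < ε) (h1 : ε < 1) {i j : Fin 5} (hij : i ≠ j) {t t' : ℝ}
    (ht : t ∈ Ioo (0 : ℝ) 1) (ht' : t' ∈ Icc (0 : ℝ) 1) : outlineArc ε i t ≠ outlineArc ε j t' := by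
  have hε : 1 < 1 / ε := by rw [lt_div_iff₀ h0]; linarith
  have hA : 0 < 1 / ε - 1 / 2 := by linarith
  have hpi := Real.pi_pos
  intro h
  have c0 : outlineArc ε i t 0 = outlineArc ε j t' 0 := by rw [h]
  have c1 : outlineArc ε i t 1 = outlineArc ε j t' 1 := by rw [h]
  have b1 : ε * t < ε := mul_lt_of_lt_one_right h0 ht.2
  have b2 : ε * t' ≤ ε := mul_le_of_le_one_right h0.le ht'.2
  have b3 : 0 < (1 / ε - 1 / 2) * t := mul_pos hA ht.1
  have b4 : (1 / ε - 1 / 2) * t < 1 / ε - 1 / 2 := mul_lt_of_lt_one_right hA ht.2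
  have b5 : 0 ≤ (1 / ε - 1 / 2) * t' := mul_nonneg hA.le ht'.1
  have hb : 0 < Real.sqrt ((1 / ε) ^ 2 - 1 / 4) := Real.sqrt_pos.2 (by nlinarith)
  have b6 : 0 < Real.sqrt ((1 / ε) ^ 2 - 1 / 4) * Real.sin (Real.pi * t) :=
    mul_pos hb (Real.sin_pos_of_pos_of_lt_pi (mul_pos hpi ht.1) (mul_lt_of_lt_one_right hpi ht.2))
  have h4 : ∀ x, x ∈ outlineArc ε 4 '' Icc 0 1 → ε ≤ x 1 ∧ focalSum !₂[0, ε] !₂[1, ε] x = 2 * (1 / ε) :=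
    fun x hx => (focalSum_eq_iff h0 h1).2 hx
  match i, j with
  | 0, 0 | 1, 1 | 2, 2 | 3, 3 | 4, 4 => exact hij rfl
  | 0, 1 => rw [(outlineArc_zero t).1, (outlineArc_one t').1] at c0; linarith
  | 0, 2 => rw [(outlineArc_zero t).2, (outlineArc_two t').2] at c1; linarith
  | 0, 3 => rw [(outlineArc_zero t).2, (outlineArc_three t').2] at c1; linarith
  | 0, 4 =>
    have := (h4 _ ⟨t', ht', rfl⟩).1
    rw [← c1, (outlineArc_zero t).2] at this; linarith
  | 1, 0 => rw [(outlineArc_one t).1, (outlineArc_zero t').1] at c0; linarith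
  | 1, 2 => rw [(outlineArc_one t).2, (outlineArc_two t').2] at c1; linarith
  | 1, 3 => rw [(outlineArc_one t).2, (outlineArc_three t').2] at c1; linarith
  | 1, 4 =>
    have := (h4 _ ⟨t', ht', rfl⟩).1
    rw [← c1, (outlineArc_one t).2] at this; linarith
  | 2, 0 => rw [(outlineArc_two t).1, (outlineArc_zero t').1] at c0; linarith
  | 2, 1 => rw [(outlineArc_two t).1, (outlineArc_one t').1] at c0; linarith
  | 2, 3 => rw [(outlineArc_two t).1, (outlineArc_three t').1] at c0; linarith
  | 2, 4 =>
    have := (h4 _ ⟨t', ht', rfl⟩).2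
    rw [← h, focalSum_of_height (outlineArc_two t).2, (outlineArc_two t).1,
      abs_of_neg (by linarith), abs_of_neg (by linarith)] at this
    linarith
  | 3, 0 => rw [(outlineArc_three t).1, (outlineArc_zero t').1] at c0; linarith
  | 3, 1 => rw [(outlineArc_three t).1, (outlineArc_one t').1] at c0; linarith
  | 3, 2 => rw [(outlineArc_three t).1, (outlineArc_two t').1] at c0; linarith
  | 3, 4 =>
    have := (h4 _ ⟨t', ht', rfl⟩).2
    rw [← h, focalSum_of_height (outlineArc_three t).2, (outlineArc_three t).1,
      abs_of_pos (by linarith), abs_of_pos (by linarith)] at this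
    linarith
  | 4, 0 => rw [(outlineArc_four t).2, (outlineArc_zero t').2] at c1; linarith
  | 4, 1 => rw [(outlineArc_four t).2, (outlineArc_one t').2] at c1; linarith
  | 4, 2 => rw [(outlineArc_four t).2, (outlineArc_two t').2] at c1; linarith
  | 4, 3 => rw [(outlineArc_four t).2, (outlineArc_three t').2] at c1; linarith

end OutlineArc

/-! ### The boundary of a nested planting -/

/-- The gaps between finitely many disjoint closed intervals inside `(0, L)`. -/
theorem exists_gaps {L : ℝ} (hL : 0 < L) (I : Finset (ℝ × ℝ))
    (hI : ∀ p ∈ I, 0 < p.1 ∧ p.1 < p.2 ∧ p.2 < L)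
    (hd : ∀ p ∈ I, ∀ q ∈ I, p ≠ q → Disjoint (Icc p.1 p.2) (Icc q.1 q.2)) :
    ∃ G : Finset (ℝ × ℝ), (∀ g ∈ G, g.1 < g.2) ∧
      (∀ g ∈ G, ∀ g' ∈ G, g ≠ g' → Disjoint (Ioo g.1 g.2) (Icc g'.1 g'.2)) ∧
      ∀ r, (∃ g ∈ G, r ∈ Icc g.1 g.2) ↔ r ∈ Icc 0 L ∧ ∀ p ∈ I, r ∉ Ioo p.1 p.2 := by
  classical
  -- A gap can begin only at `0` or at the right end of an interval, and can end only at `L` or at a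
  -- left end.
  set A : Finset ℝ := insert 0 (I.image Prod.snd) with hA
  set E : Finset ℝ := insert L (I.image Prod.fst) with hE
  have hAmem : ∀ a, a ∈ A ↔ a = 0 ∨ ∃ p ∈ I, p.2 = a := fun a => by
    rw [hA, Finset.mem_insert, Finset.mem_image]
  have hEmem : ∀ e, e ∈ E ↔ e = L ∨ ∃ p ∈ I, p.1 = e := fun e => by
    rw [hE, Finset.mem_insert, Finset.mem_image]
  have hAL : ∀ a ∈ A, 0 ≤ a ∧ a < L := by
    intro a ha
    rcases (hAmem a).1 ha with rfl | ⟨p, hp, rfl⟩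
    · exact ⟨le_rfl, hL⟩
    · have := hI p hp; exact ⟨by linarith, this.2.2⟩
  -- the end of the gap that begins at `a`
  have hex : ∀ a ∈ A, ∃ b ∈ E, a < b ∧ ∀ e ∈ E, a < e → b ≤ e := by
    intro a ha
    have hne : (E.filter (a < ·)).Nonempty :=
      ⟨L, Finset.mem_filter.2 ⟨(hEmem L).2 (Or.inl rfl), (hAL a ha).2⟩⟩
    obtain ⟨h1, h2⟩ := Finset.mem_filter.1 (Finset.min'_mem _ hne)
    exact ⟨_, h1, h2, fun e he hae => Finset.min'_le _ _ (Finset.mem_filter.2 ⟨he, hae⟩)⟩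
  choose! b hbE hb hbmin using hex
  -- no beginning of a gap lies in an interval, except as its right end
  have hstart : ∀ a ∈ A, ∀ p ∈ I, a ∈ Icc p.1 p.2 → a = p.2 := by
    intro a ha p hp hap
    rcases (hAmem a).1 ha with rfl | ⟨q, hq, rfl⟩
    · exact absurd hap.1 (not_le.2 (hI p hp).1)
    · by_contra hne
      have hpq : q ≠ p := fun h => hne (by rw [h])
      exact Set.disjoint_left.1 (hd q hq p hp hpq) ⟨(hI q hq).2.1.le, le_rfl⟩ hap
  have hbL : ∀ a ∈ A, b a ≤ L := fun a ha => hbmin a ha L ((hEmem L).2 (Or.inl rfl)) (hAL a ha).2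
  -- the next gap begins after the end of the preceding one
  have hnext : ∀ a ∈ A, ∀ a' ∈ A, a < a' → b a < a' := by
    intro a ha a' ha' hlt
    rcases (hAmem a').1 ha' with rfl | ⟨p, hp, rfl⟩
    · exact absurd hlt (not_lt.2 (hAL a ha).1)
    · have hap : a < p.1 := by
        by_contra h
        exact hlt.ne (hstart a ha p hp ⟨not_lt.1 h, hlt.le⟩)
      exact (hbmin a ha p.1 ((hEmem _).2 (Or.inr ⟨p, hp, rfl⟩)) hap).trans_lt (hI p hp).2.1
  refine ⟨A.image fun a => (a, b a), ?_, ?_, fun r => ⟨?_, ?_⟩⟩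
  · intro g hg
    obtain ⟨a, ha, rfl⟩ := Finset.mem_image.1 hg
    exact hb a ha
  · intro g hg g' hg' hne
    obtain ⟨a, ha, rfl⟩ := Finset.mem_image.1 hg
    obtain ⟨a', ha', rfl⟩ := Finset.mem_image.1 hg'
    refine Set.disjoint_left.2 fun r h1 h2 => ?_
    rcases lt_trichotomy a a' with h | rfl | h
    · have := hnext a ha a' ha' h
      linarith [h1.2, h2.1]
    · exact hne rfl
    · have := hnext a' ha' a ha h
      linarith [h1.1, h2.2]
  · rintro ⟨g, hg, hr⟩
    obtain ⟨a, ha, rfl⟩ := Finset.mem_image.1 hg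
    refine ⟨⟨(hAL a ha).1.trans hr.1, hr.2.trans (hbL a ha)⟩, fun p hp hrp => ?_⟩
    have hpa : p.1 ≤ a := by
      by_contra h
      have := hbmin a ha p.1 ((hEmem _).2 (Or.inr ⟨p, hp, rfl⟩)) (not_le.1 h)
      linarith [hr.2, hrp.1]
    have h1 := hstart a ha p hp ⟨hpa, hr.1.trans hrp.2.le⟩
    have h2 : a ≤ r := hr.1
    linarith [hrp.2]
  · rintro ⟨hr, hrI⟩
    have hne : (A.filter (· ≤ r)).Nonempty :=
      ⟨0, Finset.mem_filter.2 ⟨(hAmem 0).2 (Or.inl rfl), hr.1⟩⟩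
    obtain ⟨h1, h2⟩ := Finset.mem_filter.1 (Finset.max'_mem _ hne)
    set a := (A.filter (· ≤ r)).max' hne with ha
    refine ⟨_, Finset.mem_image_of_mem _ h1, h2, ?_⟩
    dsimp only
    by_contra hcon
    push Not at hcon
    rcases (hEmem _).1 (hbE a h1) with h3 | ⟨p, hp, h3⟩
    · rw [h3] at hcon; exact absurd hr.2 (not_le.2 hcon)
    · have h4 : p.2 ≤ r := by
        by_contra h
        exact hrI p hp ⟨by rw [h3]; exact hcon, not_le.1 h⟩
      have h5 : p.2 ≤ a := Finset.le_max' _ _ (Finset.mem_filter.2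
        ⟨(hAmem _).2 (Or.inr ⟨p, hp, rfl⟩), h4⟩)
      have h6 := hb a h1
      have h7 := (hI p hp).2.1
      linarith

namespace Planting

variable {K : Set Plane} {ε : ℝ} {S : Planting K ε}

theorem isClosed_polygon (S : Planting K ε) : IsClosed (convexHull ℝ (range S.V)) :=
  (isCompact_polygon S.V).isClosed

theorem isClosed_iUnion_mush (T : Finset (Σ _ : Fin (S.k + 3), Σ _ : ℕ, ℝ)) (hT : T ⊆ S.index) :
    IsClosed (⋃ m ∈ T, S.mush m) := isClosed_biUnion_finset fun _ hm => isClosed_mush (hT hm)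

/-- A point of the polygon on the boundary that belongs to a mushroom lies on its base. -/
theorem eq_base_of_mem_mush (hS : S.IsNested) (h0 : 0 < ε) {m : Σ _ : Fin (S.k + 3), Σ _ : ℕ, ℝ}
    (hm : m ∈ S.index) {X : Plane} (hX : X ∈ S.mush m)
    (hXf : X ∉ interior (convexHull ℝ (range S.V))) : ∃ r ∈ Icc (0 : ℝ) 1, X = S.pl m !₂[r, 0] := by
  obtain ⟨x, hx, rfl⟩ := hX
  have hR := mush_subset_rect hm ⟨x, hx, rfl⟩
  have hh := (inner_sideDir_place (S := S) (m := m) x).2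
  have hx0 := height_nonneg hm (S.rect_subset _ hR)
  have hx1 : x 1 = 0 := by
    by_contra hne
    refine hXf (hS.mem_interior m.1 _ hR ?_)
    rw [hh]
    exact mul_pos (size_pos_of_mem hm) (hx0.lt_of_ne' hne)
  rcases mem_mushroom.1 hx with ⟨a, b, -, -⟩ | ⟨a, -⟩
  · refine ⟨x 0, ⟨a, b⟩, ?_⟩
    have : x = !₂[x 0, 0] := plane_ext (by simp) (by simp [hx1])
    rw [← this]; rfl
  · linarith

/-- Outline points belong to a removed mushroom, hence not to the body, but are limits of points of
the cell outside the mushroom; the other mushrooms, being closed and disjoint, do not interfere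
nearby. -/
theorem pl_outline_subset_frontier (hS : S.IsNested) (h0 : 0 < ε) (h1 : ε < 1)
    {m : Σ _ : Fin (S.k + 3), Σ _ : ℕ, ℝ} (hm : m ∈ S.index) :
    S.pl m '' outline ε ⊆ frontier S.body := by
  classical
  rintro _ ⟨x, hx, rfl⟩
  have hxm := outline_subset_mushroom h0 h1 hx
  have hM : S.pl m x ∈ S.mush m := ⟨x, hxm, rfl⟩
  refine ⟨?_, fun hint => ?_⟩
  · have hcl : S.pl m x ∈ closure (S.pl m '' (modelCell ε \ mushroom ε)) := by
      have := (plHomeo hm).image_closure (modelCell ε \ mushroom ε)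
      change S.pl m '' closure _ = closure (S.pl m '' _) at this
      rw [← this]
      exact ⟨x, outline_subset_closure h0 h1 hx, rfl⟩
    have hnot : S.pl m x ∈ (⋃ m' ∈ S.index.erase m, S.mush m')ᶜ := by
      intro h
      obtain ⟨m', hm', h2⟩ := mem_iUnion₂.1 h
      obtain ⟨h3, h4⟩ := Finset.mem_erase.1 hm'
      exact Set.disjoint_left.1 (mush_disjoint hm h4 h3.symm) hM h2
    have ho := (isClosed_iUnion_mush (S.index.erase m) (Finset.erase_subset _ _)).isOpen_compl
    refine mem_closure_iff_nhds.2 fun t ht => ?_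
    obtain ⟨X, ⟨hXt, hXo⟩, y, hy, rfl⟩ := mem_closure_iff_nhds.1 hcl _ (inter_mem ht (ho.mem_nhds hnot))
    refine ⟨S.pl m y, hXt, ?_⟩
    rw [body_eq]
    refine ⟨S.rect_subset _ (hS.cell_subset m hm ⟨y, hy.1, rfl⟩), fun h => ?_⟩
    obtain ⟨m', hm', h2⟩ := mem_iUnion₂.1 h
    by_cases h3 : m' = m
    · subst h3
      obtain ⟨z, hz, hzy⟩ := h2
      exact hy.2 ((plHomeo hm).injective hzy ▸ hz)
    · exact hXo (mem_iUnion₂.2 ⟨m', Finset.mem_erase.2 ⟨h3, hm'⟩, h2⟩)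
  · have := interior_subset hint
    rw [body_eq] at this
    exact this.2 (mem_iUnion₂.2 ⟨m, hm, hM⟩)

/-- At a mushroom point off the outline the mushroom locally fills the polygon, so the open bases
disappear from the frontier. Mushroom points on the boundary of the polygon can only be base points,
so the rest of that boundary survives. -/
theorem frontier_body (hS : S.IsNested) (h0 : 0 < ε) (h1 : ε < 1) : frontier S.body =
    {X ∈ frontier (convexHull ℝ (range S.V)) |
      ∀ m ∈ S.index, ∀ r ∈ Ioo (0 : ℝ) 1, X ≠ S.pl m !₂[r, 0]} ∪
    ⋃ m ∈ S.index, S.pl m '' outline ε := by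
  have hP := S.isClosed_polygon
  have hU := isClosed_iUnion_mush S.index subset_rfl
  have hbP : S.body ⊆ convexHull ℝ (range S.V) := sdiff_subset
  apply Subset.antisymm
  · intro X hX
    have hXP : X ∈ convexHull ℝ (range S.V) := hP.closure_subset_iff.2 hbP hX.1
    by_cases hXM : X ∈ ⋃ m ∈ S.index, S.mush m
    · obtain ⟨m, hm, x, hx, rfl⟩ := mem_iUnion₂.1 hXM
      refine Or.inr (mem_iUnion₂.2 ⟨m, hm, x, ?_, rfl⟩)
      by_contra hxo
      have hev : ∀ᶠ Y in 𝓝 (S.pl m x), Y ∈ convexHull ℝ (range S.V) → Y ∈ S.mush m := by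
        have h2 := (plHomeo hm).symm.continuous.tendsto (S.pl m x)
        rw [← plHomeo_apply hm, Homeomorph.symm_apply_apply] at h2
        filter_upwards [h2.eventually (eventually_mem_mushroom h0 h1 hx hxo)] with Y hY hYP
        have e : S.pl m ((plHomeo hm).symm Y) = Y := (plHomeo hm).apply_symm_apply Y
        refine ⟨_, hY (height_nonneg hm ?_), e⟩
        rwa [e]
      obtain ⟨Y, hY, hYb⟩ := mem_closure_iff_nhds.1 hX.1 _ hev
      have h3 := hY (hbP hYb)
      rw [body_eq] at hYb
      exact hYb.2 (mem_iUnion₂.2 ⟨m, hm, h3⟩)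
    · refine Or.inl ⟨⟨subset_closure hXP, fun hint => hX.2 ?_⟩, fun m hm r hr hXr => hXM ?_⟩
      · rw [body_eq]
        exact mem_interior_iff_mem_nhds.2 (inter_mem (mem_interior_iff_mem_nhds.1 hint)
          (hU.isOpen_compl.mem_nhds hXM))
      · rw [hXr]
        exact mem_iUnion₂.2 ⟨m, hm, _, base_mem_mushroom h0 (Ioo_subset_Icc_self hr), rfl⟩
  · refine union_subset ?_ (iUnion₂_subset fun m hm => pl_outline_subset_frontier hS h0 h1 hm)
    rintro X ⟨hX, hXb⟩
    by_cases hXM : X ∈ ⋃ m ∈ S.index, S.mush m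
    · obtain ⟨m, hm, hXm⟩ := mem_iUnion₂.1 hXM
      obtain ⟨r, hr, hXr⟩ := eq_base_of_mem_mush hS h0 hm hXm hX.2
      refine pl_outline_subset_frontier hS h0 h1 hm ⟨!₂[r, 0], Or.inl ⟨?_, le_rfl, h0.le⟩, hXr.symm⟩
      by_contra h
      push Not at h
      exact hXb m hm r ⟨hr.1.lt_of_ne' h.1, hr.2.lt_of_ne h.2⟩ hXr
    · refine ⟨subset_closure ?_, fun h => hX.2 (interior_mono hbP h)⟩
      rw [body_eq]
      exact ⟨hP.frontier_subset hX, hXM⟩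

/-- The `i`-th side of the polygon. -/
noncomputable def sidePt (S : Planting K ε) (i : Fin (S.k + 3)) (r : ℝ) : Plane := S.V i + r • sideDir S.V i

theorem sidePt_injective (i : Fin (S.k + 3)) : Function.Injective (S.sidePt i) := fun r r' h => by
  have hne : sideDir S.V i ≠ 0 := fun h0 => by
    have := S.norm_sideDir i; rw [h0] at this; simp at this
  exact smul_left_injective ℝ hne (add_left_cancel h)

theorem sidePt_ne {i j : Fin (S.k + 3)} (hij : i ≠ j) {r r' : ℝ} (hr : r ∈ Ioo 0 ‖S.V (i + 1) - S.V i‖) :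
    S.sidePt i r ≠ S.sidePt j r' := by
  intro h
  have h1 := S.polygon.sideFun_side_pos hij.symm hr
  have h2 := S.polygon.sideFun_coords j r' 0
  rw [zero_smul, add_zero, mul_zero] at h2
  change 0 < sideFun S.V j (S.sidePt i r) at h1
  change sideFun S.V j (S.sidePt j r') = 0 at h2
  rw [h, h2] at h1
  exact lt_irrefl _ h1

theorem pl_base_eq (m : Σ _ : Fin (S.k + 3), Σ _ : ℕ, ℝ) (r : ℝ) :
    S.pl m !₂[r, 0] = S.sidePt m.1 (m.2.2 + S.size m.1 m.2.1 * r) := pl_base m r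

theorem base_Ioo_iff {m : Σ _ : Fin (S.k + 3), Σ _ : ℕ, ℝ} (hm : m ∈ S.index) {q : ℝ} :
    q ∈ Ioo m.2.2 (m.2.2 + S.size m.1 m.2.1) ↔
      ∃ r ∈ Ioo (0 : ℝ) 1, q = m.2.2 + S.size m.1 m.2.1 * r := by
  have hs := size_pos_of_mem hm
  constructor
  · rintro ⟨h1, h2⟩
    refine ⟨(q - m.2.2) / S.size m.1 m.2.1, ⟨div_pos (by linarith) hs, (div_lt_one hs).2 (by linarith)⟩, ?_⟩
    rw [mul_div_cancel₀ _ hs.ne']; ring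
  · rintro ⟨r, ⟨h1, h2⟩, rfl⟩
    have := mul_pos hs h1
    have := mul_lt_of_lt_one_right hs h2
    constructor <;> linarith

theorem mem_base_of_mem_Icc (h0 : 0 < ε) {m : Σ _ : Fin (S.k + 3), Σ _ : ℕ, ℝ} (hm : m ∈ S.index) {q : ℝ}
    (hq : q ∈ Icc m.2.2 (m.2.2 + S.size m.1 m.2.1)) : S.sidePt m.1 q ∈ S.mush m := by
  have hs := size_pos_of_mem hm
  refine ⟨!₂[(q - m.2.2) / S.size m.1 m.2.1, 0], base_mem_mushroom h0
    ⟨div_nonneg (by linarith [hq.1]) hs.le, (div_le_one hs).2 (by linarith [hq.2])⟩, ?_⟩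
  change S.pl m _ = _
  rw [pl_base_eq, mul_div_cancel₀ _ hs.ne', add_sub_cancel]

theorem exists_side_gaps (S : Planting K ε) (h0 : 0 < ε) (h1 : ε < 1) (i : Fin (S.k + 3)) :
    ∃ G : Finset (ℝ × ℝ), (∀ g ∈ G, g.1 < g.2) ∧
      (∀ g ∈ G, ∀ g' ∈ G, g ≠ g' → Disjoint (Ioo g.1 g.2) (Icc g'.1 g'.2)) ∧
      ∀ r, (∃ g ∈ G, r ∈ Icc g.1 g.2) ↔ r ∈ Icc 0 ‖S.V (i + 1) - S.V i‖ ∧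
        ∀ m ∈ S.index, m.1 = i → r ∉ Ioo m.2.2 (m.2.2 + S.size m.1 m.2.1) := by
  classical
  set I : Finset (ℝ × ℝ) :=
    (S.index.filter fun m => m.1 = i).image fun m => (m.2.2, m.2.2 + S.size m.1 m.2.1) with hI
  have hI1 : ∀ p ∈ I, 0 < p.1 ∧ p.1 < p.2 ∧ p.2 < ‖S.V (i + 1) - S.V i‖ := by
    intro p hp
    obtain ⟨m, hm, rfl⟩ := Finset.mem_image.1 hp
    obtain ⟨hmI, rfl⟩ := Finset.mem_filter.1 hm
    have h2 := base_bounds h0 h1 hmI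
    have h3 := size_pos_of_mem hmI
    exact ⟨h2.1, by dsimp only; linarith, h2.2⟩
  have hI2 : ∀ p ∈ I, ∀ q ∈ I, p ≠ q → Disjoint (Icc p.1 p.2) (Icc q.1 q.2) := by
    intro p hp q hq hpq
    obtain ⟨m, hm, rfl⟩ := Finset.mem_image.1 hp
    obtain ⟨m', hm', rfl⟩ := Finset.mem_image.1 hq
    obtain ⟨hm, hmi⟩ := Finset.mem_filter.1 hm
    obtain ⟨hm', hmi'⟩ := Finset.mem_filter.1 hm'
    have hne : m ≠ m' := fun h => hpq (by rw [h])
    refine Set.disjoint_left.2 fun r h2 h3 => ?_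
    have k2 := mem_base_of_mem_Icc h0 hm h2
    have k3 := mem_base_of_mem_Icc h0 hm' h3
    rw [hmi'] at k3
    rw [hmi] at k2
    exact Set.disjoint_left.1 (mush_disjoint hm hm' hne) k2 k3
  obtain ⟨G, hG1, hG2, hG3⟩ := exists_gaps (S.polygon.norm_pos i) I hI1 hI2
  refine ⟨G, hG1, hG2, fun r => (hG3 r).trans (and_congr_right fun _ => ⟨fun h m hm hmi => ?_,
    fun h p hp => ?_⟩)⟩
  · exact h _ (Finset.mem_image_of_mem _ (Finset.mem_filter.2 ⟨hm, hmi⟩))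
  · obtain ⟨m, hm, rfl⟩ := Finset.mem_image.1 hp
    exact h m (Finset.mem_filter.1 hm).1 (Finset.mem_filter.1 hm).2

/-- There are five arcs for each mushroom and one segment for each gap between bases. Inside an arc
the height above the base is positive, which keeps it off the boundary of the polygon and so off the
gaps. -/
theorem hasPiecewiseSmoothBoundary_body (hS : S.IsNested) (h0 : 0 < ε) (h1 : ε < 1) :
    HasPiecewiseSmoothBoundary S.body := by
  have hP := S.polygon
  choose G hG1 hG2 hG3 using fun i => S.exists_side_gaps h0 h1 i
  have hu := S.norm_sideDir
  -- The defining property of the gaps only excludes the open bases; the open gaps have to miss the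
  -- closed ones.
  have hIoo : ∀ i, ∀ g ∈ G i, ∀ r ∈ Ioo g.1 g.2, r ∈ Ioo 0 ‖S.V (i + 1) - S.V i‖ ∧
      ∀ m ∈ S.index, m.1 = i → r ∉ Icc m.2.2 (m.2.2 + S.size m.1 m.2.1) := by
    intro i g hg r hr
    have k1 := ((hG3 i g.1).1 ⟨g, hg, le_rfl, (hG1 i g hg).le⟩).1
    have k2 := ((hG3 i g.2).1 ⟨g, hg, (hG1 i g hg).le, le_rfl⟩).1
    refine ⟨⟨k1.1.trans_lt hr.1, hr.2.trans_le k2.2⟩, fun m hm hmi hrm => ?_⟩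
    have hs := size_pos_of_mem hm
    -- a gap and a base would have an interior point in common
    obtain ⟨q, hq1, hq2⟩ := exists_between (max_lt (lt_min (hG1 i g hg) (hr.1.trans_le hrm.2))
      (lt_min (hrm.1.trans_lt hr.2) (by linarith : m.2.2 < m.2.2 + S.size m.1 m.2.1)))
    rw [max_lt_iff] at hq1
    rw [lt_min_iff] at hq2
    exact ((hG3 i q).1 ⟨g, hg, hq1.1.le, hq2.1.le⟩).2 m hm hmi ⟨hq1.2, hq2.2⟩
  have hgap : ∀ i, ∀ g : ℝ × ℝ, g.1 < g.2 → ∀ s : Set ℝ,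
      (fun t : ℝ => S.sidePt i g.1 + t • ((g.2 - g.1) • sideDir S.V i)) '' s =
        S.sidePt i '' ((fun t => g.1 + t * (g.2 - g.1)) '' s) := by
    intro i g _ s
    rw [image_image]
    refine image_congr fun t _ => ?_
    simp only [sidePt]; module
  have haff : ∀ g : ℝ × ℝ, g.1 < g.2 → (fun t => g.1 + t * (g.2 - g.1)) '' Icc 0 1 = Icc g.1 g.2 ∧
      (fun t => g.1 + t * (g.2 - g.1)) '' Ioo 0 1 = Ioo g.1 g.2 := by
    intro g hg
    have hlen : 0 < g.2 - g.1 := sub_pos.2 hg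
    have e : ∀ r, g.1 + (r - g.1) / (g.2 - g.1) * (g.2 - g.1) = r := fun r => by
      rw [div_mul_cancel₀ _ hlen.ne']; ring
    constructor
    · ext r
      constructor
      · rintro ⟨t, ⟨h2, h3⟩, rfl⟩
        constructor <;> dsimp only <;> nlinarith
      · rintro ⟨h2, h3⟩
        exact ⟨(r - g.1) / (g.2 - g.1), ⟨div_nonneg (by linarith) hlen.le,
          (div_le_one hlen).2 (by linarith)⟩, e r⟩
    · ext r
      constructor
      · rintro ⟨t, ⟨h2, h3⟩, rfl⟩
        constructor <;> dsimp only <;> nlinarith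
      · rintro ⟨h2, h3⟩
        exact ⟨(r - g.1) / (g.2 - g.1), ⟨div_pos (by linarith) hlen,
          (div_lt_one hlen).2 (by linarith)⟩, e r⟩
  have hfr : ∀ i, ∀ r ∈ Icc 0 ‖S.V (i + 1) - S.V i‖, S.sidePt i r ∈ frontier (convexHull ℝ (range S.V)) :=
    fun i r hr => hP.side_mem_frontier i hr
  set γ : (S.index × Fin 5) ⊕ (Σ i, G i) → ℝ → Plane := Sum.elim
    (fun a t => S.pl a.1 (outlineArc ε a.2 t))
    (fun b t => S.sidePt b.1 b.2.1.1 + t • ((b.2.1.2 - b.2.1.1) • sideDir S.V b.1)) with hγ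
  have hγr : ∀ (i) (g : G i), γ (Sum.inr ⟨i, g⟩) '' Icc 0 1 = S.sidePt i '' Icc g.1.1 g.1.2 ∧
      γ (Sum.inr ⟨i, g⟩) '' Ioo 0 1 = S.sidePt i '' Ioo g.1.1 g.1.2 := by
    intro i g
    have hg := hG1 i g.1 g.2
    rw [← (haff g.1 hg).1, ← (haff g.1 hg).2]
    exact ⟨hgap i g.1 hg _, hgap i g.1 hg _⟩
  have hmush : ∀ (m : S.index) (a : Fin 5) (t : ℝ), t ∈ Icc (0 : ℝ) 1 →
      S.pl m (outlineArc ε a t) ∈ S.mush m := fun m a t ht =>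
    ⟨_, outline_subset_mushroom h0 h1 (by rw [outline_eq h0 h1]; exact mem_iUnion.2 ⟨a, t, ht, rfl⟩), rfl⟩
  refine hasPiecewiseSmoothBoundary_of_arcs γ ?_ ?_ ?_
  · rintro (⟨m, a⟩ | ⟨i, g⟩)
    · exact (isArc_outlineArc h0 h1 a).place _ (hu _) (size_pos_of_mem m.2)
    · refine isArc_segment _ (smul_ne_zero (sub_pos.2 (hG1 i g.1 g.2)).ne' fun h => ?_)
      have := hu i
      rw [h] at this; simp at this
  · rintro (⟨m, a⟩ | ⟨i, g⟩) (⟨m', a'⟩ | ⟨i', g'⟩) hne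
    · refine Set.disjoint_left.2 ?_
      rintro _ ⟨t, ht, rfl⟩ ⟨t', ht', hX⟩
      change S.pl m' (outlineArc ε a' t') = S.pl m (outlineArc ε a t) at hX
      by_cases hmm : m = m'
      · subst hmm
        have haa : a ≠ a' := fun h => hne (by rw [h])
        exact outlineArc_ne h0 h1 haa ht ht' ((plHomeo m.2).injective hX).symm
      · refine Set.disjoint_left.1 (mush_disjoint m.2 m'.2 fun h => hmm (Subtype.ext h))
          (hmush m a t (Ioo_subset_Icc_self ht)) ?_
        rw [← hX]
        exact hmush m' a' t' ht'
    · rw [(hγr i' g').1]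
      refine Set.disjoint_left.2 ?_
      rintro _ ⟨t, ht, rfl⟩ ⟨r, hr, hX⟩
      change S.sidePt i' r = S.pl m (outlineArc ε a t) at hX
      have hM := hmush m a t (Ioo_subset_Icc_self ht)
      refine (hfr i' r ((hG3 i' r).1 ⟨g'.1, g'.2, hr⟩).1).2 ?_
      rw [hX]
      refine hS.mem_interior m.1.1 _ (mush_subset_rect m.2 hM) ?_
      rw [pl, (inner_sideDir_place _).2]
      exact mul_pos (size_pos_of_mem m.2) (outlineArc_height_pos h0 ht)
    · rw [(hγr i g).2]
      refine Set.disjoint_left.2 ?_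
      rintro _ ⟨r, hr, rfl⟩ ⟨t, ht, hX⟩
      change S.pl m' (outlineArc ε a' t) = S.sidePt i r at hX
      obtain ⟨k1, k2⟩ := hIoo i g.1 g.2 r hr
      have hM := hmush m' a' t ht
      rw [hX] at hM
      obtain ⟨q, hq, hXq⟩ := eq_base_of_mem_mush hS h0 m'.2 hM (hfr i r (Ioo_subset_Icc_self k1)).2
      rw [pl_base_eq] at hXq
      by_cases hi : i = m'.1.1
      · subst hi
        have hs := size_pos_of_mem m'.2
        have e := sidePt_injective _ hXq
        refine k2 m'.1 m'.2 rfl ?_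
        rw [e]
        have := mul_nonneg hs.le hq.1
        have := mul_le_of_le_one_right hs.le hq.2
        constructor <;> linarith
      · exact sidePt_ne hi k1 hXq
    · rw [(hγr i g).2, (hγr i' g').1]
      refine Set.disjoint_left.2 ?_
      rintro _ ⟨r, hr, rfl⟩ ⟨r', hr', hX⟩
      by_cases hi : i = i'
      · subst hi
        have hgg : g.1 ≠ g'.1 := fun h => hne (by rw [Subtype.ext h])
        have e := sidePt_injective _ hX
        subst e
        exact Set.disjoint_left.1 (hG2 i g.1 g.2 g'.1 g'.2 hgg) hr hr'
      · exact sidePt_ne hi (hIoo i g.1 g.2 r hr).1 hX.symm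
  · rw [frontier_body hS h0 h1, iUnion_sum, union_comm]
    congr 1
    · simp only [outline_eq h0 h1, image_iUnion, image_image]
      ext X
      simp only [mem_iUnion]
      constructor
      · rintro ⟨m, hm, a, h⟩
        exact ⟨⟨⟨m, hm⟩, a⟩, h⟩
      · rintro ⟨⟨⟨m, hm⟩, a⟩, h⟩
        exact ⟨m, hm, a, h⟩
    · ext X
      rw [mem_iUnion]
      constructor
      · rintro ⟨hX, hXb⟩
        obtain ⟨i, hi⟩ := hP.exists_sideFun_eq_zero hX
        obtain ⟨r, hr, rfl⟩ := hP.mem_segment_of_sideFun_eq_zero (S.isClosed_polygon.frontier_subset hX) hi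
        obtain ⟨g, hg, hgr⟩ := (hG3 i r).2 ⟨hr, fun m hm hmi hrm => by
          obtain ⟨q, hq, hrq⟩ := (base_Ioo_iff hm).1 hrm
          refine hXb m hm q hq ?_
          rw [pl_base_eq, ← hrq, hmi]
          rfl⟩
        refine ⟨⟨i, g, hg⟩, ?_⟩
        rw [(hγr i ⟨g, hg⟩).1]
        exact ⟨r, hgr, rfl⟩
      · rintro ⟨⟨i, g⟩, hX⟩
        rw [(hγr i g).1] at hX
        obtain ⟨r, hr, rfl⟩ := hX
        obtain ⟨k1, k2⟩ := (hG3 i r).1 ⟨g.1, g.2, hr⟩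
        refine ⟨hfr i r k1, fun m hm q hq hXq => ?_⟩
        rw [pl_base_eq] at hXq
        by_cases hi : i = m.1
        · subst hi
          exact k2 m hm rfl ((base_Ioo_iff hm).2 ⟨q, hq, sidePt_injective _ hXq⟩)
        · exact sidePt_ne (Ne.symm hi) (base_bounds' h0 h1 hm (Ioo_subset_Icc_self hq)) hXq.symm

theorem IsNested.isBody (hS : S.IsNested) (h0 : 0 < ε) (h1 : ε < 1) (hb : Bornology.IsBounded K) :
    IsBody S.body where
  bounded := hb.subset (sdiff_subset.trans S.subset)
  connected := ⟨⟨_, vertex_mem_body h0 h1 0⟩, isPreconnected_body hS h0 h1⟩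
  nondegenerate := by
    rw [convexHull_body h0 h1]
    exact S.polygon.interior_nonempty
  boundary := hasPiecewiseSmoothBoundary_body hS h0 h1

end Planting

theorem mainTheorem2 (K : Set Plane) (hconv : Convex ℝ K) (hbdd : Bornology.IsBounded K)
    (hint : (interior K).Nonempty) :
    -- the resistance of `K` itself
    ‖meanResistance K‖ = perimeter K ∧
    -- the supremum over the bodies contained in `K`
    IsLUB {r : ℝ | ∃ B : Set Plane, IsBody B ∧ B ⊆ K ∧ r = ‖meanResistance B‖}
      (3 / 2 * ‖meanResistance K‖) ∧
    -- the construction can be carried out, and gives bodies contained in `K`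
    (∀ ε ∈ Set.Ioo (0 : ℝ) 1, ∃ S : Planting K ε, IsBody S.body ∧ S.body ⊆ K) ∧
    -- the supremum is attained in the limit, however the construction is carried out
    (∀ B : ℝ → Set Plane,
      (∀ᶠ ε in 𝓝[>] (0 : ℝ), ∃ S : Planting K ε, B ε = S.body) →
      Tendsto (fun ε => ‖meanResistance (B ε)‖) (𝓝[>] (0 : ℝ))
        (𝓝 (3 / 2 * ‖meanResistance K‖))) := by
  have h1 := meanResistance_convex hconv hbdd hint
  have h3 : ∀ ε ∈ Set.Ioo (0 : ℝ) 1, ∃ S : Planting K ε, IsBody S.body ∧ S.body ⊆ K := by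
    intro ε hε
    obtain ⟨S, hS⟩ := exists_nested_planting hconv hbdd hint hε.1 hε.2
    exact ⟨S, hS.isBody hε.1 hε.2 hbdd, sdiff_subset.trans S.subset⟩
  have h4 := fun B hB => tendsto_meanResistance_planting hconv hbdd B hB
  rw [h1]
  refine ⟨rfl, ⟨?_, fun c hc => ?_⟩, h3, h4⟩
  · rintro _ ⟨B, hB, hBK, rfl⟩
    have hsub : convexHull ℝ B ⊆ K := convexHull_min hBK hconv
    exact (norm_meanResistance_le hB.nondegenerate hB.bounded).trans (mul_le_mul_of_nonneg_left
      (perimeter_mono (convex_convexHull ℝ B) hB.nondegenerate hsub hconv hbdd) (by norm_num))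
  · have hex : ∀ ε ∈ Set.Ioo (0 : ℝ) 1, ∃ B : Set Plane, (∃ S : Planting K ε, B = S.body) ∧
        IsBody B ∧ B ⊆ K := fun ε hε => by
      obtain ⟨S, hS⟩ := h3 ε hε
      exact ⟨S.body, ⟨S, rfl⟩, hS⟩
    choose! B hBS hB using hex
    have hev : ∀ᶠ ε in 𝓝[>] (0 : ℝ), ε ∈ Set.Ioo (0 : ℝ) 1 := Ioo_mem_nhdsGT one_pos
    -- The bodies chosen for the various `ε` have resistances at most `c`, and these tend to `3/2 *
    -- perimeter K`.
    refine le_of_tendsto (h4 B (hev.mono fun ε hε => hBS ε hε)) ?_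
    filter_upwards [hev] with ε hε
    exact hc ⟨_, (hB ε hε).1, (hB ε hε).2, rfl⟩
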